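/- Work in $\mathbb{Z}[\beta][x_1,x_2,\dots]$. Let $s_i$ exchange $x_i$ and $x_{i+1}$, and put $\partial_i f=\frac{f-s_if}{x_i-x_{i+1}}$ and $\pi_i^{(\beta)}f=\partial_i\big((1+\beta x_{i+1})x_i f\big)$. For a composition $\alpha$ (a sequence of nonnegative integers, almost all $0$) the Lascoux polynomial $\mathfrak{L}^{(\beta)}_\alpha$ is $x^\alpha$ if $\alpha$ is a partition, and $\pi_i^{(\beta)}\mathfrak{L}^{(\beta)}_{s_i\alpha}$ if $\alpha_i<\alpha_{i+1}$. A decreasing tableau is a filling of a partition shape by positive integers that strictly decreases along rows (left to right) and along columns (top to bottom). Write $|P|$ for its number of boxes, and $\mathrm{word}(P)$ for its column-reading word (columns from left to right, each read from bottom to top). For a finite set $S$ of positive integers, $S\star m$ is obtained from $S$ by replacing its smallest element $\ge m$ by $m$, or by adjoining $m$ if there is no such element; words act letter by letter from left to right. The right key $K_+(P)$ is the tableau whose $j$-th column has entry set $\emptyset\star\mathrm{word}(P_{\ge j})$, where $P_{\ge j}$ is $P$ without its first $j-1$ columns, and $\mathfrak{L}^{(\beta)}_{K_+(P)}$ is the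 Lascoux polynomial of its weight, the composition whose $v$-th part is the number of occurrences of $v$ in $K_+(P)$. Column Hecke insertion of $x$ into a decreasing tableau inserts $x$ into the first column. To insert $x$ into a column: if no entry of the column is smaller than $x$, append $x$ at its bottom if the result is a decreasing tableau (otherwise change nothing), and stop; if some entry is smaller than $x$, let $y$ be the largest such entry, replace $y$ by $x$ if the result is a decreasing tableau (otherwise change nothing), and insert $y$ into the next column. The Hecke insertion tableau of a word $a=a_1\cdots a_n$ is obtained by inserting $a_1,\dots,a_n$ in this order, starting from the empty tableau. A pair $(a,i)$ of words of positive integers of the same length is a bounded compatible pair if $i$ is weakly decreasing, $i_j=i_{j+1}$ implies $a_j<a_{j+1}$, and $i_j\le a_j$ for all $j$. Let $\mathcal{C}_P$ be the set of bounded compatible pairs $(a,i)$ such that the Hecke insertion tableau of $a$ is $P$, and let $\mathrm{wt}(i)$ be the composition whose $v$-th part is the number of occurrences of $v$ in $i$. For a word $a$ let $\mathrm{ex}(a)=\mathrm{length}(a)-\ell(w)$, where $w=a*\mathrm{id}$ is the permutation associated with $a$ by the $0$-Hecke action ($i*w=s_iw$ if $s_iw>w$, and $i*w=w$ otherwise)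 and $\ell$ is Coxeter length. Theorem. Let $P$ be a decreasing tableau. Then $\mathcal{C}_P$ is finite, $$\mathfrak{L}^{(\beta)}_{K_+(P)}=\sum_{(a,i)\in\mathcal{C}_P}\beta^{\mathrm{length}(a)-|P|}\,x^{\mathrm{wt}(i)},$$ and $$\beta^{\mathrm{ex}(\mathrm{word}(P))}\,\mathfrak{L}^{(\beta)}_{K_+(P)}=\sum_{(a,i)\in\mathcal{C}_P}\beta^{\mathrm{ex}(a)}\,x^{\mathrm{wt}(i)}.$$ In particular, if $\mathrm{word}(P)$ is reduced, then $\mathfrak{L}^{(\beta)}_{K_+(P)}=\sum_{(a,i)\in\mathcal{C}_P}\beta^{\mathrm{ex}(a)}x^{\mathrm{wt}(i)}$. -/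

import Mathlib

/-! ## Lascoux polynomials

The ground ring is `ℤ[β][x₁, x₂, …]`: the coefficient ring is `Polynomial ℤ`, whose variable is `β`,
and the variables are indexed by the positive integers. Compositions are finitely supported
functions `ℕ+ →₀ ℕ`. -/

noncomputable section

/-- The ring `ℤ[β][x₁, x₂, …]`. -/
abbrev BetaPoly : Type := MvPolynomial ℕ+ (Polynomial ℤ)

/-- The parameter `β`, as a coefficient. -/
abbrev betaCoeff : Polynomial ℤ := Polynomial.X

/-- `s_i f`: exchange the variables `x_i` and `x_{i+1}`. -/
def swapVars (i : ℕ+) (f : BetaPoly) : BetaPoly :=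
  MvPolynomial.rename (Equiv.swap i (i + 1)) f

theorem X_sub_X_dvd_sub_swapVars (i : ℕ+) (f : BetaPoly) :
    (MvPolynomial.X i - MvPolynomial.X (i + 1) : BetaPoly) ∣ f - swapVars i f := by
  unfold swapVars
  induction f using MvPolynomial.induction_on with
  | C a => simp
  | add p q hp hq =>
    have h : p + q - MvPolynomial.rename (Equiv.swap i (i + 1)) (p + q)
        = (p - MvPolynomial.rename (Equiv.swap i (i + 1)) p)
          + (q - MvPolynomial.rename (Equiv.swap i (i + 1)) q) := by
      rw [map_add]; ring
    rw [h]
    exact dvd_add hp hq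
  | mul_X p j hp =>
    have hX : (MvPolynomial.X i - MvPolynomial.X (i + 1) : BetaPoly) ∣
        MvPolynomial.X j - MvPolynomial.X (Equiv.swap i (i + 1) j) := by
      rcases eq_or_ne j i with rfl | h1
      · simp
      · rcases eq_or_ne j (i + 1) with rfl | h2
        · rw [Equiv.swap_apply_right]
          exact ⟨-1, by ring⟩
        · simp [Equiv.swap_apply_of_ne_of_ne h1 h2]
    have h : p * MvPolynomial.X j
          - MvPolynomial.rename (Equiv.swap i (i + 1)) (p * MvPolynomial.X j)
        = (p - MvPolynomial.rename (Equiv.swap i (i + 1)) p) * MvPolynomial.X j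
          + MvPolynomial.rename (Equiv.swap i (i + 1)) p
            * (MvPolynomial.X j - MvPolynomial.X (Equiv.swap i (i + 1) j)) := by
      rw [map_mul, MvPolynomial.rename_X]; ring
    rw [h]
    exact dvd_add (hp.mul_right _) (hX.mul_left _)

/-- The divided difference `∂_i f = (f - s_i f) / (x_i - x_{i+1})`, an exact quotient in a domain. -/
def divDiff (i : ℕ+) (f : BetaPoly) : BetaPoly :=
  (X_sub_X_dvd_sub_swapVars i f).choose

theorem X_sub_X_mul_divDiff (i : ℕ+) (f : BetaPoly) :
    (MvPolynomial.X i - MvPolynomial.X (i + 1)) * divDiff i f = f - swapVars i f :=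
  (X_sub_X_dvd_sub_swapVars i f).choose_spec.symm

/-- `∂_i^{(β)} f = ∂_i ((1 + β x_{i+1}) f)`. -/
def betaDivDiff (i : ℕ+) (f : BetaPoly) : BetaPoly :=
  divDiff i ((1 + MvPolynomial.C betaCoeff * MvPolynomial.X (i + 1)) * f)

/-- `π_i^{(β)} f = ∂_i^{(β)} (x_i f)`. -/
def betaPi (i : ℕ+) (f : BetaPoly) : BetaPoly :=
  betaDivDiff i (MvPolynomial.X i * f)

/-- `s_i α`: exchange the `i`-th and `(i+1)`-th parts of a composition. -/
def swapParts (i : ℕ+) (α : ℕ+ →₀ ℕ) : ℕ+ →₀ ℕ :=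
  α.equivMapDomain (Equiv.swap i (i + 1))

/-- The statistic `∑ i, i * α_i`, used only for termination. -/
def partMoment (α : ℕ+ →₀ ℕ) : ℕ := α.sum fun i a => (i : ℕ) * a

theorem partMoment_swapParts_lt {i : ℕ+} {α : ℕ+ →₀ ℕ} (h : α i < α (i + 1)) :
    partMoment (swapParts i α) < partMoment α := by
  have hne : i ≠ i + 1 := (PNat.lt_add_right i 1).ne
  have hi : i + 1 ∈ α.support := by
    rw [Finsupp.mem_support_iff]; omega
  have e : partMoment (swapParts i α)
      = α.sum fun j a => ((Equiv.swap i (i + 1) j : ℕ+) : ℕ) * a := by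
    unfold partMoment swapParts
    rw [Finsupp.equivMapDomain_eq_mapDomain, Finsupp.sum_mapDomain_index]
    · intro b; simp
    · intro b m n; ring
  rw [e, partMoment]
  have hs : α.support ⊆ insert i α.support := Finset.subset_insert _ _
  rw [Finsupp.sum_of_support_subset _ hs _ (by intros; simp),
    Finsupp.sum_of_support_subset _ hs _ (by intros; simp)]
  have h1 : i ∈ insert i α.support := Finset.mem_insert_self _ _
  have h2 : i + 1 ∈ (insert i α.support).erase i :=
    Finset.mem_erase.2 ⟨hne.symm, Finset.mem_insert_of_mem hi⟩
  rw [← Finset.add_sum_erase _ _ h1, ← Finset.add_sum_erase _ _ h1,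
    ← Finset.add_sum_erase _ _ h2, ← Finset.add_sum_erase _ _ h2]
  have h3 : ∑ x ∈ ((insert i α.support).erase i).erase (i + 1),
        ((Equiv.swap i (i + 1) x : ℕ+) : ℕ) * α x
      = ∑ x ∈ ((insert i α.support).erase i).erase (i + 1), (x : ℕ) * α x := by
    refine Finset.sum_congr rfl fun x hx => ?_
    rw [Finset.mem_erase, Finset.mem_erase] at hx
    rw [Equiv.swap_apply_of_ne_of_ne hx.2.1 hx.1]
  rw [h3, Equiv.swap_apply_left, Equiv.swap_apply_right, PNat.add_coe, PNat.one_coe]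
  nlinarith

open Classical in
/-- The Lascoux polynomial `𝔏_α^{(β)}`: it is `x^α` if `α` is a partition (has no ascent
`α_i < α_{i+1}`), and `π_i^{(β)} 𝔏_{s_i α}^{(β)}` otherwise, where `i` is an ascent of `α`. By the
braid relations for the `π_i^{(β)}` every ascent gives the same result; the first one is used. -/
def lascoux (α : ℕ+ →₀ ℕ) : BetaPoly :=
  if h : ∃ i : ℕ+, α i < α (i + 1) then
    betaPi (PNat.find h) (lascoux (swapParts (PNat.find h) α))
  else
    MvPolynomial.monomial α 1
termination_by partMoment α
decreasing_by exact partMoment_swapParts_lt (PNat.find_spec h)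

end

/-! ## Decreasing tableaux and Hecke insertion

A filling of a partition shape is given by the list of its columns, from left to right; a column is
the list of its entries, from top to bottom. -/

/-- Column `D` may stand immediately to the right of column `C`: it is not longer, and in each of
its rows the entry of `D` is smaller than the entry of `C`. -/
def ColumnsDecrease (C D : List ℕ+) : Prop :=
  ∃ h : D.length ≤ C.length, ∀ (r : ℕ) (hr : r < D.length), D[r] < C[r]

instance (C D : List ℕ+) : Decidable (ColumnsDecrease C D) := by
  unfold ColumnsDecrease; infer_instance

/-- Decreasing tableaux of partition shape: all columns are nonempty and strictly decrease from top
to bottom, column lengths weakly decrease, and all rows strictly decrease from left to right. -/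
def IsDecreasingTableau (T : List (List ℕ+)) : Prop :=
  (∀ C ∈ T, C ≠ [] ∧ C.Pairwise (· > ·)) ∧ T.IsChain ColumnsDecrease

instance (T : List (List ℕ+)) : Decidable (IsDecreasingTableau T) := by
  unfold IsDecreasingTableau; infer_instance

/-- The number of boxes of the shape of `T`. -/
def boxCount (T : List (List ℕ+)) : ℕ := (T.map List.length).sum

/-- The column-reading word: each column from bottom to top, columns from left to right. -/
def columnWord (T : List (List ℕ+)) : List ℕ+ := (T.map List.reverse).flatten

/-- The tail of a Hecke insertion: insert `x` into the first of the columns `R`, where the columns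
`L` to the left have already been treated. If no entry of the column `C` is smaller than `x`, then
`x` is appended at the bottom of `C` and the process stops; otherwise the largest entry `y < x` of
`C` is replaced by `x` and `y` is inserted into the next column. In both cases `C` is changed only
if the whole result is a decreasing tableau. -/
def heckeInsertAux (L : List (List ℕ+)) (x : ℕ+) : List (List ℕ+) → List (List ℕ+)
  | [] => if IsDecreasingTableau (L ++ [[x]]) then L ++ [[x]] else L
  | C :: R =>
    match (C.filter (· < x)).max? with
    | none =>
      if IsDecreasingTableau (L ++ (C ++ [x]) :: R) then L ++ (C ++ [x]) :: R else L ++ C :: R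
    | some y =>
      if IsDecreasingTableau (L ++ C.replace y x :: R) then
        heckeInsertAux (L ++ [C.replace y x]) y R
      else
        heckeInsertAux (L ++ [C]) y R

/-- The (column) Hecke insertion of `x` into the decreasing tableau `T`. -/
def heckeInsert (T : List (List ℕ+)) (x : ℕ+) : List (List ℕ+) := heckeInsertAux [] x T

/-- The Hecke insertion tableau of `a = a₁ a₂ ⋯`: insert `a₁`, then `a₂`, …, starting from the empty
tableau. -/
def heckeTableau (a : List ℕ+) : List (List ℕ+) := a.foldl heckeInsert []

/-! ## The right key -/

/-- `S ⋆ m`: replace the smallest element `m' ≥ m` of `S` by `m`; if there is none, adjoin `m`. -/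
def starAct (S : Finset ℕ+) (m : ℕ+) : Finset ℕ+ :=
  if h : (S.filter (m ≤ ·)).Nonempty then insert m (S.erase ((S.filter (m ≤ ·)).min' h))
  else insert m S

/-- The right key `K₊(P)`, as the list of the entry sets of its columns: the `j`-th column is
`∅ ⋆ word(P_{≥ j})`, where `P_{≥ j}` is `P` without its first `j - 1` columns. -/
def rightKey (P : List (List ℕ+)) : List (Finset ℕ+) :=
  (List.range P.length).map fun j => (columnWord (P.drop j)).foldl starAct ∅

noncomputable section

/-- The weight of a tableau given by the entry sets of its columns: part `v` is the number of
columns that contain `v`. -/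
def keyWeight (K : List (Finset ℕ+)) : ℕ+ →₀ ℕ :=
  (K.map fun S => ∑ v ∈ S, Finsupp.single v 1).sum

/-! ## Hecke words and compatible pairs -/

/-- `i * w` in the action of the `0`-Hecke monoid: it is `s_i w` if `s_i w > w`, that is, if
`w⁻¹(i) < w⁻¹(i + 1)`, and `w` otherwise. -/
def heckeAct (i : ℕ+) (w : Equiv.Perm ℕ+) : Equiv.Perm ℕ+ :=
  if w.symm i < w.symm (i + 1) then Equiv.swap i (i + 1) * w else w

/-- The permutation `a * id` associated with the word `a`. -/
def wordPerm (a : List ℕ+) : Equiv.Perm ℕ+ := a.foldr heckeAct 1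

/-- The Coxeter length of a finitary permutation: its number of inversions. -/
def coxeterLength (w : Equiv.Perm ℕ+) : ℕ :=
  {p : ℕ+ × ℕ+ | p.1 < p.2 ∧ w p.2 < w p.1}.ncard

/-- `ex(a) = length(a) - ℓ(w)`, where `w` is the permutation associated with `a`. -/
def wordExcess (a : List ℕ+) : ℕ := a.length - coxeterLength (wordPerm a)

/-- The weight of a word: part `v` is the number of occurrences of `v`. -/
def wordWeight (i : List ℕ+) : ℕ+ →₀ ℕ := Multiset.toFinsupp (i : Multiset ℕ+)

/-- `(a, i)` is a compatible pair of words of positive integers. -/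
structure IsCompatible (a i : List ℕ+) : Prop where
  length_eq : a.length = i.length
  weaklyDecreasing : i.Pairwise (· ≥ ·)
  ascent : ∀ (j : ℕ) (ha : j + 1 < a.length) (hi : j + 1 < i.length),
    i[j] = i[j + 1] → a[j] < a[j + 1]

/-- A pair `(a, i)` is bounded if `i_j ≤ a_j` for all `j`. -/
def IsBoundedPair (a i : List ℕ+) : Prop :=
  ∀ (j : ℕ) (ha : j < a.length) (hi : j < i.length), i[j] ≤ a[j]

/-- `𝒞_P`: the bounded compatible pairs `(a, i)` such that the Hecke insertion tableau of `a`
is `P`. -/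
def compatiblePairs (P : List (List ℕ+)) : Set (List ℕ+ × List ℕ+) :=
  {p | IsCompatible p.1 p.2 ∧ IsBoundedPair p.1 p.2 ∧ heckeTableau p.1 = P}

end

/-! Split off the letters of index 1. The index word is weakly decreasing, so these letters form a
final run `u` of `a`, which is strictly increasing by compatibility. In the rest of the pair all
indices are at least 2, hence by boundedness so are all letters, and subtracting 1 leaves an
arbitrary bounded compatible pair (`IsPairList.exists_glueRun`, `isPairList_glueRun`). The sum for
`P` thus becomes a sum over all `(T, u)` for which inserting `u` into `T` gives `P`: the
contribution is `x₁ ^ |u|`, times a power of `β`, times the shifted sum for `T`, and it vanishes if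
`T` has an entry 1. By induction on a bound for the entries it suffices that Lascoux polynomials
obey the same recursion.

To enumerate the pairs `(T, u)`, insert a whole increasing word at once, column by column, with
columns regarded as sets. If the letters `U` reach the column `A` and `Z = A ∪ U`, every inserted
letter bumps its predecessor in `Z`. The new column consists of `max Z` and the elements whose
successor in `Z` lies in `A`; the bumped letters are those whose successor lies in `U`
(`foldl_setInsert_cons`). A letter blocked by the column on its left acts like the next larger
entry, which is already present (`colSets_heckeInsertAux`). This shift along `Z` is invertible once
it is known whether `min Z` comes from `A`, from `U`, or from both: the marks `keep`, `add`,
`absorb`. The pairs `(T, u)` correspond to the admissible mark lists (`unrun_spec`, `unrun_runSets`;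
the essential points are `dom_back` and `mark_cond`). Boxes are gained at `add`, and `u` has one
letter for each `add` or `absorb`, so a mark list has weight `x₁ ^ (#add + #absorb) * β ^ #absorb`.

Two actions are invariant under insertion: `⋆`, and the `0`-Hecke action. Both satisfy the K-Knuth
relations and one relation for blocked letters (`BlockRel`), so the column word of a tableau acts
like the reversed inserted word (`KKnuth.foldl_setInsert`). For `⋆` this yields `keys_runSets`: the
key of `T` arises from the key of `P` by deleting, in every column marked `add`, the smallest
element missing from the next column. For the `0`-Hecke action it yields `wordExcess_eq`, by which
the second formula follows from the first.

Summing out the `absorb` marks (`sum_markWeight`) leaves the sum `brSum` over branchings of the key,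
and the recursion for Lascoux polynomials is `brSum_eq_lascoux`. The operators `π_k` with `k ≥ 2`
respect branching, so all parts of the weight after the first may be assumed sorted. A first column
`{1, …, n}` splits off as a monomial. In the remaining keys every column is an initial segment
shifted by one; removing one level from these columns reduces the claim to the operator identity
`betaPi_core`, a consequence of the braid relations. -/

/-! ## Neighbours and counting in finite sets of positive integers -/

/-- The number of elements of `X` greater than `t`. -/
def cntGt (X : Finset ℕ+) (t : ℕ+) : ℕ := (X.filter (t < ·)).card

/-- The number of elements of `X` that are at least `t`. -/
def cntGe (X : Finset ℕ+) (t : ℕ+) : ℕ := (X.filter (t ≤ ·)).card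

/-- The largest element of `X` below `t` (or `t` if there is none). -/
def predIn (X : Finset ℕ+) (t : ℕ+) : ℕ+ := ((X.filter (· < t)).max).unbotD t

/-- The smallest element of `X` above `t` (or `t` if there is none). -/
def succIn (X : Finset ℕ+) (t : ℕ+) : ℕ+ := ((X.filter (t < ·)).min).untopD t

theorem predIn_eq {X : Finset ℕ+} {t y : ℕ+} (hy : y ∈ X) (hyt : y < t)
    (h : ∀ a ∈ X, a < t → a ≤ y) : predIn X t = y := by
  have : (X.filter (· < t)).max = (y : WithBot ℕ+) := by
    apply le_antisymm
    · refine Finset.max_le fun a ha => ?_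
      rw [Finset.mem_filter] at ha
      exact WithBot.coe_le_coe.2 (h a ha.1 ha.2)
    · exact Finset.le_max (Finset.mem_filter.2 ⟨hy, hyt⟩)
  rw [predIn, this]; rfl

theorem succIn_eq {X : Finset ℕ+} {t y : ℕ+} (hy : y ∈ X) (hyt : t < y)
    (h : ∀ a ∈ X, t < a → y ≤ a) : succIn X t = y := by
  have : (X.filter (t < ·)).min = (y : WithTop ℕ+) := by
    apply le_antisymm
    · exact Finset.min_le (Finset.mem_filter.2 ⟨hy, hyt⟩)
    · refine Finset.le_min fun a ha => ?_
      rw [Finset.mem_filter] at ha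
      exact WithTop.coe_le_coe.2 (h a ha.1 ha.2)
  rw [succIn, this]; rfl

theorem predIn_spec {X : Finset ℕ+} {t a : ℕ+} (ha : a ∈ X) (hat : a < t) :
    predIn X t ∈ X ∧ predIn X t < t ∧ ∀ a ∈ X, a < t → a ≤ predIn X t := by
  have hne : (X.filter (· < t)).Nonempty := ⟨a, Finset.mem_filter.2 ⟨ha, hat⟩⟩
  have h1 := Finset.mem_filter.1 (Finset.max'_mem _ hne)
  have h2 : predIn X t = (X.filter (· < t)).max' hne :=
    predIn_eq h1.1 h1.2 fun b hb hbt => Finset.le_max' _ _ (Finset.mem_filter.2 ⟨hb, hbt⟩)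
  rw [h2]
  exact ⟨h1.1, h1.2, fun b hb hbt => Finset.le_max' _ _ (Finset.mem_filter.2 ⟨hb, hbt⟩)⟩

theorem succIn_spec {X : Finset ℕ+} {t a : ℕ+} (ha : a ∈ X) (hat : t < a) :
    succIn X t ∈ X ∧ t < succIn X t ∧ ∀ a ∈ X, t < a → succIn X t ≤ a := by
  have hne : (X.filter (t < ·)).Nonempty := ⟨a, Finset.mem_filter.2 ⟨ha, hat⟩⟩
  have h1 := Finset.mem_filter.1 (Finset.min'_mem _ hne)
  have h2 : succIn X t = (X.filter (t < ·)).min' hne :=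
    succIn_eq h1.1 h1.2 fun b hb hbt => Finset.min'_le _ _ (Finset.mem_filter.2 ⟨hb, hbt⟩)
  rw [h2]
  exact ⟨h1.1, h1.2, fun b hb hbt => Finset.min'_le _ _ (Finset.mem_filter.2 ⟨hb, hbt⟩)⟩

theorem predIn_of_forall {X : Finset ℕ+} {t : ℕ+} (h : ∀ a ∈ X, t ≤ a) : predIn X t = t := by
  have : X.filter (· < t) = ∅ := by
    rw [Finset.filter_eq_empty_iff]; intro a ha; exact not_lt.2 (h a ha)
  rw [predIn, this]; rfl

theorem succIn_of_forall {X : Finset ℕ+} {t : ℕ+} (h : ∀ a ∈ X, a ≤ t) : succIn X t = t := by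
  have : X.filter (t < ·) = ∅ := by
    rw [Finset.filter_eq_empty_iff]; intro a ha; exact not_lt.2 (h a ha)
  rw [succIn, this]; rfl

theorem predIn_le (X : Finset ℕ+) (t : ℕ+) : predIn X t ≤ t := by
  by_cases h : ∃ a ∈ X, a < t
  · obtain ⟨a, ha, hat⟩ := h; exact (predIn_spec ha hat).2.1.le
  · push Not at h; rw [predIn_of_forall h]

theorem le_succIn (X : Finset ℕ+) (t : ℕ+) : t ≤ succIn X t := by
  by_cases h : ∃ a ∈ X, t < a
  · obtain ⟨a, ha, hat⟩ := h; exact (succIn_spec ha hat).2.1.le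
  · push Not at h; rw [succIn_of_forall h]

theorem predIn_succIn {X : Finset ℕ+} {z a : ℕ+} (hz : z ∈ X) (ha : a ∈ X) (h : z < a) :
    predIn X (succIn X z) = z := by
  obtain ⟨h1, h2, h3⟩ := succIn_spec ha h
  exact predIn_eq hz h2 fun b hb hb2 => by
    by_contra hc
    exact absurd (h3 b hb (not_le.1 hc)) (not_le.2 hb2)

theorem succIn_predIn {X : Finset ℕ+} {z a : ℕ+} (hz : z ∈ X) (ha : a ∈ X) (h : a < z) :
    succIn X (predIn X z) = z := by
  obtain ⟨h1, h2, h3⟩ := predIn_spec ha h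
  exact succIn_eq hz h2 fun b hb hb2 => by
    by_contra hc
    exact absurd (h3 b hb (not_le.1 hc)) (not_le.2 hb2)

/-! ### Counting -/

theorem cntGe_le_card (X : Finset ℕ+) (t : ℕ+) : cntGe X t ≤ X.card := Finset.card_filter_le _ _
theorem cntGt_le_card (X : Finset ℕ+) (t : ℕ+) : cntGt X t ≤ X.card := Finset.card_filter_le _ _

theorem cntGe_eq_card {X : Finset ℕ+} {t : ℕ+} (h : ∀ x ∈ X, t ≤ x) : cntGe X t = X.card := by
  rw [cntGe, Finset.filter_true_of_mem h]

theorem cntGt_eq_card {X : Finset ℕ+} {t : ℕ+} (h : ∀ x ∈ X, t < x) : cntGt X t = X.card := by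
  rw [cntGt, Finset.filter_true_of_mem h]

theorem cntGt_le_cntGe (X : Finset ℕ+) (t : ℕ+) : cntGt X t ≤ cntGe X t :=
  Finset.card_le_card fun x hx => by
    rw [Finset.mem_filter] at *; exact ⟨hx.1, hx.2.le⟩

theorem cntGe_of_mem {X : Finset ℕ+} {t : ℕ+} (h : t ∈ X) : cntGe X t = cntGt X t + 1 := by
  have : X.filter (t ≤ ·) = insert t (X.filter (t < ·)) := by
    ext x; simp only [Finset.mem_filter, Finset.mem_insert]
    constructor
    · rintro ⟨h1, h2⟩; rcases h2.eq_or_lt with rfl | h2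
      · exact Or.inl rfl
      · exact Or.inr ⟨h1, h2⟩
    · rintro (rfl | ⟨h1, h2⟩)
      · exact ⟨h, le_rfl⟩
      · exact ⟨h1, h2.le⟩
  rw [cntGe, this, Finset.card_insert_of_notMem (by simp)]; rfl

theorem cntGe_of_notMem {X : Finset ℕ+} {t : ℕ+} (h : t ∉ X) : cntGe X t = cntGt X t := by
  rw [cntGe, cntGt]; congr 1; ext x; simp only [Finset.mem_filter]
  constructor
  · rintro ⟨h1, h2⟩; exact ⟨h1, lt_of_le_of_ne h2 (by rintro rfl; exact h h1)⟩
  · rintro ⟨h1, h2⟩; exact ⟨h1, h2.le⟩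

theorem cntGe_le_cntGt_of_lt {X : Finset ℕ+} {s t : ℕ+} (h : s < t) : cntGe X t ≤ cntGt X s :=
  Finset.card_le_card fun x hx => by
    rw [Finset.mem_filter] at *; exact ⟨hx.1, h.trans_le hx.2⟩

theorem cntGt_anti (X : Finset ℕ+) {s t : ℕ+} (h : s ≤ t) : cntGt X t ≤ cntGt X s :=
  Finset.card_le_card fun x hx => by
    rw [Finset.mem_filter] at *; exact ⟨hx.1, h.trans_lt hx.2⟩

theorem cntGe_anti (X : Finset ℕ+) {s t : ℕ+} (h : s ≤ t) : cntGe X t ≤ cntGe X s :=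
  Finset.card_le_card fun x hx => by
    rw [Finset.mem_filter] at *; exact ⟨hx.1, h.trans hx.2⟩

theorem cntGt_eq_cntGe {X : Finset ℕ+} {s t : ℕ+} (hst : s < t) (h : ∀ x ∈ X, s < x → t ≤ x) :
    cntGt X s = cntGe X t := by
  rw [cntGe, cntGt]; congr 1; ext x; simp only [Finset.mem_filter]
  exact ⟨fun ⟨h1, h2⟩ => ⟨h1, h x h1 h2⟩, fun ⟨h1, h2⟩ => ⟨h1, hst.trans_le h2⟩⟩

theorem cntGt_pos {X : Finset ℕ+} {t : ℕ+} : 0 < cntGt X t ↔ ∃ x ∈ X, t < x := by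
  rw [cntGt, Finset.card_pos]
  exact ⟨fun ⟨x, hx⟩ => ⟨x, Finset.mem_filter.1 hx⟩, fun ⟨x, hx⟩ => ⟨x, Finset.mem_filter.2 hx⟩⟩

theorem cntGe_pos {X : Finset ℕ+} {t : ℕ+} : 0 < cntGe X t ↔ ∃ x ∈ X, t ≤ x := by
  rw [cntGe, Finset.card_pos]
  exact ⟨fun ⟨x, hx⟩ => ⟨x, Finset.mem_filter.1 hx⟩, fun ⟨x, hx⟩ => ⟨x, Finset.mem_filter.2 hx⟩⟩

/-- `B` may stand immediately to the right of `A` in a decreasing tableau. -/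
def Dom (A B : Finset ℕ+) : Prop := ∀ t, cntGe B t ≤ cntGt A t

/-- For `t ∉ B` one may pass to the next element of `B` above `t`: the left count does not change
and the right count does not grow. -/
theorem dom_of_mem {A B : Finset ℕ+} (h : ∀ t ∈ B, cntGe B t ≤ cntGt A t) : Dom A B := by
  intro t
  rcases Nat.eq_zero_or_pos (cntGe B t) with h0 | h0
  · omega
  · obtain ⟨x, hx, htx⟩ := cntGe_pos.1 h0
    by_cases htB : t ∈ B
    · exact h t htB
    · have hlt : t < x := lt_of_le_of_ne htx (by rintro rfl; exact htB hx)
      obtain ⟨h1, h2, h3⟩ := succIn_spec hx hlt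
      rw [cntGe_of_notMem htB, cntGt_eq_cntGe h2 h3]
      exact (h _ h1).trans (cntGt_anti _ h2.le)

theorem Dom.card_le {A B : Finset ℕ+} (h : Dom A B) : B.card ≤ A.card := by
  rw [← cntGe_eq_card (X := B) (t := 1) fun x _ => one_le]
  exact (h 1).trans (cntGt_le_card _ _)

theorem dom_empty (A : Finset ℕ+) : Dom A ∅ := by intro t; simp [cntGe]

theorem Dom.eq_empty {B : Finset ℕ+} (h : Dom ∅ B) : B = ∅ := by
  have := h.card_le; simpa using this

theorem Dom.cntGt_lt {A B : Finset ℕ+} (h : Dom A B) {b : ℕ+} (hb : b ∈ B) :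
    cntGt B b < cntGt A b := by
  have := h b; rw [cntGe_of_mem hb] at this; omega

/-! ### Shifting a pair of sets along their union -/

/-- The column obtained from the column `A` by inserting the elements of `U` in increasing order. -/
def colOut (A U : Finset ℕ+) : Finset ℕ+ :=
  (A ∪ U).filter fun z => (∃ w ∈ A ∪ U, z < w) → succIn (A ∪ U) z ∈ A

/-- The letters bumped out of the column `A` when the elements of `U` are inserted. -/
def colBump (A U : Finset ℕ+) : Finset ℕ+ :=
  (A ∪ U).filter fun z => (∃ w ∈ A ∪ U, z < w) ∧ succIn (A ∪ U) z ∈ U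

/-- Inverse of the shift: recover the old column; `p` says whether it holds the minimum. -/
def colBack (C V : Finset ℕ+) (p : Bool) : Finset ℕ+ :=
  (C ∪ V).filter fun w => if ∃ z ∈ C ∪ V, z < w then predIn (C ∪ V) w ∈ C else p = true

theorem colOut_union_colBump (A U : Finset ℕ+) : colOut A U ∪ colBump A U = A ∪ U := by
  ext z
  simp only [colOut, colBump, Finset.mem_union, Finset.mem_filter]
  constructor
  · rintro (h | h) <;> exact h.1
  · intro hz
    by_cases h : ∃ w, (w ∈ A ∨ w ∈ U) ∧ z < w
    · obtain ⟨w, hw, hzw⟩ := h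
      have := (succIn_spec (X := A ∪ U) (Finset.mem_union.2 hw) hzw).1
      rcases Finset.mem_union.1 this with h' | h'
      · exact Or.inl ⟨hz, fun _ => h'⟩
      · exact Or.inr ⟨hz, ⟨w, hw, hzw⟩, h'⟩
    · exact Or.inl ⟨hz, fun h' => absurd h' h⟩

/-- Along `A ∪ U` the shift moves each label to the preceding element. Only the label of the minimum
is lost, and `p` restores it. -/
theorem colBack_colOut {A U : Finset ℕ+} {p : Bool}
    (hp : ∀ z ∈ A ∪ U, (∀ w ∈ A ∪ U, z ≤ w) → (z ∈ A ↔ p = true)) :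
    colBack (colOut A U) (colBump A U) p = A := by
  unfold colBack
  rw [colOut_union_colBump]
  ext w
  rw [Finset.mem_filter]
  by_cases hw : w ∈ A ∪ U
  · simp only [hw, true_and]
    split_ifs with h
    · obtain ⟨z, hz, hzw⟩ := h
      obtain ⟨h1, h2, h3⟩ := predIn_spec hz hzw
      simp only [colOut, Finset.mem_filter, h1, true_and]
      rw [succIn_predIn hw hz hzw]
      exact ⟨fun h => h ⟨w, hw, h2⟩, fun h _ => h⟩
    · push Not at h
      exact (hp w hw h).symm
  · simp only [hw, false_and, false_iff]
    exact fun h => hw (Finset.mem_union_left _ h)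

theorem colBack_colBump {A U : Finset ℕ+} {p : Bool}
    (hp : ∀ z ∈ A ∪ U, (∀ w ∈ A ∪ U, z ≤ w) → (z ∈ U ↔ p = true)) :
    colBack (colBump A U) (colOut A U) p = U := by
  unfold colBack
  rw [Finset.union_comm, colOut_union_colBump]
  ext w
  rw [Finset.mem_filter]
  by_cases hw : w ∈ A ∪ U
  · simp only [hw, true_and]
    split_ifs with h
    · obtain ⟨z, hz, hzw⟩ := h
      obtain ⟨h1, h2, h3⟩ := predIn_spec hz hzw
      simp only [colBump, Finset.mem_filter, h1, true_and]
      rw [succIn_predIn hw hz hzw]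
      exact ⟨fun h => h.2, fun h => ⟨⟨w, hw, h2⟩, h⟩⟩
    · push Not at h
      exact (hp w hw h).symm
  · simp only [hw, false_and, false_iff]
    exact fun h => hw (Finset.mem_union_right _ h)

theorem colBack_union {C V : Finset ℕ+} {p q : Bool} (hpq : p = true ∨ q = true) :
    colBack C V p ∪ colBack V C q = C ∪ V := by
  unfold colBack
  rw [Finset.union_comm V C]
  ext w
  simp only [Finset.mem_union (a := w), Finset.mem_filter]
  constructor
  · rintro (h | h) <;> exact h.1
  · intro hw
    by_cases h : ∃ z ∈ C ∪ V, z < w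
    · obtain ⟨z, hz, hzw⟩ := h
      have := (predIn_spec hz hzw).1
      rcases Finset.mem_union.1 this with h' | h'
      · exact Or.inl ⟨hw, by rw [if_pos ⟨z, hz, hzw⟩]; exact h'⟩
      · exact Or.inr ⟨hw, by rw [if_pos ⟨z, hz, hzw⟩]; exact h'⟩
    · rw [if_neg h, if_neg h]
      rcases hpq with h' | h'
      · exact Or.inl ⟨hw, h'⟩
      · exact Or.inr ⟨hw, h'⟩

/-- The maximum of the union has no successor and always stays in the column. This is the only
restriction on a pair in the image of the shift, whence `hmax`. -/
theorem colOut_colBack {C V : Finset ℕ+} {p q : Bool} (hpq : p = true ∨ q = true)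
    (hmax : ∀ z ∈ C ∪ V, (∀ w ∈ C ∪ V, w ≤ z) → z ∈ C) :
    colOut (colBack C V p) (colBack V C q) = C := by
  unfold colOut
  rw [colBack_union hpq]
  ext z
  rw [Finset.mem_filter]
  by_cases hz : z ∈ C ∪ V
  · simp only [hz, true_and]
    by_cases h : ∃ w ∈ C ∪ V, z < w
    · obtain ⟨w, hw, hzw⟩ := h
      obtain ⟨h1, h2, h3⟩ := succIn_spec hw hzw
      have h4 : ∃ z ∈ C ∪ V, z < succIn (C ∪ V) z := ⟨z, hz, h2⟩
      simp only [colBack, Finset.mem_filter, h1, true_and]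
      rw [if_pos ⟨z, hz, h2⟩, predIn_succIn hz hw hzw]
      exact ⟨fun h => h ⟨w, hw, hzw⟩, fun h _ => h⟩
    · have h' := h
      push Not at h'
      exact ⟨fun _ => hmax z hz h', fun _ h'' => absurd h'' h⟩
  · simp only [hz, false_and, false_iff]
    exact fun h => hz (Finset.mem_union_left _ h)

theorem colBump_colBack {C V : Finset ℕ+} {p q : Bool} (hpq : p = true ∨ q = true)
    (hmax : ∀ z ∈ V, ∃ w ∈ C ∪ V, z < w) :
    colBump (colBack C V p) (colBack V C q) = V := by
  unfold colBump
  rw [colBack_union hpq]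
  ext z
  rw [Finset.mem_filter]
  by_cases hz : z ∈ C ∪ V
  · simp only [hz, true_and]
    by_cases h : ∃ w ∈ C ∪ V, z < w
    · obtain ⟨w, hw, hzw⟩ := h
      obtain ⟨h1, h2, h3⟩ := succIn_spec hw hzw
      rw [Finset.union_comm] at h1
      simp only [colBack, Finset.mem_filter]
      rw [Finset.union_comm] at h1
      rw [Finset.union_comm V C, if_pos ⟨z, hz, h2⟩, predIn_succIn hz hw hzw]
      exact ⟨fun h => h.2.2, fun h => ⟨⟨w, hw, hzw⟩, h1, h⟩⟩
    · exact ⟨fun h' => absurd h'.1 h, fun h' => absurd (hmax z h') h⟩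
  · simp only [hz, false_and, false_iff]
    exact fun h => hz (Finset.mem_union_right _ h)

theorem mem_colBack_of_min {C V : Finset ℕ+} {p : Bool} {z : ℕ+} (hz : z ∈ C ∪ V)
    (h : ∀ w ∈ C ∪ V, z ≤ w) : z ∈ colBack C V p ↔ p = true := by
  unfold colBack
  rw [Finset.mem_filter, if_neg (by push Not; exact h)]
  exact ⟨fun h => h.2, fun h => ⟨hz, h⟩⟩

/-- Taking successors in `A ∪ U` matches the elements of the new column from `z` on, other than the
maximum of the union, with the elements of `A` above `z`. The maximum accounts for the extra 1. All
later comparisons of columns rest on this count. -/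
theorem cntGe_colOut {A U : Finset ℕ+} {z : ℕ+} (hz : z ∈ A ∪ U) :
    cntGe (colOut A U) z = cntGt A z + 1 := by
  -- Descend along `A ∪ U`, by induction on the number of its elements above `z`.
  have key : ∀ n, ∀ z ∈ A ∪ U, cntGt (A ∪ U) z = n → cntGe (colOut A U) z = cntGt A z + 1 := by
    intro n
    induction n using Nat.strong_induction_on with
    | _ n ih =>
      intro z hz hn
      have hsub : ∀ x ∈ colOut A U, x ∈ A ∪ U := fun x hx => (Finset.mem_filter.1 hx).1
      by_cases h : ∃ w ∈ A ∪ U, z < w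
      · obtain ⟨w, hw, hzw⟩ := h
        obtain ⟨h1, h2, h3⟩ := succIn_spec hw hzw
        set s := succIn (A ∪ U) z with hs
        have hlt : cntGt (A ∪ U) s < n := by
          rw [← hn, cntGt_eq_cntGe h2 h3, cntGe_of_mem h1]; omega
        have ih' := ih _ hlt s h1 rfl
        have e1 : cntGt (colOut A U) z = cntGe (colOut A U) s :=
          cntGt_eq_cntGe h2 fun x hx => h3 x (hsub x hx)
        have e2 : cntGt A z = cntGe A s :=
          cntGt_eq_cntGe h2 fun x hx => h3 x (Finset.mem_union_left _ hx)
        by_cases hsA : s ∈ A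
        · have hzC : z ∈ colOut A U := Finset.mem_filter.2 ⟨hz, fun _ => hsA⟩
          rw [cntGe_of_mem hzC, e1, ih', e2, cntGe_of_mem hsA]
        · have hzC : z ∉ colOut A U := fun h => hsA ((Finset.mem_filter.1 h).2 ⟨w, hw, hzw⟩)
          rw [cntGe_of_notMem hzC, e1, ih', e2, cntGe_of_notMem hsA]
      · have hzC : z ∈ colOut A U := Finset.mem_filter.2 ⟨hz, fun h' => absurd h' h⟩
        push Not at h
        have e1 : cntGt (colOut A U) z = 0 := by
          by_contra h0
          obtain ⟨x, hx, hzx⟩ := cntGt_pos.1 (Nat.pos_of_ne_zero h0)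
          exact absurd (h x (hsub x hx)) (not_le.2 hzx)
        have e2 : cntGt A z = 0 := by
          by_contra h0
          obtain ⟨x, hx, hzx⟩ := cntGt_pos.1 (Nat.pos_of_ne_zero h0)
          exact absurd (h x (Finset.mem_union_left _ hx)) (not_le.2 hzx)
        rw [cntGe_of_mem hzC, e1, e2]
  exact key _ z hz rfl

theorem colOut_subset (A U : Finset ℕ+) : colOut A U ⊆ A ∪ U := Finset.filter_subset _ _
theorem colBump_subset (A U : Finset ℕ+) : colBump A U ⊆ A ∪ U := Finset.filter_subset _ _

theorem mem_colBump {A U : Finset ℕ+} {v : ℕ+} :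
    v ∈ colBump A U ↔ v ∈ A ∪ U ∧ (∃ w ∈ A ∪ U, v < w) ∧ succIn (A ∪ U) v ∈ U := by
  rw [colBump, Finset.mem_filter]

theorem mem_colOut {A U : Finset ℕ+} {v : ℕ+} :
    v ∈ colOut A U ↔ v ∈ A ∪ U ∧ ((∃ w ∈ A ∪ U, v < w) → succIn (A ∪ U) v ∈ A) := by
  rw [colOut, Finset.mem_filter]

/-- Insertion only raises entries or adds one. At elements of the union this is `cntGe_colOut`; any
other `t` is replaced by the next element of the union. -/
theorem cntGe_le_cntGe_colOut {A U : Finset ℕ+} (t : ℕ+) : cntGe A t ≤ cntGe (colOut A U) t := by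
  rcases Nat.eq_zero_or_pos (cntGe A t) with h0 | h0
  · omega
  obtain ⟨x, hx, htx⟩ := cntGe_pos.1 h0
  by_cases htZ : t ∈ A ∪ U
  · rw [cntGe_colOut htZ]
    by_cases htA : t ∈ A
    · rw [cntGe_of_mem htA]
    · rw [cntGe_of_notMem htA]; omega
  · have hlt : t < x := lt_of_le_of_ne htx
      (by rintro rfl; exact htZ (Finset.mem_union_left _ hx))
    obtain ⟨h1, h2, h3⟩ := succIn_spec (Finset.mem_union_left U hx) hlt
    have e1 : cntGe A t = cntGe A (succIn (A ∪ U) t) := by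
      rw [cntGe_of_notMem (fun h => htZ (Finset.mem_union_left _ h))]
      exact cntGt_eq_cntGe h2 fun y hy => h3 y (Finset.mem_union_left _ hy)
    rw [e1]
    have e2 := cntGe_colOut h1
    have e3 : cntGe A (succIn (A ∪ U) t) ≤ cntGt A (succIn (A ∪ U) t) + 1 := by
      by_cases htA : succIn (A ∪ U) t ∈ A
      · rw [cntGe_of_mem htA]
      · rw [cntGe_of_notMem htA]; omega
    have e4 := cntGe_anti (colOut A U) h2.le
    omega

theorem card_colOut_of_min_mem {A U : Finset ℕ+} {z : ℕ+} (hz : z ∈ A)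
    (h : ∀ w ∈ A ∪ U, z ≤ w) : (colOut A U).card = A.card := by
  have h1 := cntGe_colOut (U := U) (Finset.mem_union_left U hz)
  rw [cntGe_eq_card fun x hx => h x (colOut_subset _ _ hx)] at h1
  rw [h1, ← cntGe_of_mem hz, cntGe_eq_card fun x hx => h x (Finset.mem_union_left _ hx)]

theorem card_colOut_of_min_notMem {A U : Finset ℕ+} {z : ℕ+} (hz : z ∈ U) (hzA : z ∉ A)
    (h : ∀ w ∈ A ∪ U, z ≤ w) : (colOut A U).card = A.card + 1 := by
  have h1 := cntGe_colOut (A := A) (Finset.mem_union_right A hz)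
  rw [cntGe_eq_card fun x hx => h x (colOut_subset _ _ hx)] at h1
  rw [h1, ← cntGe_of_notMem hzA, cntGe_eq_card fun x hx => h x (Finset.mem_union_left _ hx)]

/-- Successor is a bijection from the bumped letters onto the inserted letters that have a
predecessor in the union. -/
theorem card_colBump {A U : Finset ℕ+} {z : ℕ+} (hz : z ∈ A ∪ U)
    (h : ∀ w ∈ A ∪ U, z ≤ w) : (colBump A U).card = (U.erase z).card := by
  refine Finset.card_bij (fun v _ => succIn (A ∪ U) v) ?_ ?_ ?_
  · intro v hv
    rw [mem_colBump] at hv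
    obtain ⟨h1, ⟨w, hw, hvw⟩, h2⟩ := hv
    exact Finset.mem_erase.2 ⟨((h v h1).trans_lt (succIn_spec hw hvw).2.1).ne', h2⟩
  · intro v hv v' hv' he
    rw [mem_colBump] at hv hv'
    obtain ⟨h1, ⟨w, hw, hvw⟩, h2⟩ := hv
    obtain ⟨h1', ⟨w', hw', hvw'⟩, h2'⟩ := hv'
    rw [← predIn_succIn h1 hw hvw, ← predIn_succIn h1' hw' hvw']
    exact congrArg _ he
  · intro u hu
    rw [Finset.mem_erase] at hu
    have hu' : u ∈ A ∪ U := Finset.mem_union_right _ hu.2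
    have hlt : z < u := lt_of_le_of_ne (h u hu') hu.1.symm
    obtain ⟨h1, h2, h3⟩ := predIn_spec hz hlt
    refine ⟨predIn (A ∪ U) u, mem_colBump.2 ⟨h1, ⟨u, hu', h2⟩, ?_⟩, succIn_predIn hu' hz hlt⟩
    rw [succIn_predIn hu' hz hlt]; exact hu.2

/-! ## Insertion of an increasing word, column by column -/

/-- The letter passed on to the next column `B` when `y` is bumped from a column that has
become `A`. -/
def adj (A B : Finset ℕ+) (y : ℕ+) : ℕ+ := if cntGt A y = cntGt B y then succIn B y else y

/-- Inverse of `adj`. -/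
def unadj (C B : Finset ℕ+) (u : ℕ+) : ℕ+ :=
  if u ∈ B ∧ cntGe C u = cntGe B u then predIn C u else u

/-- Insertion of `x` into a column in which some entry is smaller than `x`. -/
def colIns (A : Finset ℕ+) (x : ℕ+) : Finset ℕ+ :=
  if x ∈ A then A else insert x (A.erase (predIn A x))

/-- Hecke insertion on lists of column sets. -/
def setInsert : List (Finset ℕ+) → ℕ+ → List (Finset ℕ+)
  | [], x => [{x}]
  | A :: R, x =>
    if ∃ a ∈ A, a < x then
      colIns A x :: setInsert R (adj (colIns A x) (R.headD ∅) (predIn A x))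
    else insert x A :: R

/-- The elements of `U` in increasing order. -/
def ascWord (U : Finset ℕ+) : List ℕ+ := U.sort (· ≤ ·)

/-- The set of letters passed on to the next column `B`. -/
def passOn (A U B : Finset ℕ+) : Finset ℕ+ := (colBump A U).image (adj (colOut A U) B)

theorem ascWord_insert_max {U : Finset ℕ+} {x : ℕ+} (h : ∀ u ∈ U, u < x) :
    ascWord (insert x U) = ascWord U ++ [x] := by
  have hx : x ∉ U := fun hx => lt_irrefl _ (h x hx)
  refine List.Perm.eq_of_pairwise (le := (· ≤ ·)) ?_ (Finset.pairwise_sort _ _) ?_ ?_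
  · intro a b _ _ h1 h2; exact le_antisymm h1 h2
  · rw [List.pairwise_append]
    refine ⟨Finset.pairwise_sort _ _, List.pairwise_singleton _ _, ?_⟩
    intro a ha b hb
    rw [List.mem_singleton] at hb
    rw [hb]; exact (h a ((Finset.mem_sort _).1 ha)).le
  · refine (List.perm_ext_iff_of_nodup (Finset.sort_nodup _ _) ?_).2 ?_
    · rw [List.nodup_append]
      refine ⟨Finset.sort_nodup _ _, List.nodup_singleton _, ?_⟩
      intro a ha b hb
      rw [List.mem_singleton] at hb
      rw [hb]; exact (h a ((Finset.mem_sort _).1 ha)).ne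
    · intro a
      simp [ascWord, or_comm]

@[simp] theorem ascWord_empty : ascWord ∅ = [] := by simp [ascWord]

/-- The adjusted letter depends only on how many entries on the left exceed `y` and on the part of
the right column above `y`. Hence it is not affected by the insertion of the other letters of an
increasing word. -/
theorem adj_congr {A B A' B' : Finset ℕ+} {y : ℕ+} (hA : cntGt A y = cntGt A' y)
    (hB : B.filter (y < ·) = B'.filter (y < ·)) : adj A B y = adj A' B' y := by
  unfold adj
  have : cntGt B y = cntGt B' y := by unfold cntGt; rw [hB]
  rw [hA, this, succIn, succIn, hB]

theorem le_adj (A B : Finset ℕ+) (y : ℕ+) : y ≤ adj A B y := by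
  unfold adj; split_ifs
  · exact le_succIn _ _
  · exact le_rfl

/-- If the adjusted letter `b` reached the next element `s` of the union, then `cntGt A s + 1 =
cntGe C s ≤ cntGt C v = cntGe B b ≤ cntGt A b ≤ cntGt A s` for the new column `C`. Consequently
letters passed on in succession remain strictly increasing. -/
theorem adj_lt_succIn {A U B : Finset ℕ+} (hAB : Dom A B) {v : ℕ+} (hv : v ∈ colBump A U) :
    adj (colOut A U) B v < succIn (A ∪ U) v := by
  obtain ⟨h1, ⟨w, hw, hvw⟩, h2⟩ := mem_colBump.1 hv
  obtain ⟨h3, h4, h5⟩ := succIn_spec hw hvw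
  unfold adj; split_ifs with h
  · by_cases hB : ∃ b ∈ B, v < b
    · obtain ⟨b, hb, hvb⟩ := hB
      obtain ⟨g1, g2, g3⟩ := succIn_spec hb hvb
      by_contra hc
      rw [not_lt] at hc
      have e1 := hAB (succIn B v)
      rw [← cntGt_eq_cntGe g2 g3, ← h] at e1
      have e2 := cntGt_anti A hc
      have e3 := cntGe_colOut h3
      have e4 : cntGe (colOut A U) (succIn (A ∪ U) v) ≤ cntGt (colOut A U) v :=
        cntGe_le_cntGt_of_lt h4
      omega
    · push Not at hB
      rw [succIn_of_forall hB]; exact h4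
  · exact h4

/-- Only `x` and possibly an entry below `x` are affected. So a later, larger letter sees the same
entries above it as before. -/
theorem filter_headD_setInsert (R : List (Finset ℕ+)) {x t : ℕ+} (h : x ≤ t) :
    ((setInsert R x).headD ∅).filter (t < ·) = (R.headD ∅).filter (t < ·) := by
  cases R with
  | nil => ext a; simp [setInsert]; rintro rfl; exact h
  | cons A R =>
    have hh : ∀ {S : Finset ℕ+}, (insert x S).filter (t < ·) = S.filter (t < ·) := by
      intro S; rw [Finset.filter_insert, if_neg (not_lt.2 h)]
    unfold setInsert
    split_ifs with h1
    · obtain ⟨a, ha, hax⟩ := h1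
      simp only [List.headD_cons, colIns]
      split_ifs
      · rfl
      · rw [hh]
        ext b
        simp only [Finset.mem_filter, Finset.mem_erase]
        have := (predIn_spec ha hax).2.1
        constructor
        · rintro ⟨⟨_, h2⟩, h3⟩; exact ⟨h2, h3⟩
        · rintro ⟨h2, h3⟩; exact ⟨⟨(this.trans_le (h.trans h3.le)).ne', h2⟩, h3⟩
    · simp only [List.headD_cons]; rw [hh]

theorem filter_headD_foldl_setInsert (l : List ℕ+) (R : List (Finset ℕ+)) {t : ℕ+}
    (h : ∀ x ∈ l, x ≤ t) :
    ((l.foldl setInsert R).headD ∅).filter (t < ·) = (R.headD ∅).filter (t < ·) := by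
  induction l generalizing R with
  | nil => rfl
  | cons x l ih =>
    rw [List.foldl_cons, ih _ fun y hy => h y (List.mem_cons_of_mem _ hy),
      filter_headD_setInsert _ (h x List.mem_cons_self)]

/-! ### Effect on one column of a further letter larger than all earlier ones -/

section AddMax

variable {A U : Finset ℕ+} {x : ℕ+}

/-- The two hypotheses together force `U` to be empty, so `x` is the first letter and lands at the
bottom or is absorbed there. -/
theorem colOut_insert_of_forall_le (hZ : ∀ z ∈ A ∪ U, x ≤ z) (hU : ∀ u ∈ U, u < x) :
    colOut A (insert x U) = insert x A ∧ colBump A (insert x U) = ∅ ∧ colOut A U = A ∧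
      colBump A U = ∅ := by
  have hU0 : U = ∅ := by
    rw [Finset.eq_empty_iff_forall_notMem]
    exact fun u hu => absurd (hZ u (Finset.mem_union_right _ hu)) (not_le.2 (hU u hu))
  subst hU0
  have hu1 : A ∪ insert x ∅ = insert x A := by ext; simp
  have hs : ∀ z w, w ∈ insert x A → z ∈ insert x A → z < w → succIn (insert x A) z ∈ A ∧
      succIn (insert x A) z ≠ x := by
    intro z w hw hz hzw
    obtain ⟨h1, h2, -⟩ := succIn_spec hw hzw
    have hxz : x ≤ z := by
      rcases Finset.mem_insert.1 hz with rfl | h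
      · exact le_rfl
      · exact hZ z (by simpa using h)
    have h3 : succIn (insert x A) z ≠ x := (hxz.trans_lt h2).ne'
    exact ⟨(Finset.mem_insert.1 h1).resolve_left h3, h3⟩
  refine ⟨?_, ?_, ?_, ?_⟩
  · rw [colOut, hu1, Finset.filter_true_of_mem]
    rintro z hz ⟨w, hw, hzw⟩; exact (hs z w hw hz hzw).1
  · rw [colBump, hu1, Finset.filter_eq_empty_iff]
    rintro z hz ⟨⟨w, hw, hzw⟩, h⟩
    exact (hs z w hw hz hzw).2 (by simpa using h)
  · rw [colOut, Finset.union_empty, Finset.filter_true_of_mem]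
    rintro z hz ⟨w, hw, hzw⟩; exact (succIn_spec hw hzw).1
  · rw [colBump, Finset.filter_eq_empty_iff]
    rintro z hz ⟨_, h⟩; simp at h

/-- A successor of this predecessor is at least `x`, hence not in `U`; so the predecessor has
remained in the column and is what `x` bumps. -/
theorem predIn_colOut (hU : ∀ u ∈ U, u < x) {z : ℕ+} (hz : z ∈ A ∪ U) (hzx : z < x) :
    predIn (A ∪ U) x ∈ colOut A U ∧ predIn (colOut A U) x = predIn (A ∪ U) x := by
  obtain ⟨h1, h2, h3⟩ := predIn_spec hz hzx
  have hm : predIn (A ∪ U) x ∈ colOut A U := by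
    rw [mem_colOut]
    refine ⟨h1, fun ⟨w, hw, hlt⟩ => ?_⟩
    obtain ⟨g1, g2, g3⟩ := succIn_spec hw hlt
    rcases Finset.mem_union.1 g1 with h | h
    · exact h
    · exact absurd (h3 _ g1 (hU _ h)) (not_le.2 g2)
  exact ⟨hm, predIn_eq hm h2 fun a ha hax => h3 a (colOut_subset _ _ ha) hax⟩

theorem succIn_insert_max (hU : ∀ u ∈ U, u < x) {z w : ℕ+} (hz : z ∈ A ∪ U) (hw : w ∈ A ∪ U)
    (hzw : z < w) (hne : z ≠ predIn (A ∪ U) x) :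
    succIn (A ∪ insert x U) z = succIn (A ∪ U) z := by
  obtain ⟨g1, g2, g3⟩ := succIn_spec hw hzw
  have hsub : A ∪ insert x U = insert x (A ∪ U) := by rw [Finset.union_insert]
  rw [hsub]
  refine succIn_eq (Finset.mem_insert_of_mem g1) g2 fun a ha hza => ?_
  rcases Finset.mem_insert.1 ha with rfl | ha
  · obtain ⟨h1, h2, h3⟩ := predIn_spec hz hza
    exact (g3 _ h1 (lt_of_le_of_ne (h3 z hz hza) hne)).trans h2.le
  · exact g3 a ha hza

/-- Adjoining `x` changes the successor of only one old element, the predecessor `y` of `x`, which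
therefore gets bumped. If `x ∈ A`, then `x` is the successor of `y` in both roles: `y` is bumped and
also stays, as in an insertion that leaves the column unchanged. -/
theorem colOut_insert_max (hU : ∀ u ∈ U, u < x) {z₀ : ℕ+} (hz₀ : z₀ ∈ A ∪ U) (hzx : z₀ < x) :
    colOut A (insert x U) = colIns (colOut A U) x ∧
      colBump A (insert x U) = insert (predIn (A ∪ U) x) (colBump A U) := by
  obtain ⟨h1, h2, h3⟩ := predIn_spec hz₀ hzx
  obtain ⟨hp1, hp2⟩ := predIn_colOut hU hz₀ hzx
  set y := predIn (A ∪ U) x with hy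
  have hZ : A ∪ insert x U = insert x (A ∪ U) := by rw [Finset.union_insert]
  have hxU : x ∉ U := fun h => lt_irrefl _ (hU x h)
  have hsy : succIn (A ∪ insert x U) y = x := by
    rw [hZ]
    refine succIn_eq (Finset.mem_insert_self _ _) h2 fun a ha hya => ?_
    rcases Finset.mem_insert.1 ha with rfl | ha
    · exact le_rfl
    · by_contra hc; exact absurd (h3 a ha (not_le.1 hc)) (not_le.2 hya)
  have hsgt : ∀ z w, z ∈ A ∪ insert x U → w ∈ A ∪ insert x U → z < w → x ≤ z →
      succIn (A ∪ insert x U) z ∈ A := by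
    intro z w hz hw hzw hxz
    obtain ⟨g1, g2, -⟩ := succIn_spec hw hzw
    rcases Finset.mem_union.1 g1 with g | g
    · exact g
    · exact absurd (lt_of_le_of_lt hxz g2) (not_lt.2 (by
        rcases Finset.mem_insert.1 g with e | g
        · exact e.le
        · exact (hU _ g).le))
  have hlt_ex : ∀ z ∈ A ∪ U, z ≠ y → (∃ w ∈ A ∪ insert x U, z < w) → ∃ w ∈ A ∪ U, z < w := by
    rintro z hz hne ⟨w, hw, hzw⟩
    rw [hZ] at hw
    rcases Finset.mem_insert.1 hw with rfl | hw
    · exact ⟨y, h1, lt_of_le_of_ne (h3 z hz hzw) hne⟩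
    · exact ⟨w, hw, hzw⟩
  have hsub : A ∪ U ⊆ A ∪ insert x U := by rw [hZ]; exact Finset.subset_insert _ _
  constructor
  · by_cases hxA : x ∈ A
    · have hxZ : x ∈ A ∪ U := Finset.mem_union_left _ hxA
      have hZ' : A ∪ insert x U = A ∪ U := by rw [hZ]; exact Finset.insert_eq_of_mem hxZ
      have hxC : x ∈ colOut A U := mem_colOut.2 ⟨hxZ, fun ⟨w, hw, hlt⟩ => by
        have := hsgt x w (by rwa [hZ']) (by rwa [hZ']) hlt le_rfl
        rwa [hZ'] at this⟩
      rw [colIns, if_pos hxC, colOut, colOut, hZ']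
    · have hxZ : x ∉ A ∪ U := by simp [hxA, hxU]
      have hxC : x ∉ colOut A U := fun h => hxZ (colOut_subset _ _ h)
      rw [colIns, if_neg hxC, hp2]
      ext z
      rw [mem_colOut, Finset.mem_insert, Finset.mem_erase, mem_colOut]
      constructor
      · rintro ⟨hz, hz2⟩
        rw [hZ] at hz
        rcases Finset.mem_insert.1 hz with rfl | hz
        · exact Or.inl rfl
        · have hne : z ≠ y := by
            rintro rfl
            exact hxA (hsy ▸ hz2 ⟨x, by rw [hZ]; exact Finset.mem_insert_self _ _, h2⟩)
          refine Or.inr ⟨hne, hz, fun ⟨w, hw, hlt⟩ => ?_⟩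
          rw [← succIn_insert_max hU hz hw hlt hne]
          exact hz2 ⟨w, hsub hw, hlt⟩
      · rintro (rfl | ⟨hne, hz, hz2⟩)
        · refine ⟨by rw [hZ]; exact Finset.mem_insert_self _ _, fun ⟨w, hw, hlt⟩ => ?_⟩
          exact hsgt z w (by rw [hZ]; exact Finset.mem_insert_self _ _) hw hlt le_rfl
        · refine ⟨hsub hz, fun hex => ?_⟩
          obtain ⟨w, hw, hlt⟩ := hlt_ex z hz hne hex
          rw [succIn_insert_max hU hz hw hlt hne]
          exact hz2 ⟨w, hw, hlt⟩
  · ext z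
    rw [Finset.mem_insert (a := z), mem_colBump, mem_colBump]
    constructor
    · rintro ⟨hz, ⟨w, hw, hlt⟩, hz2⟩
      by_cases hne : z = y
      · exact Or.inl hne
      right
      have hz' : z ∈ A ∪ U := by
        rw [hZ] at hz
        rcases Finset.mem_insert.1 hz with rfl | hz
        · exfalso
          obtain ⟨g1, g2, -⟩ := succIn_spec hw hlt
          rcases Finset.mem_insert.1 hz2 with e | g
          · exact g2.ne' e
          · exact lt_asymm g2 (hU _ g)
        · exact hz
      obtain ⟨w', hw', hlt'⟩ := hlt_ex z hz' hne ⟨w, hw, hlt⟩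
      refine ⟨hz', ⟨w', hw', hlt'⟩, ?_⟩
      rw [succIn_insert_max hU hz' hw' hlt' hne] at hz2
      rcases Finset.mem_insert.1 hz2 with e | g
      · exfalso
        obtain ⟨g1, g2, g3⟩ := succIn_spec hw' hlt'
        rw [e] at g2 g3
        exact absurd (g3 y h1 (lt_of_le_of_ne (h3 z hz' g2) hne)) (not_le.2 h2)
      · exact g
    · rintro (rfl | ⟨hz, ⟨w, hw, hlt⟩, hz2⟩)
      · refine ⟨hsub h1, ⟨x, by rw [hZ]; exact Finset.mem_insert_self _ _, h2⟩, ?_⟩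
        rw [hsy]; exact Finset.mem_insert_self _ _
      · refine ⟨hsub hz, ⟨w, hsub hw, hlt⟩, ?_⟩
        have hne : z ≠ y := by
          rintro rfl
          exact absurd (h3 _ (succIn_spec hw hlt).1 (hU _ hz2))
            (not_le.2 (succIn_spec hw hlt).2.1)
        rw [succIn_insert_max hU hz hw hlt hne]
        exact Finset.mem_insert_of_mem hz2

theorem succIn_le_predIn_of_mem_colBump (hU : ∀ u ∈ U, u < x) {v : ℕ+} (hv : v ∈ colBump A U) :
    succIn (A ∪ U) v ≤ predIn (A ∪ U) x := by
  obtain ⟨h1, ⟨w, hw, hvw⟩, h2⟩ := mem_colBump.1 hv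
  have h3 := (succIn_spec hw hvw).1
  exact (predIn_spec h3 (hU _ h2)).2.2 _ h3 (hU _ h2)

/-- One element above `v` is exchanged for another. This keeps the adjustments of the letters bumped
earlier valid. -/
theorem cntGt_colIns_of_lt {C : Finset ℕ+} {x z v : ℕ+} (hz : z ∈ C) (hzx : z < x)
    (hv : v < predIn C x) : cntGt (colIns C x) v = cntGt C v := by
  obtain ⟨h1, h2, h3⟩ := predIn_spec hz hzx
  unfold colIns
  split_ifs with h
  · rfl
  · unfold cntGt
    rw [Finset.filter_insert, if_pos (hv.trans h2), Finset.filter_erase,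
      Finset.card_insert_of_notMem, Finset.card_erase_of_mem]
    · have : 0 < (C.filter (v < ·)).card := Finset.card_pos.2 ⟨_, Finset.mem_filter.2 ⟨h1, hv⟩⟩
      omega
    · exact Finset.mem_filter.2 ⟨h1, hv⟩
    · exact fun h' => h (Finset.mem_filter.1 (Finset.mem_of_mem_erase h')).1

end AddMax

/-- Inserting the elements of `U` in increasing order acts column by column. -/
theorem foldl_setInsert_cons (A : Finset ℕ+) (R : List (Finset ℕ+)) (hR : Dom A (R.headD ∅))
    (U : Finset ℕ+) :
    (ascWord U).foldl setInsert (A :: R)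
      = colOut A U :: (ascWord (passOn A U (R.headD ∅))).foldl setInsert R := by
  induction U using Finset.induction_on_max with
  | empty =>
    have h1 : colOut A ∅ = A := by
      rw [colOut, Finset.union_empty, Finset.filter_true_of_mem]
      rintro z hz ⟨w, hw, hzw⟩; exact (succIn_spec hw hzw).1
    have h2 : colBump A ∅ = ∅ := by
      rw [colBump, Finset.filter_eq_empty_iff]
      rintro z hz ⟨_, h⟩; simp at h
    simp [passOn, h1, h2]
  | insert x U hU ih =>
    rw [ascWord_insert_max hU, List.foldl_append, ih, List.foldl_cons, List.foldl_nil]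
    by_cases hz : ∃ z ∈ A ∪ U, z < x
    · obtain ⟨z₀, hz₀, hzx⟩ := hz
      obtain ⟨h1, h2, h3⟩ := predIn_spec hz₀ hzx
      obtain ⟨hp1, hp2⟩ := predIn_colOut hU hz₀ hzx
      obtain ⟨e1, e2⟩ := colOut_insert_max hU hz₀ hzx
      -- Everything passed on before is smaller than the entry bumped now, so the new letter comes
      -- last in the next increasing word.
      have hlt : ∀ u ∈ passOn A U (R.headD ∅), u < predIn (A ∪ U) x := by
        intro u hu
        obtain ⟨v, hv, rfl⟩ := Finset.mem_image.1 hu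
        exact (adj_lt_succIn hR hv).trans_le (succIn_le_predIn_of_mem_colBump hU hv)
      have hpass : passOn A (insert x U) (R.headD ∅)
          = insert (adj (colIns (colOut A U) x) (R.headD ∅) (predIn (A ∪ U) x))
              (passOn A U (R.headD ∅)) := by
        rw [passOn, e1, e2, Finset.image_insert]
        congr 1
        refine Finset.image_congr fun v hv => ?_
        refine adj_congr ?_ rfl
        have hv' : v < predIn (A ∪ U) x :=
          lt_of_lt_of_le ((succIn_spec (mem_colBump.1 hv).2.1.choose_spec.1
            (mem_colBump.1 hv).2.1.choose_spec.2).2.1) (succIn_le_predIn_of_mem_colBump hU hv)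
        exact cntGt_colIns_of_lt hp1 h2 (by rw [hp2]; exact hv')
      rw [hpass, ascWord_insert_max (fun u hu => (hlt u hu).trans_le (le_adj _ _ _)),
        List.foldl_append, List.foldl_cons, List.foldl_nil, setInsert,
        if_pos ⟨_, hp1, h2⟩, hp2, e1]
      congr 2
      -- The next column has meanwhile absorbed the earlier letters, but its entries above the
      -- bumped letter are still the original ones.
      refine adj_congr rfl ?_
      exact filter_headD_foldl_setInsert _ _ fun u hu => (hlt u ((Finset.mem_sort _).1 hu)).le
    · push Not at hz
      obtain ⟨e1, e2, e3, e4⟩ := colOut_insert_of_forall_le hz hU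
      simp only [passOn, e1, e2, e3, e4, Finset.image_empty, ascWord_empty, List.foldl_nil]
      rw [setInsert, if_neg]
      push Not
      exact fun a ha => hz a (Finset.mem_union_left _ ha)

/-! ## Hecke insertion in terms of column sets -/

theorem cntGt_insert_of_lt {S : Finset ℕ+} {c t : ℕ+} (hc : c ∉ S) (h : t < c) :
    cntGt (insert c S) t = cntGt S t + 1 := by
  rw [cntGt, Finset.filter_insert, if_pos h, Finset.card_insert_of_notMem]
  · rfl
  · exact fun h' => hc (Finset.mem_filter.1 h').1

theorem cntGt_eq_zero {X : Finset ℕ+} {t : ℕ+} (h : ∀ x ∈ X, x ≤ t) : cntGt X t = 0 := by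
  by_contra h0
  obtain ⟨x, hx, htx⟩ := cntGt_pos.1 (Nat.pos_of_ne_zero h0)
  exact absurd (h x hx) (not_le.2 htx)

/-- In a strictly decreasing column the entries above `t` fill the top rows. This converts
row-by-row comparison into counting. -/
theorem lt_getElem_iff {C : List ℕ+} (hC : C.Pairwise (· > ·)) {r : ℕ} (hr : r < C.length)
    (t : ℕ+) : t < C[r] ↔ r < cntGt C.toFinset t := by
  induction C generalizing r with
  | nil => simp at hr
  | cons c C ih =>
    rw [List.pairwise_cons] at hC
    have hc : c ∉ C.toFinset := fun h => lt_irrefl _ (hC.1 c (List.mem_toFinset.1 h))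
    rw [List.toFinset_cons]
    by_cases htc : t < c
    · rw [cntGt_insert_of_lt hc htc]
      cases r with
      | zero => simp [htc]
      | succ r =>
        rw [List.getElem_cons_succ, ih hC.2 (by simpa using hr)]; omega
    · rw [cntGt_eq_zero]
      · simp only [not_lt_zero, iff_false, not_lt]
        cases r with
        | zero => simpa using htc
        | succ r =>
          rw [List.getElem_cons_succ]
          exact (hC.1 _ (List.getElem_mem _)).le.trans (not_lt.1 htc)
      · intro x hx
        rcases Finset.mem_insert.1 hx with rfl | hx
        · exact not_lt.1 htc
        · exact (hC.1 _ (List.mem_toFinset.1 hx)).le.trans (not_lt.1 htc)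

theorem le_getElem_iff {C : List ℕ+} (hC : C.Pairwise (· > ·)) {r : ℕ} (hr : r < C.length)
    (t : ℕ+) : t ≤ C[r] ↔ r < cntGe C.toFinset t := by
  by_cases ht : t ∈ C.toFinset
  · rw [cntGe_of_mem ht]
    obtain ⟨s, hs, rfl⟩ := List.mem_iff_getElem.1 (List.mem_toFinset.1 ht)
    have h0 := (lt_getElem_iff hC hs C[s]).not.1 (lt_irrefl _)
    have h1 := lt_getElem_iff hC hr C[s]
    have h2 : s < cntGt C.toFinset C[s] + 1 := by
      rcases Nat.eq_zero_or_pos s with h | h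
      · omega
      · have := (lt_getElem_iff hC (r := s - 1) (by omega) C[s]).1
          (List.pairwise_iff_getElem.1 hC (s - 1) s (by omega) hs (by omega))
        omega
    rw [le_iff_lt_or_eq, h1]
    constructor
    · rintro (h | h)
      · omega
      · have := List.Nodup.getElem_inj_iff (hC.imp (fun h => ne_of_gt h)) |>.1 h
        omega
    · intro h
      by_cases h' : r < cntGt C.toFinset C[s]
      · exact Or.inl h'
      · have : s = r := by omega
        subst this; exact Or.inr rfl
  · rw [cntGe_of_notMem ht, ← lt_getElem_iff hC hr]
    exact ⟨fun h => lt_of_le_of_ne h fun e => ht (e ▸ List.mem_toFinset.2 (List.getElem_mem _)),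
      le_of_lt⟩

theorem columnsDecrease_iff {C D : List ℕ+} (hC : C.Pairwise (· > ·)) (hD : D.Pairwise (· > ·)) :
    ColumnsDecrease C D ↔ Dom C.toFinset D.toFinset := by
  have cardC : C.toFinset.card = C.length :=
    List.toFinset_card_of_nodup (hC.imp fun h => ne_of_gt h)
  have cardD : D.toFinset.card = D.length :=
    List.toFinset_card_of_nodup (hD.imp fun h => ne_of_gt h)
  constructor
  · rintro ⟨h, h'⟩ t
    rcases Nat.eq_zero_or_pos (cntGe D.toFinset t) with h0 | h0
    · omega
    · have hle := cntGe_le_card D.toFinset t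
      have hr : cntGe D.toFinset t - 1 < D.length := by omega
      have h1 := (le_getElem_iff hD hr t).2 (by omega)
      have h2 := (lt_getElem_iff hC (by omega) t).1 (h1.trans_lt (h' _ hr))
      omega
  · intro h
    refine ⟨by rw [← cardC, ← cardD]; exact h.card_le, fun r hr => ?_⟩
    have h1 := (le_getElem_iff hD hr D[r]).1 le_rfl
    exact (lt_getElem_iff hC _ _).2 (h1.trans_le (h _))

/-- The list of the column sets of a tableau. -/
def colSets (T : List (List ℕ+)) : List (Finset ℕ+) := T.map List.toFinset

theorem isDecreasingTableau_iff {T : List (List ℕ+)} :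
    IsDecreasingTableau T ↔
      (∀ C ∈ T, C ≠ [] ∧ C.Pairwise (· > ·)) ∧ (colSets T).IsChain Dom := by
  unfold IsDecreasingTableau colSets
  rw [List.isChain_map]
  refine and_congr_right fun h => List.IsChain.iff_of_mem_imp fun a b ha hb => ?_
  exact columnsDecrease_iff (h a ha).2 (h b hb).2

/-- The column `S` may be placed after the columns `L`. -/
def LeftDom (L : List (List ℕ+)) (S : Finset ℕ+) : Prop := ∀ A ∈ L.getLast?, Dom A.toFinset S

theorem isDecreasingTableau_append_cons_iff {L R : List (List ℕ+)} {C : List ℕ+} :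
    IsDecreasingTableau (L ++ C :: R) ↔ IsDecreasingTableau L ∧ IsDecreasingTableau R ∧
      (C ≠ [] ∧ C.Pairwise (· > ·)) ∧ LeftDom L C.toFinset ∧
        Dom C.toFinset ((colSets R).headD ∅) := by
  simp only [isDecreasingTableau_iff, colSets, List.map_append, List.map_cons,
    List.isChain_append, List.isChain_cons, List.mem_append, List.mem_cons, LeftDom]
  have e1 : (∀ y ∈ (List.map List.toFinset R).head?, Dom C.toFinset y) ↔
      Dom C.toFinset ((List.map List.toFinset R).headD ∅) := by
    cases R with
    | nil => simp [dom_empty]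
    | cons B R => simp
  have e2 : (∀ x ∈ (List.map List.toFinset L).getLast?, ∀ y ∈
      (C.toFinset :: List.map List.toFinset R).head?, Dom x y) ↔
      ∀ A ∈ L.getLast?, Dom A.toFinset C.toFinset := by
    rw [List.getLast?_map]
    simp
  rw [e1, e2]
  constructor
  · rintro ⟨h1, h2, ⟨h3, h4⟩, h5⟩
    exact ⟨⟨fun D hD => h1 D (Or.inl hD), h2⟩, ⟨fun D hD => h1 D (Or.inr (Or.inr hD)), h4⟩,
      h1 C (Or.inr (Or.inl rfl)), h5, h3⟩
  · rintro ⟨⟨h1, h2⟩, ⟨h3, h4⟩, h5, h6, h7⟩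
    refine ⟨?_, h2, ⟨h7, h4⟩, h6⟩
    rintro D (hD | rfl | hD)
    · exact h1 D hD
    · exact h5
    · exact h3 D hD

/-- Raising an entry cannot violate the condition on the right neighbour. So a replacement is
refused only because of the column itself or its left neighbour. -/
theorem Dom.insert_bump {C B : Finset ℕ+} {z y : ℕ+} (h : Dom C B) (hzy : z < y) (hy : y ∉ C) :
    Dom (insert y (C.erase z)) B := by
  intro t
  refine (h t).trans ?_
  unfold cntGt
  by_cases htz : t < z
  · by_cases hzC : z ∈ C
    · rw [Finset.filter_insert, if_pos (htz.trans hzy), Finset.filter_erase,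
        Finset.card_insert_of_notMem, Finset.card_erase_of_mem]
      · have : 0 < (C.filter (t < ·)).card :=
          Finset.card_pos.2 ⟨z, Finset.mem_filter.2 ⟨hzC, htz⟩⟩
        omega
      · exact Finset.mem_filter.2 ⟨hzC, htz⟩
      · exact fun h' => hy (Finset.mem_filter.1 (Finset.mem_of_mem_erase h')).1
    · rw [Finset.erase_eq_of_notMem hzC]
      exact Finset.card_le_card (Finset.filter_subset_filter _ (Finset.subset_insert _ _))
  · refine Finset.card_le_card fun x hx => ?_
    rw [Finset.mem_filter] at *
    refine ⟨Finset.mem_insert_of_mem (Finset.mem_erase.2 ⟨?_, hx.1⟩), hx.2⟩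
    rintro rfl; exact htz hx.2

theorem Dom.mono_left {A A' B : Finset ℕ+} (h : Dom A B) (hA : A ⊆ A') : Dom A' B := fun t =>
  (h t).trans (Finset.card_le_card (Finset.filter_subset_filter _ hA))

theorem dom_insert {A C : Finset ℕ+} {y : ℕ+} (h : Dom A C) (hC : ∀ c ∈ C, y < c)
    (hlt : cntGt C y < cntGt A y) : Dom A (insert y C) := by
  refine dom_of_mem fun t ht => ?_
  have hyC : y ∉ C := fun h => lt_irrefl _ (hC y h)
  rcases Finset.mem_insert.1 ht with rfl | ht
  · rw [cntGe_of_mem (Finset.mem_insert_self _ _)]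
    have : cntGt (insert t C) t = cntGt C t := by
      unfold cntGt; rw [Finset.filter_insert, if_neg (lt_irrefl _)]
    omega
  · refine le_trans (le_of_eq ?_) (h t)
    unfold cntGe; rw [Finset.filter_insert, if_neg (not_le.2 (hC t ht))]

/-- The strict count provides a row in which `y` lies to the right of a larger entry; all other
entries keep their rows, since `z` is the entry just below `y`. -/
theorem dom_insert_erase {A C : Finset ℕ+} {y z : ℕ+} (h : Dom A C) (hzC : z ∈ C) (hzy : z < y)
    (hyC : y ∉ C) (hz : ∀ c ∈ C, c < y → c ≤ z) (hlt : cntGt C y < cntGt A y) :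
    Dom A (insert y (C.erase z)) := by
  refine dom_of_mem fun t ht => ?_
  rcases Finset.mem_insert.1 ht with rfl | ht'
  · rw [cntGe_of_mem ht]
    have : cntGt (insert t (C.erase z)) t = cntGt C t := by
      unfold cntGt; rw [Finset.filter_insert, if_neg (lt_irrefl _)]
      congr 1; ext x; simp only [Finset.mem_filter, Finset.mem_erase]
      exact ⟨fun ⟨⟨_, h1⟩, h2⟩ => ⟨h1, h2⟩, fun ⟨h1, h2⟩ => ⟨⟨(hzy.trans h2).ne', h1⟩, h2⟩⟩
    omega
  · refine le_trans (le_of_eq ?_) (h t)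
    rw [Finset.mem_erase] at ht'
    unfold cntGe
    rcases lt_trichotomy t y with hty | rfl | hty
    · have htz : t < z := lt_of_le_of_ne (hz t ht'.2 hty) ht'.1
      rw [Finset.filter_insert, if_pos hty.le, Finset.filter_erase,
        Finset.card_insert_of_notMem, Finset.card_erase_of_mem]
      · have : 0 < (C.filter (t ≤ ·)).card :=
          Finset.card_pos.2 ⟨z, Finset.mem_filter.2 ⟨hzC, htz.le⟩⟩
        omega
      · exact Finset.mem_filter.2 ⟨hzC, htz.le⟩
      · exact fun h' => hyC (Finset.mem_filter.1 (Finset.mem_of_mem_erase h')).1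
    · exact absurd ht'.2 hyC
    · rw [Finset.filter_insert, if_neg (not_le.2 hty), Finset.filter_erase,
        Finset.erase_eq_of_notMem]
      exact fun h' => absurd (Finset.mem_filter.1 h').2 (not_le.2 (hzy.trans hty))

/-- With equal counts the row that `y` would occupy faces no larger entry on the left. Equality of
counts is thus exactly the blocking condition. -/
theorem not_dom_insert {A C : Finset ℕ+} {y : ℕ+} {S : Finset ℕ+} (hS : ∀ c ∈ C, y < c → c ∈ S)
    (hyS : y ∈ S) (heq : cntGt A y = cntGt C y) : ¬ Dom A S := by
  intro h
  have := h y
  rw [cntGe_of_mem hyS] at this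
  have h2 : cntGt C y ≤ cntGt S y := Finset.card_le_card fun x hx => by
    rw [Finset.mem_filter] at *; exact ⟨hS x hx.1 hx.2, hx.2⟩
  omega

theorem mem_of_mem_replace {C : List ℕ+} {z y x : ℕ+} (h : x ∈ C.replace z y) :
    x ∈ C ∨ x = y := by
  induction C with
  | nil => simp at h
  | cons c C ih =>
    rw [List.replace_cons] at h
    split at h
    · rcases List.mem_cons.1 h with rfl | h
      · exact Or.inr rfl
      · exact Or.inl (List.mem_cons_of_mem _ h)
    · rcases List.mem_cons.1 h with rfl | h
      · exact Or.inl List.mem_cons_self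
      · exact (ih h).imp (List.mem_cons_of_mem _) id

theorem replace_spec {C : List ℕ+} (hC : C.Pairwise (· > ·)) {z y : ℕ+} (hz : z ∈ C)
    (hzy : z < y) (hy : y ∉ C) (hmax : ∀ c ∈ C, c < y → c ≤ z) :
    (C.replace z y).Pairwise (· > ·) ∧
      (C.replace z y).toFinset = insert y (C.toFinset.erase z) := by
  induction C with
  | nil => simp at hz
  | cons c C ih =>
    rw [List.pairwise_cons] at hC
    rw [List.replace_cons]
    by_cases hzc : z = c
    · subst hzc
      have hzC : z ∉ C := fun h => lt_irrefl _ (hC.1 z h)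
      simp only [beq_self_eq_true, List.pairwise_cons, List.toFinset_cons]
      refine ⟨⟨fun a ha => (hC.1 a ha).trans hzy, hC.2⟩, ?_⟩
      rw [Finset.erase_insert (by simpa using hzC)]
    · have hzC : z ∈ C := (List.mem_cons.1 hz).resolve_left hzc
      have hyc : y < c := by
        have h1 := hC.1 z hzC
        by_contra h
        rcases (not_lt.1 h).eq_or_lt with rfl | h
        · exact hy List.mem_cons_self
        · exact absurd (hmax c List.mem_cons_self h) (not_le.2 h1)
      obtain ⟨h1, h2⟩ := ih hC.2 hzC (fun h => hy (List.mem_cons_of_mem _ h))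
        fun a ha => hmax a (List.mem_cons_of_mem _ ha)
      have : (z == c) = false := by simpa using hzc
      simp only [this, List.pairwise_cons, List.toFinset_cons, h2]
      refine ⟨⟨fun a ha => ?_, h1⟩, ?_⟩
      · rcases mem_of_mem_replace ha with h | rfl
        · exact hC.1 a h
        · exact hyc
      · rw [Finset.erase_insert_of_ne (fun h => hzc h.symm), Finset.insert_comm]

theorem not_pairwise_replace {C : List ℕ+} (hC : C.Pairwise (· > ·)) {z y : ℕ+} (hz : z ∈ C)
    (hzy : z < y) (hy : y ∈ C) : ¬ (C.replace z y).Pairwise (· > ·) := by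
  induction C with
  | nil => simp at hz
  | cons c C ih =>
    rw [List.pairwise_cons] at hC
    rw [List.replace_cons]
    by_cases hzc : z = c
    · subst hzc
      exfalso
      rcases List.mem_cons.1 hy with h | h
      · exact hzy.ne' h
      · exact absurd (hC.1 y h) (not_lt.2 hzy.le)
    · have hzC : z ∈ C := (List.mem_cons.1 hz).resolve_left hzc
      have : (z == c) = false := by simpa using hzc
      simp only [this, List.pairwise_cons]
      rintro ⟨h1, h2⟩
      rcases List.mem_cons.1 hy with rfl | h
      · have hm : ∀ {l : List ℕ+}, z ∈ l → y ∈ l.replace z y := by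
          intro l hl
          induction l with
          | nil => simp at hl
          | cons d l ih' =>
            rw [List.replace_cons]
            split
            · exact List.mem_cons_self
            · rename_i hne
              refine List.mem_cons_of_mem _ (ih' ?_)
              rcases List.mem_cons.1 hl with rfl | h
              · simp at hne
              · exact h
        exact lt_irrefl _ (h1 y (hm hzC))
      · exact ih hC.2 hzC h h2

/-- The letter effectively inserted into the first of the columns `R`, given the columns `L` to
the left. -/
def effLetter (L : List (List ℕ+)) (B : Finset ℕ+) (y : ℕ+) : ℕ+ :=
  match L.getLast? with
  | none => y
  | some A => adj A.toFinset B y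

theorem heckeInsertAux_isDecreasing (L R : List (List ℕ+)) (x : ℕ+)
    (h : IsDecreasingTableau (L ++ R)) : IsDecreasingTableau (heckeInsertAux L x R) := by
  induction R generalizing L x with
  | nil =>
    unfold heckeInsertAux
    split_ifs with h1
    · exact h1
    · simpa using h
  | cons C R ih =>
    unfold heckeInsertAux
    split
    · split_ifs with h1
      · exact h1
      · exact h
    · split_ifs with h1
      · exact ih _ _ (by simpa using h1)
      · exact ih _ _ (by simpa using h)

theorem heckeInsert_isDecreasing {T : List (List ℕ+)} (hT : IsDecreasingTableau T) (x : ℕ+) :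
    IsDecreasingTableau (heckeInsert T x) := heckeInsertAux_isDecreasing [] T x (by simpa using hT)

/-- If the left neighbour blocks `y`, the column is unchanged and the entry below `y` is bumped.
Inserting the next larger entry `b` of the column has the same effect, as `b` is present already and
has the same predecessor. Replacing `y` by `b` therefore eliminates the test against the left
neighbour, and `setInsert` needs no such test. The hypothesis `hpos` guarantees that `b` exists when
`y` is blocked. -/
theorem colSets_heckeInsertAux (L R : List (List ℕ+)) (y : ℕ+)
    (h : IsDecreasingTableau (L ++ R)) (hpos : ∀ A ∈ L.getLast?, 0 < cntGt A.toFinset y) :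
    colSets (heckeInsertAux L y R)
      = colSets L ++ setInsert (colSets R) (effLetter L ((colSets R).headD ∅) y) := by
  induction R generalizing L y with
  | nil =>
    have hy : effLetter L ((colSets []).headD ∅) y = y := by
      unfold effLetter
      split
      · rfl
      · rename_i A hA
        have := hpos A hA
        rw [adj, if_neg]
        simpa [colSets, cntGt] using this.ne'
    rw [hy]
    have hdec : IsDecreasingTableau (L ++ [[y]]) := by
      rw [isDecreasingTableau_append_cons_iff]
      refine ⟨by simpa using h, ⟨by simp, by simp⟩, ⟨by simp, by simp⟩, fun A hA => ?_,
        dom_empty _⟩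
      have := dom_insert (dom_empty A.toFinset) (y := y) (by simp) (by simpa [cntGt] using hpos A hA)
      simpa using this
    unfold heckeInsertAux
    rw [if_pos hdec]
    simp [colSets, setInsert]
  | cons C R ih =>
    obtain ⟨hL, hR, ⟨hCne, hC⟩, hLC, hCR⟩ := isDecreasingTableau_append_cons_iff.1 h
    have hback : ∀ C' : List ℕ+, colSets (L ++ [C']) = colSets L ++ [C'.toFinset] := by
      simp [colSets]
    have heff : ∀ (C' : List ℕ+) (B : Finset ℕ+) (z : ℕ+),
        effLetter (L ++ [C']) B z = adj C'.toFinset B z := by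
      intro C' B z; simp [effLetter]
    have hlast : ∀ (C' : List ℕ+) (z : ℕ+), 0 < cntGt C'.toFinset z →
        ∀ A ∈ (L ++ [C']).getLast?, 0 < cntGt A.toFinset z := by
      intro C' z hz A hA
      simp at hA; subst hA; exact hz
    have hassoc : ∀ C' : List ℕ+, L ++ [C'] ++ R = L ++ C' :: R := by simp
    have hhd : (colSets (C :: R)).headD ∅ = C.toFinset := rfl
    rw [hhd]
    -- whether the left neighbour blocks the insertion
    by_cases hblock : ∃ A ∈ L.getLast?, cntGt A.toFinset y = cntGt C.toFinset y
    · obtain ⟨A, hA, heq⟩ := hblock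
      have hA' : L.getLast? = some A := hA
      have hposA := hpos A hA
      -- Equality of the counts carries the larger entry supplied by `hpos` from `A` over to `C`, so
      -- `succIn` does not take its default value.
      obtain ⟨c, hc, hyc⟩ := cntGt_pos.1 (heq ▸ hposA)
      obtain ⟨s1, s2, s3⟩ := succIn_spec hc hyc
      have hyC : y ∉ C.toFinset := fun hy => by
        have := (hLC A hA).cntGt_lt hy; omega
      have he : effLetter L C.toFinset y = succIn C.toFinset y := by
        rw [effLetter, hA']; simp [adj, heq]
      rw [he]
      have hbl : ∀ C' : List ℕ+, (∀ c ∈ C.toFinset, y < c → c ∈ C') → y ∈ C' →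
          ¬ IsDecreasingTableau (L ++ C' :: R) := by
        intro C' h1 h2 h3
        refine not_dom_insert (S := C'.toFinset) (fun c hc hyc => ?_) (by simpa using h2) heq
          ((isDecreasingTableau_append_cons_iff.1 h3).2.2.2.1 A hA)
        simpa using h1 c hc hyc
      -- No entry of `C` lies between `y` and its successor, so both letters bump the same entry.
      have hsm : ∀ a, a ∈ C.toFinset → (a < succIn C.toFinset y ↔ a < y) := by
        intro a ha
        constructor
        · intro h1
          by_contra h2
          have h3 : y < a := lt_of_le_of_ne (not_lt.1 h2) (by rintro rfl; exact hyC ha)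
          exact absurd (s3 a ha h3) (not_le.2 h1)
        · intro h1; exact h1.trans s2
      have hfs : colIns C.toFinset (succIn C.toFinset y) = C.toFinset := by
        rw [colIns, if_pos s1]
      have hpr : predIn C.toFinset (succIn C.toFinset y) = predIn C.toFinset y ∨
          ∀ a ∈ C.toFinset, ¬ a < y := by
        by_cases hex : ∃ a ∈ C.toFinset, a < y
        · obtain ⟨a, ha, hay⟩ := hex
          obtain ⟨p1, p2, p3⟩ := predIn_spec ha hay
          exact Or.inl (predIn_eq p1 (p2.trans s2) fun b hb hb2 => p3 b hb ((hsm b hb).1 hb2))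
        · push Not at hex; exact Or.inr fun a ha => not_lt.2 (hex a ha)
      unfold heckeInsertAux
      split
      · rename_i hnone
        rw [List.max?_eq_none_iff, List.filter_eq_nil_iff] at hnone
        have hno : ∀ a ∈ C.toFinset, ¬ a < y := fun a ha => by
          simpa using hnone a (List.mem_toFinset.1 ha)
        rw [if_neg (hbl _ (fun c hc _ => by simp at hc; simp [hc]) (by simp))]
        simp only [colSets, List.map_append, List.map_cons]
        rw [setInsert, if_neg]
        · rw [Finset.insert_eq_of_mem s1]
        · rintro ⟨a, ha, ha2⟩; exact hno a ha ((hsm a ha).1 ha2)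
      · rename_i z hz
        rw [List.max?_eq_some_iff] at hz
        obtain ⟨hz1, hz2⟩ := hz
        simp only [List.mem_filter, decide_eq_true_eq] at hz1 hz2
        have hzC : z ∈ C.toFinset := by simpa using hz1.1
        have hpz : predIn C.toFinset y = z :=
          predIn_eq hzC hz1.2 fun a ha hay => hz2 a ⟨by simpa using ha, hay⟩
        rw [if_neg]
        · rw [ih _ _ (by simpa using h) (hlast C z (cntGt_pos.2 ⟨c, hc, hz1.2.trans hyc⟩)),
            hback, heff]
          simp only [colSets, List.map_cons]
          rw [setInsert, if_pos ⟨z, hzC, (hsm z hzC).2 hz1.2⟩, hfs]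
          rw [hpr.resolve_right fun h' => h' z hzC hz1.2, hpz]
          simp
        · refine hbl _ (fun c hc hyc => ?_) ?_
          · by_contra hcon
            have : ∀ {l : List ℕ+}, c ∈ l → z ≠ c → c ∈ l.replace z y := by
              intro l hl hne
              induction l with
              | nil => simp at hl
              | cons d l ih' =>
                rw [List.replace_cons]
                rcases List.mem_cons.1 hl with rfl | hl
                · have : (z == c) = false := by simpa using hne
                  simp [this]
                · split
                  · exact List.mem_cons_of_mem _ hl
                  · exact List.mem_cons_of_mem _ (ih' hl)
            exact hcon (this (by simpa using hc) (hz1.2.trans hyc).ne)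
          · have := (replace_spec hC hz1.1 hz1.2 (by simpa using hyC)
              fun a ha hay => hz2 a ⟨ha, hay⟩).2
            have h2 : y ∈ (C.replace z y).toFinset := by rw [this]; exact Finset.mem_insert_self _ _
            simpa using h2
    · push Not at hblock
      have he : effLetter L C.toFinset y = y := by
        unfold effLetter
        split
        · rfl
        · rename_i A hA
          rw [adj, if_neg (hblock A hA)]
      rw [he]
      -- `Dom` gives a weak inequality; not being blocked makes it strict, which is the room needed
      -- for `y`.
      have hlt : ∀ A ∈ L.getLast?, cntGt C.toFinset y < cntGt A.toFinset y := by
        intro A hA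
        refine lt_of_le_of_ne ((cntGt_le_cntGe _ _).trans (hLC A hA y)) ?_
        exact fun h => hblock A hA h.symm
      unfold heckeInsertAux
      split
      · rename_i hnone
        rw [List.max?_eq_none_iff, List.filter_eq_nil_iff] at hnone
        have hno : ∀ a ∈ C.toFinset, ¬ a < y := fun a ha => by
          simpa using hnone a (List.mem_toFinset.1 ha)
        have hres : setInsert (colSets (C :: R)) y = insert y C.toFinset :: colSets R := by
          simp only [colSets, List.map_cons]
          rw [setInsert, if_neg]
          rintro ⟨a, ha, hay⟩; exact hno a ha hay
        rw [hres]
        by_cases hyC : y ∈ C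
        · rw [if_neg]
          · simp [colSets, hyC]
          · intro h3
            have := (isDecreasingTableau_append_cons_iff.1 h3).2.2.1.2
            rw [List.pairwise_append] at this
            exact lt_irrefl _ (this.2.2 y hyC y (by simp))
        · have hgt : ∀ c ∈ C.toFinset, y < c := fun c hc =>
            lt_of_le_of_ne (not_lt.1 (hno c hc)) (by rintro rfl; exact hyC (by simpa using hc))
          have hfs : (C ++ [y]).toFinset = insert y C.toFinset := by
            ext a; simp
          rw [if_pos]
          · simp only [colSets, List.map_append, List.map_cons, hfs]
          · rw [isDecreasingTableau_append_cons_iff, hfs]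
            refine ⟨hL, hR, ⟨by simp, ?_⟩, ?_, hCR.mono_left (Finset.subset_insert _ _)⟩
            · rw [List.pairwise_append]
              refine ⟨hC, by simp, fun a ha b hb => ?_⟩
              simp at hb; subst hb; exact hgt a (by simpa using ha)
            · intro A hA
              exact dom_insert (hLC A hA) hgt (hlt A hA)
      · rename_i z hz
        rw [List.max?_eq_some_iff] at hz
        obtain ⟨hz1, hz2⟩ := hz
        simp only [List.mem_filter, decide_eq_true_eq] at hz1 hz2
        have hzC : z ∈ C.toFinset := by simpa using hz1.1
        have hmax : ∀ c ∈ C, c < y → c ≤ z := fun a ha hay => hz2 a ⟨ha, hay⟩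
        have hpz : predIn C.toFinset y = z :=
          predIn_eq hzC hz1.2 fun a ha hay => hz2 a ⟨by simpa using ha, hay⟩
        have hres : setInsert (colSets (C :: R)) y = colIns C.toFinset y ::
            setInsert (colSets R) (adj (colIns C.toFinset y) ((colSets R).headD ∅) z) := by
          simp only [colSets, List.map_cons]
          rw [setInsert, if_pos ⟨z, hzC, hz1.2⟩, hpz]
        rw [hres]
        by_cases hyC : y ∈ C
        · have hfs : colIns C.toFinset y = C.toFinset := by
            rw [colIns, if_pos (by simpa using hyC)]
          rw [if_neg, hfs, ih _ _ (by simpa using h)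
            (hlast C z (cntGt_pos.2 ⟨y, by simpa using hyC, hz1.2⟩)), hback, heff]
          · simp
          · intro h3
            exact not_pairwise_replace hC hz1.1 hz1.2 hyC
              (isDecreasingTableau_append_cons_iff.1 h3).2.2.1.2
        · obtain ⟨q1, q2⟩ := replace_spec hC hz1.1 hz1.2 hyC hmax
          have hyC' : y ∉ C.toFinset := by simpa using hyC
          have hfs : colIns C.toFinset y = (C.replace z y).toFinset := by
            rw [colIns, if_neg hyC', hpz, q2]
          have hdec : IsDecreasingTableau (L ++ C.replace z y :: R) := by
            rw [isDecreasingTableau_append_cons_iff, q2]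
            refine ⟨hL, hR, ⟨?_, q1⟩, ?_, hCR.insert_bump hz1.2 hyC'⟩
            · intro h0
              have := congrArg List.length h0
              rw [List.length_replace] at this
              exact hCne (List.length_eq_zero_iff.1 this)
            · intro A hA
              exact dom_insert_erase (hLC A hA) hzC hz1.2 hyC'
                (fun c hc => hmax c (by simpa using hc)) (hlt A hA)
          rw [if_pos hdec, hfs, ih _ _ (by simpa using hdec)
            (hlast _ z (cntGt_pos.2 ⟨y, by rw [q2]; exact Finset.mem_insert_self _ _, hz1.2⟩)),
            hback, heff]
          simp

theorem colSets_heckeInsert {T : List (List ℕ+)} (hT : IsDecreasingTableau T) (x : ℕ+) :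
    colSets (heckeInsert T x) = setInsert (colSets T) x := by
  rw [heckeInsert, colSets_heckeInsertAux [] T x (by simpa using hT) (by simp)]
  simp [colSets, effLetter]

theorem foldl_heckeInsert_isDecreasing {T : List (List ℕ+)} (hT : IsDecreasingTableau T)
    (a : List ℕ+) : IsDecreasingTableau (a.foldl heckeInsert T) := by
  induction a generalizing T with
  | nil => exact hT
  | cons x a ih => exact ih (heckeInsert_isDecreasing hT x)

theorem colSets_foldl_heckeInsert {T : List (List ℕ+)} (hT : IsDecreasingTableau T)
    (a : List ℕ+) : colSets (a.foldl heckeInsert T) = a.foldl setInsert (colSets T) := by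
  induction a generalizing T with
  | nil => rfl
  | cons x a ih =>
    rw [List.foldl_cons, ih (heckeInsert_isDecreasing hT x), colSets_heckeInsert hT,
      List.foldl_cons]

/-! ## Reversing the insertion of an increasing word -/

/-- How the insertion of an increasing word ends in a column: every letter bumps an entry
(`keep`), or the first letter is appended at the bottom (`add`) or absorbed (`absorb`). -/
inductive Mark
  | keep
  | add
  | absorb
  deriving DecidableEq

/-- The smallest element of `A ∪ U` belongs to the old column `A`. -/
def Mark.old : Mark → Bool
  | keep => true
  | add => false
  | absorb => true

/-- The smallest element of `A ∪ U` is one of the inserted letters. -/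
def Mark.new : Mark → Bool
  | keep => false
  | add => true
  | absorb => true

/-- The way in which the insertion of `U` into the column `A` ends. -/
def markOf (A U : Finset ℕ+) : Mark :=
  if ∃ z ∈ U, ∀ w ∈ A ∪ U, z ≤ w then
    if ∃ z ∈ A, ∀ w ∈ A ∪ U, z ≤ w then Mark.absorb else Mark.add
  else Mark.keep

theorem markOf_spec {A U : Finset ℕ+} {z : ℕ+} (hz : z ∈ A ∪ U) (h : ∀ w ∈ A ∪ U, z ≤ w) :
    (z ∈ A ↔ (markOf A U).old = true) ∧ (z ∈ U ↔ (markOf A U).new = true) := by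
  have e1 : (∃ z ∈ U, ∀ w ∈ A ∪ U, z ≤ w) ↔ z ∈ U :=
    ⟨fun ⟨y, hy, hy'⟩ => by
      rwa [le_antisymm (h y (Finset.mem_union_right _ hy)) (hy' z hz)], fun hz => ⟨z, hz, h⟩⟩
  have e2 : (∃ z ∈ A, ∀ w ∈ A ∪ U, z ≤ w) ↔ z ∈ A :=
    ⟨fun ⟨y, hy, hy'⟩ => by
      rwa [le_antisymm (h y (Finset.mem_union_left _ hy)) (hy' z hz)], fun hz => ⟨z, hz, h⟩⟩
  unfold markOf
  simp only [e1, e2]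
  rw [Finset.mem_union] at hz
  by_cases h1 : z ∈ U <;> by_cases h2 : z ∈ A <;> simp [h1, h2, Mark.old, Mark.new]
  tauto

theorem exists_min_union {A U : Finset ℕ+} (h : (A ∪ U).Nonempty) :
    ∃ z ∈ A ∪ U, ∀ w ∈ A ∪ U, z ≤ w :=
  ⟨_, Finset.min'_mem _ h, fun w hw => Finset.min'_le _ w hw⟩

theorem markOf_empty : markOf ∅ ∅ = Mark.keep := by simp [markOf]

theorem Mark.eq_of_old_new {m m' : Mark} (h1 : m.old = m'.old) (h2 : m.new = m'.new) : m = m' := by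
  cases m <;> cases m' <;> simp_all [Mark.old, Mark.new]

theorem Mark.old_or_new (m : Mark) : m.old = true ∨ m.new = true := by
  cases m <;> simp [Mark.old, Mark.new]

theorem Mark.old_eq_false {m : Mark} : m.old = false ↔ m = Mark.add := by
  cases m <;> simp [Mark.old]

theorem markOf_eq {A U : Finset ℕ+} {m : Mark} (hne : (A ∪ U).Nonempty)
    (h : ∀ z ∈ A ∪ U, (∀ w ∈ A ∪ U, z ≤ w) → (z ∈ A ↔ m.old = true) ∧ (z ∈ U ↔ m.new = true)) :
    markOf A U = m := by
  obtain ⟨z, hz, hz'⟩ := exists_min_union hne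
  obtain ⟨h1, h2⟩ := h z hz hz'
  obtain ⟨h3, h4⟩ := markOf_spec hz hz'
  exact Mark.eq_of_old_new (Bool.eq_iff_iff.2 (h3.symm.trans h1)) (Bool.eq_iff_iff.2 (h4.symm.trans h2))

theorem card_colOut (A U : Finset ℕ+) :
    (colOut A U).card = A.card + if markOf A U = Mark.add then 1 else 0 := by
  rcases (A ∪ U).eq_empty_or_nonempty with h | h
  · obtain ⟨rfl, rfl⟩ := Finset.union_eq_empty.1 h
    simp [markOf_empty, colOut]
  · obtain ⟨z, hz, hz'⟩ := exists_min_union h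
    obtain ⟨h3, h4⟩ := markOf_spec hz hz'
    by_cases hA : z ∈ A
    · rw [card_colOut_of_min_mem hA hz', if_neg]; · rfl
      intro h0; rw [h0] at h3; simp [Mark.old, hA] at h3
    · have hU : z ∈ U := (Finset.mem_union.1 hz).resolve_left hA
      rw [card_colOut_of_min_notMem hU hA hz', if_pos]
      cases hm : markOf A U <;> simp_all [Mark.old]

/-- Every inserted letter bumps an entry, except one that is the minimum of the union. -/
theorem card_colBump' (A U : Finset ℕ+) :
    U.card = (colBump A U).card + if markOf A U = Mark.keep then 0 else 1 := by
  rcases (A ∪ U).eq_empty_or_nonempty with h | h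
  · obtain ⟨rfl, rfl⟩ := Finset.union_eq_empty.1 h
    simp [markOf_empty, colBump]
  · obtain ⟨z, hz, hz'⟩ := exists_min_union h
    obtain ⟨h3, h4⟩ := markOf_spec hz hz'
    rw [card_colBump hz hz']
    by_cases hU : z ∈ U
    · rw [Finset.card_erase_of_mem hU, if_neg]
      · have := Finset.card_pos.2 ⟨z, hU⟩; omega
      · intro h0; rw [h0] at h4; simp [Mark.new, hU] at h4
    · rw [Finset.erase_eq_of_notMem hU, if_pos]; · rfl
      cases hm : markOf A U <;> simp_all [Mark.new]

/-- The letters bumped out of the column that became `C`, given the set `U` of letters that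
reached the next column, which was `B`. -/
def unpass (C U B : Finset ℕ+) : Finset ℕ+ := U.image (unadj C B)

/-- If `v` was moved to `b`, the equality of counts forces `v` into the new column, as its largest
element below `b`, and the same equality read at `b` reveals the move. If `v` was not moved, `unadj`
leaves it alone: the new column counts one more than `cntGt A v`, which already bounds `cntGe B v`.
-/
theorem unadj_adj {A U B : Finset ℕ+} (hAB : Dom A B) {v : ℕ+} (hv : v ∈ colBump A U) :
    unadj (colOut A U) B (adj (colOut A U) B v) = v := by
  obtain ⟨h1, ⟨w, hw, hvw⟩, h2⟩ := mem_colBump.1 hv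
  obtain ⟨h3, h4, h5⟩ := succIn_spec hw hvw
  have hcv := cntGe_colOut h1
  have hfix : unadj (colOut A U) B v = v := by
    unfold unadj
    rw [if_neg]
    rintro ⟨hB, he⟩
    have := hAB v
    omega
  by_cases hcond : cntGt (colOut A U) v = cntGt B v
  · by_cases hB : ∃ b ∈ B, v < b
    · obtain ⟨b, hb, hvb⟩ := hB
      obtain ⟨g1, g2, g3⟩ := succIn_spec hb hvb
      have hlt := adj_lt_succIn hAB hv
      have hadj : adj (colOut A U) B v = succIn B v := by rw [adj, if_pos hcond]
      rw [hadj] at hlt ⊢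
      have hbt : cntGt (colOut A U) v = cntGe (colOut A U) (succIn B v) := by
        refine cntGt_eq_cntGe g2 fun x hx hvx => ?_
        exact hlt.le.trans (h5 x (colOut_subset _ _ hx) hvx)
      have hvC : v ∈ colOut A U := by
        by_contra hvC
        rw [cntGe_of_notMem hvC] at hcv
        have e1 := hAB (succIn B v)
        rw [← cntGt_eq_cntGe g2 g3] at e1
        have e2 := cntGt_anti A g2.le
        omega
      rw [unadj, if_pos ⟨g1, by rw [← hbt, hcond, cntGt_eq_cntGe g2 g3]⟩]
      refine predIn_eq hvC g2 fun a ha hab => ?_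
      by_contra hc
      exact absurd (h5 a (colOut_subset _ _ ha) (not_le.1 hc)) (not_le.2 (hab.trans hlt))
    · push Not at hB
      -- With nothing of `B` above `v`, `succIn` takes its default value `v`.
      rw [adj, if_pos hcond, succIn_of_forall hB, hfix]
  · rw [adj, if_neg hcond, hfix]

theorem unpass_passOn {A U B : Finset ℕ+} (hAB : Dom A B) :
    unpass (colOut A U) (passOn A U B) B = colBump A U := by
  rw [unpass, passOn, Finset.image_image]
  refine (Finset.image_congr fun v hv => ?_).trans Finset.image_id
  exact unadj_adj hAB hv

/-! ### Undoing the insertion in one column -/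

section Reverse

variable {C B U : Finset ℕ+} (hC : Dom C (colOut B U))
include hC

/-- In the column that received `U`, one more entry is at least `u` than entries of `B` exceeded
`u`, and `C` dominates that column. So `u` itself was not blocked by `C`. -/
theorem cntGt_lt_of_mem {u : ℕ+} (hu : u ∈ U) : cntGt B u < cntGt C u := by
  have h1 := cntGe_colOut (Finset.mem_union_right B hu)
  have h2 := hC u
  omega

theorem adj_of_mem {u : ℕ+} (hu : u ∈ U) : adj C B u = u := by
  have := cntGt_lt_of_mem hC hu
  rw [adj, if_neg]; omega

/-- Besides inverting `adj`, this records where a recovered letter lies: it is in `C`, or it is the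
letter `u` itself. In the second case, if `u` meets the criterion for having been moved, nothing of
`C` lies below it; `dom_back` needs this. -/
theorem unadj_spec {u : ℕ+} (hu : u ∈ U) :
    (adj C B (unadj C B u) = u) ∧
    ((unadj C B u ∈ C ∧ unadj C B u < u ∧ u ∈ B) ∨
      (unadj C B u = u ∧ (u ∈ B → cntGe C u = cntGe B u → ∀ c ∈ C, u ≤ c))) := by
  by_cases h : u ∈ B ∧ cntGe C u = cntGe B u
  · by_cases hc : ∃ c ∈ C, c < u
    · obtain ⟨c, hc, hcu⟩ := hc
      obtain ⟨p1, p2, p3⟩ := predIn_spec hc hcu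
      have he : unadj C B u = predIn C u := by rw [unadj, if_pos h]
      rw [he]
      refine ⟨?_, Or.inl ⟨p1, p2, h.1⟩⟩
      set c := predIn C u
      have e1 : cntGt C c = cntGe C u := cntGt_eq_cntGe p2 fun x hx hcx => by
        by_contra hxu; exact absurd (p3 x hx (not_le.1 hxu)) (not_le.2 hcx)
      -- An entry of `B` strictly between `c` and `u` would exceed the room that `C` leaves above
      -- `c`, because the counts at `u` are already equal.
      have e2 : ∀ x ∈ B, c < x → u ≤ x := by
        intro x hx hcx
        by_contra hxu
        rw [not_le] at hxu
        have f1 := hC x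
        have f2 := cntGe_le_cntGe_colOut (A := B) (U := U) x
        have f3 := cntGt_anti C hcx.le
        have f4 := cntGe_le_cntGt_of_lt (X := B) hxu
        rw [cntGe_of_mem hx] at f2
        omega
      have e3 : cntGt B c = cntGe B u := cntGt_eq_cntGe p2 e2
      rw [adj, if_pos (by rw [e1, e3, h.2])]
      exact succIn_eq h.1 p2 e2
    · push Not at hc
      have he : unadj C B u = u := by rw [unadj, if_pos h, predIn_of_forall hc]
      rw [he]
      exact ⟨adj_of_mem hC hu, Or.inr ⟨rfl, fun _ _ => hc⟩⟩
  · have he : unadj C B u = u := by rw [unadj, if_neg h]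
    rw [he]
    exact ⟨adj_of_mem hC hu, Or.inr ⟨rfl, fun h1 h2 => absurd ⟨h1, h2⟩ h⟩⟩

theorem exists_lt_of_mem_unpass {v : ℕ+} (hv : v ∈ unpass C U B) : ∃ c ∈ C, v < c := by
  obtain ⟨u, hu, rfl⟩ := Finset.mem_image.1 hv
  obtain ⟨c, hc, huc⟩ := cntGt_pos.1 ((Nat.zero_le _).trans_lt (cntGt_lt_of_mem hC hu))
  rcases (unadj_spec hC hu).2 with ⟨h1, h2, h3⟩ | ⟨h1, _⟩
  · exact ⟨c, hc, h2.trans huc⟩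
  · rw [h1]; exact ⟨c, hc, huc⟩

theorem image_adj_unpass : (unpass C U B).image (adj C B) = U := by
  rw [unpass, Finset.image_image]
  refine (Finset.image_congr fun u hu => ?_).trans Finset.image_id
  exact (unadj_spec hC hu).1

variable {m : Mark}

/-- Every recovered letter is below some entry of `C`, so the maximum of the union lies in `C`, as
the shift requires. -/
theorem colOut_back :
    colOut (colBack C (unpass C U B) m.old) (colBack (unpass C U B) C m.new) = C := by
  refine colOut_colBack m.old_or_new fun z hz h => ?_
  rcases Finset.mem_union.1 hz with hz | hz
  · exact hz
  · obtain ⟨c, hc, hzc⟩ := exists_lt_of_mem_unpass hC hz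
    exact absurd (h c (Finset.mem_union_left _ hc)) (not_le.2 hzc)

theorem colBump_back :
    colBump (colBack C (unpass C U B) m.old) (colBack (unpass C U B) C m.new) = unpass C U B := by
  refine colBump_colBack m.old_or_new fun z hz => ?_
  obtain ⟨c, hc, hzc⟩ := exists_lt_of_mem_unpass hC hz
  exact ⟨c, Finset.mem_union_left _ hc, hzc⟩

theorem passOn_back :
    passOn (colBack C (unpass C U B) m.old) (colBack (unpass C U B) C m.new) B = U := by
  rw [passOn, colOut_back hC, colBump_back hC, image_adj_unpass hC]

omit hC in
theorem markOf_back (hne : C.Nonempty) :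
    markOf (colBack C (unpass C U B) m.old) (colBack (unpass C U B) C m.new) = m := by
  have hu := colBack_union (C := C) (V := unpass C U B) m.old_or_new
  refine markOf_eq ?_ fun z hz h => ?_
  · rw [hu]; exact hne.mono Finset.subset_union_left
  · rw [hu] at hz h
    refine ⟨mem_colBack_of_min hz h, mem_colBack_of_min ?_ ?_⟩
    · rwa [Finset.union_comm]
    · rwa [Finset.union_comm]

/-- By `cntGe_colOut` the recovered column has one entry fewer above `z` than `C` has from `z` on,
for `z` in the union. Domination of `B` can then fail in two ways only. Either the bottom entry of
`B` coincides with an arriving letter while `C` and the new right column are equally long, which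
means an absorption and is excluded by `h1`; or the recovered column is too short, which `h2`
excludes. -/
theorem dom_back (hne : C.Nonempty)
    (h1 : C.card = (colOut B U).card → markOf B U ≠ Mark.absorb)
    (h2 : m = Mark.add → (colOut B U).card < C.card ∨ markOf B U = Mark.add) :
    Dom (colBack C (unpass C U B) m.old) B := by
  set V := unpass C U B with hV
  set A := colBack C V m.old with hA
  set W := colBack V C m.new with hW
  have hu : A ∪ W = C ∪ V := colBack_union m.old_or_new
  have hCeq : colOut A W = C := colOut_back hC
  have hcnt : ∀ z ∈ C ∪ V, cntGe C z = cntGt A z + 1 := fun z hz => by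
    have := cntGe_colOut (A := A) (U := W) (z := z) (by rw [hu]; exact hz)
    rwa [hCeq] at this
  have hBle : ∀ t, cntGe B t ≤ cntGt C t := fun t => (cntGe_le_cntGe_colOut t).trans (hC t)
  have hVcase : ∀ v ∈ V, v ∈ C ∨ (v ∈ U ∧ (v ∈ B → cntGe C v = cntGe B v → ∀ c ∈ C, v ≤ c)) := by
    intro v hv
    obtain ⟨u, hu, rfl⟩ := Finset.mem_image.1 hv
    rcases (unadj_spec hC hu).2 with ⟨h1, -, -⟩ | ⟨h1, h2⟩
    · exact Or.inl h1
    · rw [h1]; exact Or.inr ⟨hu, h2⟩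
  refine dom_of_mem fun b hb => ?_
  have hBC := hBle b
  by_cases hbZ : b ∈ C ∪ V
  · have e1 := hcnt b hbZ
    by_cases hbC : b ∈ C
    · rw [cntGe_of_mem hbC] at e1; omega
    · obtain ⟨hbU, hbf⟩ := (hVcase b ((Finset.mem_union.1 hbZ).resolve_left hbC)).resolve_left hbC
      rw [cntGe_of_notMem hbC] at e1
      -- Failure at `b` forces all the column lengths involved to be equal and makes `b` the minimum
      -- of both `B` and `U`.
      by_contra hcon
      have e2 : cntGe C b = cntGe B b := by rw [cntGe_of_notMem hbC]; omega
      have hall := hbf hb e2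
      rw [cntGe_eq_card hall] at e2
      have e3 := cntGe_le_card B b
      have e4 := hC.card_le
      have e5 := card_colOut B U
      have e6 : B.card = C.card := by omega
      have e7 : (colOut B U).card = C.card := by omega
      have hball : ∀ x ∈ B, b ≤ x := by
        have : cntGe B b = B.card := by omega
        intro x hx
        have h := Finset.eq_of_subset_of_card_le (Finset.filter_subset (b ≤ ·) B) this.ge
        rw [← h] at hx; exact (Finset.mem_filter.1 hx).2
      have hbmin : ∀ w ∈ B ∪ U, b ≤ w := by
        intro w hw
        rcases Finset.mem_union.1 hw with hw | hw
        · exact hball w hw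
        · by_contra hlt
          rw [not_le] at hlt
          have f1 := cntGt_lt_of_mem hC hw
          have f2 : cntGt B w = B.card := cntGt_eq_card fun x hx => hlt.trans_le (hball x hx)
          have f3 := cntGt_le_card C w
          omega
      obtain ⟨g1, g2⟩ := markOf_spec (Finset.mem_union_left U hb) hbmin
      refine h1 e7.symm (Mark.eq_of_old_new ?_ ?_)
      · rw [g1.1 hb]; rfl
      · rw [g2.1 hbU]; rfl
  · by_cases hz : ∃ z ∈ C ∪ V, z < b
    · obtain ⟨z, hz, hzb⟩ := hz
      obtain ⟨p1, p2, p3⟩ := predIn_spec hz hzb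
      set z := predIn (C ∪ V) b
      have hgap : ∀ x ∈ C ∪ V, z < x → b ≤ x := fun x hx hzx => by
        by_contra hxb; exact absurd (p3 x hx (not_le.1 hxb)) (not_le.2 hzx)
      have e1 := hcnt z p1
      have e2 : cntGt A z = cntGe A b := cntGt_eq_cntGe p2 fun x hx => hgap x (by
        rw [← hu]; exact Finset.mem_union_left _ hx)
      have e3 : cntGt C z = cntGe C b := cntGt_eq_cntGe p2 fun x hx =>
        hgap x (Finset.mem_union_left _ hx)
      have e4 : cntGe A b = cntGt A b := cntGe_of_notMem fun h => hbZ (by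
        rw [← hu]; exact Finset.mem_union_left _ h)
      have e5 : cntGe C b = cntGt C b := cntGe_of_notMem fun h => hbZ (Finset.mem_union_left _ h)
      by_cases hzC : z ∈ C
      · rw [cntGe_of_mem hzC] at e1; omega
      · have hzU := ((hVcase z ((Finset.mem_union.1 p1).resolve_left hzC)).resolve_left hzC).1
        have f1 := cntGe_le_cntGt_of_lt (X := B) p2
        have f2 := cntGt_lt_of_mem hC hzU
        rw [cntGe_of_notMem hzC] at e1
        omega
    · push Not at hz
      -- Nothing of the union lies at or below `b`, so only the lengths of the columns matter.
      have e1 : cntGt A b = A.card := cntGt_eq_card fun x hx => by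
        have hx' : x ∈ C ∪ V := by rw [← hu]; exact Finset.mem_union_left _ hx
        exact lt_of_le_of_ne (hz x hx') (by rintro rfl; exact hbZ hx')
      have e2 := card_colOut A W
      rw [hCeq, markOf_back hne] at e2
      have e3 := card_colOut B U
      have e4 := hC.card_le
      have e5 := cntGe_le_card B b
      split_ifs at e2 with h
      · rcases h2 h with h' | h'
        · split_ifs at e3 <;> omega
        · rw [if_pos h'] at e3; omega
      · split_ifs at e3 <;> omega

end Reverse

/-- Suppose the right column absorbs its first letter at `b` and the results are equally long. Then
`A` gained no box, and all of `A` exceeds `b`. But the absorbed letter stems from a bumped `v ≤ b`,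
so the minimum of `A ∪ U` is not in `A`, which would mean that `A` did gain a box. The second
condition only compares lengths. -/
theorem mark_cond {A U B : Finset ℕ+} (hAB : Dom A B) :
    ((colOut A U).card = (colOut B (passOn A U B)).card →
      markOf B (passOn A U B) ≠ Mark.absorb) ∧
    (markOf A U = Mark.add → (colOut B (passOn A U B)).card < (colOut A U).card ∨
      markOf B (passOn A U B) = Mark.add) := by
  have e1 := card_colOut A U
  have e2 := card_colOut B (passOn A U B)
  have e3 := hAB.card_le
  constructor
  · intro h habs
    rw [if_neg (by rw [habs]; simp)] at e2
    rcases (B ∪ passOn A U B).eq_empty_or_nonempty with h0 | h0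
    · obtain ⟨h1, h2⟩ := Finset.union_eq_empty.1 h0
      rw [h2, h1, markOf_empty] at habs; simp at habs
    obtain ⟨b, hb, hbmin⟩ := exists_min_union h0
    obtain ⟨g1, g2⟩ := markOf_spec hb hbmin
    have hbB : b ∈ B := g1.2 (by rw [habs]; rfl)
    have hbU : b ∈ passOn A U B := g2.2 (by rw [habs]; rfl)
    obtain ⟨v, hv, hvb⟩ := Finset.mem_image.1 hbU
    have hvle : v ≤ b := hvb ▸ le_adj _ _ _
    have f1 := hAB b
    rw [cntGe_eq_card fun x hx => hbmin x (Finset.mem_union_left _ hx)] at f1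
    have f2 := cntGt_le_card A b
    split_ifs at e1 with hm
    · omega
    have f3 : cntGt A b = A.card := by omega
    have hall : ∀ x ∈ A, b < x := by
      intro x hx
      have h := Finset.eq_of_subset_of_card_le (Finset.filter_subset (b < ·) A) f3.ge
      rw [← h] at hx; exact (Finset.mem_filter.1 hx).2
    have hvZ := colBump_subset _ _ hv
    obtain ⟨z, hz, hzmin⟩ := exists_min_union (A := A) (U := U) ⟨v, hvZ⟩
    have hzA : z ∉ A := fun hzA => absurd (hall z hzA) (not_lt.2 ((hzmin v hvZ).trans hvle))
    obtain ⟨k1, k2⟩ := markOf_spec hz hzmin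
    refine hm (Mark.old_eq_false.1 ?_)
    rw [k1] at hzA; simpa using hzA
  · intro h
    rw [if_pos h] at e1
    by_cases h' : markOf B (passOn A U B) = Mark.add
    · exact Or.inr h'
    · rw [if_neg h'] at e2; left; omega

/-! ### Runs through all columns and their inverses -/

/-- Insertion of the increasing word of `U` into the columns `F`; the second component holds the
letters that leave the last column. -/
def runSets : List (Finset ℕ+) → Finset ℕ+ → List (Finset ℕ+) × Finset ℕ+
  | [], U => ([], U)
  | A :: R, U => (colOut A U :: (runSets R (passOn A U (R.headD ∅))).1,
      (runSets R (passOn A U (R.headD ∅))).2)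

/-- The marks of all columns. -/
def runMarks : List (Finset ℕ+) → Finset ℕ+ → List Mark
  | [], _ => []
  | A :: R, U => markOf A U :: runMarks R (passOn A U (R.headD ∅))

/-- The columns and the increasing word whose insertion gives `P` with the given marks. -/
def unrun : List (Finset ℕ+) → List Mark → List (Finset ℕ+) × Finset ℕ+
  | C :: P, m :: ms =>
    (colBack C (unpass C (unrun P ms).2 ((unrun P ms).1.headD ∅)) m.old :: (unrun P ms).1,
      colBack (unpass C (unrun P ms).2 ((unrun P ms).1.headD ∅)) C m.new)
  | _, _ => ([], ∅)

/-- The mark lists that occur for the columns `P`. -/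
def Admissible : List (Finset ℕ+) → List Mark → Prop
  | [], [] => True
  | C :: P, m :: ms =>
    (C.card = (P.headD ∅).card → ms.headD Mark.keep ≠ Mark.absorb) ∧
    (m = Mark.add → (P.headD ∅).card < C.card ∨ ms.headD Mark.keep = Mark.add) ∧
    Admissible P ms
  | _, _ => False

theorem isChain_dom_cons {C : Finset ℕ+} {P : List (Finset ℕ+)} :
    (C :: P).IsChain Dom ↔ Dom C (P.headD ∅) ∧ P.IsChain Dom := by
  cases P with
  | nil => simp [dom_empty]
  | cons D P => simp

theorem colOut_empty (A : Finset ℕ+) : colOut A ∅ = A := by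
  rw [colOut, Finset.union_empty, Finset.filter_true_of_mem]
  rintro z hz ⟨w, hw, hzw⟩; exact (succIn_spec hw hzw).1

/-- Past the last column an empty column with mark `keep` stands in; this is consistent because no
letter arrives there. -/
theorem runSets_headD {R : List (Finset ℕ+)} {U : Finset ℕ+} (h : (runSets R U).2 = ∅) :
    (runSets R U).1.headD ∅ = colOut (R.headD ∅) U ∧
      (runMarks R U).headD Mark.keep = markOf (R.headD ∅) U := by
  cases R with
  | nil => simp only [runSets] at h; subst h; simp [runSets, runMarks, colOut_empty, markOf_empty]
  | cons A R => simp [runSets, runMarks]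

/-- Work from the right: the remaining columns and marks determine the former right neighbour and
the letters that entered it, hence the letters that left the present column. Admissibility is what
`dom_back` needs. -/
theorem unrun_spec {P : List (Finset ℕ+)} {ms : List Mark} (hP : P.IsChain Dom)
    (hne : ∀ C ∈ P, C.Nonempty) (hms : Admissible P ms) :
    (unrun P ms).1.length = P.length ∧ (unrun P ms).1.IsChain Dom ∧
      runSets (unrun P ms).1 (unrun P ms).2 = (P, ∅) ∧
      runMarks (unrun P ms).1 (unrun P ms).2 = ms := by
  induction P generalizing ms with
  | nil =>
    cases ms with
    | nil => simp [unrun, runSets, runMarks]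
    | cons m ms => exact hms.elim
  | cons C P ih =>
    cases ms with
    | nil => exact hms.elim
    | cons m ms =>
      obtain ⟨c1, c2, c3⟩ := hms
      rw [isChain_dom_cons] at hP
      obtain ⟨i1, i2, i3, i4⟩ := ih hP.2 (fun D hD => hne D (List.mem_cons_of_mem _ hD)) c3
      have hCne := hne C List.mem_cons_self
      obtain ⟨r1, r2⟩ := runSets_headD (R := (unrun P ms).1) (U := (unrun P ms).2) (by rw [i3])
      rw [i3] at r1
      rw [i4] at r2
      simp only at r1
      have hC : Dom C (colOut ((unrun P ms).1.headD ∅) (unrun P ms).2) := by rw [← r1]; exact hP.1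
      refine ⟨by simp [unrun, i1], ?_, ?_, ?_⟩
      · rw [unrun, isChain_dom_cons]
        refine ⟨dom_back hC hCne ?_ ?_, i2⟩
        · rw [← r1, ← r2]; exact c1
        · rw [← r1, ← r2]; exact c2
      · simp only [unrun, runSets]
        rw [passOn_back hC, colOut_back hC, i3]
      · simp only [unrun, runMarks]
        rw [passOn_back hC, markOf_back hCne, i4]

/-- With the former right neighbour known by induction, `unadj` recovers the bumped letters and the
mark recovers the minimum. Admissibility of the marks is `mark_cond`. -/
theorem unrun_runSets {F P : List (Finset ℕ+)} {U : Finset ℕ+} (hF : F.IsChain Dom)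
    (hrun : runSets F U = (P, ∅)) (hP : P.IsChain Dom) (hne : ∀ C ∈ P, C.Nonempty) :
    Admissible P (runMarks F U) ∧ unrun P (runMarks F U) = (F, U) := by
  induction F generalizing P U with
  | nil =>
    simp only [runSets, Prod.mk.injEq] at hrun
    obtain ⟨rfl, rfl⟩ := hrun
    simp [runMarks, Admissible, unrun]
  | cons A R ih =>
    simp only [runSets, Prod.mk.injEq] at hrun
    obtain ⟨rfl, hout⟩ := hrun
    rw [isChain_dom_cons] at hF hP
    obtain ⟨i1, i2⟩ := ih hF.2 (Prod.ext rfl hout) hP.2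
      (fun D hD => hne D (List.mem_cons_of_mem _ hD))
    obtain ⟨r1, r2⟩ := runSets_headD hout
    obtain ⟨c1, c2⟩ := mark_cond (U := U) hF.1
    constructor
    · refine ⟨?_, ?_, i1⟩
      · rw [r1, r2]; exact c1
      · rw [r1, r2]; exact c2
    · simp only [runMarks, unrun, i2, Prod.mk.injEq]
      rw [unpass_passOn hF.1]
      refine ⟨?_, ?_⟩
      · congr 1
        exact colBack_colOut fun z hz h => (markOf_spec hz h).1
      · exact colBack_colBump fun z hz h => (markOf_spec hz h).2

/-! ## The tableaux from which a given tableau arises by inserting an increasing word -/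

/-- The tableau with the given column sets, empty columns being dropped. -/
def toTableau (F : List (Finset ℕ+)) : List (List ℕ+) :=
  (F.filter (· ≠ ∅)).map fun S => S.sort (· ≥ ·)

/-- Empty columns occur only at the right end. -/
def TrailingEmpty (F : List (Finset ℕ+)) : Prop := F.IsChain fun A B => B ≠ ∅ → A ≠ ∅

theorem trailingEmpty_of_isChain {F : List (Finset ℕ+)} (h : F.IsChain Dom) : TrailingEmpty F :=
  h.imp fun _ _ hAB hB hA => hB (by subst hA; exact hAB.eq_empty)

theorem trailingEmpty_cons {A : Finset ℕ+} {R : List (Finset ℕ+)} :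
    TrailingEmpty (A :: R) ↔ (R.headD ∅ ≠ ∅ → A ≠ ∅) ∧ TrailingEmpty R := by
  cases R with
  | nil => simp [TrailingEmpty]
  | cons D P => simp [TrailingEmpty]

theorem TrailingEmpty.filter_eq_nil {R : List (Finset ℕ+)} (h : TrailingEmpty R)
    (h0 : R.headD ∅ = ∅) : R.filter (· ≠ ∅) = [] := by
  induction R with
  | nil => rfl
  | cons A R ih =>
    rw [trailingEmpty_cons] at h
    have hA : A = ∅ := h0
    rw [List.filter_cons_of_neg (by simpa using hA)]
    refine ih h.2 ?_
    by_contra hc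
    exact h.1 hc hA

theorem TrailingEmpty.headD_filter {R : List (Finset ℕ+)} (h : TrailingEmpty R) :
    (R.filter (· ≠ ∅)).headD ∅ = R.headD ∅ := by
  cases R with
  | nil => rfl
  | cons A R =>
    by_cases hA : A = ∅
    · rw [h.filter_eq_nil (by simpa using hA)]; simp [hA]
    · rw [List.filter_cons_of_pos (by simpa using hA)]; rfl

theorem colIns_ne_empty {A : Finset ℕ+} (hA : A ≠ ∅) (x : ℕ+) : colIns A x ≠ ∅ := by
  unfold colIns; split_ifs
  · exact hA
  · exact Finset.insert_ne_empty _ _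

/-- Lists are padded by empty columns so that old and new tableau have equally many columns;
insertion does not notice the padding. -/
theorem TrailingEmpty.setInsert {R : List (Finset ℕ+)} (h : TrailingEmpty R) (x : ℕ+) :
    TrailingEmpty (setInsert R x) ∧
      (setInsert R x).filter (· ≠ ∅) = _root_.setInsert (R.filter (· ≠ ∅)) x := by
  induction R generalizing x with
  | nil => simp [_root_.setInsert, TrailingEmpty]
  | cons A R ih =>
    rw [trailingEmpty_cons] at h
    obtain ⟨h1, h2⟩ := h
    by_cases hA : A = ∅
    · subst hA
      have h0 : R.headD ∅ = ∅ := by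
        by_contra hc; exact h1 hc rfl
      rw [List.filter_cons_of_neg (by simp), h2.filter_eq_nil h0]
      simp only [_root_.setInsert]
      rw [if_neg (by simp), List.filter_cons_of_pos (by simp), h2.filter_eq_nil h0,
        trailingEmpty_cons]
      exact ⟨⟨fun _ => by simp, h2⟩, rfl⟩
    · rw [List.filter_cons_of_pos (by simpa using hA)]
      simp only [_root_.setInsert]
      split_ifs with hx
      · rw [trailingEmpty_cons, List.filter_cons_of_pos (by simpa using colIns_ne_empty hA x),
          h2.headD_filter]
        obtain ⟨i1, i2⟩ := ih h2 (adj (colIns A x) (R.headD ∅) (predIn A x))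
        exact ⟨⟨fun _ => colIns_ne_empty hA x, i1⟩, by rw [i2]⟩
      · rw [trailingEmpty_cons, List.filter_cons_of_pos (by simp)]
        exact ⟨⟨fun _ => by simp, h2⟩, rfl⟩

theorem TrailingEmpty.filter_foldl {R : List (Finset ℕ+)} (h : TrailingEmpty R) (u : List ℕ+) :
    (u.foldl _root_.setInsert R).filter (· ≠ ∅)
      = u.foldl _root_.setInsert (R.filter (· ≠ ∅)) := by
  induction u generalizing R with
  | nil => rfl
  | cons x u ih => rw [List.foldl_cons, ih (h.setInsert x).1, (h.setInsert x).2, List.foldl_cons]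

theorem foldl_setInsert_eq_runSets {F : List (Finset ℕ+)} (hF : F.IsChain Dom) (U : Finset ℕ+) :
    (ascWord U).foldl setInsert F
      = (runSets F U).1 ++ (ascWord (runSets F U).2).foldl setInsert [] := by
  induction F generalizing U with
  | nil => simp [runSets]
  | cons A R ih =>
    rw [isChain_dom_cons] at hF
    rw [foldl_setInsert_cons A R hF.1, ih hF.2]
    simp [runSets]

theorem length_runSets (F : List (Finset ℕ+)) (U : Finset ℕ+) :
    (runSets F U).1.length = F.length := by
  induction F generalizing U with
  | nil => rfl
  | cons A R ih => simp [runSets, ih]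

/-- A letter that leaves a column has a successor in `A ∪ U`, and the maximum of this union remains
in the column. -/
theorem nonempty_of_runSets_snd {F : List (Finset ℕ+)} {U : Finset ℕ+}
    (h : (runSets F U).2 ≠ ∅) : U ≠ ∅ ∧ ∀ C ∈ (runSets F U).1, C ≠ ∅ := by
  induction F generalizing U with
  | nil => exact ⟨h, by simp [runSets]⟩
  | cons A R ih =>
    obtain ⟨i1, i2⟩ := ih (U := passOn A U (R.headD ∅)) h
    have hV : (colBump A U).Nonempty := by
      rw [Finset.nonempty_iff_ne_empty]; intro h0
      rw [passOn, h0, Finset.image_empty] at i1; exact i1 rfl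
    obtain ⟨v, hv⟩ := hV
    obtain ⟨v1, v2, v3⟩ := mem_colBump.1 hv
    have hZ : (A ∪ U).Nonempty := ⟨v, v1⟩
    refine ⟨Finset.nonempty_iff_ne_empty.1 ⟨_, v3⟩, fun C hC => ?_⟩
    rcases List.mem_cons.1 hC with rfl | hC
    · refine Finset.nonempty_iff_ne_empty.1 ⟨(A ∪ U).max' hZ, mem_colOut.2
        ⟨Finset.max'_mem _ _, fun ⟨w, hw, hlt⟩ => ?_⟩⟩
      exact absurd (Finset.le_max' _ w hw) (not_le.2 hlt)
    · exact i2 C hC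

theorem length_le_length_setInsert (R : List (Finset ℕ+)) (x : ℕ+) :
    R.length ≤ (setInsert R x).length := by
  induction R generalizing x with
  | nil => simp
  | cons A R ih =>
    rw [setInsert]; split_ifs
    · simpa using ih _
    · simp

theorem length_le_length_foldl_setInsert (R : List (Finset ℕ+)) (u : List ℕ+) :
    R.length ≤ (u.foldl setInsert R).length := by
  induction u generalizing R with
  | nil => exact le_rfl
  | cons x u ih => exact (length_le_length_setInsert R x).trans (ih _)

theorem sort_toFinset_eq {C : List ℕ+} (hC : C.Pairwise (· > ·)) :
    C.toFinset.sort (· ≥ ·) = C := by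
  refine List.Perm.eq_of_pairwise (le := (· ≥ ·)) ?_ (Finset.pairwise_sort _ _)
    (hC.imp fun h => le_of_lt h) ?_
  · intro a b _ _ h1 h2; exact le_antisymm h2 h1
  · refine (List.perm_ext_iff_of_nodup (Finset.sort_nodup _ _) (hC.imp fun h => ne_of_gt h)).2 ?_
    intro a; simp

theorem pairwise_sort_gt (S : Finset ℕ+) : (S.sort (· ≥ ·)).Pairwise (· > ·) := by
  have h1 : (S.sort (· ≥ ·)).Pairwise (· ≥ ·) := Finset.pairwise_sort _ _
  have h2 : (S.sort (· ≥ ·)).Nodup := Finset.sort_nodup _ _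
  exact (h1.and h2).imp fun ⟨h, h'⟩ => lt_of_le_of_ne h h'.symm

theorem colSets_toTableau (F : List (Finset ℕ+)) :
    colSets (toTableau F) = F.filter (· ≠ ∅) := by
  simp only [colSets, toTableau, List.map_map]
  conv_rhs => rw [← List.map_id (F.filter (· ≠ ∅))]
  refine List.map_congr_left fun S _ => ?_
  simp

theorem colSets_ne_empty {T : List (List ℕ+)} (hT : IsDecreasingTableau T) :
    ∀ C ∈ colSets T, C ≠ ∅ := by
  intro C hC
  obtain ⟨D, hD, rfl⟩ := List.mem_map.1 hC
  rw [Ne, List.toFinset_eq_empty_iff]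
  exact (hT.1 D hD).1

theorem toTableau_colSets {T : List (List ℕ+)} (hT : IsDecreasingTableau T) :
    toTableau (colSets T) = T := by
  rw [toTableau, List.filter_eq_self.2 fun C hC => by simpa using colSets_ne_empty hT C hC,
    colSets, List.map_map]
  conv_rhs => rw [← List.map_id T]
  exact List.map_congr_left fun C hC => sort_toFinset_eq (hT.1 C hC).2

theorem isChain_filter {F : List (Finset ℕ+)} (hF : F.IsChain Dom) :
    (F.filter (· ≠ ∅)).IsChain Dom := by
  induction F with
  | nil => simp
  | cons A R ih =>
    have hR := trailingEmpty_of_isChain (isChain_dom_cons.1 hF).2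
    rw [List.filter_cons]
    split_ifs
    · rw [isChain_dom_cons, hR.headD_filter]
      exact ⟨(isChain_dom_cons.1 hF).1, ih (isChain_dom_cons.1 hF).2⟩
    · exact ih (isChain_dom_cons.1 hF).2

theorem isDecreasingTableau_toTableau {F : List (Finset ℕ+)} (hF : F.IsChain Dom) :
    IsDecreasingTableau (toTableau F) := by
  rw [isDecreasingTableau_iff, colSets_toTableau]
  refine ⟨fun C hC => ?_, isChain_filter hF⟩
  obtain ⟨S, hS, rfl⟩ := List.mem_map.1 hC
  refine ⟨?_, pairwise_sort_gt S⟩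
  have := (List.mem_filter.1 hS).2
  intro h0
  have h1 := congrArg List.toFinset h0
  simp at h1; simp [h1] at this

theorem eq_of_colSets_eq {T T' : List (List ℕ+)} (hT : IsDecreasingTableau T)
    (hT' : IsDecreasingTableau T') (h : colSets T = colSets T') : T = T' := by
  rw [← toTableau_colSets hT, h, toTableau_colSets hT']

/-- The tableau to which `lastRun P ms` is inserted to give `P`. -/
def prevTableau (P : List (List ℕ+)) (ms : List Mark) : List (List ℕ+) :=
  toTableau (unrun (colSets P) ms).1

/-- The increasing word whose insertion into `prevTableau P ms` gives `P`. -/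
def lastRun (P : List (List ℕ+)) (ms : List Mark) : List ℕ+ := ascWord (unrun (colSets P) ms).2

theorem ascWord_pairwise (U : Finset ℕ+) : (ascWord U).Pairwise (· < ·) := by
  have h1 : (U.sort (· ≤ ·)).Pairwise (· ≤ ·) := Finset.pairwise_sort _ _
  have h2 : (U.sort (· ≤ ·)).Nodup := Finset.sort_nodup _ _
  exact (h1.and h2).imp fun ⟨h, h'⟩ => lt_of_le_of_ne h h'

theorem ascWord_toFinset {u : List ℕ+} (hu : u.Pairwise (· < ·)) : ascWord u.toFinset = u := by
  refine List.Perm.eq_of_pairwise (le := (· ≤ ·)) ?_ (Finset.pairwise_sort _ _)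
    (hu.imp fun h => le_of_lt h) ?_
  · intro a b _ _ h1 h2; exact le_antisymm h1 h2
  · refine (List.perm_ext_iff_of_nodup (Finset.sort_nodup _ _) (hu.imp fun h => ne_of_lt h)).2 ?_
    intro a; simp

/-! ### The bijection between admissible marks and pairs of a tableau and an increasing word -/

section Branch

variable {P : List (List ℕ+)} (hP : IsDecreasingTableau P)
include hP

theorem unrun_colSets {ms : List Mark} (hms : Admissible (colSets P) ms) :
    (unrun (colSets P) ms).1.length = (colSets P).length ∧
      (unrun (colSets P) ms).1.IsChain Dom ∧
      runSets (unrun (colSets P) ms).1 (unrun (colSets P) ms).2 = (colSets P, ∅) ∧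
      runMarks (unrun (colSets P) ms).1 (unrun (colSets P) ms).2 = ms :=
  unrun_spec (isDecreasingTableau_iff.1 hP).2
    (fun C hC => Finset.nonempty_iff_ne_empty.2 (colSets_ne_empty hP C hC)) hms

theorem prevTableau_isDecreasing {ms : List Mark} (hms : Admissible (colSets P) ms) :
    IsDecreasingTableau (prevTableau P ms) :=
  isDecreasingTableau_toTableau (unrun_colSets hP hms).2.1

theorem foldl_lastRun {ms : List Mark} (hms : Admissible (colSets P) ms) :
    (lastRun P ms).foldl heckeInsert (prevTableau P ms) = P := by
  obtain ⟨h1, h2, h3, h4⟩ := unrun_colSets hP hms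
  have hd := prevTableau_isDecreasing hP hms
  refine eq_of_colSets_eq (foldl_heckeInsert_isDecreasing hd _) hP ?_
  rw [colSets_foldl_heckeInsert hd, prevTableau, colSets_toTableau,
    ← (trailingEmpty_of_isChain h2).filter_foldl, lastRun, foldl_setInsert_eq_runSets h2, h3]
  simp only [ascWord_empty, List.foldl_nil, List.append_nil]
  exact List.filter_eq_self.2 fun C hC => by simpa using colSets_ne_empty hP C hC

/-- Pad `T` by empty columns to the number of columns of `P`; then the run ends inside the list, and
`unrun_runSets` applies. -/
theorem exists_marks {T : List (List ℕ+)} (hT : IsDecreasingTableau T) {u : List ℕ+}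
    (hu : u.Pairwise (· < ·)) (h : u.foldl heckeInsert T = P) :
    ∃ ms, Admissible (colSets P) ms ∧ prevTableau P ms = T ∧ lastRun P ms = u := by
  have hcs : u.foldl setInsert (colSets T) = colSets P := by
    rw [← colSets_foldl_heckeInsert hT, h]
  have hlen : (colSets T).length ≤ (colSets P).length := by
    rw [← hcs]; exact length_le_length_foldl_setInsert _ _
  set k := (colSets P).length - (colSets T).length with hk
  set F := colSets T ++ List.replicate k ∅ with hF
  have hTne := colSets_ne_empty hT
  have hfil : F.filter (· ≠ ∅) = colSets T := by
    rw [hF, List.filter_append, List.filter_eq_self.2 fun C hC => by simpa using hTne C hC]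
    simp
  have hchain : F.IsChain Dom := by
    rw [hF, List.isChain_append]
    refine ⟨(isDecreasingTableau_iff.1 hT).2, ?_, ?_⟩
    · exact (List.isChain_replicate_of_rel k (dom_empty ∅))
    · intro x _ y hy
      have := List.eq_of_mem_replicate (List.mem_of_mem_head? hy)
      rw [this]; exact dom_empty _
  have hFlen : F.length = (colSets P).length := by
    rw [hF, List.length_append, List.length_replicate]; omega
  have hfold : ((ascWord u.toFinset).foldl setInsert F).filter (· ≠ ∅) = colSets P := by
    rw [(trailingEmpty_of_isChain hchain).filter_foldl, hfil, ascWord_toFinset hu, hcs]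
  rw [foldl_setInsert_eq_runSets hchain] at hfold
  -- A letter leaving the padded list would open a new column after nonempty ones, giving more
  -- columns than `P` has.
  have hout : (runSets F u.toFinset).2 = ∅ := by
    by_contra hne
    obtain ⟨-, h2⟩ := nonempty_of_runSets_snd hne
    have h3 := congrArg List.length hfold
    rw [List.filter_append, List.filter_eq_self.2 fun C hC => by simpa using h2 C hC,
      List.length_append, length_runSets, hFlen] at h3
    obtain ⟨v, hv⟩ := Finset.nonempty_iff_ne_empty.2 hne
    have hl : ∃ a l, ascWord (runSets F u.toFinset).2 = a :: l := by
      cases hw : ascWord (runSets F u.toFinset).2 with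
      | nil =>
        have : v ∈ ascWord (runSets F u.toFinset).2 := (Finset.mem_sort _).2 hv
        rw [hw] at this; simp at this
      | cons a l => exact ⟨a, l, rfl⟩
    obtain ⟨a, l, hal⟩ := hl
    have htr : TrailingEmpty ([] : List (Finset ℕ+)) := by simp [TrailingEmpty]
    rw [htr.filter_foldl, hal] at h3
    have := length_le_length_foldl_setInsert (setInsert ([] : List (Finset ℕ+)) a) l
    simp [setInsert] at this h3
    rw [h3] at this; simp at this
  rw [hout] at hfold
  simp only [ascWord_empty, List.foldl_nil, List.append_nil] at hfold
  have hrun : (runSets F u.toFinset).1 = colSets P := by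
    rw [← hfold]
    refine (List.filter_eq_self.2 ?_).symm
    rw [← List.length_filter_eq_length_iff, hfold, length_runSets, hFlen]
  obtain ⟨g1, g2⟩ := unrun_runSets (P := colSets P) hchain (Prod.ext hrun hout) (isDecreasingTableau_iff.1 hP).2
    (fun C hC => Finset.nonempty_iff_ne_empty.2 (colSets_ne_empty hP C hC))
  refine ⟨_, g1, ?_, ?_⟩
  · refine eq_of_colSets_eq (prevTableau_isDecreasing hP g1) hT ?_
    rw [prevTableau, g2, colSets_toTableau, hfil]
  · rw [lastRun, g2, ascWord_toFinset hu]

theorem marks_injective {ms ms' : List Mark} (hms : Admissible (colSets P) ms)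
    (hms' : Admissible (colSets P) ms') (h1 : prevTableau P ms = prevTableau P ms')
    (h2 : lastRun P ms = lastRun P ms') : ms = ms' := by
  obtain ⟨a1, a2, a3, a4⟩ := unrun_colSets hP hms
  obtain ⟨b1, b2, b3, b4⟩ := unrun_colSets hP hms'
  have hU : (unrun (colSets P) ms).2 = (unrun (colSets P) ms').2 := by
    have := congrArg List.toFinset h2
    simpa [lastRun, ascWord] using this
  have hfil := congrArg colSets h1
  rw [prevTableau, prevTableau, colSets_toTableau, colSets_toTableau] at hfil
  -- A padded list is determined by its length and its nonempty columns.
  have key : ∀ F F' : List (Finset ℕ+), TrailingEmpty F → TrailingEmpty F' →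
      F.length = F'.length → F.filter (· ≠ ∅) = F'.filter (· ≠ ∅) → F = F' := by
    intro F
    induction F with
    | nil => intro F' _ _ h _; exact (List.length_eq_zero_iff.1 h.symm).symm
    | cons A R ih =>
      intro F' hF hF' hl hf
      cases F' with
      | nil => simp at hl
      | cons A' R' =>
        have hh : A = A' := by
          have := hF.headD_filter
          rw [hf, hF'.headD_filter] at this; exact this.symm
        subst hh
        congr 1
        refine ih R' (trailingEmpty_cons.1 hF).2 (trailingEmpty_cons.1 hF').2 (by simpa using hl) ?_
        by_cases hA : A = ∅
        · rwa [List.filter_cons_of_neg (by simpa using hA),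
            List.filter_cons_of_neg (by simpa using hA)] at hf
        · rw [List.filter_cons_of_pos (by simpa using hA),
            List.filter_cons_of_pos (by simpa using hA)] at hf
          exact (List.cons.inj hf).2
  have hF := key _ _ (trailingEmpty_of_isChain a2) (trailingEmpty_of_isChain b2)
    (a1.trans b1.symm) hfil
  rw [← a4, ← b4, hF, hU]

end Branch

/-! ## Insertion and column words in a monoid with the `K`-Knuth relations -/

/-- The elements `f 1, f 2, …` of a monoid satisfy the `K`-Knuth relations. -/
structure KKnuth {M : Type*} [Monoid M] (f : ℕ+ → M) : Prop where
  idem : ∀ p, f p * f p = f p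
  braid : ∀ p q, f p * f q * f p = f q * f p * f q
  left : ∀ x y z, x < y → y < z → f x * f z * f y = f z * f x * f y
  right : ∀ x y z, x < y → y < z → f y * f x * f z = f y * f z * f x

/-- The product of the letters of a word. -/
def wordProd {M : Type*} [Monoid M] (f : ℕ+ → M) (l : List ℕ+) : M := (l.map f).prod

/-- The column-reading word. -/
def setWord (F : List (Finset ℕ+)) : List ℕ+ := (F.map ascWord).flatten

theorem ascWord_union {S T : Finset ℕ+} (h : ∀ s ∈ S, ∀ t ∈ T, s < t) :
    ascWord (S ∪ T) = ascWord S ++ ascWord T := by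
  refine List.Perm.eq_of_pairwise (le := (· ≤ ·)) ?_ (Finset.pairwise_sort _ _) ?_ ?_
  · intro a b _ _ h1 h2; exact le_antisymm h1 h2
  · rw [List.pairwise_append]
    exact ⟨Finset.pairwise_sort _ _, Finset.pairwise_sort _ _, fun a ha b hb =>
      (h a ((Finset.mem_sort _).1 ha) b ((Finset.mem_sort _).1 hb)).le⟩
  · refine (List.perm_ext_iff_of_nodup (Finset.sort_nodup _ _) ?_).2 ?_
    · rw [List.nodup_append]
      exact ⟨Finset.sort_nodup _ _, Finset.sort_nodup _ _, fun a ha b hb =>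
        (h a ((Finset.mem_sort _).1 ha) b ((Finset.mem_sort _).1 hb)).ne⟩
    · intro a; simp [ascWord]

theorem ascWord_singleton (x : ℕ+) : ascWord {x} = [x] := by simp [ascWord]

theorem mem_ascWord {S : Finset ℕ+} {x : ℕ+} : x ∈ ascWord S ↔ x ∈ S := Finset.mem_sort _

theorem ascWord_insert_min {U : Finset ℕ+} {x : ℕ+} (h : ∀ u ∈ U, x < u) :
    ascWord (insert x U) = x :: ascWord U := by
  rw [Finset.insert_eq, ascWord_union (by simpa using h), ascWord_singleton]; rfl

section Monoid

variable {M : Type*} [Monoid M] {f : ℕ+ → M}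

theorem wordProd_append (l l' : List ℕ+) : wordProd f (l ++ l') = wordProd f l * wordProd f l' := by
  simp [wordProd]

theorem wordProd_cons (a : ℕ+) (l : List ℕ+) : wordProd f (a :: l) = f a * wordProd f l := by
  simp [wordProd]

theorem wordProd_nil : wordProd f [] = 1 := rfl

/-- Each smaller letter is passed with the help of the letter following it, which lies between it
and `x`; for the last one this is `y`. -/
theorem KKnuth.move_left (hf : KKnuth f) {x y : ℕ+} (hyx : y < x) {l : List ℕ+}
    (hl : l.Pairwise (· < ·)) (hly : ∀ a ∈ l, a < y) :
    f x * wordProd f l * f y = wordProd f l * f x * f y := by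
  induction l with
  | nil => simp [wordProd_nil]
  | cons a l ih =>
    rw [List.pairwise_cons] at hl
    have ih' := ih hl.2 fun b hb => hly b (List.mem_cons_of_mem _ hb)
    have key : f x * f a * (wordProd f l * f y) = f a * f x * (wordProd f l * f y) := by
      cases l with
      | nil =>
        rw [wordProd_nil, one_mul, ← hf.left a y x (hly a List.mem_cons_self) hyx]
      | cons b l =>
        have hbx : b < x := (hly b (by simp)).trans hyx
        simp only [wordProd_cons, ← mul_assoc]
        rw [← hf.left a b x (hl.1 b List.mem_cons_self) hbx]
    calc f x * wordProd f (a :: l) * f y = f x * f a * (wordProd f l * f y) := by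
          simp only [wordProd_cons, mul_assoc]
      _ = f a * (f x * wordProd f l * f y) := by rw [key]; simp only [mul_assoc]
      _ = wordProd f (a :: l) * f x * f y := by rw [ih']; simp only [wordProd_cons, mul_assoc]

/-- Here the letter just passed, or `x` at the start, stands to the left and lies between `y` and
the next letter. -/
theorem KKnuth.move_right (hf : KKnuth f) {x y : ℕ+} (hyx : y < x) {l : List ℕ+}
    (hl : l.Pairwise (· < ·)) (hlx : ∀ a ∈ l, x < a) :
    f x * f y * wordProd f l = f x * wordProd f l * f y := by
  induction l generalizing x with
  | nil => simp [wordProd_nil]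
  | cons c l ih =>
    rw [List.pairwise_cons] at hl
    have hxc := hlx c List.mem_cons_self
    calc f x * f y * wordProd f (c :: l) = (f x * f y * f c) * wordProd f l := by
          simp only [wordProd_cons, mul_assoc]
      _ = f x * (f c * f y * wordProd f l) := by
          rw [hf.right y x c hyx hxc]; simp only [mul_assoc]
      _ = f x * wordProd f (c :: l) * f y := by
          rw [ih (hyx.trans hxc) hl.2 hl.1]; simp only [wordProd_cons, mul_assoc]

theorem KKnuth.insert_min (hf : KKnuth f) {A : Finset ℕ+} {x : ℕ+} (h : ∀ a ∈ A, x ≤ a) :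
    f x * wordProd f (ascWord A) = wordProd f (ascWord (insert x A)) := by
  by_cases hx : x ∈ A
  · rw [Finset.insert_eq_of_mem hx]
    have : A = insert x (A.erase x) := (Finset.insert_erase hx).symm
    rw [this, ascWord_insert_min, wordProd_cons, ← mul_assoc, hf.idem]
    intro a ha
    rw [Finset.mem_erase] at ha
    exact lt_of_le_of_ne (h a ha.2) ha.1.symm
  · rw [ascWord_insert_min, wordProd_cons]
    intro a ha
    exact lt_of_le_of_ne (h a ha) (by rintro rfl; exact hx ha)

/-- Write the column word as `L y R`, or `L y x R` if `x` is present. The letter `x` moves past `L`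
with `y` as witness; if `x` occurs, `x y x = y x y`; then `y` moves past `R` with `x` as witness. -/
theorem KKnuth.colIns (hf : KKnuth f) {A : Finset ℕ+} {x a : ℕ+} (ha : a ∈ A) (hax : a < x) :
    f x * wordProd f (ascWord A) = wordProd f (ascWord (colIns A x)) * f (predIn A x) := by
  obtain ⟨h1, h2, h3⟩ := predIn_spec ha hax
  set y := predIn A x with hy
  set L := A.filter (· < y) with hL
  set R := A.filter (x < ·) with hR
  have hLy : ∀ b ∈ ascWord L, b < y := fun b hb => (Finset.mem_filter.1 (mem_ascWord.1 hb)).2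
  have hRx : ∀ b ∈ ascWord R, x < b := fun b hb => (Finset.mem_filter.1 (mem_ascWord.1 hb)).2
  have mL := hf.move_left h2 (ascWord_pairwise L) hLy
  have mR := hf.move_right h2 (ascWord_pairwise R) hRx
  have hsplit : ∀ z, (y ≤ z) → z ≤ x → ascWord (L ∪ insert z R) = ascWord L ++ z :: ascWord R := by
    intro z hz hz2
    rw [ascWord_union, ascWord_insert_min]
    · intro u hu; exact hz2.trans_lt (hRx u (mem_ascWord.2 hu))
    · intro s hs t ht
      have hs' := hLy s (mem_ascWord.2 hs)
      rcases Finset.mem_insert.1 ht with rfl | ht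
      · exact hs'.trans_le hz
      · exact (hs'.trans h2).trans (hRx t (mem_ascWord.2 ht))
  by_cases hxA : x ∈ A
  · have hA : A = L ∪ insert y (insert x R) := by
      ext b
      simp only [hL, hR, Finset.mem_union, Finset.mem_insert, Finset.mem_filter]
      constructor
      · intro hb
        rcases lt_trichotomy b x with h | h | h
        · rcases (h3 b hb h).lt_or_eq with h' | h'
          · exact Or.inl ⟨hb, h'⟩
          · exact Or.inr (Or.inl h')
        · exact Or.inr (Or.inr (Or.inl h))
        · exact Or.inr (Or.inr (Or.inr ⟨hb, h⟩))
      · rintro (h | rfl | rfl | h)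
        · exact h.1
        · exact h1
        · exact hxA
        · exact h.1
    have hw : ascWord A = ascWord L ++ y :: x :: ascWord R := by
      conv_lhs => rw [hA]
      rw [ascWord_union, ascWord_insert_min, ascWord_insert_min]
      · intro u hu; exact hRx u (mem_ascWord.2 hu)
      · intro u hu
        rcases Finset.mem_insert.1 hu with rfl | hu
        · exact h2
        · exact h2.trans (hRx u (mem_ascWord.2 hu))
      · intro s hs t ht
        have hs' := hLy s (mem_ascWord.2 hs)
        rcases Finset.mem_insert.1 ht with rfl | ht
        · exact hs'
        rcases Finset.mem_insert.1 ht with rfl | ht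
        · exact hs'.trans h2
        · exact (hs'.trans h2).trans (hRx t (mem_ascWord.2 ht))
    rw [_root_.colIns, if_pos hxA, hw]
    simp only [wordProd_append, wordProd_cons]
    calc f x * (wordProd f (ascWord L) * (f y * (f x * wordProd f (ascWord R))))
        = (f x * wordProd f (ascWord L) * f y) * (f x * wordProd f (ascWord R)) := by
          simp only [mul_assoc]
      _ = wordProd f (ascWord L) * (f x * f y * f x) * wordProd f (ascWord R) := by
          rw [mL]; simp only [mul_assoc]
      _ = wordProd f (ascWord L) * f y * (f x * f y * wordProd f (ascWord R)) := by
          rw [hf.braid x y]; simp only [mul_assoc]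
      _ = _ := by rw [mR]; simp only [mul_assoc]
  · have hA : A = L ∪ insert y R := by
      ext b
      simp only [hL, hR, Finset.mem_union, Finset.mem_insert, Finset.mem_filter]
      constructor
      · intro hb
        rcases lt_trichotomy b x with h | h | h
        · rcases (h3 b hb h).lt_or_eq with h' | h'
          · exact Or.inl ⟨hb, h'⟩
          · exact Or.inr (Or.inl h')
        · exact absurd (h ▸ hb) hxA
        · exact Or.inr (Or.inr ⟨hb, h⟩)
      · rintro (h | rfl | h)
        · exact h.1
        · exact h1
        · exact h.1
    have hA' : insert x (A.erase y) = L ∪ insert x R := by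
      ext b
      rw [Finset.mem_insert, Finset.mem_erase]
      simp only [hL, hR, Finset.mem_union, Finset.mem_insert, Finset.mem_filter]
      constructor
      · rintro (rfl | ⟨hb1, hb⟩)
        · exact Or.inr (Or.inl rfl)
        · rcases lt_trichotomy b x with h | h | h
          · exact Or.inl ⟨hb, lt_of_le_of_ne (h3 b hb h) hb1⟩
          · exact absurd (h ▸ hb) hxA
          · exact Or.inr (Or.inr ⟨hb, h⟩)
      · rintro (h | rfl | h)
        · exact Or.inr ⟨h.2.ne, h.1⟩
        · exact Or.inl rfl
        · exact Or.inr ⟨(h2.trans h.2).ne', h.1⟩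
    have hw : ascWord A = ascWord L ++ y :: ascWord R := by
      conv_lhs => rw [hA]
      exact hsplit y le_rfl h2.le
    rw [_root_.colIns, if_neg hxA, hA', hsplit x h2.le le_rfl, hw]
    simp only [wordProd_append, wordProd_cons]
    calc f x * (wordProd f (ascWord L) * (f y * wordProd f (ascWord R)))
        = (f x * wordProd f (ascWord L) * f y) * wordProd f (ascWord R) := by
          simp only [mul_assoc]
      _ = wordProd f (ascWord L) * (f x * f y * wordProd f (ascWord R)) := by
          rw [mL]; simp only [mul_assoc]
      _ = _ := by rw [mR]; simp only [mul_assoc]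

/-- The extra relation for a letter that cannot be placed because of the column to the left. -/
def BlockRel (f : ℕ+ → M) : Prop :=
  ∀ (A B : Finset ℕ+) (y b : ℕ+), Dom A B → y ∈ A → b ∈ B → y < b → (∀ c ∈ B, y < c → b ≤ c) →
    y ∉ B → (∀ a ∈ A, y < a → b < a) → cntGt A y = cntGt B y →
    wordProd f (ascWord A) * f y * wordProd f (ascWord B)
      = wordProd f (ascWord A) * f b * wordProd f (ascWord B)

theorem setWord_cons (A : Finset ℕ+) (R : List (Finset ℕ+)) :
    setWord (A :: R) = ascWord A ++ setWord R := by simp [setWord]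

theorem wordProd_setWord_headD (R : List (Finset ℕ+)) :
    wordProd f (setWord R)
      = wordProd f (ascWord (R.headD ∅)) * wordProd f (setWord R.tail) := by
  cases R with
  | nil => simp [setWord, wordProd_nil]
  | cons A R => simp [setWord_cons, wordProd_append]

/-- Insertion multiplies the column word by the inserted letter. -/
theorem KKnuth.setInsert (hf : KKnuth f) (hb : BlockRel f) {F : List (Finset ℕ+)}
    (hF : F.IsChain Dom) (x : ℕ+) :
    f x * wordProd f (setWord F) = wordProd f (setWord (setInsert F x)) := by
  induction F generalizing x with
  | nil => simp [setWord, _root_.setInsert, ascWord_singleton, wordProd]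
  | cons A R ih =>
    rw [isChain_dom_cons] at hF
    rw [_root_.setInsert]
    split_ifs with h
    · obtain ⟨a, ha, hax⟩ := h
      obtain ⟨p1, p2, p3⟩ := predIn_spec ha hax
      set y := predIn A x
      rw [setWord_cons, setWord_cons, wordProd_append, wordProd_append, ← ih hF.2, ← mul_assoc,
        hf.colIns ha hax]
      rw [adj]
      split_ifs with hc
      · by_cases hex : ∃ b ∈ R.headD ∅, y < b
        · obtain ⟨b, hb1, hb2⟩ := hex
          obtain ⟨s1, s2, s3⟩ := succIn_spec hb1 hb2
          -- A genuinely new `x` adds an entry above `y` on the left, so equal counts would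
          -- contradict domination. Hence an adjustment occurs only if the column is unchanged.
          have hxA : x ∈ A := by
            by_contra hxA
            have e1 : cntGt (_root_.colIns A x) y = cntGt A y + 1 := by
              rw [_root_.colIns, if_neg hxA, cntGt_insert_of_lt _ p2]
              · congr 1
                unfold cntGt; rw [Finset.filter_erase, Finset.erase_eq_of_notMem]
                simp only [Finset.mem_filter, not_and, not_lt]
                exact fun _ => le_rfl
              · exact fun h => hxA (Finset.mem_of_mem_erase h)
            have e2 := (cntGt_le_cntGe (R.headD ∅) y).trans (hF.1 y)
            omega
          have hA : _root_.colIns A x = A := by rw [_root_.colIns, if_pos hxA]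
          rw [hA] at hc ⊢
          have hyB : y ∉ R.headD ∅ := fun hy => by
            have := hF.1.cntGt_lt hy; omega
          -- An entry of `A` in this gap would make the count above `y` larger than the one which
          -- domination compares at the successor.
          have hgap : ∀ a ∈ A, y < a → succIn (R.headD ∅) y < a := by
            intro a ha hya
            by_contra hcon
            rw [not_lt] at hcon
            have f1 := hF.1 (succIn (R.headD ∅) y)
            rw [← cntGt_eq_cntGe s2 s3, ← hc] at f1
            have f2 := cntGt_anti A hcon
            have f3 := cntGe_le_cntGt_of_lt (X := A) hya
            rw [cntGe_of_mem ha] at f3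
            omega
          have := hb A (R.headD ∅) y _ hF.1 p1 s1 s2 s3 hyB hgap hc
          rw [wordProd_setWord_headD R, ← mul_assoc, ← mul_assoc, this]
          simp only [mul_assoc]
        · push Not at hex
          rw [succIn_of_forall hex, mul_assoc]
      · rw [mul_assoc]
    · push Not at h
      rw [setWord_cons, setWord_cons, wordProd_append, wordProd_append, ← mul_assoc,
        hf.insert_min h]

end Monoid

theorem isChain_of_filter {F : List (Finset ℕ+)} (h : TrailingEmpty F)
    (hF : (F.filter (· ≠ ∅)).IsChain Dom) : F.IsChain Dom := by
  induction F with
  | nil => simp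
  | cons A R ih =>
    rw [trailingEmpty_cons] at h
    rw [isChain_dom_cons]
    by_cases hA : A = ∅
    · subst hA
      have h0 : R.headD ∅ = ∅ := by
        by_contra hc; exact h.1 hc rfl
      refine ⟨by rw [h0]; exact dom_empty _, ih h.2 ?_⟩
      rw [h.2.filter_eq_nil h0]; simp
    · rw [List.filter_cons_of_pos (by simpa using hA), isChain_dom_cons, h.2.headD_filter] at hF
      exact ⟨hF.1, ih h.2 hF.2⟩

/-- Transported from Hecke insertion, which by definition only ever produces decreasing tableaux. -/
theorem isChain_setInsert {F : List (Finset ℕ+)} (hF : F.IsChain Dom) (x : ℕ+) :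
    (setInsert F x).IsChain Dom := by
  obtain ⟨h1, h2⟩ := (trailingEmpty_of_isChain hF).setInsert x
  refine isChain_of_filter h1 ?_
  have hT := isDecreasingTableau_toTableau hF
  rw [h2, ← colSets_toTableau, ← colSets_heckeInsert hT]
  exact (isDecreasingTableau_iff.1 (heckeInsert_isDecreasing hT x)).2

/-- Each inserted letter multiplies on the left, so the inserted word appears reversed. -/
theorem KKnuth.foldl_setInsert {M : Type*} [Monoid M] {f : ℕ+ → M} (hf : KKnuth f)
    (hb : BlockRel f) {F : List (Finset ℕ+)} (hF : F.IsChain Dom) (u : List ℕ+) :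
    wordProd f u.reverse * wordProd f (setWord F)
      = wordProd f (setWord (u.foldl _root_.setInsert F)) := by
  induction u generalizing F with
  | nil => simp [wordProd_nil]
  | cons x u ih =>
    rw [List.reverse_cons, wordProd_append, List.foldl_cons, ← ih (isChain_setInsert hF x),
      ← hf.setInsert hb hF x, mul_assoc]
    simp [wordProd]

/-! ## Keys -/

/-- Removing the least element from `m` on amounts to keeping those with another such element below
them. In this form the identities for `⋆` are purely order-theoretic. -/
theorem mem_starAct {S : Finset ℕ+} {m v : ℕ+} :
    v ∈ starAct S m ↔ v = m ∨ (v ∈ S ∧ (v < m ∨ ∃ s ∈ S, m ≤ s ∧ s < v)) := by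
  unfold starAct
  split_ifs with h
  · have h1 := Finset.mem_filter.1 (Finset.min'_mem _ h)
    have h2 : ∀ w ∈ S, m ≤ w → (S.filter (m ≤ ·)).min' h ≤ w := fun w hw hmw =>
      Finset.min'_le _ _ (Finset.mem_filter.2 ⟨hw, hmw⟩)
    rw [Finset.mem_insert, Finset.mem_erase]
    refine or_congr_right ⟨fun ⟨h3, h4⟩ => ⟨h4, ?_⟩, fun ⟨h3, h4⟩ => ⟨?_, h3⟩⟩
    · rcases lt_or_ge v m with h5 | h5
      · exact Or.inl h5
      · exact Or.inr ⟨_, h1.1, h1.2, lt_of_le_of_ne (h2 v h4 h5) h3.symm⟩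
    · rintro rfl
      rcases h4 with h4 | ⟨s, hs, hms, hsv⟩
      · exact absurd h1.2 (not_le.2 h4)
      · exact absurd (h2 s hs hms) (not_le.2 hsv)
  · rw [Finset.not_nonempty_iff_eq_empty, Finset.filter_eq_empty_iff] at h
    rw [Finset.mem_insert]
    refine or_congr_right ⟨fun h3 => ⟨h3, Or.inl (not_le.1 (h h3))⟩, fun h3 => h3.1⟩

theorem starAct_of_mem {S : Finset ℕ+} {m : ℕ+} (h : m ∈ S) : starAct S m = S := by
  ext v
  rw [mem_starAct]
  constructor
  · rintro (rfl | h1)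
    · exact h
    · exact h1.1
  · intro hv
    rcases lt_trichotomy v m with h1 | h1 | h1
    · exact Or.inr ⟨hv, Or.inl h1⟩
    · exact Or.inl h1
    · exact Or.inr ⟨hv, Or.inr ⟨m, h, le_rfl, h1⟩⟩

theorem mem_starAct_self (S : Finset ℕ+) (m : ℕ+) : m ∈ starAct S m := mem_starAct.2 (Or.inl rfl)

theorem starAct_mono {S T : Finset ℕ+} (h : S ⊆ T) (m : ℕ+) : starAct S m ⊆ starAct T m := by
  intro v hv
  rw [mem_starAct] at *
  rcases hv with hv | ⟨h1, h2 | ⟨s, hs, h2⟩⟩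
  · exact Or.inl hv
  · exact Or.inr ⟨h h1, Or.inl h2⟩
  · exact Or.inr ⟨h h1, Or.inr ⟨s, h hs, h2⟩⟩

/-- The letters `x` and `z` displace the same element, so `z` is placed and then overwritten by `x`.
-/
theorem starAct_absorb {S : Finset ℕ+} {x z : ℕ+} (hxz : x < z) (h : ∀ s ∈ S, x ≤ s → z ≤ s) :
    starAct (starAct S z) x = starAct S x := by
  ext v
  simp only [mem_starAct]
  constructor
  · rintro (rfl | ⟨rfl | ⟨h1, h2⟩, h3⟩)
    · exact Or.inl rfl
    · rcases h3 with h3 | ⟨s, rfl | ⟨h4, h5⟩, h6, h7⟩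
      · exact absurd h3 (not_lt.2 hxz.le)
      · exact absurd h7 (lt_irrefl _)
      · exact absurd (h s h4 h6) (not_le.2 h7)
    · refine Or.inr ⟨h1, ?_⟩
      rcases h2 with h2 | ⟨s, hs, h4, h5⟩
      · left; by_contra h6
        exact absurd (h v h1 (not_lt.1 h6)) (not_le.2 h2)
      · exact Or.inr ⟨s, hs, hxz.le.trans h4, h5⟩
  · rintro (rfl | ⟨h1, h2⟩)
    · exact Or.inl rfl
    · rcases h2 with h2 | ⟨s, hs, h3, h4⟩
      · exact Or.inr ⟨Or.inr ⟨h1, Or.inl (h2.trans hxz)⟩, Or.inl h2⟩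
      · exact Or.inr ⟨Or.inr ⟨h1, Or.inr ⟨s, hs, h s hs h3, h4⟩⟩,
          Or.inr ⟨z, Or.inl rfl, hxz.le, (h s hs h3).trans_lt h4⟩⟩

/-- The element displaced by `a` is at most `s`, hence below `b`, so the two replacements do not
interact. -/
theorem starAct_comm {S : Finset ℕ+} {a b s : ℕ+} (hs : s ∈ S) (has : a ≤ s) (hsb : s < b) :
    starAct (starAct S a) b = starAct (starAct S b) a := by
  have hab := has.trans_lt hsb
  ext v
  simp only [mem_starAct]
  constructor
  · rintro (rfl | ⟨rfl | ⟨h1, h2⟩, h3⟩)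
    · exact Or.inr ⟨Or.inl rfl, Or.inr ⟨s, Or.inr ⟨hs, Or.inl hsb⟩, has, hsb⟩⟩
    · exact Or.inl rfl
    · refine Or.inr ⟨Or.inr ⟨h1, ?_⟩, ?_⟩
      · rcases h3 with h3 | ⟨t, rfl | ⟨ht, -⟩, h4, h5⟩
        · exact Or.inl h3
        · exact absurd h4 (not_le.2 hab)
        · exact Or.inr ⟨t, ht, h4, h5⟩
      · rcases lt_or_ge v b with h6 | h6
        · rcases h2 with h2 | ⟨t, ht, h4, h5⟩
          · exact Or.inl h2
          · exact Or.inr ⟨t, Or.inr ⟨ht, Or.inl (h5.trans h6)⟩, h4, h5⟩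
        · exact Or.inr ⟨s, Or.inr ⟨hs, Or.inl hsb⟩, has, hsb.trans_le h6⟩
  · rintro (rfl | ⟨rfl | ⟨h1, h2⟩, h3⟩)
    · exact Or.inr ⟨Or.inl rfl, Or.inl hab⟩
    · exact Or.inl rfl
    · refine Or.inr ⟨Or.inr ⟨h1, ?_⟩, ?_⟩
      · rcases h3 with h3 | ⟨t, rfl | ⟨ht, -⟩, h4, h5⟩
        · exact Or.inl h3
        · exact Or.inr ⟨s, hs, has, hsb.trans h5⟩
        · exact Or.inr ⟨t, ht, h4, h5⟩
      · rcases h2 with h2 | ⟨t, ht, h4, h5⟩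
        · exact Or.inl h2
        · exact Or.inr ⟨t, Or.inr ⟨ht, Or.inr ⟨s, hs, has, hsb.trans_le h4⟩⟩, h4, h5⟩

/-- The action `⋆` as a family of elements of a monoid. -/
def starEnd (m : ℕ+) : (Function.End (Finset ℕ+))ᵐᵒᵖ :=
  MulOpposite.op (fun S => starAct S m : Function.End (Finset ℕ+))

theorem unop_wordProd_starEnd (l : List ℕ+) (S : Finset ℕ+) :
    (MulOpposite.unop (wordProd starEnd l) : Function.End (Finset ℕ+)) S = l.foldl starAct S := by
  induction l generalizing S with
  | nil => rfl
  | cons a l ih => rw [wordProd_cons, List.foldl_cons, ← ih]; rfl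

theorem wordProd_starEnd_eq_iff {l l' : List ℕ+} :
    wordProd starEnd l = wordProd starEnd l' ↔ ∀ S, l.foldl starAct S = l'.foldl starAct S := by
  simp only [← unop_wordProd_starEnd]
  exact ⟨fun h S => by rw [h], fun h => MulOpposite.unop_injective (funext h)⟩

/-- If `S` has an element between the two letters that change places, they commute; otherwise the
larger one is absorbed. In the last relation the letter just inserted serves as the separating
element. -/
theorem kKnuth_starEnd : KKnuth starEnd := by
  have e3 : ∀ a b c, starEnd a * starEnd b * starEnd c = wordProd starEnd [a, b, c] := fun a b c => by
    simp [wordProd, mul_assoc]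
  have e2 : ∀ a b, starEnd a * starEnd b = wordProd starEnd [a, b] := fun a b => by simp [wordProd]
  have e1 : ∀ a, starEnd a = wordProd starEnd [a] := fun a => by simp [wordProd]
  refine ⟨fun p => ?_, fun p q => ?_, fun x y z hxy hyz => ?_, fun x y z hxy hyz => ?_⟩
  · rw [e2, e1]
    refine wordProd_starEnd_eq_iff.2 fun S => ?_
    exact starAct_of_mem (mem_starAct_self S p)
  · have key : ∀ p q : ℕ+, p < q → ∀ S, starAct (starAct (starAct S p) q) p
        = starAct (starAct (starAct S q) p) q := by
      intro p q hpq S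
      by_cases h : ∃ s ∈ S, p ≤ s ∧ s < q
      · obtain ⟨s, hs, h1, h2⟩ := h
        rw [starAct_comm hs h1 h2, starAct_of_mem (mem_starAct_self _ p), ← starAct_comm hs h1 h2,
          starAct_of_mem (mem_starAct_self _ q)]
      · push Not at h
        rw [starAct_absorb hpq h, starAct_of_mem]
        exact mem_starAct.2 (Or.inr ⟨mem_starAct_self _ _, Or.inl hpq⟩)
    rw [e3, e3]
    refine wordProd_starEnd_eq_iff.2 fun S => ?_
    simp only [List.foldl_cons, List.foldl_nil]
    rcases lt_trichotomy p q with h | rfl | h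
    · exact key p q h S
    · rfl
    · exact (key q p h S).symm
  · rw [e3, e3]
    refine wordProd_starEnd_eq_iff.2 fun S => ?_
    simp only [List.foldl_cons, List.foldl_nil]
    by_cases h : ∃ s ∈ S, x ≤ s ∧ s < z
    · obtain ⟨s, hs, h1, h2⟩ := h
      rw [starAct_comm hs h1 h2]
    · push Not at h
      rw [starAct_absorb (hxy.trans hyz) h, starAct_absorb hyz]
      intro s hs hys
      rcases mem_starAct.1 hs with rfl | ⟨h1, -⟩
      · exact absurd hys (not_le.2 hxy)
      · exact h s h1 (hxy.le.trans hys)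
  · rw [e3, e3]
    refine wordProd_starEnd_eq_iff.2 fun S => ?_
    simp only [List.foldl_cons, List.foldl_nil]
    exact starAct_comm (mem_starAct_self S y) hxy.le hyz

theorem starAct_eq {S : Finset ℕ+} {m : ℕ+} (h : ∃ s ∈ S, m ≤ s) :
    ∃ s ∈ S, m ≤ s ∧ (∀ t ∈ S, m ≤ t → s ≤ t) ∧ starAct S m = insert m (S.erase s) := by
  obtain ⟨s, hs, hms⟩ := h
  have hne : (S.filter (m ≤ ·)).Nonempty := ⟨s, Finset.mem_filter.2 ⟨hs, hms⟩⟩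
  have h1 := Finset.mem_filter.1 (Finset.min'_mem _ hne)
  refine ⟨_, h1.1, h1.2, fun t ht hmt => Finset.min'_le _ _ (Finset.mem_filter.2 ⟨ht, hmt⟩), ?_⟩
  rw [starAct, dif_pos hne]

theorem card_starAct {S : Finset ℕ+} {m : ℕ+} (h : ∃ s ∈ S, m ≤ s) :
    (starAct S m).card = S.card := by
  obtain ⟨s, hs, hms, hmin, e⟩ := starAct_eq h
  rw [e, Finset.card_insert_of_notMem, Finset.card_erase_of_mem hs]
  · have := Finset.card_pos.2 ⟨s, hs⟩; omega
  · rw [Finset.mem_erase]; rintro ⟨h1, h2⟩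
    exact h1 (le_antisymm hms (hmin m h2 le_rfl))

/-- Acting by `a` lowers one element of `S` to `a`, and the loss is compensated by dropping `a` from
the dominated set. This propagates domination along an increasing word, so that no letter is ever
adjoined. -/
theorem cntGe_le_cntGe_starAct {S B : Finset ℕ+} {a : ℕ+} (hB : ∀ b ∈ B, a < b)
    (h : ∀ t, cntGe (insert a B) t ≤ cntGe S t) : ∀ t, cntGe B t ≤ cntGe (starAct S a) t := by
  have haB : a ∉ B := fun h => lt_irrefl _ (hB a h)
  have hpos : 0 < cntGe S a :=
    lt_of_lt_of_le (cntGe_pos.2 ⟨a, Finset.mem_insert_self _ _, le_rfl⟩) (h a)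
  have hS := cntGe_pos.1 hpos
  obtain ⟨s, hs, has, hmin, e⟩ := starAct_eq hS
  intro t
  have hBt : cntGe B t ≤ cntGe (insert a B) t := Finset.card_le_card
    (Finset.filter_subset_filter _ (Finset.subset_insert _ _))
  have hle : cntGe S t - 1 ≤ cntGe (starAct S a) t := by
    rw [cntGe, cntGe]
    refine Finset.pred_card_le_card_erase.trans (Finset.card_le_card (s := (S.filter (t ≤ ·)).erase s) ?_)
    intro v hv
    rw [Finset.mem_erase, Finset.mem_filter] at hv
    rw [Finset.mem_filter, e]
    exact ⟨Finset.mem_insert_of_mem (Finset.mem_erase.2 ⟨hv.1, hv.2.1⟩), hv.2.2⟩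
  rcases le_or_gt t a with hta | hta
  · refine (hBt.trans (h t)).trans ?_
    have e1 : insert a ((S.filter (t ≤ ·)).erase s) ⊆ (starAct S a).filter (t ≤ ·) := by
      intro v hv
      rw [Finset.mem_insert, Finset.mem_erase, Finset.mem_filter] at hv
      rw [Finset.mem_filter, e, Finset.mem_insert, Finset.mem_erase]
      rcases hv with rfl | hv
      · exact ⟨Or.inl rfl, hta⟩
      · exact ⟨Or.inr ⟨hv.1, hv.2.1⟩, hv.2.2⟩
    refine le_trans ?_ (Finset.card_le_card e1)
    have hsf : s ∈ S.filter (t ≤ ·) := Finset.mem_filter.2 ⟨hs, hta.trans has⟩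
    rw [Finset.card_insert_of_notMem, Finset.card_erase_of_mem hsf]
    · unfold cntGe; omega
    · rw [Finset.mem_erase, Finset.mem_filter]; rintro ⟨h1, h2, -⟩
      exact h1 (le_antisymm has (hmin a h2 le_rfl))
  · rcases le_or_gt t s with hts | hts
    · have e1 : cntGe S t = cntGe S a := by
        unfold cntGe; congr 1; ext v; simp only [Finset.mem_filter]
        exact ⟨fun ⟨h1, h2⟩ => ⟨h1, hta.le.trans h2⟩, fun ⟨h1, h2⟩ => ⟨h1, hts.trans (hmin v h1 h2)⟩⟩
      have e2 := h a
      rw [cntGe_eq_card (X := insert a B) (t := a) (by simpa using fun b hb => (hB b hb).le),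
        Finset.card_insert_of_notMem haB] at e2
      have e3 := cntGe_le_card B t
      omega
    · refine (hBt.trans (h t)).trans (Finset.card_le_card ?_)
      intro v hv
      rw [Finset.mem_filter] at *
      refine ⟨mem_starAct.2 (Or.inr ⟨hv.1, Or.inr ⟨s, hs, has, hts.trans_le hv.2⟩⟩), hv.2⟩

theorem card_foldl_starAct {l : List ℕ+} (hl : l.Pairwise (· < ·)) {S : Finset ℕ+}
    (h : ∀ t, cntGe l.toFinset t ≤ cntGe S t) : (l.foldl starAct S).card = S.card := by
  induction l generalizing S with
  | nil => rfl
  | cons a l ih =>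
    rw [List.pairwise_cons] at hl
    rw [List.toFinset_cons] at h
    have hS := cntGe_pos.1
      (lt_of_lt_of_le (cntGe_pos.2 ⟨a, Finset.mem_insert_self _ _, le_rfl⟩) (h a))
    rw [List.foldl_cons, ih hl.2, card_starAct hS]
    exact cntGe_le_cntGe_starAct (by simpa using hl.1) h

theorem subset_foldl_starAct {l : List ℕ+} (hl : l.Pairwise (· < ·)) (S : Finset ℕ+) :
    (S.filter fun s => ∀ a ∈ l, s < a) ⊆ l.foldl starAct S ∧ l.toFinset ⊆ l.foldl starAct S := by
  induction l generalizing S with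
  | nil => simp
  | cons a l ih =>
    rw [List.pairwise_cons] at hl
    obtain ⟨h1, h2⟩ := ih hl.2 (starAct S a)
    rw [List.foldl_cons]
    refine ⟨fun s hs => h1 ?_, fun s hs => ?_⟩
    · simp only [Finset.mem_filter, List.mem_cons, forall_eq_or_imp] at hs ⊢
      exact ⟨mem_starAct.2 (Or.inr ⟨hs.1, Or.inl hs.2.1⟩), hs.2.2⟩
    · rw [List.toFinset_cons, Finset.mem_insert] at hs
      rcases hs with rfl | hs
      · exact h1 (Finset.mem_filter.2 ⟨mem_starAct_self _ _, hl.1⟩)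
      · exact h2 hs

theorem foldl_starAct_of_lt {l : List ℕ+} (hl : l.Pairwise (· < ·)) {S : Finset ℕ+}
    (h : ∀ s ∈ S, ∀ a ∈ l, s < a) : l.foldl starAct S = S ∪ l.toFinset := by
  induction l generalizing S with
  | nil => simp
  | cons a l ih =>
    rw [List.pairwise_cons] at hl
    have e : starAct S a = insert a S := by
      ext v; rw [mem_starAct, Finset.mem_insert]
      exact or_congr_right ⟨fun h => h.1, fun hv => ⟨hv, Or.inl (h v hv a List.mem_cons_self)⟩⟩
    rw [List.foldl_cons, e, ih hl.2]
    · rw [List.toFinset_cons]; ext; simp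
    · intro s hs b hb
      rcases Finset.mem_insert.1 hs with rfl | hs
      · exact hl.1 b hb
      · exact h s hs b (List.mem_cons_of_mem _ hb)

theorem toFinset_ascWord (A : Finset ℕ+) : (ascWord A).toFinset = A := by
  ext; simp [ascWord]

theorem foldl_starAct_ascWord_empty (A : Finset ℕ+) : (ascWord A).foldl starAct ∅ = A := by
  rw [foldl_starAct_of_lt (ascWord_pairwise A) (by simp), toFinset_ascWord, Finset.empty_union]

/-- By the domination hypothesis each letter of `l`, in its turn, finds an element that is at most
`y` to displace, and therefore commutes with `b`. -/
theorem foldl_starAct_comm {l : List ℕ+} (hl : l.Pairwise (· < ·)) {S : Finset ℕ+} {y b : ℕ+}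
    (hyb : y < b) (h : ∀ t, cntGe l.toFinset t ≤ cntGe (S.filter (· ≤ y)) t) :
    l.foldl starAct (starAct S b) = starAct (l.foldl starAct S) b := by
  induction l generalizing S with
  | nil => rfl
  | cons a l ih =>
    rw [List.pairwise_cons] at hl
    rw [List.toFinset_cons] at h
    obtain ⟨s, hs, has⟩ := cntGe_pos.1
      (lt_of_lt_of_le (cntGe_pos.2 ⟨a, Finset.mem_insert_self _ _, le_rfl⟩) (h a))
    rw [Finset.mem_filter] at hs
    rw [List.foldl_cons, List.foldl_cons, ← starAct_comm hs.1 has (hs.2.trans_lt hyb), ih hl.2]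
    have e : (starAct S a).filter (· ≤ y) = starAct (S.filter (· ≤ y)) a := by
      ext v
      simp only [Finset.mem_filter, mem_starAct]
      constructor
      · rintro ⟨rfl | ⟨h1, h2⟩, h3⟩
        · exact Or.inl rfl
        · refine Or.inr ⟨⟨h1, h3⟩, ?_⟩
          rcases h2 with h2 | ⟨t, ht, h4, h5⟩
          · exact Or.inl h2
          · exact Or.inr ⟨t, ⟨ht, h5.le.trans h3⟩, h4, h5⟩
      · rintro (rfl | ⟨⟨h1, h2⟩, h3⟩)
        · exact ⟨Or.inl rfl, has.trans hs.2⟩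
        · refine ⟨Or.inr ⟨h1, ?_⟩, h2⟩
          rcases h3 with h3 | ⟨t, ht, h4⟩
          · exact Or.inl h3
          · exact Or.inr ⟨t, ht.1, h4⟩
    rw [e]
    exact cntGe_le_cntGe_starAct (by simpa using hl.1) h

/-- After the word of `A` has acted, `y` is present and does nothing. The letter `b` commutes with
the letters of `B` below `y` and is then absorbed by the occurrence of `b` in `B`. -/
theorem blockRel_starEnd : BlockRel starEnd := by
  intro A B y b hAB hyA hbB hyb hb hyB hgap hcnt
  have e0 : ∀ x, starEnd x = wordProd starEnd [x] := fun x => by simp [wordProd]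
  rw [e0 y, e0 b]
  simp only [← wordProd_append]
  rw [wordProd_starEnd_eq_iff]
  intro S
  simp only [List.foldl_append, List.foldl_cons, List.foldl_nil]
  set M := (ascWord A).foldl starAct S with hM
  have hAM : A ⊆ M := by
    have := (subset_foldl_starAct (ascWord_pairwise A) S).2
    rwa [toFinset_ascWord] at this
  rw [starAct_of_mem (hAM hyA)]
  set L := B.filter (· < y) with hL
  set R := B.filter (b < ·) with hR
  have hB : B = L ∪ insert b R := by
    ext v
    simp only [hL, hR, Finset.mem_union, Finset.mem_insert, Finset.mem_filter]
    constructor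
    · intro hv
      rcases lt_trichotomy v y with h | h | h
      · exact Or.inl ⟨hv, h⟩
      · exact absurd (h ▸ hv) hyB
      · rcases (hb v hv h).eq_or_lt with h | h
        · exact Or.inr (Or.inl h.symm)
        · exact Or.inr (Or.inr ⟨hv, h⟩)
    · rintro (h | rfl | h)
      exacts [h.1, hbB, h.1]
  have hw : ascWord B = ascWord L ++ b :: ascWord R := by
    conv_lhs => rw [hB]
    rw [ascWord_union, ascWord_insert_min]
    · intro u hu; exact (Finset.mem_filter.1 hu).2
    · intro s hs t ht
      have hs' := (Finset.mem_filter.1 hs).2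
      rcases Finset.mem_insert.1 ht with rfl | ht
      · exact hs'.trans hyb
      · exact (hs'.trans hyb).trans (Finset.mem_filter.1 ht).2
  -- Subtract the equal counts above `y` from the domination of `B` by `A`; what is left dominates
  -- the letters below `y`.
  have hall : ∀ t, cntGe (ascWord L).toFinset t ≤ cntGe (M.filter (· ≤ y)) t := by
    intro t
    rw [toFinset_ascWord]
    refine le_trans ?_ (Finset.card_le_card (Finset.filter_subset_filter _
      (Finset.filter_subset_filter _ hAM)))
    change _ ≤ cntGe (A.filter (· ≤ y)) t
    rcases le_or_gt t y with hty | hty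
    · have split : ∀ X : Finset ℕ+, cntGe X t = cntGe (X.filter (· ≤ y)) t + cntGt X y := by
        intro X
        unfold cntGe cntGt
        rw [← Finset.card_union_of_disjoint]
        · congr 1; ext v; simp only [Finset.mem_filter, Finset.mem_union]
          constructor
          · rintro ⟨h1, h2⟩
            rcases le_or_gt v y with h | h
            · exact Or.inl ⟨⟨h1, h⟩, h2⟩
            · exact Or.inr ⟨h1, h⟩
          · rintro (h | h)
            · exact ⟨h.1.1, h.2⟩
            · exact ⟨h.1, hty.trans h.2.le⟩
        · rw [Finset.disjoint_left]; intro v h1 h2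
          simp only [Finset.mem_filter] at h1 h2
          exact absurd h1.1.2 (not_le.2 h2.2)
      have e1 := split A
      have e2 := split B
      have e3 := hAB t
      have e4 := cntGt_le_cntGe A t
      have e5 : B.filter (· ≤ y) = L := by
        ext v; simp only [hL, Finset.mem_filter]
        exact ⟨fun ⟨h1, h2⟩ => ⟨h1, lt_of_le_of_ne h2 (by rintro rfl; exact hyB h1)⟩,
          fun ⟨h1, h2⟩ => ⟨h1, h2.le⟩⟩
      rw [e5] at e2
      omega
    · have : cntGe L t = 0 := by
        by_contra h0
        obtain ⟨x, hx, htx⟩ := cntGe_pos.1 (Nat.pos_of_ne_zero h0)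
        exact absurd (hty.trans_le htx) (not_lt.2 (Finset.mem_filter.1 hx).2.le)
      omega
  rw [hw, List.foldl_append, List.foldl_append, List.foldl_cons, List.foldl_cons,
    foldl_starAct_comm (ascWord_pairwise L) hyb hall, starAct_of_mem (mem_starAct_self _ b)]

/-! ### Comparing two actions that differ by one adjoined element -/

/-- `M⁺` is `M` or has one more element, which is smaller than all elements of `M` outside `N`. -/
def MinAdded (N M M' : Finset ℕ+) : Prop :=
  N ⊆ M ∧ (M' = M ∨ ∃ e, e ∉ M ∧ M' = insert e M ∧ ∀ x ∈ M, x ∉ N → e < x)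

/-- The extra element `e` survives unless `m` displaces it. Then the element that `m` displaces in
`M` becomes the extra one, or the difference disappears if there is no such element. Minimality
outside `N` persists because the displaced elements are the smallest possible. -/
theorem MinAdded.starAct {N M M' : Finset ℕ+} (h : MinAdded N M M') (m : ℕ+) :
    MinAdded (starAct N m) (starAct M m) (starAct M' m) := by
  obtain ⟨hNM, h⟩ := h
  refine ⟨starAct_mono hNM m, ?_⟩
  rcases h with rfl | ⟨e, heM, rfl, he⟩
  · exact Or.inl rfl
  rcases lt_or_ge e m with hem | hme
  · refine Or.inr ⟨e, ?_, ?_, ?_⟩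
    · rw [mem_starAct]; rintro (h | h)
      · exact hem.ne h
      · exact heM h.1
    · ext v; simp only [mem_starAct, Finset.mem_insert]
      constructor
      · rintro (h | ⟨h | h1, h2⟩)
        · exact Or.inr (Or.inl h)
        · exact Or.inl h
        · refine Or.inr (Or.inr ⟨h1, ?_⟩)
          rcases h2 with h2 | ⟨s, rfl | hs, h3, h4⟩
          · exact Or.inl h2
          · exact absurd h3 (not_le.2 hem)
          · exact Or.inr ⟨s, hs, h3, h4⟩
      · rintro (rfl | h | ⟨h1, h2⟩)
        · exact Or.inr ⟨Or.inl rfl, Or.inl hem⟩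
        · exact Or.inl h
        · refine Or.inr ⟨Or.inr h1, ?_⟩
          rcases h2 with h2 | ⟨s, hs, h3⟩
          · exact Or.inl h2
          · exact Or.inr ⟨s, Or.inr hs, h3⟩
    · intro x hx hxN
      rw [mem_starAct] at hx hxN
      push Not at hxN
      rcases hx with hx | hx
      · exact absurd hx hxN.1
      · by_cases hN : x ∈ N
        · exact hem.trans_le (hxN.2 hN).1
        · exact he x hx.1 hN
  · by_cases hn : ∃ n ∈ N, m ≤ n ∧ n < e
    · obtain ⟨n, hnN, hmn, hne⟩ := hn
      refine Or.inr ⟨e, ?_, ?_, ?_⟩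
      · rw [mem_starAct]; rintro (h | h)
        · exact absurd (hmn.trans_lt hne) (by rw [h]; exact lt_irrefl _)
        · exact heM h.1
      · ext v; simp only [mem_starAct, Finset.mem_insert]
        constructor
        · rintro (h | ⟨h | h1, h2⟩)
          · exact Or.inr (Or.inl h)
          · exact Or.inl h
          · refine Or.inr (Or.inr ⟨h1, ?_⟩)
            rcases h2 with h2 | ⟨s, rfl | hs, h3, h4⟩
            · exact Or.inl h2
            · exact Or.inr ⟨n, hNM hnN, hmn, hne.trans h4⟩
            · exact Or.inr ⟨s, hs, h3, h4⟩
        · rintro (rfl | h | ⟨h1, h2⟩)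
          · exact Or.inr ⟨Or.inl rfl, Or.inr ⟨n, Or.inr (hNM hnN), hmn, hne⟩⟩
          · exact Or.inl h
          · refine Or.inr ⟨Or.inr h1, ?_⟩
            rcases h2 with h2 | ⟨s, hs, h3⟩
            · exact Or.inl h2
            · exact Or.inr ⟨s, Or.inr hs, h3⟩
      · intro x hx hxN
        rw [mem_starAct] at hx hxN
        push Not at hxN
        rcases hx with hx | ⟨hx1, hx2⟩
        · exact absurd hx hxN.1
        · by_cases hN : x ∈ N
          · obtain ⟨h1, h2⟩ := hxN.2 hN
            rcases hx2 with hx2 | ⟨s, hs, hms, hsx⟩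
            · exact absurd hx2 (not_lt.2 h1)
            · by_cases hsN : s ∈ N
              · exact absurd hsx (not_lt.2 (h2 s hsN hms))
              · exact (he s hs hsN).trans hsx
          · exact he x hx1 hN
    -- Here `e` is the least element of the larger set from `m` on, so `m` replaces it.
    · push Not at hn
      have hM : ∀ s ∈ M, m ≤ s → e < s := by
        intro s hs hms
        by_cases hsN : s ∈ N
        · exact lt_of_le_of_ne (hn s hsN hms) (by rintro rfl; exact heM hs)
        · exact he s hs hsN
      have e1 : _root_.starAct (insert e M) m = insert m M := by
        ext v; simp only [mem_starAct, Finset.mem_insert]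
        refine or_congr_right ⟨?_, fun hv => ⟨Or.inr hv, ?_⟩⟩
        · rintro ⟨rfl | h, h2⟩
          · rcases h2 with h2 | ⟨s, rfl | hs, h3, h4⟩
            · exact absurd h2 (not_lt.2 hme)
            · exact absurd h4 (lt_irrefl _)
            · exact absurd (hM s hs h3) (not_lt.2 h4.le)
          · exact h
        · rcases lt_or_ge v m with h | h
          · exact Or.inl h
          · exact Or.inr ⟨e, Or.inl rfl, hme, hM v hv h⟩
      rw [e1]
      by_cases hne : ∃ s ∈ M, m ≤ s
      · obtain ⟨s, hs, hms, hmin, e2⟩ := starAct_eq hne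
        have hsm : m ≠ s := by rintro rfl; exact absurd (hM m hs le_rfl) (not_lt.2 hme)
        refine Or.inr ⟨s, ?_, ?_, ?_⟩
        · rw [e2, Finset.mem_insert, Finset.mem_erase]; rintro (h | h)
          · exact hsm h.symm
          · exact h.1 rfl
        · rw [e2, Finset.insert_comm, Finset.insert_erase hs]
        · intro x hx hxN
          rw [mem_starAct] at hx hxN
          push Not at hxN
          rcases hx with hx | ⟨hx1, hx2⟩
          · exact absurd hx hxN.1
          · rcases hx2 with hx2 | ⟨t, ht, hmt, htx⟩
            · have hN : x ∉ N := fun hN => absurd hx2 (not_lt.2 (hxN.2 hN).1)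
              exact absurd (he x hx1 hN) (not_lt.2 (hx2.le.trans hme))
            · exact (hmin t ht hmt).trans_lt htx
      · push Not at hne
        left
        ext v; rw [Finset.mem_insert, mem_starAct]
        exact or_congr_right ⟨fun hv => ⟨hv, Or.inl (hne v hv)⟩, fun hv => hv.1⟩

theorem MinAdded.foldl {N M M' : Finset ℕ+} (h : MinAdded N M M') (l : List ℕ+) :
    MinAdded (l.foldl _root_.starAct N) (l.foldl _root_.starAct M) (l.foldl _root_.starAct M') := by
  induction l generalizing N M M' with
  | nil => exact h
  | cons a l ih => exact ih (h.starAct a)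

/-! ### Right keys and their behaviour under insertion of an increasing word -/

/-- The right key, for a list of column sets. -/
def keys : List (Finset ℕ+) → List (Finset ℕ+)
  | [] => []
  | A :: R => (setWord (A :: R)).foldl starAct ∅ :: keys R

theorem keys_headD (F : List (Finset ℕ+)) :
    (keys F).headD ∅ = (setWord F).foldl starAct ∅ := by
  cases F <;> rfl

theorem columnWord_eq_setWord {T : List (List ℕ+)} (hT : ∀ C ∈ T, C.Pairwise (· > ·)) :
    columnWord T = setWord (colSets T) := by
  rw [columnWord, setWord, colSets, List.map_map]
  congr 1
  refine List.map_congr_left fun C hC => ?_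
  have h : C.reverse.Pairwise (· < ·) := List.pairwise_reverse.2 (hT C hC)
  rw [Function.comp, ← ascWord_toFinset h]
  congr 1; ext; simp

theorem range_map_drop {α β : Type*} (g : List α → β) (T : List α) :
    (List.range T.length).map (fun j => g (T.drop j))
      = match T with
        | [] => []
        | C :: R => g (C :: R) :: (List.range R.length).map fun j => g (R.drop j) := by
  cases T with
  | nil => rfl
  | cons C R => simp [List.range_succ_eq_map, Function.comp_def]

theorem rightKey_eq_keys {T : List (List ℕ+)} (hT : ∀ C ∈ T, C.Pairwise (· > ·)) :
    rightKey T = keys (colSets T) := by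
  induction T with
  | nil => rfl
  | cons C R ih =>
    have ih' := ih fun D hD => hT D (List.mem_cons_of_mem _ hD)
    rw [rightKey] at ih' ⊢
    rw [range_map_drop (fun T => (columnWord T).foldl starAct ∅)]
    simp only
    rw [ih', columnWord_eq_setWord hT]
    rfl

/-- After the word of a column has acted, the set contains that column, which dominates the next; so
each letter displaces an element. -/
theorem card_foldl_starAct_setWord {F : List (Finset ℕ+)} (hF : F.IsChain Dom) {S : Finset ℕ+}
    (h : ∀ t, cntGe (F.headD ∅) t ≤ cntGe S t) : ((setWord F).foldl starAct S).card = S.card := by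
  induction F generalizing S with
  | nil => rfl
  | cons A R ih =>
    rw [isChain_dom_cons] at hF
    have h1 : ∀ t, cntGe (ascWord A).toFinset t ≤ cntGe S t := by rw [toFinset_ascWord]; exact h
    rw [setWord_cons, List.foldl_append, ih hF.2, card_foldl_starAct (ascWord_pairwise A) h1]
    intro t
    have h2 := (subset_foldl_starAct (ascWord_pairwise A) S).2
    rw [toFinset_ascWord] at h2
    exact (hF.1 t).trans ((cntGt_le_cntGe _ _).trans
      (Finset.card_le_card (Finset.filter_subset_filter _ h2)))

theorem card_keys_head {A : Finset ℕ+} {R : List (Finset ℕ+)} (hF : (A :: R).IsChain Dom) :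
    ((setWord (A :: R)).foldl starAct ∅).card = A.card := by
  rw [isChain_dom_cons] at hF
  rw [setWord_cons, List.foldl_append, foldl_starAct_ascWord_empty,
    card_foldl_starAct_setWord hF.2]
  exact fun t => (hF.1 t).trans (cntGt_le_cntGe _ _)

theorem map_card_keys {F : List (Finset ℕ+)} (hF : F.IsChain Dom) :
    (keys F).map Finset.card = F.map Finset.card := by
  induction F with
  | nil => rfl
  | cons A R ih =>
    rw [keys, List.map_cons, List.map_cons, card_keys_head hF, ih (isChain_dom_cons.1 hF).2]

theorem foldl_starAct_mono {S T : Finset ℕ+} (h : S ⊆ T) (l : List ℕ+) :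
    l.foldl starAct S ⊆ l.foldl starAct T := by
  induction l generalizing S T with
  | nil => exact h
  | cons a l ih => exact ih (starAct_mono h a)

/-- Columns further right start acting on the empty set instead of a larger one, and `⋆` is
monotone. -/
theorem isChain_keys (F : List (Finset ℕ+)) : (keys F).IsChain (· ⊇ ·) := by
  induction F with
  | nil => exact List.isChain_nil
  | cons A R ih =>
    rw [keys]
    cases R with
    | nil => simp [keys]
    | cons B R =>
      rw [keys, List.isChain_cons_cons]
      refine ⟨?_, ih⟩
      rw [setWord_cons A, List.foldl_append]
      exact foldl_starAct_mono (Finset.empty_subset _) _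

/-- Remove from `K` its smallest element outside `N`. -/
def eraseMin (K N : Finset ℕ+) : Finset ℕ+ := K.filter fun v => v ∈ N ∨ ∃ u ∈ K, u ∉ N ∧ u < v

theorem mem_eraseMin {K N : Finset ℕ+} {v : ℕ+} :
    v ∈ eraseMin K N ↔ v ∈ K ∧ (v ∈ N ∨ ∃ u ∈ K, u ∉ N ∧ u < v) := Finset.mem_filter

theorem eraseMin_insert {M N : Finset ℕ+} {e : ℕ+} (he : e ∉ M) (hN : N ⊆ M)
    (h : ∀ x ∈ M, x ∉ N → e < x) : eraseMin (insert e M) N = M := by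
  have heN : e ∉ N := fun h => he (hN h)
  ext v
  rw [mem_eraseMin, Finset.mem_insert]
  constructor
  · rintro ⟨rfl | hv, h2⟩
    · rcases h2 with h2 | ⟨u, hu, huN, hue⟩
      · exact absurd h2 heN
      · rcases Finset.mem_insert.1 hu with rfl | hu
        · exact absurd hue (lt_irrefl _)
        · exact absurd hue (h u hu huN).not_gt
    · exact hv
  · intro hv
    refine ⟨Or.inr hv, ?_⟩
    by_cases hvN : v ∈ N
    · exact Or.inl hvN
    · exact Or.inr ⟨e, Finset.mem_insert_self _ _, heN, h v hv hvN⟩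

/-- Remove from each marked column of a key the smallest element that is not in the next column. -/
def brKeys : List (Finset ℕ+) → List Bool → List (Finset ℕ+)
  | K :: Ks, d :: ds =>
    (if d then eraseMin K ((brKeys Ks ds).headD ∅) else K) :: brKeys Ks ds
  | _, _ => []

/-- In a decreasing word each letter replaces its predecessor, so only the smallest survives. -/
theorem foldl_starAct_reverse {l : List ℕ+} (hl : l.Pairwise (· < ·)) :
    l.reverse.foldl starAct ∅ = l.head?.elim ∅ singleton := by
  induction l with
  | nil => rfl
  | cons x l ih =>
    rw [List.pairwise_cons] at hl
    rw [List.reverse_cons, List.foldl_append, ih hl.2, List.foldl_cons, List.foldl_nil]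
    cases l with
    | nil => ext; simp [mem_starAct]
    | cons y l =>
      ext v
      simp only [List.head?_cons, Option.elim_some, mem_starAct, Finset.mem_singleton, exists_eq_left]
      have := hl.1 y List.mem_cons_self
      constructor
      · rintro (h | ⟨rfl, h | h⟩)
        · exact h
        · exact absurd h (not_lt.2 this.le)
        · exact absurd h.2 (lt_irrefl _)
      · exact Or.inl

/-- The smallest letter of `U` either is overwritten by the first letter of `A` or lies below all of
`A` and stays as an additional element. -/
theorem minAdded_column (A U : Finset ℕ+) :
    MinAdded ∅ A ((ascWord A).foldl starAct ((ascWord U).reverse.foldl starAct ∅)) := by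
  refine ⟨Finset.empty_subset _, ?_⟩
  rw [foldl_starAct_reverse (ascWord_pairwise U)]
  cases ascWord U with
  | nil => exact Or.inl (foldl_starAct_ascWord_empty A)
  | cons u l =>
    rw [List.head?_cons, Option.elim_some]
    by_cases h : ∀ a ∈ A, u < a
    · refine Or.inr ⟨u, fun hu => lt_irrefl _ (h u hu), ?_, fun x hx _ => h x hx⟩
      rw [foldl_starAct_of_lt (ascWord_pairwise A), toFinset_ascWord]; · rfl
      intro s hs a ha
      rw [Finset.mem_singleton] at hs; subst hs
      exact h a (mem_ascWord.1 ha)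
    · push Not at h
      obtain ⟨b, hb, hbu⟩ := h
      left
      have e := foldl_starAct_ascWord_empty A
      have hw := ascWord_pairwise A
      have hb' := mem_ascWord.2 hb
      revert hb' e hw
      cases ascWord A with
      | nil => simp
      | cons a w =>
        intro e hw hb'
        rw [List.pairwise_cons] at hw
        have hau : a ≤ u := by
          rcases List.mem_cons.1 hb' with rfl | h
          · exact hbu
          · exact (hw.1 b h).le.trans hbu
        rw [List.foldl_cons] at e ⊢
        have : starAct {u} a = starAct ∅ a := by
          ext v
          simp only [mem_starAct, Finset.mem_singleton, exists_eq_left]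
          constructor
          · rintro (h | ⟨rfl, h | h⟩)
            · exact Or.inl h
            · exact absurd hau (not_le.2 h)
            · exact absurd h.2 (lt_irrefl _)
          · rintro (h | h)
            · exact Or.inl h
            · exact absurd h.1 (Finset.notMem_empty _)
        rw [this, e]

theorem isChain_foldl_setInsert {F : List (Finset ℕ+)} (hF : F.IsChain Dom) (u : List ℕ+) :
    (u.foldl setInsert F).IsChain Dom := by
  induction u generalizing F with
  | nil => exact hF
  | cons x u ih => exact ih (isChain_setInsert hF x)

/-- By invariance of the action, the key column after insertion is the result of the reversed
increasing word followed by the old column word. It contains the old key column and has at most one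
further element, which is smallest outside the key of the remaining old columns. Since key columns
are as long as tableau columns, there is such an element exactly if the mark is `add`. -/
theorem keys_runSets {F : List (Finset ℕ+)} {U : Finset ℕ+} (hF : F.IsChain Dom)
    (hU : (runSets F U).2 = ∅) :
    keys F = brKeys (keys (runSets F U).1) ((runMarks F U).map (· == Mark.add)) := by
  induction F generalizing U with
  | nil => rfl
  | cons A R ih =>
    have hrun : (ascWord U).foldl setInsert (A :: R) = (runSets (A :: R) U).1 := by
      rw [foldl_setInsert_eq_runSets hF, hU]; simp [ascWord]
    have hchain := isChain_foldl_setInsert hF (ascWord U)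
    have hword := kKnuth_starEnd.foldl_setInsert blockRel_starEnd hF (ascWord U)
    rw [hrun, ← wordProd_append, wordProd_starEnd_eq_iff] at hword
    rw [hrun] at hchain
    have hword := hword ∅
    rw [List.foldl_append, setWord_cons, List.foldl_append] at hword
    simp only [runSets, runMarks, List.map_cons] at hU hword hchain ⊢
    have hR := ih (isChain_dom_cons.1 hF).2 hU
    rw [keys, keys, brKeys, ← hR, keys_headD]
    congr 1
    have hmin := (minAdded_column A U).foldl (setWord R)
    rw [hword] at hmin
    have hA : (setWord (A :: R)).foldl starAct ∅ = (setWord R).foldl starAct A := by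
      rw [setWord_cons, List.foldl_append, foldl_starAct_ascWord_empty]
    have c1 := card_keys_head hF
    have c2 := card_keys_head hchain
    rw [card_colOut] at c2
    rw [hA] at c1 ⊢
    obtain ⟨hsub, h | ⟨e, he, h1, h2⟩⟩ := hmin
    · rw [h, c1] at c2
      have : markOf A U ≠ Mark.add := fun hm => by rw [if_pos hm] at c2; omega
      rw [h, if_neg (by simpa using this)]
    · rw [h1, Finset.card_insert_of_notMem he, c1] at c2
      have : markOf A U = Mark.add := by
        by_contra hm; rw [if_neg hm] at c2; omega
      rw [h1, if_pos (by simpa using this), eraseMin_insert he hsub h2]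

/-! ## The `0`-Hecke action -/

theorem swap_lt_swap_iff {i p q : ℕ+} (h : ¬ (p = i ∧ q = i + 1)) (h' : ¬ (p = i + 1 ∧ q = i)) :
    Equiv.swap i (i + 1) p < Equiv.swap i (i + 1) q ↔ p < q := by
  simp only [Equiv.swap_apply_def]
  split_ifs <;> simp only [← PNat.coe_inj, ← PNat.coe_lt_coe, PNat.add_coe, PNat.one_coe] at * <;>
    omega

theorem pnat_ne_add_one (i : ℕ+) : i ≠ i + 1 := (PNat.lt_add_right i 1).ne

theorem heckeAct_eq_of_lt {i : ℕ+} {w : Equiv.Perm ℕ+} (h : w.symm i < w.symm (i + 1)) :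
    heckeAct i w = Equiv.swap i (i + 1) * w := if_pos h

theorem heckeAct_eq_of_gt {i : ℕ+} {w : Equiv.Perm ℕ+} (h : w.symm (i + 1) < w.symm i) :
    heckeAct i w = w := if_neg (not_lt.2 h.le)

theorem symm_lt_or_gt (i : ℕ+) (w : Equiv.Perm ℕ+) :
    w.symm i < w.symm (i + 1) ∨ w.symm (i + 1) < w.symm i :=
  lt_or_gt_of_ne (w.symm.injective.ne (pnat_ne_add_one i))

theorem swap_mul_symm_apply (i j : ℕ+) (w : Equiv.Perm ℕ+) :
    (Equiv.swap i (i + 1) * w).symm j = w.symm (Equiv.swap i (i + 1) j) := by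
  rw [Equiv.symm_apply_eq, Equiv.Perm.mul_apply, Equiv.apply_symm_apply, Equiv.swap_apply_self]

theorem heckeAct_idem (i : ℕ+) (w : Equiv.Perm ℕ+) :
    heckeAct i (heckeAct i w) = heckeAct i w := by
  rcases symm_lt_or_gt i w with h | h
  · rw [heckeAct_eq_of_lt h, heckeAct_eq_of_gt]
    simpa [swap_mul_symm_apply] using h
  · rw [heckeAct_eq_of_gt h, heckeAct_eq_of_gt h]

theorem swap_mul_swap_comm {i j : ℕ+} (h : i + 1 < j) :
    Equiv.swap i (i + 1) * Equiv.swap j (j + 1) = Equiv.swap j (j + 1) * Equiv.swap i (i + 1) := by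
  refine Equiv.ext fun x => ?_
  simp only [Equiv.Perm.mul_apply, Equiv.swap_apply_def]
  split_ifs <;> simp only [← PNat.coe_inj, ← PNat.coe_lt_coe, PNat.add_coe, PNat.one_coe] at * <;>
    omega

theorem heckeAct_comm {i j : ℕ+} (h : i + 1 < j) (w : Equiv.Perm ℕ+) :
    heckeAct i (heckeAct j w) = heckeAct j (heckeAct i w) := by
  have e1 : Equiv.swap i (i + 1) j = j := Equiv.swap_apply_of_ne_of_ne
    ((PNat.lt_add_right i 1).trans h).ne' h.ne'
  have e2 : Equiv.swap i (i + 1) (j + 1) = j + 1 := Equiv.swap_apply_of_ne_of_ne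
    (((PNat.lt_add_right i 1).trans h).trans (PNat.lt_add_right j 1)).ne'
    (h.trans (PNat.lt_add_right j 1)).ne'
  have e3 : Equiv.swap j (j + 1) i = i := Equiv.swap_apply_of_ne_of_ne
    ((PNat.lt_add_right i 1).trans h).ne
    (((PNat.lt_add_right i 1).trans h).trans (PNat.lt_add_right j 1)).ne
  have e4 : Equiv.swap j (j + 1) (i + 1) = i + 1 := Equiv.swap_apply_of_ne_of_ne h.ne
    (h.trans (PNat.lt_add_right j 1)).ne
  have f : ∀ x k, heckeAct k x = if x.symm k < x.symm (k + 1) then Equiv.swap k (k + 1) * x else x :=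
    fun _ _ => rfl
  by_cases h1 : w.symm i < w.symm (i + 1) <;> by_cases h2 : w.symm j < w.symm (j + 1)
  all_goals
    rw [f w i, f w j]
    simp only [h1, h2, if_true, if_false, f, swap_mul_symm_apply, e1, e2, e3, e4]
  rw [← mul_assoc, swap_mul_swap_comm h, mul_assoc]

theorem swap_braid (i : ℕ+) :
    Equiv.swap i (i + 1) * Equiv.swap (i + 1) (i + 1 + 1) * Equiv.swap i (i + 1)
      = Equiv.swap (i + 1) (i + 1 + 1) * Equiv.swap i (i + 1)
        * Equiv.swap (i + 1) (i + 1 + 1) := by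
  have h1 := pnat_ne_add_one i
  have h2 := pnat_ne_add_one (i + 1)
  have h3 : i ≠ i + 1 + 1 := ((PNat.lt_add_right i 1).trans (PNat.lt_add_right (i + 1) 1)).ne
  rw [Equiv.swap_mul_swap_mul_swap h1 h3, Equiv.swap_comm i (i + 1),
    Equiv.swap_comm (i + 1) (i + 1 + 1), Equiv.swap_mul_swap_mul_swap h2.symm h3.symm,
    Equiv.swap_comm]

theorem heckeAct_braid (i : ℕ+) (w : Equiv.Perm ℕ+) :
    heckeAct i (heckeAct (i + 1) (heckeAct i w))
      = heckeAct (i + 1) (heckeAct i (heckeAct (i + 1) w)) := by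
  have e1 : Equiv.swap i (i + 1) (i + 1 + 1) = i + 1 + 1 := Equiv.swap_apply_of_ne_of_ne
    (((PNat.lt_add_right i 1).trans (PNat.lt_add_right (i + 1) 1))).ne'
    (PNat.lt_add_right (i + 1) 1).ne'
  have e2 : Equiv.swap (i + 1) (i + 1 + 1) i = i := Equiv.swap_apply_of_ne_of_ne
    (PNat.lt_add_right i 1).ne
    ((PNat.lt_add_right i 1).trans (PNat.lt_add_right (i + 1) 1)).ne
  have hb := congrArg (· * w) (swap_braid i)
  simp only [mul_assoc] at hb
  have hne : w.symm i ≠ w.symm (i + 1 + 1) := w.symm.injective.ne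
    ((PNat.lt_add_right i 1).trans (PNat.lt_add_right (i + 1) 1)).ne
  have f : ∀ x k, heckeAct k x = if x.symm k < x.symm (k + 1) then Equiv.swap k (k + 1) * x else x :=
    fun _ _ => rfl
  rcases symm_lt_or_gt i w with h1 | h1 <;> rcases symm_lt_or_gt (i + 1) w with h2 | h2
  · have h3 := h1.trans h2
    simp only [f w i, f w (i + 1), h1, h2, if_true]
    simp only [f _ (i + 1), f (Equiv.swap (i + 1) (i + 1 + 1) * w) i, swap_mul_symm_apply, e1, e2,
      Equiv.swap_apply_left, Equiv.swap_apply_right, h3, if_true]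
    simp only [f, swap_mul_symm_apply, e1, e2, Equiv.swap_apply_left, h1, h2,
      if_true, hb]
  · rw [heckeAct_eq_of_gt h2, heckeAct_eq_of_lt h1]
    rcases lt_or_gt_of_ne hne with h | h <;>
    simp [f, swap_mul_symm_apply, e1, e2, h, h1.le, h2.le, not_lt.2 h.le]
  · rw [heckeAct_eq_of_gt h1, heckeAct_eq_of_lt h2]
    rcases lt_or_gt_of_ne hne with h | h <;>
    simp [f, swap_mul_symm_apply, e1, e2, h, h1.le, h2.le, not_lt.2 h.le]
  · rw [heckeAct_eq_of_gt h1, heckeAct_eq_of_gt h2, heckeAct_eq_of_gt h1, heckeAct_eq_of_gt h2]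

/-- The `0`-Hecke action as a family of elements of a monoid. -/
def heckeEnd (i : ℕ+) : Function.End (Equiv.Perm ℕ+) := heckeAct i

theorem heckeEnd_comm {i j : ℕ+} (h : i + 1 < j) :
    heckeEnd i * heckeEnd j = heckeEnd j * heckeEnd i := funext fun w => heckeAct_comm h w

/-- Letters `x < z` with a letter strictly between them commute, which gives both Knuth relations.
For the braid relation, either the letters are adjacent, or they commute and idempotence suffices.
-/
theorem kKnuth_heckeEnd : KKnuth heckeEnd := by
  have idem : ∀ p, heckeEnd p * heckeEnd p = heckeEnd p := fun p => funext fun w => heckeAct_idem p w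
  have lt2 : ∀ {x y z : ℕ+}, x < y → y < z → x + 1 < z := fun {x y z} h1 h2 =>
    (PNat.add_one_le_iff.2 h1).trans_lt h2
  have key : ∀ p q : ℕ+, p < q → heckeEnd p * heckeEnd q * heckeEnd p
      = heckeEnd q * heckeEnd p * heckeEnd q := by
    intro p q h
    rcases (PNat.add_one_le_iff.2 h).eq_or_lt with rfl | h2
    · exact funext fun w => heckeAct_braid p w
    · rw [heckeEnd_comm h2, mul_assoc, idem, mul_assoc, heckeEnd_comm h2, ← mul_assoc, idem]
  refine ⟨idem, fun p q => ?_, fun x y z h1 h2 => ?_, fun x y z h1 h2 => ?_⟩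
  · rcases lt_trichotomy p q with h | rfl | h
    · exact key p q h
    · rfl
    · exact (key q p h).symm
  · rw [heckeEnd_comm (lt2 h1 h2)]
  · rw [mul_assoc, heckeEnd_comm (lt2 h1 h2), mul_assoc]

theorem ascWord_split {A : Finset ℕ+} {c : ℕ+} (hc : c ∈ A) :
    ascWord A = ascWord (A.filter (· < c)) ++ c :: ascWord (A.filter (c < ·)) := by
  have hA : A = A.filter (· < c) ∪ insert c (A.filter (c < ·)) := by
    ext v
    simp only [Finset.mem_union, Finset.mem_insert, Finset.mem_filter]
    constructor
    · intro hv
      rcases lt_trichotomy v c with h | h | h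
      · exact Or.inl ⟨hv, h⟩
      · exact Or.inr (Or.inl h)
      · exact Or.inr (Or.inr ⟨hv, h⟩)
    · rintro (h | rfl | h)
      exacts [h.1, hc, h.1]
  conv_lhs => rw [hA]
  rw [ascWord_union, ascWord_insert_min]
  · intro u hu; exact (Finset.mem_filter.1 hu).2
  · intro s hs t ht
    have hs' := (Finset.mem_filter.1 hs).2
    rcases Finset.mem_insert.1 ht with rfl | ht
    · exact hs'
    · exact hs'.trans (Finset.mem_filter.1 ht).2

theorem wordProd_comm {M : Type*} [Monoid M] {f : ℕ+ → M} {l : List ℕ+} {m : M}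
    (h : ∀ a ∈ l, f a * m = m * f a) : wordProd f l * m = m * wordProd f l := by
  induction l with
  | nil => simp [wordProd_nil]
  | cons a l ih =>
    rw [wordProd_cons, mul_assoc, ih fun b hb => h b (List.mem_cons_of_mem _ hb), ← mul_assoc,
      h a List.mem_cons_self, mul_assoc]

/-- The letters of `A` above `y` are even above `b ≥ y + 1`, so `y` commutes past them and is
absorbed by `y ∈ A`. The letters of `B` below `b` are below `y`, so `b` is likewise absorbed by `b ∈
B`. -/
theorem blockRel_heckeEnd : BlockRel heckeEnd := by
  intro A B y b _ hyA hbB hyb hb hyB hgap _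
  have h1 : wordProd heckeEnd (ascWord A) * heckeEnd y = wordProd heckeEnd (ascWord A) := by
    rw [ascWord_split hyA, wordProd_append, wordProd_cons, mul_assoc, mul_assoc,
      wordProd_comm (m := heckeEnd y), ← mul_assoc (heckeEnd y), kKnuth_heckeEnd.idem]
    intro a ha
    have ha' := Finset.mem_filter.1 (mem_ascWord.1 ha)
    exact (heckeEnd_comm ((PNat.add_one_le_iff.2 hyb).trans_lt (hgap a ha'.1 ha'.2))).symm
  have h2 : heckeEnd b * wordProd heckeEnd (ascWord B) = wordProd heckeEnd (ascWord B) := by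
    rw [ascWord_split hbB, wordProd_append, wordProd_cons, ← mul_assoc,
      ← wordProd_comm (m := heckeEnd b), mul_assoc, ← mul_assoc (heckeEnd b), kKnuth_heckeEnd.idem]
    intro a ha
    have ha' := Finset.mem_filter.1 (mem_ascWord.1 ha)
    rw [heckeEnd_comm]
    rcases lt_or_ge y a with h | h
    · exact absurd ha'.2 (not_lt.2 (hb a ha'.1 h))
    · exact (PNat.add_one_le_iff.2 (lt_of_le_of_ne h (by rintro rfl; exact hyB ha'.1))).trans_lt hyb
  rw [h1, mul_assoc, h2]

theorem wordPerm_eq (a : List ℕ+) : wordPerm a = wordProd heckeEnd a 1 := by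
  induction a with
  | nil => rfl
  | cons x a ih =>
    rw [wordProd_cons]
    change heckeAct x (wordPerm a) = _
    rw [ih]; rfl

/-! ### Length -/

theorem inversions_swap_mul {i : ℕ+} {w : Equiv.Perm ℕ+} (h : w.symm i < w.symm (i + 1)) :
    {p : ℕ+ × ℕ+ | p.1 < p.2 ∧ (Equiv.swap i (i + 1) * w) p.2 < (Equiv.swap i (i + 1) * w) p.1}
      = insert (w.symm i, w.symm (i + 1)) {p : ℕ+ × ℕ+ | p.1 < p.2 ∧ w p.2 < w p.1} := by
  ext ⟨p, q⟩
  simp only [Set.mem_ofPred_eq, Set.mem_insert_iff, Prod.mk.injEq, Equiv.Perm.mul_apply]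
  by_cases hs : w p = i ∧ w q = i + 1
  · obtain ⟨h1, h2⟩ := hs
    have e1 : p = w.symm i := by rw [← h1]; simp
    have e2 : q = w.symm (i + 1) := by rw [← h2]; simp
    simp only [h1, h2, Equiv.swap_apply_left, Equiv.swap_apply_right, ← e1, ← e2]
    rw [← e1, ← e2] at h
    simp [h, PNat.lt_add_right i 1]
  · by_cases hs' : w p = i + 1 ∧ w q = i
    · obtain ⟨h1, h2⟩ := hs'
      have e1 : p = w.symm (i + 1) := by rw [← h1]; simp
      have e2 : q = w.symm i := by rw [← h2]; simp
      subst e1 e2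
      simp [not_lt.2 h.le, pnat_ne_add_one i]
    · rw [swap_lt_swap_iff (fun h => hs' h.symm) (fun h => hs h.symm)]
      have : ¬ (p = w.symm i ∧ q = w.symm (i + 1)) := by
        rintro ⟨rfl, rfl⟩; simp at hs
      tauto

theorem coxeterLength_heckeAct_le (i : ℕ+) (w : Equiv.Perm ℕ+) :
    coxeterLength (heckeAct i w) ≤ coxeterLength w + 1 := by
  rcases symm_lt_or_gt i w with h | h
  · rw [heckeAct_eq_of_lt h, coxeterLength, inversions_swap_mul h]
    exact Set.ncard_insert_le _ _
  · rw [heckeAct_eq_of_gt h]; omega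

theorem coxeterLength_one : coxeterLength 1 = 0 := by
  have : {p : ℕ+ × ℕ+ | p.1 < p.2 ∧ (1 : Equiv.Perm ℕ+) p.2 < (1 : Equiv.Perm ℕ+) p.1} = ∅ := by
    ext ⟨p, q⟩
    simpa using fun h : p < q => h.le
  rw [coxeterLength, this, Set.ncard_empty]

theorem coxeterLength_wordPerm_le (a : List ℕ+) : coxeterLength (wordPerm a) ≤ a.length := by
  induction a with
  | nil => exact coxeterLength_one.le
  | cons x a ih =>
    exact (coxeterLength_heckeAct_le x (wordPerm a)).trans (by simpa using ih)

theorem coxeterLength_inv (w : Equiv.Perm ℕ+) : coxeterLength w⁻¹ = coxeterLength w := by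
  refine (Set.ncard_congr (fun p _ => (w p.2, w p.1)) ?_ ?_ ?_).symm
  · rintro ⟨p, q⟩ ⟨h1, h2⟩; exact ⟨h2, by simpa using h1⟩
  · rintro ⟨p, q⟩ ⟨p', q'⟩ _ _ h
    simp only [Prod.mk.injEq, EmbeddingLike.apply_eq_iff_eq] at h
    exact Prod.ext h.2 h.1
  · rintro ⟨p, q⟩ ⟨h1, h2⟩
    exact ⟨(w⁻¹ q, w⁻¹ p), ⟨h2, by simpa using h1⟩, by simp⟩

/-- The right action of the `0`-Hecke monoid. -/
def heckeActRight (w : Equiv.Perm ℕ+) (i : ℕ+) : Equiv.Perm ℕ+ :=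
  if w i < w (i + 1) then w * Equiv.swap i (i + 1) else w

theorem heckeAct_inv (i : ℕ+) (w : Equiv.Perm ℕ+) : heckeAct i w⁻¹ = (heckeActRight w i)⁻¹ := by
  unfold heckeAct heckeActRight
  have e : ∀ x, (w⁻¹).symm x = w x := fun x => rfl
  rw [e, e]
  split_ifs
  · rw [mul_inv_rev, Equiv.swap_inv]
  · rfl

/-- The comparison on one side is unaffected by the other action unless `w` maps `{i, i + 1}` onto
`{j, j + 1}`. In that case both actions are the same multiplication, or both are trivial. -/
theorem heckeAct_heckeActRight (j i : ℕ+) (w : Equiv.Perm ℕ+) :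
    heckeAct j (heckeActRight w i) = heckeActRight (heckeAct j w) i := by
  have hsymm : ∀ x, (w * Equiv.swap i (i + 1)).symm x = Equiv.swap i (i + 1) (w.symm x) := by
    intro x; rw [Equiv.symm_apply_eq]; simp
  have hi : i < i + 1 := PNat.lt_add_right i 1
  have hj : j < j + 1 := PNat.lt_add_right j 1
  have f : ∀ x, heckeAct j x = if x.symm j < x.symm (j + 1) then Equiv.swap j (j + 1) * x else x :=
    fun _ => rfl
  have g : ∀ x, heckeActRight x i = if x i < x (i + 1) then x * Equiv.swap i (i + 1) else x :=
    fun _ => rfl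
  by_cases h1 : w i = j ∧ w (i + 1) = j + 1
  · obtain ⟨h1, h2⟩ := h1
    have e1 : w.symm j = i := by rw [← h1]; simp
    have e2 : w.symm (j + 1) = i + 1 := by rw [← h2]; simp
    have c : w * Equiv.swap i (i + 1) = Equiv.swap j (j + 1) * w := by
      rw [Equiv.mul_swap_eq_swap_mul, h1, h2]
    rw [g w, f w, h1, h2, e1, e2, if_pos hi, if_pos hj, f, g, if_neg, if_neg, c]
    · simp [h1, h2, hj.le]
    · simpa [hsymm, e1, e2] using hi.le
  · by_cases h2 : w i = j + 1 ∧ w (i + 1) = j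
    · obtain ⟨h2, h3⟩ := h2
      have e1 : w.symm j = i + 1 := by rw [← h3]; simp
      have e2 : w.symm (j + 1) = i := by rw [← h2]; simp
      rw [g w, f w, h2, h3, e1, e2, if_neg (not_lt.2 hi.le), if_neg (not_lt.2 hj.le), f, g, e1, e2,
        h2, h3, if_neg (not_lt.2 hi.le), if_neg (not_lt.2 hj.le)]
    · have a1 := swap_lt_swap_iff (i := j) (p := w i) (q := w (i + 1)) h1 h2
      have a2 := swap_lt_swap_iff (i := i) (p := w.symm j) (q := w.symm (j + 1))
        (fun h => h1 ⟨by rw [← h.1]; simp, by rw [← h.2]; simp⟩)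
        (fun h => h2 ⟨by rw [← h.2]; simp, by rw [← h.1]; simp⟩)
      have a3 : (w * Equiv.swap i (i + 1)).symm j < (w * Equiv.swap i (i + 1)).symm (j + 1)
          ↔ w.symm j < w.symm (j + 1) := by rw [hsymm, hsymm, a2]
      have a4 : (Equiv.swap j (j + 1) * w) i < (Equiv.swap j (j + 1) * w) (i + 1)
          ↔ w i < w (i + 1) := a1
      rw [g w, f w]
      by_cases b1 : w i < w (i + 1) <;> by_cases b2 : w.symm j < w.symm (j + 1)
      · rw [if_pos b1, if_pos b2, f, g, if_pos (a3.2 b2), if_pos (a4.2 b1), mul_assoc]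
      · rw [if_pos b1, if_neg b2, f, g, if_neg (mt a3.1 b2), if_pos b1]
      · rw [if_neg b1, if_pos b2, f, g, if_pos b2, if_neg (mt a4.1 b1)]
      · rw [if_neg b1, if_neg b2, f, g, if_neg b2, if_neg b1]

theorem wordPerm_append_singleton (a : List ℕ+) (i : ℕ+) :
    wordPerm (a ++ [i]) = heckeActRight (wordPerm a) i := by
  induction a with
  | nil =>
    have h : (1 : Equiv.Perm ℕ+).symm i < (1 : Equiv.Perm ℕ+).symm (i + 1) := PNat.lt_add_right i 1
    change heckeAct i 1 = heckeActRight 1 i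
    rw [heckeAct_eq_of_lt h, heckeActRight, mul_one, one_mul]
    exact (if_pos (PNat.lt_add_right i 1)).symm
  | cons j a ih =>
    change heckeAct j (wordPerm (a ++ [i])) = heckeActRight (heckeAct j (wordPerm a)) i
    rw [ih, heckeAct_heckeActRight]

theorem wordPerm_reverse (a : List ℕ+) : wordPerm a.reverse = (wordPerm a)⁻¹ := by
  induction a with
  | nil => simp [wordPerm]
  | cons x a ih =>
    rw [List.reverse_cons, wordPerm_append_singleton, ih]
    change _ = (heckeAct x (wordPerm a))⁻¹
    rw [← inv_inj, ← heckeAct_inv, inv_inv, inv_inv]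

/-- The column word represents the reversed word, that is, the inverse permutation, which has the
same length. -/
theorem coxeterLength_wordPerm_heckeTableau (a : List ℕ+) :
    coxeterLength (wordPerm (columnWord (heckeTableau a))) = coxeterLength (wordPerm a) := by
  have h0 : IsDecreasingTableau [] := ⟨by simp, List.isChain_nil⟩
  have hT := foldl_heckeInsert_isDecreasing h0 a
  have h := kKnuth_heckeEnd.foldl_setInsert blockRel_heckeEnd (F := []) List.isChain_nil a
  rw [heckeTableau, columnWord_eq_setWord fun C hC => (hT.1 C hC).2, wordPerm_eq,
    colSets_foldl_heckeInsert h0]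
  change coxeterLength (wordProd heckeEnd (setWord (a.foldl setInsert [])) 1) = _
  rw [← h]
  change coxeterLength (wordProd heckeEnd a.reverse 1) = _
  rw [← wordPerm_eq, wordPerm_reverse, coxeterLength_inv]

/-! ## Divided differences -/

open MvPolynomial in
theorem swapVars_X (i j : ℕ+) : swapVars i (X j) = X (Equiv.swap i (i + 1) j) := rename_X _ _

theorem swapVars_add (i : ℕ+) (f g : BetaPoly) : swapVars i (f + g) = swapVars i f + swapVars i g :=
  map_add _ _ _

theorem swapVars_sub (i : ℕ+) (f g : BetaPoly) : swapVars i (f - g) = swapVars i f - swapVars i g :=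
  map_sub _ _ _

theorem swapVars_mul (i : ℕ+) (f g : BetaPoly) : swapVars i (f * g) = swapVars i f * swapVars i g :=
  map_mul _ _ _

theorem swapVars_pow (i : ℕ+) (f : BetaPoly) (n : ℕ) : swapVars i (f ^ n) = swapVars i f ^ n :=
  map_pow _ _ _

theorem swapVars_one (i : ℕ+) : swapVars i 1 = 1 := map_one _

theorem swapVars_C (i : ℕ+) (c : Polynomial ℤ) :
    swapVars i (MvPolynomial.C c) = MvPolynomial.C c := MvPolynomial.rename_C _ _

theorem swapVars_X_left (i : ℕ+) :
    swapVars i (MvPolynomial.X i) = MvPolynomial.X (i + 1) := by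
  rw [swapVars_X, Equiv.swap_apply_left]

theorem swapVars_X_right (i : ℕ+) :
    swapVars i (MvPolynomial.X (i + 1)) = MvPolynomial.X i := by
  rw [swapVars_X, Equiv.swap_apply_right]

theorem swapVars_X_of_ne {i j : ℕ+} (h1 : j ≠ i) (h2 : j ≠ i + 1) :
    swapVars i (MvPolynomial.X j) = MvPolynomial.X j := by
  rw [swapVars_X, Equiv.swap_apply_of_ne_of_ne h1 h2]

theorem swapVars_swapVars (i : ℕ+) (f : BetaPoly) : swapVars i (swapVars i f) = f := by
  rw [swapVars, swapVars, MvPolynomial.rename_rename]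
  have : (Equiv.swap i (i + 1) : ℕ+ → ℕ+) ∘ Equiv.swap i (i + 1) = id := by
    funext x; simp
  rw [this, MvPolynomial.rename_id_apply]

theorem swapVars_braid (i : ℕ+) (f : BetaPoly) :
    swapVars i (swapVars (i + 1) (swapVars i f))
      = swapVars (i + 1) (swapVars i (swapVars (i + 1) f)) := by
  simp only [swapVars, MvPolynomial.rename_rename]
  congr 2
  funext x
  have := DFunLike.congr_fun (swap_braid i) x
  simpa only [Equiv.Perm.mul_apply, Function.comp_apply] using this

theorem swapVars_comm {i j : ℕ+} (h : i + 1 < j) (f : BetaPoly) :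
    swapVars i (swapVars j f) = swapVars j (swapVars i f) := by
  simp only [swapVars, MvPolynomial.rename_rename]
  congr 2
  funext x
  have := DFunLike.congr_fun (swap_mul_swap_comm h) x
  simpa only [Equiv.Perm.mul_apply, Function.comp_apply] using this

theorem X_sub_X_ne_zero {i j : ℕ+} (h : i ≠ j) :
    (MvPolynomial.X i - MvPolynomial.X j : BetaPoly) ≠ 0 :=
  sub_ne_zero.2 fun e => h (MvPolynomial.X_injective e)

theorem divDiff_eq_of {i : ℕ+} {f q : BetaPoly}
    (h : (MvPolynomial.X i - MvPolynomial.X (i + 1)) * q = f - swapVars i f) : divDiff i f = q :=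
  mul_left_cancel₀ (X_sub_X_ne_zero (pnat_ne_add_one i)) ((X_sub_X_mul_divDiff i f).trans h.symm)

theorem divDiff_of_symm {i : ℕ+} {f : BetaPoly} (h : swapVars i f = f) : divDiff i f = 0 :=
  divDiff_eq_of (by rw [h]; ring)

theorem divDiff_sub (i : ℕ+) (f g : BetaPoly) : divDiff i (f - g) = divDiff i f - divDiff i g :=
  divDiff_eq_of (by rw [mul_sub, X_sub_X_mul_divDiff, X_sub_X_mul_divDiff, swapVars_sub]; ring)

theorem divDiff_mul_of_symm {i : ℕ+} {u : BetaPoly} (hu : swapVars i u = u) (f : BetaPoly) :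
    divDiff i (u * f) = u * divDiff i f :=
  divDiff_eq_of (by
    rw [swapVars_mul, hu]
    linear_combination u * X_sub_X_mul_divDiff i f)

theorem swapVars_divDiff (i : ℕ+) (f : BetaPoly) : swapVars i (divDiff i f) = divDiff i f := by
  have h := congrArg (swapVars i) (X_sub_X_mul_divDiff i f)
  rw [swapVars_mul, swapVars_sub, swapVars_sub, swapVars_X_left, swapVars_X_right,
    swapVars_swapVars] at h
  refine mul_left_cancel₀ (X_sub_X_ne_zero (pnat_ne_add_one i)) ?_
  linear_combination -h - X_sub_X_mul_divDiff i f

theorem divDiff_X_mul (i : ℕ+) (f : BetaPoly) :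
    divDiff i (MvPolynomial.X i * f) = f + MvPolynomial.X (i + 1) * divDiff i f :=
  divDiff_eq_of (by
    rw [swapVars_mul, swapVars_X_left]
    linear_combination MvPolynomial.X (i + 1) * X_sub_X_mul_divDiff i f)

/-- After multiplication by the Vandermonde product of the three variables both sides become the
alternating sum over the six images of `f`. The images of intermediate quotients are obtained by
applying the swaps to their defining equations. -/
theorem divDiff_braid (i : ℕ+) (f : BetaPoly) :
    divDiff i (divDiff (i + 1) (divDiff i f))
      = divDiff (i + 1) (divDiff i (divDiff (i + 1) f)) := by
  have n1 := pnat_ne_add_one i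
  have n2 := pnat_ne_add_one (i + 1)
  have n3 : i ≠ i + 1 + 1 := ((PNat.lt_add_right i 1).trans (PNat.lt_add_right (i + 1) 1)).ne
  have hx := swapVars_X_of_ne n1 n3
  have hz := swapVars_X_of_ne n3.symm n2.symm
  refine mul_left_cancel₀ (mul_ne_zero (mul_ne_zero (X_sub_X_ne_zero n1) (X_sub_X_ne_zero n3))
    (X_sub_X_ne_zero n2)) ?_
  have xl := swapVars_X_left i
  have xr := swapVars_X_right i
  have yl := swapVars_X_left (i + 1)
  have yr := swapVars_X_right (i + 1)
  have a1 := X_sub_X_mul_divDiff i f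
  have sa := swapVars_divDiff i f
  have b1 := X_sub_X_mul_divDiff (i + 1) (divDiff i f)
  have c1 := X_sub_X_mul_divDiff i (divDiff (i + 1) (divDiff i f))
  have ta := congrArg (swapVars (i + 1)) a1
  have sta := congrArg (swapVars i) ta
  have sb := congrArg (swapVars i) b1
  have a1' := X_sub_X_mul_divDiff (i + 1) f
  have sa' := swapVars_divDiff (i + 1) f
  have b1' := X_sub_X_mul_divDiff i (divDiff (i + 1) f)
  have c1' := X_sub_X_mul_divDiff (i + 1) (divDiff i (divDiff (i + 1) f))
  have ta' := congrArg (swapVars i) a1'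
  have sta' := congrArg (swapVars (i + 1)) ta'
  have sb' := congrArg (swapVars (i + 1)) b1'
  have hb := swapVars_braid i f
  simp only [swapVars_mul, swapVars_sub, xl, xr, yl, yr, hx, hz, sa, sa'] at ta sta sb ta' sta' sb'
  generalize (MvPolynomial.X i : BetaPoly) = x at *
  generalize (MvPolynomial.X (i + 1) : BetaPoly) = y at *
  generalize (MvPolynomial.X (i + 1 + 1) : BetaPoly) = z at *
  linear_combination (x - z) * (y - z) * c1 + (x - z) * b1 - (y - z) * sb + a1 - ta + sta
    - ((x - y) * (x - z) * c1' + (x - z) * b1' - (x - y) * sb' + a1' - ta' + sta') - hb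

/-! ### The operators `π_i` -/

open MvPolynomial in
theorem X_sub_X_mul_betaPi (i : ℕ+) (f : BetaPoly) :
    (X i - X (i + 1)) * betaPi i f
      = X i * (1 + C betaCoeff * X (i + 1)) * f
        - X (i + 1) * (1 + C betaCoeff * X i) * swapVars i f := by
  rw [betaPi, betaDivDiff, X_sub_X_mul_divDiff, swapVars_mul, swapVars_mul, swapVars_add,
    swapVars_mul, swapVars_one, swapVars_C, swapVars_X_left, swapVars_X_right]
  ring

open MvPolynomial in
theorem betaPi_eq_of {i : ℕ+} {f q : BetaPoly}
    (h : (X i - X (i + 1)) * q = X i * (1 + C betaCoeff * X (i + 1)) * f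
        - X (i + 1) * (1 + C betaCoeff * X i) * swapVars i f) : betaPi i f = q :=
  mul_left_cancel₀ (X_sub_X_ne_zero (pnat_ne_add_one i)) ((X_sub_X_mul_betaPi i f).trans h.symm)

theorem swapVars_betaPi (i : ℕ+) (f : BetaPoly) : swapVars i (betaPi i f) = betaPi i f :=
  swapVars_divDiff _ _

theorem betaPi_of_symm {i : ℕ+} {f : BetaPoly} (h : swapVars i f = f) : betaPi i f = f :=
  betaPi_eq_of (by rw [h]; ring)

theorem betaPi_betaPi (i : ℕ+) (f : BetaPoly) : betaPi i (betaPi i f) = betaPi i f :=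
  betaPi_of_symm (swapVars_betaPi i f)

theorem betaPi_zero (i : ℕ+) : betaPi i 0 = 0 := betaPi_of_symm (map_zero _)

theorem betaPi_add (i : ℕ+) (f g : BetaPoly) : betaPi i (f + g) = betaPi i f + betaPi i g := by
  refine betaPi_eq_of ?_
  rw [swapVars_add]
  linear_combination X_sub_X_mul_betaPi i f + X_sub_X_mul_betaPi i g

theorem betaPi_mul_of_symm {i : ℕ+} {u : BetaPoly} (hu : swapVars i u = u) (f : BetaPoly) :
    betaPi i (u * f) = u * betaPi i f :=
  betaPi_eq_of (by
    rw [swapVars_mul, hu]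
    linear_combination u * X_sub_X_mul_betaPi i f)

theorem betaPi_comm {i j : ℕ+} (h : i + 1 < j) (f : BetaPoly) :
    betaPi i (betaPi j f) = betaPi j (betaPi i f) := by
  have hij : i < j := (PNat.lt_add_right i 1).trans h
  have n1 := pnat_ne_add_one i
  have n2 := pnat_ne_add_one j
  have hj1 := PNat.lt_add_right j 1
  have e1 := swapVars_X_of_ne hij.ne' h.ne'
  have e2 := swapVars_X_of_ne (hij.trans hj1).ne' (h.trans hj1).ne'
  have e3 := swapVars_X_of_ne hij.ne (hij.trans hj1).ne
  have e4 := swapVars_X_of_ne h.ne (h.trans hj1).ne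
  refine mul_left_cancel₀ (mul_ne_zero (X_sub_X_ne_zero n1) (X_sub_X_ne_zero n2)) ?_
  have a := X_sub_X_mul_betaPi j f
  have b := X_sub_X_mul_betaPi i (betaPi j f)
  have sa := congrArg (swapVars i) a
  have a' := X_sub_X_mul_betaPi i f
  have b' := X_sub_X_mul_betaPi j (betaPi i f)
  have sa' := congrArg (swapVars j) a'
  have hc := swapVars_comm h f
  simp only [swapVars_mul, swapVars_sub, swapVars_add, swapVars_one, swapVars_C, e1, e2, e3, e4]
    at sa sa'
  generalize (MvPolynomial.X i : BetaPoly) = x at *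
  generalize (MvPolynomial.X (i + 1) : BetaPoly) = y at *
  generalize (MvPolynomial.X j : BetaPoly) = z at *
  generalize (MvPolynomial.X (j + 1) : BetaPoly) = u at *
  generalize (MvPolynomial.C betaCoeff : BetaPoly) = c at *
  linear_combination (z - u) * b + x * (1 + c * y) * a - y * (1 + c * x) * sa
    - ((x - y) * b' + z * (1 + c * u) * a' - u * (1 + c * z) * sa')
    + y * (1 + c * x) * u * (1 + c * z) * hc

/-- Clearing denominators turns both sides into the same weighted sum over the images of `f`; only
the longest image, reached along two reduced words, needs the braid relation of the swaps. -/
theorem betaPi_braid (i : ℕ+) (f : BetaPoly) :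
    betaPi i (betaPi (i + 1) (betaPi i f))
      = betaPi (i + 1) (betaPi i (betaPi (i + 1) f)) := by
  have n1 := pnat_ne_add_one i
  have n2 := pnat_ne_add_one (i + 1)
  have n3 : i ≠ i + 1 + 1 := ((PNat.lt_add_right i 1).trans (PNat.lt_add_right (i + 1) 1)).ne
  have hx := swapVars_X_of_ne n1 n3
  have hz := swapVars_X_of_ne n3.symm n2.symm
  refine mul_left_cancel₀ (mul_ne_zero (mul_ne_zero (X_sub_X_ne_zero n1) (X_sub_X_ne_zero n3))
    (X_sub_X_ne_zero n2)) ?_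
  have xl := swapVars_X_left i
  have xr := swapVars_X_right i
  have yl := swapVars_X_left (i + 1)
  have yr := swapVars_X_right (i + 1)
  have a1 := X_sub_X_mul_betaPi i f
  have sa := swapVars_betaPi i f
  have b1 := X_sub_X_mul_betaPi (i + 1) (betaPi i f)
  have c1 := X_sub_X_mul_betaPi i (betaPi (i + 1) (betaPi i f))
  have ta := congrArg (swapVars (i + 1)) a1
  have sta := congrArg (swapVars i) ta
  have sb := congrArg (swapVars i) b1
  have a1' := X_sub_X_mul_betaPi (i + 1) f
  have sa' := swapVars_betaPi (i + 1) f
  have b1' := X_sub_X_mul_betaPi i (betaPi (i + 1) f)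
  have c1' := X_sub_X_mul_betaPi (i + 1) (betaPi i (betaPi (i + 1) f))
  have ta' := congrArg (swapVars i) a1'
  have sta' := congrArg (swapVars (i + 1)) ta'
  have sb' := congrArg (swapVars (i + 1)) b1'
  have hb := swapVars_braid i f
  simp only [swapVars_mul, swapVars_sub, swapVars_add, swapVars_one, swapVars_C, xl, xr, yl, yr, hx,
    hz, sa, sa'] at ta sta sb ta' sta' sb'
  generalize (MvPolynomial.X i : BetaPoly) = x at *
  generalize (MvPolynomial.X (i + 1) : BetaPoly) = y at *
  generalize (MvPolynomial.X (i + 1 + 1) : BetaPoly) = z at *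
  generalize (MvPolynomial.C betaCoeff : BetaPoly) = c at *
  linear_combination (x - z) * (y - z) * c1 + x * (1 + c * y) * (x - z) * b1
    - y * (1 + c * x) * (y - z) * sb + x * y * (1 + c * z) ^ 2 * a1
    - x * z * (1 + c * y) ^ 2 * ta + y * z * (1 + c * x) ^ 2 * sta
    - ((x - y) * (x - z) * c1' + y * (1 + c * z) * (x - z) * b1'
      - z * (1 + c * y) * (x - y) * sb' + x ^ 2 * (1 + c * y) * (1 + c * z) * a1'
      - y ^ 2 * (1 + c * x) * (1 + c * z) * ta' + z ^ 2 * (1 + c * x) * (1 + c * y) * sta')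
    - y * z ^ 2 * (1 + c * x) ^ 2 * (1 + c * y) * hb

/-! ### Shifting the variables -/

/-- `x_i ↦ x_{i+1}`. -/
noncomputable def shVars (f : BetaPoly) : BetaPoly := MvPolynomial.rename (fun v : ℕ+ => v + 1) f

theorem shVars_X (j : ℕ+) : shVars (MvPolynomial.X j) = MvPolynomial.X (j + 1) :=
  MvPolynomial.rename_X _ _

theorem shVars_C (c : Polynomial ℤ) : shVars (MvPolynomial.C c) = MvPolynomial.C c :=
  MvPolynomial.rename_C _ _

theorem shVars_one : shVars 1 = 1 := map_one _

theorem shVars_zero : shVars 0 = 0 := map_zero _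

theorem shVars_add (f g : BetaPoly) : shVars (f + g) = shVars f + shVars g := map_add _ _ _

theorem shVars_sub (f g : BetaPoly) : shVars (f - g) = shVars f - shVars g := map_sub _ _ _

theorem shVars_mul (f g : BetaPoly) : shVars (f * g) = shVars f * shVars g := map_mul _ _ _

theorem shVars_pow (f : BetaPoly) (n : ℕ) : shVars (f ^ n) = shVars f ^ n := map_pow _ _ _

theorem swap_add_one (i v : ℕ+) :
    Equiv.swap (i + 1) (i + 1 + 1) (v + 1) = Equiv.swap i (i + 1) v + 1 := by
  simp only [Equiv.swap_apply_def, add_left_inj]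
  split_ifs <;> rfl

theorem shVars_swapVars (i : ℕ+) (f : BetaPoly) :
    shVars (swapVars i f) = swapVars (i + 1) (shVars f) := by
  simp only [shVars, swapVars, MvPolynomial.rename_rename]
  congr 2
  funext v
  exact (swap_add_one i v).symm

theorem shVars_betaPi (i : ℕ+) (f : BetaPoly) :
    shVars (betaPi i f) = betaPi (i + 1) (shVars f) := by
  refine (betaPi_eq_of ?_).symm
  have := congrArg shVars (X_sub_X_mul_betaPi i f)
  simp only [shVars_mul, shVars_sub, shVars_add, shVars_X, shVars_C, shVars_one,
    shVars_swapVars] at this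
  exact this

theorem swapVars_shVars_shVars (f : BetaPoly) :
    swapVars 1 (shVars (shVars f)) = shVars (shVars f) := by
  simp only [shVars, swapVars, MvPolynomial.rename_rename]
  congr 2
  funext v
  refine Equiv.swap_apply_of_ne_of_ne ?_ ?_
  · rw [← PNat.coe_inj.ne]; simp
  · rw [← PNat.coe_inj.ne]; simp

theorem pnat_one_or_add_one (v : ℕ+) : v = 1 ∨ ∃ u, v = u + 1 := by
  induction v using PNat.recOn with
  | one => exact Or.inl rfl
  | succ u _ => exact Or.inr ⟨u, rfl⟩

/-! ### Operator identities on which the branching recursion depends -/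

section Core

variable {i : ℕ+}

local notation "x₁" => (MvPolynomial.X i : BetaPoly)
local notation "x₂" => (MvPolynomial.X (i + 1) : BetaPoly)
local notation "x₃" => (MvPolynomial.X (i + 1 + 1) : BetaPoly)
local notation "bb" => (MvPolynomial.C betaCoeff : BetaPoly)

theorem betaPi_eq_add_divDiff (b : ℕ) (g : BetaPoly) :
    betaPi i (x₁ ^ b * g)
      = x₂ ^ b * swapVars i g + x₁ * (1 + bb * x₂) * divDiff i (x₁ ^ b * g) := by
  refine betaPi_eq_of ?_
  have := X_sub_X_mul_divDiff i (x₁ ^ b * g)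
  rw [swapVars_mul, swapVars_pow, swapVars_X_left] at *
  linear_combination x₁ * (1 + bb * x₂) * this

theorem betaPi_pow_succ (n : ℕ) (g : BetaPoly) :
    betaPi i (x₁ ^ (n + 1) * g)
      = x₁ * betaPi i (x₁ ^ n * g) + (1 + bb * x₁) * x₂ ^ (n + 1) * swapVars i g := by
  refine betaPi_eq_of ?_
  have := X_sub_X_mul_betaPi i (x₁ ^ n * g)
  rw [swapVars_mul, swapVars_pow, swapVars_X_left] at *
  linear_combination x₁ * this

/-- The summands are matched with the branchings of `c` columns of length one in
`sum_brWeight_replicate`. -/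
theorem betaPi_pow_add (b c : ℕ) (g : BetaPoly) :
    betaPi i (x₁ ^ (b + c) * g) = x₁ ^ c * betaPi i (x₁ ^ b * g)
      + ∑ q ∈ Finset.range c, x₁ ^ (c - 1 - q) * (1 + bb * x₁)
          * (x₂ ^ (b + (q + 1)) * swapVars i g) := by
  induction c with
  | zero => simp
  | succ c ih =>
    rw [← add_assoc, betaPi_pow_succ, ih, Finset.sum_range_succ, mul_add, Finset.mul_sum]
    have e : ∀ q ∈ Finset.range c, x₁ * (x₁ ^ (c - 1 - q) * (1 + bb * x₁)
          * (x₂ ^ (b + (q + 1)) * swapVars i g))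
        = x₁ ^ (c + 1 - 1 - q) * (1 + bb * x₁) * (x₂ ^ (b + (q + 1)) * swapVars i g) := by
      intro q hq
      rw [Finset.mem_range] at hq
      have : c + 1 - 1 - q = (c - 1 - q) + 1 := by omega
      rw [this]; ring
    rw [Finset.sum_congr rfl e]
    simp only [Nat.add_sub_cancel, Nat.sub_self, pow_zero, add_assoc]
    ring

/-- The left side is invariant under `π_{i+1}` by the braid relation. Apply this operator to the
decomposition `betaPi_eq_add_divDiff`: the first summand gives the right side, and the second is
annihilated. -/
theorem betaPi_core (b : ℕ) {h : BetaPoly} (hh : swapVars i h = h) :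
    betaPi i (x₁ ^ b * betaPi (i + 1) (x₂ ^ b * h))
      = betaPi (i + 1) (x₂ ^ b * swapVars i (betaPi (i + 1) (x₂ ^ b * h))) := by
  have n1 := pnat_ne_add_one i
  have n2 := pnat_ne_add_one (i + 1)
  have n3 : i ≠ i + 1 + 1 := ((PNat.lt_add_right i 1).trans (PNat.lt_add_right (i + 1) 1)).ne
  have hx := swapVars_X_of_ne n1 n3
  have hz := swapVars_X_of_ne n3.symm n2.symm
  have hxp : ∀ n, swapVars (i + 1) (x₁ ^ n) = x₁ ^ n := fun n => by rw [swapVars_pow, hx]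
  set g := betaPi (i + 1) (x₂ ^ b * h) with hg
  have hgs : swapVars (i + 1) g = g := swapVars_betaPi _ _
  have hw : swapVars i (x₁ ^ b * (x₂ ^ b * h)) = x₁ ^ b * (x₂ ^ b * h) := by
    rw [swapVars_mul, swapVars_mul, swapVars_pow, swapVars_pow, swapVars_X_left,
      swapVars_X_right, hh]
    ring
  -- The product `x_i ^ b * x_{i+1} ^ b * h` is fixed by `π_i`, so a third operator may be inserted
  -- before the braid relation is used.
  have step1 : betaPi (i + 1) (betaPi i (x₁ ^ b * g)) = betaPi i (x₁ ^ b * g) := by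
    rw [hg, ← betaPi_mul_of_symm (hxp b), ← betaPi_of_symm hw, betaPi_braid, betaPi_betaPi]
  -- Apart from a symmetric factor this is `∂_{i+1}` of `∂_i (x_i F) - F`, with `F = x_i ^ b g`
  -- symmetric under `s_{i+1}`. Moreover `x_i F` is `∂_{i+1}` of an `s_i`-symmetric polynomial, so
  -- the braid relation for divided differences finishes.
  have step2 : betaPi (i + 1) (x₁ * (1 + bb * x₂) * divDiff i (x₁ ^ b * g)) = 0 := by
    have e0 : swapVars (i + 1) (x₁ * (1 + bb * x₂) * (1 + bb * x₃))
        = x₁ * (1 + bb * x₂) * (1 + bb * x₃) := by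
      simp only [swapVars_mul, swapVars_add, swapVars_one, swapVars_C, hx, swapVars_X_left,
        swapVars_X_right]
      ring
    have e1 : x₂ * divDiff i (x₁ ^ b * g) = divDiff i (x₁ * (x₁ ^ b * g)) - x₁ ^ b * g := by
      rw [divDiff_X_mul]; ring
    have e2 : divDiff (i + 1) (x₁ ^ b * g) = 0 :=
      divDiff_of_symm (by rw [swapVars_mul, hxp, hgs])
    have e3 : x₁ * (x₁ ^ b * g)
        = divDiff (i + 1) (x₁ ^ (b + 1) * ((1 + bb * x₃) * (x₂ * (x₂ ^ b * h)))) := by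
      rw [divDiff_mul_of_symm (hxp _), hg, betaPi, betaDivDiff]
      ring
    have e4 : divDiff i (x₁ ^ (b + 1) * ((1 + bb * x₃) * (x₂ * (x₂ ^ b * h)))) = 0 := by
      refine divDiff_of_symm ?_
      simp only [swapVars_mul, swapVars_pow, swapVars_add, swapVars_one, swapVars_C, hz, hh,
        swapVars_X_left, swapVars_X_right]
      ring
    have e5 : divDiff (i + 1) (x₂ * divDiff i (x₁ ^ b * g)) = 0 := by
      rw [e1, divDiff_sub, e2, e3, ← divDiff_braid, e4, divDiff_of_symm (i := i + 1) (map_zero _),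
        divDiff_of_symm (i := i) (map_zero _), sub_zero]
    have e6 : (1 + bb * x₃) * (x₂ * (x₁ * (1 + bb * x₂) * divDiff i (x₁ ^ b * g)))
        = (x₁ * (1 + bb * x₂) * (1 + bb * x₃)) * (x₂ * divDiff i (x₁ ^ b * g)) := by ring
    rw [betaPi, betaDivDiff, e6, divDiff_mul_of_symm e0, e5, mul_zero]
  rw [← step1]
  conv_lhs => rw [betaPi_eq_add_divDiff]
  rw [betaPi_add, step2, add_zero]

end Core

/-! ### Lascoux polynomials -/

theorem swapParts_apply (i : ℕ+) (α : ℕ+ →₀ ℕ) (j : ℕ+) :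
    swapParts i α j = α (Equiv.swap i (i + 1) j) := by
  rw [swapParts, Finsupp.equivMapDomain_apply, Equiv.symm_swap]

theorem swapParts_left (i : ℕ+) (α : ℕ+ →₀ ℕ) : swapParts i α i = α (i + 1) := by
  rw [swapParts_apply, Equiv.swap_apply_left]

theorem swapParts_right (i : ℕ+) (α : ℕ+ →₀ ℕ) : swapParts i α (i + 1) = α i := by
  rw [swapParts_apply, Equiv.swap_apply_right]

theorem swapParts_of_ne {i j : ℕ+} (h1 : j ≠ i) (h2 : j ≠ i + 1) (α : ℕ+ →₀ ℕ) :
    swapParts i α j = α j := by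
  rw [swapParts_apply, Equiv.swap_apply_of_ne_of_ne h1 h2]

theorem swapParts_swapParts (i : ℕ+) (α : ℕ+ →₀ ℕ) : swapParts i (swapParts i α) = α := by
  ext j; rw [swapParts_apply, swapParts_apply, Equiv.swap_apply_self]

theorem swapParts_braid (i : ℕ+) (α : ℕ+ →₀ ℕ) :
    swapParts i (swapParts (i + 1) (swapParts i α))
      = swapParts (i + 1) (swapParts i (swapParts (i + 1) α)) := by
  ext j
  simp only [swapParts_apply]
  congr 1
  have := DFunLike.congr_fun (swap_braid i) j
  simpa only [Equiv.Perm.mul_apply] using this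

theorem swapParts_comm {i j : ℕ+} (h : i + 1 < j) (α : ℕ+ →₀ ℕ) :
    swapParts i (swapParts j α) = swapParts j (swapParts i α) := by
  ext k
  simp only [swapParts_apply]
  congr 1
  have := DFunLike.congr_fun (swap_mul_swap_comm h) k
  simpa only [Equiv.Perm.mul_apply] using this.symm

theorem lascoux_of_forall {α : ℕ+ →₀ ℕ} (h : ∀ i, α (i + 1) ≤ α i) :
    lascoux α = MvPolynomial.monomial α 1 := by
  rw [lascoux, dif_neg]
  rintro ⟨i, hi⟩; exact absurd hi (not_lt.2 (h i))

/-- Two ascents can be completed to a common composition of smaller moment, by commutation if they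
are far apart and by the braid relation if they are adjacent. -/
theorem lascoux_eq {α : ℕ+ →₀ ℕ} {i : ℕ+} (h : α i < α (i + 1)) :
    lascoux α = betaPi i (lascoux (swapParts i α)) := by
  induction hn : partMoment α using Nat.strong_induction_on generalizing α i with
  | _ n ih =>
    subst hn
    have key : ∀ i j : ℕ+, i < j → α i < α (i + 1) → α j < α (j + 1) →
        betaPi i (lascoux (swapParts i α)) = betaPi j (lascoux (swapParts j α)) := by
      intro i j hij hi hj
      have mi := partMoment_swapParts_lt hi
      have mj := partMoment_swapParts_lt hj
      have hi1 := PNat.lt_add_right i 1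
      have hj1 := PNat.lt_add_right j 1
      rcases (PNat.add_one_le_iff.2 hij).eq_or_lt with rfl | h2
      · have n3 : i ≠ i + 1 + 1 := (hi1.trans hj1).ne
        have b1 : swapParts i α (i + 1) < swapParts i α (i + 1 + 1) := by
          rw [swapParts_right, swapParts_of_ne n3.symm hj1.ne']; omega
        have b2 : swapParts (i + 1) (swapParts i α) i
            < swapParts (i + 1) (swapParts i α) (i + 1) := by
          rw [swapParts_of_ne hi1.ne n3, swapParts_left, swapParts_left,
            swapParts_of_ne n3.symm hj1.ne']; omega
        have c1 : swapParts (i + 1) α i < swapParts (i + 1) α (i + 1) := by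
          rw [swapParts_left, swapParts_of_ne hi1.ne n3]; omega
        have c2 : swapParts i (swapParts (i + 1) α) (i + 1)
            < swapParts i (swapParts (i + 1) α) (i + 1 + 1) := by
          rw [swapParts_right, swapParts_of_ne n3.symm hj1.ne', swapParts_right,
            swapParts_of_ne hi1.ne n3]; omega
        have mb := partMoment_swapParts_lt b1
        have mc := partMoment_swapParts_lt c1
        rw [ih _ mi b1 rfl, ih _ (mb.trans mi) b2 rfl, ih _ mj c1 rfl, ih _ (mc.trans mj) c2 rfl,
          betaPi_braid, swapParts_braid]
      · have b1 : swapParts i α j < swapParts i α (j + 1) := by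
          rwa [swapParts_of_ne hij.ne' h2.ne', swapParts_of_ne (hij.trans hj1).ne' (h2.trans hj1).ne']
        have c1 : swapParts j α i < swapParts j α (i + 1) := by
          rwa [swapParts_of_ne hij.ne (hij.trans hj1).ne, swapParts_of_ne h2.ne (h2.trans hj1).ne]
        rw [ih _ mi b1 rfl, ih _ mj c1 rfl, betaPi_comm h2, swapParts_comm h2]
    have hex : ∃ i : ℕ+, α i < α (i + 1) := ⟨i, h⟩
    rw [lascoux, dif_pos hex]
    rcases lt_trichotomy (PNat.find hex) i with hlt | heq | hlt
    · exact key _ _ hlt (PNat.find_spec hex) h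
    · rw [heq]
    · exact (key _ _ hlt h (PNat.find_spec hex)).symm

theorem swapVars_monomial (k : ℕ+) (α : ℕ+ →₀ ℕ) :
    swapVars k (MvPolynomial.monomial α 1) = MvPolynomial.monomial (swapParts k α) 1 := by
  rw [swapVars, MvPolynomial.rename_monomial, swapParts, Finsupp.equivMapDomain_eq_mapDomain]

/-- For a partition the monomial is symmetric. Otherwise take an ascent `i`: if it is far from `k`,
the operators commute; if adjacent, two exchanges bring the equal parts to position `i`, and the
braid relation moves the operator there. -/
theorem betaPi_lascoux_of_eq {α : ℕ+ →₀ ℕ} {k : ℕ+} (h : α k = α (k + 1)) :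
    betaPi k (lascoux α) = lascoux α := by
  induction hn : partMoment α using Nat.strong_induction_on generalizing α k with
  | _ n ih =>
    subst hn
    have hk1 := PNat.lt_add_right k 1
    by_cases hex : ∃ i : ℕ+, α i < α (i + 1)
    · obtain ⟨i, hi⟩ := hex
      have mi := partMoment_swapParts_lt hi
      have hi1 := PNat.lt_add_right i 1
      rcases lt_trichotomy i k with hik | rfl | hki
      · rcases (PNat.add_one_le_iff.2 hik).eq_or_lt with rfl | h2
        · have n3 : i ≠ i + 1 + 1 := (hi1.trans hk1).ne
          have b1 : swapParts i α (i + 1) < swapParts i α (i + 1 + 1) := by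
            rw [swapParts_right, swapParts_of_ne n3.symm hk1.ne']; omega
          have b2 : swapParts (i + 1) (swapParts i α) i
              = swapParts (i + 1) (swapParts i α) (i + 1) := by
            rw [swapParts_of_ne hi1.ne n3, swapParts_left, swapParts_left,
              swapParts_of_ne n3.symm hk1.ne']; omega
          rw [lascoux_eq hi, lascoux_eq b1, ← betaPi_braid,
            ih _ ((partMoment_swapParts_lt b1).trans mi) b2 rfl]
        · rw [lascoux_eq hi, ← betaPi_comm h2, ih _ mi _ rfl]
          rw [swapParts_of_ne hik.ne' h2.ne', swapParts_of_ne (hik.trans hk1).ne' (h2.trans hk1).ne', h]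
      · omega
      · rcases (PNat.add_one_le_iff.2 hki).eq_or_lt with rfl | h2
        · have n3 : k ≠ k + 1 + 1 := (hk1.trans hi1).ne
          have b1 : swapParts (k + 1) α k < swapParts (k + 1) α (k + 1) := by
            rw [swapParts_left, swapParts_of_ne hk1.ne n3]; omega
          have b2 : swapParts k (swapParts (k + 1) α) (k + 1)
              = swapParts k (swapParts (k + 1) α) (k + 1 + 1) := by
            rw [swapParts_right, swapParts_of_ne n3.symm hi1.ne', swapParts_right,
              swapParts_of_ne hk1.ne n3]; omega
          rw [lascoux_eq hi, lascoux_eq b1, betaPi_braid,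
            ih _ ((partMoment_swapParts_lt b1).trans mi) b2 rfl]
        · rw [lascoux_eq hi, betaPi_comm h2, ih _ mi _ rfl]
          rw [swapParts_of_ne hki.ne (hki.trans hi1).ne, swapParts_of_ne h2.ne (h2.trans hi1).ne, h]
    · push Not at hex
      rw [lascoux_of_forall hex]
      refine betaPi_of_symm ?_
      rw [swapVars_monomial]
      congr 2
      ext j
      by_cases h1 : j = k
      · subst h1; rw [swapParts_left, h]
      · by_cases h2 : j = k + 1
        · subst h2; rw [swapParts_right, h]
        · rw [swapParts_of_ne h1 h2]

theorem betaPi_lascoux_of_le {α : ℕ+ →₀ ℕ} {k : ℕ+} (h : α k ≤ α (k + 1)) :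
    betaPi k (lascoux α) = lascoux α := by
  rcases h.lt_or_eq with h | h
  · rw [lascoux_eq h, betaPi_betaPi]
  · exact betaPi_lascoux_of_eq h

theorem betaPi_lascoux_of_ge {α : ℕ+ →₀ ℕ} {k : ℕ+} (h : α (k + 1) ≤ α k) :
    betaPi k (lascoux α) = lascoux (swapParts k α) := by
  have h' : swapParts k α k ≤ swapParts k α (k + 1) := by rwa [swapParts_left, swapParts_right]
  rcases h'.lt_or_eq with h | h
  · rw [lascoux_eq h, swapParts_swapParts]
  · rw [← betaPi_lascoux_of_eq h]
    congr 2
    rw [swapParts_left, swapParts_right] at h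
    ext j
    by_cases h1 : j = k
    · subst h1; rw [swapParts_left, h]
    · by_cases h2 : j = k + 1
      · subst h2; rw [swapParts_right, h]
      · rw [swapParts_of_ne h1 h2]

/-- Shift the parts of a composition by one position. -/
noncomputable def shParts (γ : ℕ+ →₀ ℕ) : ℕ+ →₀ ℕ := γ.mapDomain (· + 1)

theorem shParts_add_one (γ : ℕ+ →₀ ℕ) (v : ℕ+) : shParts γ (v + 1) = γ v :=
  Finsupp.mapDomain_apply (f := fun v : ℕ+ => v + 1) (add_left_injective 1) γ v

theorem shParts_one (γ : ℕ+ →₀ ℕ) : shParts γ 1 = 0 := by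
  refine Finsupp.mapDomain_of_notMem_range _ _ ?_
  rintro ⟨v, hv⟩
  exact absurd hv (by rw [← PNat.coe_inj]; simp)

theorem shVars_monomial (γ : ℕ+ →₀ ℕ) (c : Polynomial ℤ) :
    shVars (MvPolynomial.monomial γ c) = MvPolynomial.monomial (shParts γ) c :=
  MvPolynomial.rename_monomial _ _ _

theorem ext_parts {α α' : ℕ+ →₀ ℕ} (h1 : α 1 = α' 1) (h : ∀ v, α (v + 1) = α' (v + 1)) :
    α = α' := by
  ext v
  rcases pnat_one_or_add_one v with rfl | ⟨u, rfl⟩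
  · exact h1
  · exact h u

theorem single_one_apply_add_one (p : ℕ) (v : ℕ+) :
    (Finsupp.single (1 : ℕ+) p) (v + 1) = 0 :=
  Finsupp.single_eq_of_ne (by rw [← PNat.coe_inj.ne]; simp)

/-- A maximal first part never takes part in an ascent; all operators used act on later variables
and commute with multiplication by `x₁ ^ p`. -/
theorem lascoux_cons {p : ℕ} {γ : ℕ+ →₀ ℕ} (h : ∀ v, γ v ≤ p) :
    lascoux (Finsupp.single (1 : ℕ+) p + shParts γ) = MvPolynomial.X 1 ^ p * shVars (lascoux γ) := by
  induction hn : partMoment γ using Nat.strong_induction_on generalizing γ with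
  | _ n ih =>
    subst hn
    have hval : ∀ γ : ℕ+ →₀ ℕ, ∀ v, (Finsupp.single (1 : ℕ+) p + shParts γ) (v + 1) = γ v := fun γ v => by
      rw [Finsupp.add_apply, shParts_add_one, single_one_apply_add_one, zero_add]
    by_cases hex : ∃ i : ℕ+, γ i < γ (i + 1)
    · obtain ⟨i, hi⟩ := hex
      have hi' : (Finsupp.single (1 : ℕ+) p + shParts γ) (i + 1)
          < (Finsupp.single (1 : ℕ+) p + shParts γ) (i + 1 + 1) := by rwa [hval, hval]
      have e : swapParts (i + 1) (Finsupp.single (1 : ℕ+) p + shParts γ)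
          = Finsupp.single 1 p + shParts (swapParts i γ) := by
        refine ext_parts ?_ fun v => ?_
        · have n1 : (1 : ℕ+) ≠ i + 1 := by rw [← PNat.coe_inj.ne]; simp
          have n2 : (1 : ℕ+) ≠ i + 1 + 1 := by rw [← PNat.coe_inj.ne]; simp
          rw [swapParts_of_ne n1 n2, Finsupp.add_apply, Finsupp.add_apply, shParts_one, shParts_one]
        · rw [hval, swapParts_apply, swap_add_one, hval, swapParts_apply]
      have hx : swapVars (i + 1) (MvPolynomial.X 1 ^ p) = MvPolynomial.X 1 ^ p := by
        rw [swapVars_pow, swapVars_X_of_ne]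
        · rw [← PNat.coe_inj.ne]; simp
        · rw [← PNat.coe_inj.ne]; simp
      rw [lascoux_eq hi', e, ih _ (partMoment_swapParts_lt hi) (fun v => ?_) rfl,
        betaPi_mul_of_symm hx, ← shVars_betaPi, ← lascoux_eq hi]
      rw [swapParts_apply]; exact h _
    · push Not at hex
      rw [lascoux_of_forall hex, lascoux_of_forall, shVars_monomial, MvPolynomial.monomial_single_add]
      intro i
      rw [hval]
      rcases pnat_one_or_add_one i with rfl | ⟨u, rfl⟩
      · rw [Finsupp.add_apply, shParts_one, Finsupp.single_eq_same]; exact h 1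
      · rw [hval]; exact hex u

/-- The parts of `ρ` drop only beyond the support of `γ`, so `x ^ ρ` is symmetric at every ascent of
`γ`. -/
theorem lascoux_add {γ ρ : ℕ+ →₀ ℕ} (hρ : ∀ i, ρ (i + 1) ≤ ρ i)
    (h : ∀ i, ρ i ≠ ρ (i + 1) → ∀ v, i < v → γ v = 0) :
    lascoux (γ + ρ) = MvPolynomial.monomial ρ 1 * lascoux γ := by
  induction hn : partMoment γ using Nat.strong_induction_on generalizing γ with
  | _ n ih =>
    subst hn
    by_cases hex : ∃ i : ℕ+, γ i < γ (i + 1)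
    · obtain ⟨i, hi⟩ := hex
      have hi1 := PNat.lt_add_right i 1
      have hρi : ρ i = ρ (i + 1) := by
        by_contra hne
        have := h i hne (i + 1) hi1
        omega
      have hi' : (γ + ρ) i < (γ + ρ) (i + 1) := by
        rw [Finsupp.add_apply, Finsupp.add_apply, hρi]; omega
      have hsρ : swapParts i ρ = ρ := by
        ext j
        by_cases h1 : j = i
        · subst h1; rw [swapParts_left, hρi]
        · by_cases h2 : j = i + 1
          · subst h2; rw [swapParts_right, hρi]
          · rw [swapParts_of_ne h1 h2]
      have e : swapParts i (γ + ρ) = swapParts i γ + ρ := by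
        ext j
        have := DFunLike.congr_fun hsρ j
        rw [swapParts_apply] at this
        rw [swapParts_apply, Finsupp.add_apply, Finsupp.add_apply, swapParts_apply, this]
      have hx : swapVars i (MvPolynomial.monomial ρ 1) = MvPolynomial.monomial ρ 1 := by
        rw [swapVars_monomial, hsρ]
      rw [lascoux_eq hi', e, ih _ (partMoment_swapParts_lt hi) (fun j hj v hv => ?_) rfl,
        betaPi_mul_of_symm hx, ← lascoux_eq hi]
      have hij : i < j := by
        rcases lt_trichotomy i j with h' | rfl | h'
        · exact h'
        · exact absurd hρi hj
        · have := h j hj (i + 1) (h'.trans hi1); omega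
      rw [swapParts_of_ne (hij.trans hv).ne', h j hj v hv]
      exact ((PNat.add_one_le_iff.2 hij).trans_lt hv).ne'
    · push Not at hex
      rw [lascoux_of_forall hex, lascoux_of_forall, MvPolynomial.monomial_mul, one_mul, add_comm]
      intro i
      rw [Finsupp.add_apply, Finsupp.add_apply]
      exact add_le_add (hex i) (hρ i)

/-! ## Branching of keys -/

/-- All words of length `n` with letters in `A`. -/
def words {τ : Type*} [DecidableEq τ] (A : Finset τ) : ℕ → Finset (List τ)
  | 0 => {[]}
  | n + 1 => (A ×ˢ words A n).image fun p => p.1 :: p.2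

theorem mem_words {τ : Type*} [DecidableEq τ] {A : Finset τ} {n : ℕ} {w : List τ} :
    w ∈ words A n ↔ w.length = n ∧ ∀ a ∈ w, a ∈ A := by
  induction n generalizing w with
  | zero =>
    rw [words, Finset.mem_singleton, List.length_eq_zero_iff]
    exact ⟨fun h => ⟨h, by simp [h]⟩, fun h => h.1⟩
  | succ n ih =>
    rw [words, Finset.mem_image]
    constructor
    · rintro ⟨⟨a, w⟩, h, rfl⟩
      rw [Finset.mem_product, ih] at h
      simpa using ⟨h.2.1, h.1, h.2.2⟩
    · rintro ⟨h1, h2⟩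
      cases w with
      | nil => simp at h1
      | cons a w =>
        refine ⟨(a, w), Finset.mem_product.2 ⟨h2 a List.mem_cons_self, ih.2 ⟨by simpa using h1, ?_⟩⟩, rfl⟩
        exact fun b hb => h2 b (List.mem_cons_of_mem _ hb)

theorem sum_words_succ {τ M : Type*} [DecidableEq τ] [AddCommMonoid M] (A : Finset τ) (n : ℕ)
    (f : List τ → M) :
    ∑ w ∈ words A (n + 1), f w = ∑ w ∈ words A n, ∑ a ∈ A, f (a :: w) := by
  rw [words, Finset.sum_image, Finset.sum_product_right]
  rintro ⟨a, w⟩ _ ⟨a', w'⟩ _ h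
  simpa using h

theorem sum_words_add {τ M : Type*} [DecidableEq τ] [AddCommMonoid M] (A : Finset τ) (m n : ℕ)
    (f : List τ → M) :
    ∑ w ∈ words A (m + n), f w = ∑ w ∈ words A n, ∑ u ∈ words A m, f (u ++ w) := by
  induction m generalizing f with
  | zero => simp [words]
  | succ m ih =>
    rw [add_right_comm, sum_words_succ, ih]
    refine Finset.sum_congr rfl fun w _ => ?_
    rw [sum_words_succ]; rfl

/-- All words of length `n` in `true` and `false`. -/
abbrev boolWords (n : ℕ) : Finset (List Bool) := words Finset.univ n

theorem mem_boolWords {n : ℕ} {w : List Bool} : w ∈ boolWords n ↔ w.length = n := by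
  simp [mem_words]

/-- The coefficient of a choice of columns from which an element is removed. -/
noncomputable def brWeight : List (Finset ℕ+) → List Bool → BetaPoly
  | [], [] => 1
  | K :: Ks, d :: ds => brWeight Ks ds *
      if (Ks.headD ∅).card < K.card ∨ ds.headD false = true then
        if d then MvPolynomial.X 1 else 1 + MvPolynomial.C betaCoeff * MvPolynomial.X 1
      else if d then 0 else 1
  | _, _ => 0

/-- Inverse of `shParts`, forgetting the first part. -/
noncomputable def unshParts (γ : ℕ+ →₀ ℕ) : ℕ+ →₀ ℕ :=
  γ.comapDomain (· + 1) (add_left_injective (1 : ℕ+)).injOn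

theorem unshParts_apply (γ : ℕ+ →₀ ℕ) (v : ℕ+) : unshParts γ v = γ (v + 1) := rfl

theorem unshParts_shParts (γ : ℕ+ →₀ ℕ) : unshParts (shParts γ) = γ := by
  ext v; rw [unshParts_apply, shParts_add_one]

theorem shParts_unshParts {γ : ℕ+ →₀ ℕ} (h : γ 1 = 0) : shParts (unshParts γ) = γ :=
  ext_parts (by rw [shParts_one, h]) fun v => by rw [shParts_add_one, unshParts_apply]

theorem unshParts_add (γ δ : ℕ+ →₀ ℕ) : unshParts (γ + δ) = unshParts γ + unshParts δ := by
  ext v; simp [unshParts_apply]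

open Classical in
/-- The polynomial of a key without entries `1`; zero if there is such an entry. -/
noncomputable def brValue (R : List (Finset ℕ+)) : BetaPoly :=
  if 1 ∈ R.headD ∅ then 0 else shVars (lascoux (unshParts (keyWeight R)))

/-- The sum over all branchings of a key. -/
noncomputable def brSum (K : List (Finset ℕ+)) : BetaPoly :=
  ∑ ds ∈ boolWords K.length, brWeight K ds * brValue (brKeys K ds)

/-! ### Weights of keys -/

theorem keyWeight_nil : keyWeight [] = 0 := rfl

theorem sum_single_apply (S : Finset ℕ+) (v : ℕ+) :
    (∑ u ∈ S, Finsupp.single u 1 : ℕ+ →₀ ℕ) v = if v ∈ S then 1 else 0 := by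
  rw [Finsupp.finsetSum_apply]
  simp [Finsupp.single_apply]

theorem keyWeight_cons_apply (S : Finset ℕ+) (K : List (Finset ℕ+)) (v : ℕ+) :
    keyWeight (S :: K) v = (if v ∈ S then 1 else 0) + keyWeight K v := by
  rw [← sum_single_apply]
  simp [keyWeight]

theorem keyWeight_append (K K' : List (Finset ℕ+)) :
    keyWeight (K ++ K') = keyWeight K + keyWeight K' := by
  simp [keyWeight]

theorem keyWeight_le_length (K : List (Finset ℕ+)) (v : ℕ+) : keyWeight K v ≤ K.length := by
  induction K with
  | nil => simp [keyWeight_nil]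
  | cons S K ih =>
    rw [keyWeight_cons_apply, List.length_cons]
    split_ifs <;> omega

theorem keyWeight_eq_zero {K : List (Finset ℕ+)} {v : ℕ+} (h : ∀ S ∈ K, v ∉ S) :
    keyWeight K v = 0 := by
  induction K with
  | nil => rfl
  | cons S K ih =>
    rw [keyWeight_cons_apply, if_neg (h S List.mem_cons_self),
      ih fun T hT => h T (List.mem_cons_of_mem _ hT)]

theorem keyWeight_mono {K : List (Finset ℕ+)} {u v : ℕ+} (h : ∀ S ∈ K, u ∈ S → v ∈ S) :
    keyWeight K u ≤ keyWeight K v := by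
  induction K with
  | nil => rfl
  | cons S K ih =>
    rw [keyWeight_cons_apply, keyWeight_cons_apply]
    have h1 := ih fun T hT => h T (List.mem_cons_of_mem _ hT)
    have h2 := h S List.mem_cons_self
    by_cases hu : u ∈ S
    · rw [if_pos hu, if_pos (h2 hu)]; omega
    · rw [if_neg hu]; omega

theorem subset_head_of_isChain {A : Finset ℕ+} {R : List (Finset ℕ+)}
    (h : (A :: R).IsChain (· ⊇ ·)) : ∀ S ∈ R, S ⊆ A := by
  have : (A :: R).Pairwise (· ⊇ ·) := h.pairwise
  exact fun S hS => (List.pairwise_cons.1 this).1 S hS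

/-- In a key, the columns with `u` and the columns with `v` are nested. -/
theorem imp_of_keyWeight_le {K : List (Finset ℕ+)} (hK : K.IsChain (· ⊇ ·)) {u v : ℕ+}
    (h : keyWeight K u ≤ keyWeight K v) : ∀ S ∈ K, u ∈ S → v ∈ S := by
  induction K with
  | nil => simp
  | cons A R ih =>
    have hsub := subset_head_of_isChain hK
    rw [keyWeight_cons_apply, keyWeight_cons_apply] at h
    by_cases hv : v ∈ A
    · by_cases hu : u ∈ A
      · rw [if_pos hu, if_pos hv] at h
        intro S hS
        rcases List.mem_cons.1 hS with rfl | hS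
        · exact fun _ => hv
        · exact ih hK.tail (by omega) S hS
      · intro S hS huS
        rcases List.mem_cons.1 hS with rfl | hS
        · exact hv
        · exact absurd (hsub S hS huS) hu
    · have h0 : keyWeight R v = 0 := keyWeight_eq_zero fun S hS hvS => hv (hsub S hS hvS)
      rw [if_neg hv, h0] at h
      have hu : u ∉ A := fun hu => by rw [if_pos hu] at h; omega
      intro S hS huS
      rcases List.mem_cons.1 hS with rfl | hS
      · exact absurd huS hu
      · exact absurd (hsub S hS huS) hu

theorem keyWeight_map_apply {f : Finset ℕ+ → Finset ℕ+} {u v : ℕ+} (K : List (Finset ℕ+))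
    (h : ∀ S ∈ K, v ∈ f S ↔ u ∈ S) : keyWeight (K.map f) v = keyWeight K u := by
  induction K with
  | nil => rfl
  | cons S K ih =>
    rw [List.map_cons, keyWeight_cons_apply, keyWeight_cons_apply,
      ih fun T hT => h T (List.mem_cons_of_mem _ hT)]
    simp only [h S List.mem_cons_self]

/-- Exchange `k` and `k + 1` in a set. -/
def swapSet (k : ℕ+) (S : Finset ℕ+) : Finset ℕ+ := S.map (Equiv.swap k (k + 1)).toEmbedding

theorem mem_swapSet {k v : ℕ+} {S : Finset ℕ+} :
    v ∈ swapSet k S ↔ Equiv.swap k (k + 1) v ∈ S := by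
  rw [swapSet, Finset.mem_map_equiv, Equiv.symm_swap]

theorem swapSet_swapSet (k : ℕ+) (S : Finset ℕ+) : swapSet k (swapSet k S) = S := by
  ext; simp [mem_swapSet]

theorem card_swapSet (k : ℕ+) (S : Finset ℕ+) : (swapSet k S).card = S.card := Finset.card_map _

theorem swapSet_empty (k : ℕ+) : swapSet k ∅ = ∅ := Finset.map_empty _

theorem swapSet_mono {k : ℕ+} {S T : Finset ℕ+} (h : S ⊆ T) : swapSet k S ⊆ swapSet k T :=
  Finset.map_subset_map.2 h

theorem swapSet_eq_self {k : ℕ+} {S : Finset ℕ+} (h : k ∈ S ↔ k + 1 ∈ S) : swapSet k S = S := by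
  ext v
  rw [mem_swapSet]
  by_cases h1 : v = k
  · subst h1; rw [Equiv.swap_apply_left, h]
  · by_cases h2 : v = k + 1
    · subst h2; rw [Equiv.swap_apply_right, h]
    · rw [Equiv.swap_apply_of_ne_of_ne h1 h2]

theorem keyWeight_map_swapSet (k : ℕ+) (K : List (Finset ℕ+)) :
    keyWeight (K.map (swapSet k)) = swapParts k (keyWeight K) := by
  ext v
  rw [swapParts_apply]
  exact keyWeight_map_apply K fun S _ => mem_swapSet

theorem one_lt_add_one (k : ℕ+) : 1 < k + 1 := PNat.lt_add_left 1 k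

/-- Add one to all elements of a set. -/
def shSet (S : Finset ℕ+) : Finset ℕ+ := S.map (addRightEmbedding 1)

theorem add_one_mem_shSet {S : Finset ℕ+} {v : ℕ+} : v + 1 ∈ shSet S ↔ v ∈ S := by
  rw [shSet, Finset.mem_map]
  simp [addRightEmbedding]

theorem one_notMem_shSet (S : Finset ℕ+) : 1 ∉ shSet S := by
  rw [shSet, Finset.mem_map]
  rintro ⟨v, -, hv⟩
  exact (one_lt_add_one v).ne' hv

theorem card_shSet (S : Finset ℕ+) : (shSet S).card = S.card := Finset.card_map _

theorem shSet_empty : shSet ∅ = ∅ := Finset.map_empty _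

theorem ext_sets {S T : Finset ℕ+} (h1 : 1 ∈ S ↔ 1 ∈ T) (h : ∀ v, v + 1 ∈ S ↔ v + 1 ∈ T) :
    S = T := by
  ext v
  rcases pnat_one_or_add_one v with rfl | ⟨u, rfl⟩
  · exact h1
  · exact h u

theorem keyWeight_map_shSet (K : List (Finset ℕ+)) :
    keyWeight (K.map shSet) = shParts (keyWeight K) := by
  refine ext_parts ?_ fun v => ?_
  · rw [shParts_one, keyWeight_eq_zero]
    intro S hS
    obtain ⟨T, -, rfl⟩ := List.mem_map.1 hS
    exact one_notMem_shSet T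
  · rw [shParts_add_one]
    exact keyWeight_map_apply K fun S _ => add_one_mem_shSet

theorem brValue_map_shSet (R : List (Finset ℕ+)) :
    brValue (R.map shSet) = shVars (lascoux (keyWeight R)) := by
  rw [brValue, if_neg, keyWeight_map_shSet, unshParts_shParts]
  cases R with
  | nil => simp
  | cons A R => exact one_notMem_shSet A

/-! ### Exchanging two values -/

theorem eraseMin_subset (K N : Finset ℕ+) : eraseMin K N ⊆ K := Finset.filter_subset _ _

theorem subset_eraseMin {K N : Finset ℕ+} (h : N ⊆ K) : N ⊆ eraseMin K N := fun _ hv =>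
  mem_eraseMin.2 ⟨h hv, Or.inl hv⟩

theorem brKeys_headD_subset (K : List (Finset ℕ+)) (ds : List Bool) :
    (brKeys K ds).headD ∅ ⊆ K.headD ∅ := by
  cases K with
  | nil => simp [brKeys]
  | cons A R =>
    cases ds with
    | nil => simp [brKeys]
    | cons d ds =>
      rw [brKeys]
      simp only [List.headD_cons]
      split_ifs
      · exact eraseMin_subset _ _
      · exact Finset.Subset.refl _

theorem headD_subset_of_isChain {A : Finset ℕ+} {R : List (Finset ℕ+)}
    (h : (A :: R).IsChain (· ⊇ ·)) : R.headD ∅ ⊆ A := by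
  cases R with
  | nil => simp
  | cons B R => exact subset_head_of_isChain h B List.mem_cons_self

theorem isChain_brKeys {K : List (Finset ℕ+)} (hK : K.IsChain (· ⊇ ·)) (ds : List Bool) :
    (brKeys K ds).IsChain (· ⊇ ·) := by
  induction K generalizing ds with
  | nil => simp [brKeys]
  | cons A R ih =>
    cases ds with
    | nil => simp [brKeys]
    | cons d ds =>
      have ih' := ih hK.tail ds
      have hsub := (brKeys_headD_subset R ds).trans (headD_subset_of_isChain hK)
      rw [brKeys]
      revert ih' hsub
      generalize brKeys R ds = L
      cases L with
      | nil => simp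
      | cons B L =>
        intro ih' hsub
        rw [List.isChain_cons_cons]
        refine ⟨?_, ih'⟩
        simp only [List.headD_cons] at hsub ⊢
        split_ifs
        · exact subset_eraseMin hsub
        · exact hsub

/-- Exchanging `k` and `k + 1` alters the order only between these two. It matters only if both are
candidates for removal. -/
theorem eraseMin_swapSet {K N : Finset ℕ+} {k : ℕ+}
    (h : ¬ ((k ∈ K ∧ k ∉ N) ∧ (k + 1 ∈ K ∧ k + 1 ∉ N))) :
    eraseMin (swapSet k K) (swapSet k N) = swapSet k (eraseMin K N) := by
  ext v
  rw [mem_eraseMin, mem_swapSet, mem_swapSet, mem_swapSet, mem_eraseMin]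
  refine and_congr_right fun hv => ?_
  by_cases hvN : Equiv.swap k (k + 1) v ∈ N
  · simp [hvN]
  · simp only [hvN, false_or]
    set y := Equiv.swap k (k + 1) v with hy
    have hvy : v = Equiv.swap k (k + 1) y := by rw [hy, Equiv.swap_apply_self]
    have key : ∀ w ∈ K, w ∉ N → (Equiv.swap k (k + 1) w < v ↔ w < y) := by
      intro w hw hwN
      rw [hvy]
      apply swap_lt_swap_iff
      · rintro ⟨rfl, h2⟩; rw [h2] at hv hvN; exact h ⟨⟨hw, hwN⟩, hv, hvN⟩
      · rintro ⟨rfl, h2⟩; rw [h2] at hv hvN; exact h ⟨⟨hv, hvN⟩, hw, hwN⟩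
    constructor
    · rintro ⟨u, hu, huN, huv⟩
      rw [mem_swapSet] at hu huN
      refine ⟨_, hu, huN, ?_⟩
      rw [← key _ hu huN, Equiv.swap_apply_self]; exact huv
    · rintro ⟨w, hw, hwN, hwy⟩
      refine ⟨Equiv.swap k (k + 1) w, ?_, ?_, (key w hw hwN).2 hwy⟩
      · rwa [mem_swapSet, Equiv.swap_apply_self]
      · rwa [mem_swapSet, Equiv.swap_apply_self]

theorem headD_map_swapSet (k : ℕ+) (R : List (Finset ℕ+)) :
    (R.map (swapSet k)).headD ∅ = swapSet k (R.headD ∅) := by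
  cases R with
  | nil => simp [swapSet_empty]
  | cons A R => rfl

theorem map_swapSet_eq_self {k : ℕ+} {R : List (Finset ℕ+)} (hR : R.IsChain (· ⊇ ·))
    (h1 : k ∉ R.headD ∅) (h2 : k + 1 ∉ R.headD ∅) : R.map (swapSet k) = R := by
  cases R with
  | nil => rfl
  | cons A R =>
    have hsub := subset_head_of_isChain hR
    have : ∀ S ∈ A :: R, S ⊆ A := by
      intro S hS
      rcases List.mem_cons.1 hS with rfl | hS
      · exact Finset.Subset.refl _
      · exact hsub S hS
    conv_rhs => rw [← List.map_id (A :: R)]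
    refine List.map_congr_left fun S hS => swapSet_eq_self ?_
    exact iff_of_false (fun h => h1 (this S hS h)) fun h => h2 (this S hS h)

theorem isChain_map_swapSet {k : ℕ+} {K : List (Finset ℕ+)} (hK : K.IsChain (· ⊇ ·)) :
    (K.map (swapSet k)).IsChain (· ⊇ ·) := by
  rw [List.isChain_map]
  exact hK.imp fun _ _ h => swapSet_mono h

/-- Usually branching commutes with the exchange. It may fail where both values are candidates in
the same column; but then neither occurs further right, the column itself is symmetric, and the two
branchings coincide. In either case `π_k` relates the values, see `betaPi_brValue`. -/
theorem brKeys_map_swapSet {k : ℕ+} {K : List (Finset ℕ+)} (hK : K.IsChain (· ⊇ ·))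
    (hk : ∀ S ∈ K, k ∈ S → k + 1 ∈ S) {ds : List Bool} (hds : ds.length = K.length) :
    (brKeys K ds = (brKeys (K.map (swapSet k)) ds).map (swapSet k) ∨
      brKeys K ds = brKeys (K.map (swapSet k)) ds) ∧
    ∀ S ∈ brKeys K ds, k ∈ S → k + 1 ∈ S := by
  induction K generalizing ds with
  | nil => simp [brKeys]
  | cons A R ih =>
    cases ds with
    | nil => simp at hds
    | cons d ds =>
      obtain ⟨ih1, ih2⟩ := ih hK.tail (fun S hS => hk S (List.mem_cons_of_mem _ hS))
        (by simpa using hds)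
      have hsub := (brKeys_headD_subset R ds).trans (headD_subset_of_isChain hK)
      have hchain : (brKeys R ds).IsChain (· ⊇ ·) := isChain_brKeys hK.tail ds
      have hsub' := (brKeys_headD_subset (R.map (swapSet k)) ds).trans
        (headD_subset_of_isChain (isChain_map_swapSet (k := k) hK))
      have hA := hk A List.mem_cons_self
      rw [List.map_cons, brKeys, brKeys]
      have hN : k ∈ (brKeys R ds).headD ∅ → k + 1 ∈ (brKeys R ds).headD ∅ := by
        cases hL : brKeys R ds with
        | nil => simp
        | cons B L => exact ih2 B (by rw [hL]; exact List.mem_cons_self)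
      generalize brKeys R ds = L at *
      generalize brKeys (R.map (swapSet k)) ds = L' at *
      have hfix : k ∉ L.headD ∅ → k + 1 ∉ L.headD ∅ → L.map (swapSet k) = L :=
        map_swapSet_eq_self hchain
      have hfix' : k ∉ L.headD ∅ → k + 1 ∉ L.headD ∅ → L = L' := by
        intro h1 h2
        rcases ih1 with h | h
        · rw [← hfix h1 h2, h, List.map_map]
          conv_rhs => rw [← List.map_id L']
          exact List.map_congr_left fun S _ => swapSet_swapSet k S
        · exact h
      constructor
      · by_cases hboth : (k ∈ A ↔ k + 1 ∈ A) ∧ L = L'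
        · right; rw [swapSet_eq_self hboth.1, hboth.2]
        · have hsw : L = L'.map (swapSet k) := by
            rcases ih1 with h | h
            · exact h
            · have hAiff : ¬ (k ∈ A ↔ k + 1 ∈ A) := fun h' => hboth ⟨h', h⟩
              have hkA : k ∉ A := fun h' => hAiff ⟨fun _ => hA h', fun _ => h'⟩
              have h1 : k ∉ L.headD ∅ := fun h' => hkA (hsub h')
              have h2 : k + 1 ∉ L.headD ∅ := by
                rw [h]; intro h'
                have := hsub' h'
                rw [mem_swapSet, Equiv.swap_apply_right] at this
                exact hkA this
              rw [← h]; exact (hfix h1 h2).symm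
          by_cases hX : (k ∈ A ∧ k ∉ L.headD ∅) ∧ (k + 1 ∈ A ∧ k + 1 ∉ L.headD ∅)
          · exact absurd ⟨iff_of_true hX.1.1 hX.2.1, hfix' hX.1.2 hX.2.2⟩ hboth
          · left
            have hsw' : L' = L.map (swapSet k) := by
              rw [hsw, List.map_map]
              conv_lhs => rw [← List.map_id L']
              exact List.map_congr_left fun S _ => (swapSet_swapSet k S).symm
            rw [List.map_cons, ← hsw]
            congr 1
            rw [hsw', headD_map_swapSet, eraseMin_swapSet hX]
            split_ifs <;> rw [swapSet_swapSet]
      · intro S hS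
        rcases List.mem_cons.1 hS with rfl | hS
        · split_ifs
          · rw [mem_eraseMin, mem_eraseMin]
            rintro ⟨h1, h2⟩
            refine ⟨hA h1, ?_⟩
            rcases h2 with h2 | ⟨u, hu, huN, huk⟩
            · exact Or.inl (hN h2)
            · exact Or.inr ⟨u, hu, huN, huk.trans (PNat.lt_add_right k 1)⟩
          · exact hA
        · exact ih2 S hS

theorem brWeight_congr {K K' : List (Finset ℕ+)} (h : K.map Finset.card = K'.map Finset.card)
    (ds : List Bool) : brWeight K ds = brWeight K' ds := by
  induction K generalizing K' ds with
  | nil =>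
    cases K' with
    | nil => rfl
    | cons A R => simp at h
  | cons A R ih =>
    cases K' with
    | nil => simp at h
    | cons A' R' =>
      rw [List.map_cons, List.map_cons, List.cons.injEq] at h
      have hh : (R.headD ∅).card = (R'.headD ∅).card := by
        cases R <;> cases R' <;> simp_all
      cases ds with
      | nil => rfl
      | cons d ds => rw [brWeight, brWeight, ih h.2, hh, h.1]

theorem swapVars_brWeight {i : ℕ+} (hi : 1 < i) (K : List (Finset ℕ+)) (ds : List Bool) :
    swapVars i (brWeight K ds) = brWeight K ds := by
  have hx : swapVars i (MvPolynomial.X 1) = MvPolynomial.X 1 :=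
    swapVars_X_of_ne hi.ne (hi.trans (PNat.lt_add_right i 1)).ne
  induction K generalizing ds with
  | nil =>
    cases ds
    · exact swapVars_one _
    · exact map_zero _
  | cons A R ih =>
    cases ds with
    | nil => exact map_zero _
    | cons d ds =>
      rw [brWeight, swapVars_mul, ih]
      congr 1
      split_ifs
      · exact hx
      · rw [swapVars_add, swapVars_mul, swapVars_one, swapVars_C, hx]
      · exact map_zero _
      · exact swapVars_one _

theorem unshParts_swapParts (k : ℕ+) (γ : ℕ+ →₀ ℕ) :
    unshParts (swapParts (k + 1) γ) = swapParts k (unshParts γ) := by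
  ext v
  rw [unshParts_apply, swapParts_apply, swapParts_apply, unshParts_apply, swap_add_one]

/-- In the exchanged case the operator performs the exchange of the two parts; in the equal case the
parts are already weakly increasing there, and the operator acts trivially. -/
theorem betaPi_brValue {k : ℕ+} {R R' : List (Finset ℕ+)}
    (h : R = R'.map (swapSet (k + 1)) ∨ R = R') (hR : ∀ S ∈ R, k + 1 ∈ S → k + 1 + 1 ∈ S) :
    betaPi (k + 1) (brValue R') = brValue R := by
  have hone : (1 ∈ R.headD ∅) ↔ 1 ∈ R'.headD ∅ := by
    rcases h with rfl | rfl
    · rw [headD_map_swapSet, mem_swapSet, Equiv.swap_apply_of_ne_of_ne]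
      · exact (one_lt_add_one k).ne
      · exact ((one_lt_add_one k).trans (PNat.lt_add_right _ 1)).ne
    · rfl
  by_cases h1 : 1 ∈ R.headD ∅
  · rw [brValue, brValue, if_pos h1, if_pos (hone.1 h1), betaPi_zero]
  · rw [brValue, brValue, if_neg h1, if_neg (mt hone.2 h1), ← shVars_betaPi]
    have hle := keyWeight_mono hR
    congr 1
    rcases h with rfl | rfl
    · rw [keyWeight_map_swapSet] at hle ⊢
      rw [unshParts_swapParts, betaPi_lascoux_of_ge]
      rw [swapParts_left, swapParts_right] at hle
      exact hle
    · exact betaPi_lascoux_of_le hle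

theorem betaPi_sum {ι : Type*} (k : ℕ+) (s : Finset ι) (f : ι → BetaPoly) :
    betaPi k (∑ a ∈ s, f a) = ∑ a ∈ s, betaPi k (f a) := by
  classical
  induction s using Finset.induction_on with
  | empty => rw [Finset.sum_empty, Finset.sum_empty, betaPi_zero]
  | insert a s ha ih => rw [Finset.sum_insert ha, Finset.sum_insert ha, betaPi_add, ih]

/-- The weights involve only `x₁` and the column lengths, so the operator acts on each branching
separately. This reduces the branching formula to keys whose parts after the first are sorted. -/
theorem betaPi_brSum {k : ℕ+} {K : List (Finset ℕ+)} (hK : K.IsChain (· ⊇ ·))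
    (hk : ∀ S ∈ K, k + 1 ∈ S → k + 1 + 1 ∈ S) :
    betaPi (k + 1) (brSum (K.map (swapSet (k + 1)))) = brSum K := by
  rw [brSum, brSum, betaPi_sum, List.length_map]
  refine Finset.sum_congr rfl fun ds hds => ?_
  obtain ⟨h1, h2⟩ := brKeys_map_swapSet hK hk (mem_boolWords.1 hds)
  rw [betaPi_mul_of_symm (swapVars_brWeight (one_lt_add_one k) _ _), betaPi_brValue h1 h2,
    brWeight_congr]
  rw [List.map_map]
  exact List.map_congr_left fun S _ => card_swapSet _ S

/-! ### Keys with sorted weight -/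

/-- The set `{1, …, n}`. -/
def seg : ℕ → Finset ℕ+
  | 0 => ∅
  | n + 1 => insert 1 (shSet (seg n))

theorem mem_seg {n : ℕ} {v : ℕ+} : v ∈ seg n ↔ (v : ℕ) ≤ n := by
  induction n generalizing v with
  | zero => simp [seg]
  | succ n ih =>
    rw [seg, Finset.mem_insert]
    rcases pnat_one_or_add_one v with rfl | ⟨u, rfl⟩
    · simp
    · rw [add_one_mem_shSet, ih]
      simp [(one_lt_add_one u).ne']

theorem card_seg (n : ℕ) : (seg n).card = n := by
  induction n with
  | zero => rfl
  | succ n ih => rw [seg, Finset.card_insert_of_notMem (one_notMem_shSet _), card_shSet, ih]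

theorem eraseMin_shSet (A B : Finset ℕ+) :
    eraseMin (shSet A) (shSet B) = shSet (eraseMin A B) := by
  refine ext_sets (iff_of_false (fun h => one_notMem_shSet _ (eraseMin_subset _ _ h))
    (one_notMem_shSet _)) fun v => ?_
  rw [mem_eraseMin, add_one_mem_shSet, add_one_mem_shSet, add_one_mem_shSet, mem_eraseMin]
  refine and_congr_right fun _ => or_congr_right ⟨?_, ?_⟩
  · rintro ⟨u, hu, huB, huv⟩
    rcases pnat_one_or_add_one u with rfl | ⟨w, rfl⟩
    · exact absurd hu (one_notMem_shSet _)
    · rw [add_one_mem_shSet] at hu huB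
      exact ⟨w, hu, huB, by simpa using huv⟩
  · rintro ⟨w, hw, hwB, hwv⟩
    exact ⟨w + 1, add_one_mem_shSet.2 hw, mt add_one_mem_shSet.1 hwB, by simpa using hwv⟩

theorem eraseMin_insert_one {A : Finset ℕ+} (hA : 1 ∉ A) (B : Finset ℕ+) :
    eraseMin (insert 1 A) (insert 1 B) = insert 1 (eraseMin A B) := by
  ext v
  simp only [mem_eraseMin, Finset.mem_insert]
  by_cases hv : v = 1
  · simp [hv]
  · simp only [hv, false_or]
    refine and_congr_right fun _ => or_congr_right ⟨?_, ?_⟩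
    · rintro ⟨u, hu, huB, huv⟩
      push Not at huB
      exact ⟨u, hu.resolve_left huB.1, huB.2, huv⟩
    · rintro ⟨u, hu, huB, huv⟩
      exact ⟨u, Or.inr hu, by push Not; exact ⟨by rintro rfl; exact hA hu, huB⟩, huv⟩

/-- Adjoin `1` and shift. -/
def upSet (S : Finset ℕ+) : Finset ℕ+ := shSet (insert 1 S)

theorem eraseMin_upSet {A : Finset ℕ+} (hA : 1 ∉ A) (B : Finset ℕ+) :
    eraseMin (upSet A) (upSet B) = upSet (eraseMin A B) := by
  rw [upSet, upSet, eraseMin_shSet, eraseMin_insert_one hA, upSet]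

theorem card_upSet {S : Finset ℕ+} (hS : 1 ∉ S) : (upSet S).card = S.card + 1 := by
  rw [upSet, card_shSet, Finset.card_insert_of_notMem hS]

theorem two_mem_upSet (S : Finset ℕ+) : 1 + 1 ∈ upSet S :=
  add_one_mem_shSet.2 (Finset.mem_insert_self _ _)

theorem three_mem_upSet {S : Finset ℕ+} : 1 + 1 + 1 ∈ upSet S ↔ 1 + 1 ∈ S := by
  rw [upSet, add_one_mem_shSet, Finset.mem_insert]
  simp [(one_lt_add_one 1).ne']

theorem headD_map_append {α β : Type*} (f : α → β) (L : List α) (T : List β) (a : α) (b : β)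
    (h : T.headD b = f a) : (L.map f ++ T).headD b = f (L.headD a) := by
  cases L with
  | nil => exact h
  | cons A R => rfl

/-- If the adjoining short column keeps its entry 2, this entry is never a candidate to its left,
and branching proceeds as for `L`. -/
theorem brKeys_map_upSet_append {L T : List (Finset ℕ+)} {ds es : List Bool}
    (hL : ∀ S ∈ L, 1 ∉ S) (h : (brKeys T es).headD ∅ = upSet ∅) (hds : ds.length = L.length) :
    brKeys (L.map upSet ++ T) (ds ++ es) = (brKeys L ds).map upSet ++ brKeys T es := by
  induction L generalizing ds with
  | nil => rw [List.length_eq_zero_iff.1 hds]; rfl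
  | cons A R ih =>
    cases ds with
    | nil => simp at hds
    | cons d ds =>
      have ih' := ih (fun S hS => hL S (List.mem_cons_of_mem _ hS)) (by simpa using hds)
      simp only [List.map_cons, List.cons_append, brKeys]
      rw [ih', headD_map_append upSet _ _ ∅ ∅ h, eraseMin_upSet (hL A List.mem_cons_self)]
      congr 1
      split_ifs <;> rfl

/-- Next to an empty column the entry 2 is removed, whereas the branching of `A` removes what
becomes 3. Since the column contains both, the results differ by exchanging 2 and 3. -/
theorem eraseMin_upSet_empty {A : Finset ℕ+} (h1 : 1 ∉ A) (h2 : 1 + 1 ∈ A) :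
    eraseMin (upSet A) ∅ = swapSet (1 + 1) (upSet (eraseMin A ∅)) := by
  have hswap : swapSet (1 + 1) (upSet A) = upSet A :=
    swapSet_eq_self (iff_of_true (two_mem_upSet A) (three_mem_upSet.2 h2))
  rw [← eraseMin_upSet h1, ← eraseMin_swapSet fun h => h.1.2 (two_mem_upSet _), hswap]
  have h3 : ∀ v, v ∈ swapSet (1 + 1) (upSet ∅) ↔ v = 1 + 1 + 1 := by
    intro v
    rw [mem_swapSet, upSet, shSet, Finset.mem_map]
    simp only [Finset.mem_insert, Finset.notMem_empty, or_false, exists_eq_left]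
    change (1 : ℕ+) + 1 = Equiv.swap (1 + 1) (1 + 1 + 1) v ↔ _
    rw [eq_comm, Equiv.swap_apply_eq_iff, Equiv.swap_apply_left]
  have hlt : (1 + 1 : ℕ+) < 1 + 1 + 1 := PNat.lt_add_right _ 1
  ext v
  simp only [mem_eraseMin, h3, Finset.notMem_empty, false_or, not_false_eq_true, true_and]
  refine and_congr_right fun hv => ⟨?_, ?_⟩
  · rintro ⟨u, hu, huv⟩
    refine Or.inr ⟨1 + 1, two_mem_upSet A, hlt.ne, lt_of_le_of_lt ?_ huv⟩
    rcases pnat_one_or_add_one u with rfl | ⟨w, rfl⟩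
    · exact absurd hu (one_notMem_shSet _)
    · simp
  · rintro (rfl | ⟨u, hu, -, huv⟩)
    · exact ⟨1 + 1, two_mem_upSet A, hlt⟩
    · exact ⟨u, hu, huv⟩

/-- If the adjoining columns have become empty, the first removal takes 2 instead of 3, and from
there on the branching is that of `L` with 2 and 3 exchanged. Columns left intact contain both and
are not affected. -/
theorem brKeys_map_upSet_append' {L T : List (Finset ℕ+)} {ds es : List Bool}
    (hL : ∀ S ∈ L, 1 ∉ S ∧ 1 + 1 ∈ S) (h : (brKeys T es).headD ∅ = ∅)
    (hds : ds.length = L.length) :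
    brKeys (L.map upSet ++ T) (ds ++ es)
      = (brKeys L ds).map (fun S => swapSet (1 + 1) (upSet S)) ++ brKeys T es := by
  induction L generalizing ds with
  | nil => rw [List.length_eq_zero_iff.1 hds]; rfl
  | cons A R ih =>
    cases ds with
    | nil => simp at hds
    | cons d ds =>
      obtain ⟨h1, h2⟩ := hL A List.mem_cons_self
      have ih' := ih (fun S hS => hL S (List.mem_cons_of_mem _ hS)) (by simpa using hds)
      simp only [List.map_cons, List.cons_append, brKeys]
      have hswap : swapSet (1 + 1) (upSet A) = upSet A :=
        swapSet_eq_self (iff_of_true (two_mem_upSet A) (three_mem_upSet.2 h2))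
      rw [ih']
      congr 1
      have key : eraseMin (upSet A) (((brKeys R ds).map (fun S => swapSet (1 + 1) (upSet S)) ++
          brKeys T es).headD ∅) = swapSet (1 + 1) (upSet (eraseMin A ((brKeys R ds).headD ∅))) := by
        cases brKeys R ds with
        | nil =>
          rw [List.map_nil, List.nil_append, h]
          exact eraseMin_upSet_empty h1 h2
        | cons N L =>
          simp only [List.map_cons, List.cons_append, List.headD_cons]
          rw [← eraseMin_upSet h1, ← eraseMin_swapSet fun h => h.1.2 (two_mem_upSet _), hswap]
      rw [key]
      split_ifs
      · rfl
      · exact hswap.symm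

theorem brWeight_map_upSet_append {L T : List (Finset ℕ+)} {ds es : List Bool}
    (hL : ∀ S ∈ L, 1 ∉ S ∧ S.Nonempty) (h : (T.headD ∅).card ≤ 1) (hds : ds.length = L.length) :
    brWeight (L.map upSet ++ T) (ds ++ es) = brWeight L ds * brWeight T es := by
  induction L generalizing ds with
  | nil => rw [List.length_eq_zero_iff.1 hds, brWeight, one_mul]; rfl
  | cons A R ih =>
    cases ds with
    | nil => simp at hds
    | cons d ds =>
      obtain ⟨h1, h2⟩ := hL A List.mem_cons_self
      have hR := fun S hS => hL S (List.mem_cons_of_mem A hS)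
      have ih' := ih hR (by simpa using hds)
      simp only [List.map_cons, List.cons_append, brWeight]
      rw [ih', mul_right_comm, card_upSet h1]
      have hcond : (((R.map upSet ++ T).headD ∅).card < A.card + 1 ∨ (ds ++ es).headD false = true)
          ↔ ((R.headD ∅).card < A.card ∨ ds.headD false = true) := by
        have hA := h2.card_pos
        cases R with
        | nil =>
          simp only [List.map_nil, List.nil_append, List.headD_nil, Finset.card_empty]
          exact iff_of_true (Or.inl (by omega)) (Or.inl hA)
        | cons B R =>
          cases ds with
          | nil => simp at hds
          | cons e ds =>
            simp only [List.map_cons, List.cons_append, List.headD_cons]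
            rw [card_upSet (hR B List.mem_cons_self).1, Nat.add_lt_add_iff_right]
      simp only [hcond]

-- Among columns of equal length the removals must form a final segment. Each contributes `x₁`; the
-- last column that is kept contributes `1 + β x₁`, and the kept columns before it contribute 1.
open MvPolynomial in
theorem sum_brWeight_replicate (c : ℕ) {S : Finset ℕ+} (hS : S.card = 1) (G : List Bool → BetaPoly) :
    ∑ es ∈ boolWords c, brWeight (List.replicate c S) es * G es
      = X 1 ^ c * G (List.replicate c true)
        + ∑ q ∈ Finset.range c, X 1 ^ (c - 1 - q) * (1 + C betaCoeff * X 1)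
            * G (List.replicate (q + 1) false ++ List.replicate (c - 1 - q) true) := by
  induction c generalizing G with
  | zero => simp [words, brWeight]
  | succ c ih =>
    rw [sum_words_succ]
    have e : ∀ es : List Bool, ∑ d, brWeight (List.replicate (c + 1) S) (d :: es) * G (d :: es)
        = brWeight (List.replicate c S) es *
          (if c = 0 ∨ es.headD false = true then
            X 1 * G (true :: es) + (1 + C betaCoeff * X 1) * G (false :: es)
            else G (false :: es)) := by
      intro es
      have hc : ((List.replicate c S).headD ∅).card < S.card ↔ c = 0 := by
        cases c with
        | zero => simp [hS]
        | succ c => simp [List.replicate_succ]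
      simp only [List.replicate_succ, brWeight, hc, Fintype.sum_bool, if_true, Bool.false_eq_true,
        if_false]
      split_ifs <;> ring
    simp only [e]
    rw [ih, Finset.sum_range_succ']
    have hc : c = 0 ∨ (List.replicate c true).headD false = true := by
      cases c with
      | zero => exact Or.inl rfl
      | succ c => exact Or.inr rfl
    rw [if_pos hc]
    have e2 : ∀ q ∈ Finset.range c, X 1 ^ (c - 1 - q) * (1 + C betaCoeff * X 1) *
        (if c = 0 ∨ (List.replicate (q + 1) false ++ List.replicate (c - 1 - q) true).headD false
            = true then
          X 1 * G (true :: (List.replicate (q + 1) false ++ List.replicate (c - 1 - q) true))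
            + (1 + C betaCoeff * X 1)
              * G (false :: (List.replicate (q + 1) false ++ List.replicate (c - 1 - q) true))
          else G (false :: (List.replicate (q + 1) false ++ List.replicate (c - 1 - q) true)))
        = (X 1 ^ (c + 1 - 1 - (q + 1)) * (1 + C betaCoeff * X 1) *
          G (List.replicate (q + 1 + 1) false ++ List.replicate (c + 1 - 1 - (q + 1)) true)
            : BetaPoly) := by
      intro q hq
      rw [Finset.mem_range] at hq
      have h1 : c + 1 - 1 - (q + 1) = c - 1 - q := by omega
      rw [if_neg, h1]
      · rfl
      · rintro (h | h)
        · omega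
        · simp [List.replicate_succ] at h
    rw [Finset.sum_congr rfl e2]
    simp only [Nat.add_sub_cancel, Nat.sub_zero, List.replicate_succ, List.replicate_zero,
      List.cons_append, List.nil_append, zero_add]
    ring

theorem brKeys_replicate (a b : ℕ) {v : ℕ+} :
    brKeys (List.replicate (a + b) {v}) (List.replicate a false ++ List.replicate b true)
      = List.replicate a {v} ++ List.replicate b ∅ := by
  induction a with
  | zero =>
    rw [Nat.zero_add]
    simp only [List.replicate_zero, List.nil_append]
    induction b with
    | zero => rfl
    | succ b ih =>
      rw [List.replicate_succ, List.replicate_succ, List.replicate_succ, brKeys, ih]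
      have : (List.replicate b (∅ : Finset ℕ+)).headD ∅ = ∅ := by
        cases b <;> simp [List.replicate_succ]
      rw [this, if_pos rfl]
      congr 1
      ext u
      simp only [mem_eraseMin, Finset.mem_singleton, Finset.notMem_empty, false_or, iff_false]
      rintro ⟨rfl, w, rfl, -, h⟩
      exact lt_irrefl _ h
  | succ a ih =>
    rw [Nat.add_right_comm, List.replicate_succ, List.replicate_succ, List.cons_append, brKeys, ih,
      if_neg (by simp), List.replicate_succ, List.cons_append]

theorem length_brKeys {K : List (Finset ℕ+)} {ds : List Bool} (h : ds.length = K.length) :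
    (brKeys K ds).length = K.length := by
  induction K generalizing ds with
  | nil => simp [brKeys]
  | cons A R ih =>
    cases ds with
    | nil => simp at h
    | cons d ds => rw [brKeys, List.length_cons, List.length_cons, ih (by simpa using h)]

theorem exists_subset_of_mem_brKeys {K : List (Finset ℕ+)} {ds : List Bool} {S : Finset ℕ+}
    (hS : S ∈ brKeys K ds) : ∃ T ∈ K, S ⊆ T := by
  induction K generalizing ds with
  | nil => simp [brKeys] at hS
  | cons A R ih =>
    cases ds with
    | nil => simp [brKeys] at hS
    | cons d ds =>
      rw [brKeys] at hS
      rcases List.mem_cons.1 hS with rfl | hS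
      · refine ⟨A, List.mem_cons_self, ?_⟩
        split_ifs
        · exact eraseMin_subset _ _
        · exact Finset.Subset.refl _
      · obtain ⟨T, hT, h⟩ := ih hS
        exact ⟨T, List.mem_cons_of_mem _ hT, h⟩

theorem keyWeight_apply_eq_length {K : List (Finset ℕ+)} {v : ℕ+} (h : ∀ S ∈ K, v ∈ S) :
    keyWeight K v = K.length := by
  induction K with
  | nil => rfl
  | cons A R ih =>
    rw [keyWeight_cons_apply, if_pos (h A List.mem_cons_self),
      ih fun S hS => h S (List.mem_cons_of_mem _ hS), List.length_cons, add_comm]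

theorem keyWeight_map_insert_one {K : List (Finset ℕ+)} (hK : ∀ S ∈ K, 1 ∉ S) :
    keyWeight (K.map (insert 1)) = Finsupp.single 1 K.length + keyWeight K := by
  refine ext_parts ?_ fun v => ?_
  · rw [Finsupp.add_apply, keyWeight_eq_zero hK, keyWeight_apply_eq_length]
    · simp
    · intro S hS
      obtain ⟨T, -, rfl⟩ := List.mem_map.1 hS
      exact Finset.mem_insert_self _ _
  · rw [Finsupp.add_apply, single_one_apply_add_one, zero_add]
    refine keyWeight_map_apply K fun S _ => ?_
    rw [Finset.mem_insert]
    simp [(one_lt_add_one v).ne']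

theorem keyWeight_replicate_empty (r : ℕ) : keyWeight (List.replicate r ∅) = 0 := by
  ext v
  rw [keyWeight_eq_zero]; · rfl
  intro S hS; rw [List.eq_of_mem_replicate hS]; simp

theorem keyWeight_replicate_one (q : ℕ) :
    keyWeight (List.replicate q {1}) = Finsupp.single 1 q := by
  have h := keyWeight_map_insert_one (K := List.replicate q ∅) (fun S hS => by
    rw [List.eq_of_mem_replicate hS]; simp)
  simpa [keyWeight_replicate_empty] using h

theorem brValue_of_forall {R : List (Finset ℕ+)} (hR : ∀ S ∈ R, 1 ∉ S) :
    brValue R = shVars (lascoux (unshParts (keyWeight R))) := by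
  rw [brValue, if_neg]
  cases R with
  | nil => simp
  | cons A R => exact hR A List.mem_cons_self

/-- The entry 2 occurs in every nonempty column, so its multiplicity is maximal and `lascoux_cons`
splits it off. -/
theorem brValue_map_upSet {R : List (Finset ℕ+)} (hR : ∀ S ∈ R, 1 ∉ S) (q r : ℕ) :
    brValue (R.map upSet ++ (List.replicate q (upSet ∅) ++ List.replicate r ∅))
      = MvPolynomial.X (1 + 1) ^ (R.length + q) * shVars (brValue R) := by
  have e : R.map upSet ++ (List.replicate q (upSet ∅) ++ List.replicate r ∅)
      = (R.map (insert 1) ++ (List.replicate q {1} ++ List.replicate r ∅)).map shSet := by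
    simp only [List.map_append, List.map_map, List.map_replicate, shSet_empty]
    rfl
  rw [e, brValue_map_shSet, keyWeight_append, keyWeight_append, keyWeight_map_insert_one hR,
    keyWeight_replicate_one, keyWeight_replicate_empty, add_zero, add_right_comm,
    ← Finsupp.single_add, ← shParts_unshParts (keyWeight_eq_zero hR), lascoux_cons, shVars_mul,
    shVars_pow, shVars_X, brValue_of_forall hR]
  exact fun v => (keyWeight_le_length R (v + 1)).trans (Nat.le_add_right _ _)

theorem brValue_map_swapSet_upSet {R : List (Finset ℕ+)} (hR : ∀ S ∈ R, 1 ∉ S) (r : ℕ) :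
    brValue (R.map (fun S => swapSet (1 + 1) (upSet S)) ++ List.replicate r ∅)
      = betaPi (1 + 1) (MvPolynomial.X (1 + 1) ^ R.length * shVars (brValue R)) := by
  have e : R.map (fun S => swapSet (1 + 1) (upSet S)) ++ List.replicate r ∅
      = (R.map upSet ++ (List.replicate 0 (upSet ∅) ++ List.replicate r ∅)).map
          (swapSet (1 + 1)) := by
    simp only [List.map_append, List.map_map, List.map_replicate, swapSet_empty,
      List.replicate_zero, List.nil_append]
    rfl
  rw [← add_zero R.length, ← brValue_map_upSet hR 0 r, betaPi_brValue (Or.inl rfl), e]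
  intro S hS _
  rw [List.mem_map] at hS
  obtain ⟨T, hT, rfl⟩ := hS
  rw [mem_swapSet, Equiv.swap_apply_right]
  rcases List.mem_append.1 hT with hT | hT
  · obtain ⟨V, -, rfl⟩ := List.mem_map.1 hT
    exact two_mem_upSet V
  · have hT' : T = ∅ := List.eq_of_mem_replicate (n := r) (by simpa using hT)
    subst hT'
    rename_i h
    rw [swapSet_empty] at h
    exact absurd h (Finset.notMem_empty _)

theorem swapVars_shVars_brWeight (K : List (Finset ℕ+)) (ds : List Bool) :
    swapVars 1 (shVars (brWeight K ds)) = brWeight K ds := by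
  have hx : swapVars 1 (shVars (MvPolynomial.X 1)) = MvPolynomial.X 1 := by
    rw [shVars_X, swapVars_X_right]
  induction K generalizing ds with
  | nil =>
    cases ds
    · rw [brWeight, shVars_one, swapVars_one]
    · change swapVars 1 (shVars 0) = 0
      rw [shVars_zero]; exact map_zero _
  | cons A R ih =>
    cases ds with
    | nil =>
      change swapVars 1 (shVars 0) = 0
      rw [shVars_zero]; exact map_zero _
    | cons d ds =>
      rw [brWeight, shVars_mul, swapVars_mul, ih]
      congr 1
      split_ifs
      · exact hx
      · rw [shVars_add, shVars_mul, shVars_one, shVars_C, swapVars_add, swapVars_mul, swapVars_one,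
          swapVars_C, hx]
      · rw [shVars_zero]; exact map_zero _
      · rw [shVars_one]; exact swapVars_one _

/-- The combined substitution fixes `x₁` and sends `x_j` to `x_{j+1}` for `j ≥ 2`. It therefore
preserves the weights and shifts the values, which do not involve `x₁`. -/
theorem swapVars_shVars_brSum (K : List (Finset ℕ+)) :
    swapVars 1 (shVars (brSum K))
      = ∑ ds ∈ boolWords K.length, brWeight K ds * shVars (brValue (brKeys K ds)) := by
  rw [brSum, shVars, map_sum, swapVars, map_sum]
  refine Finset.sum_congr rfl fun ds _ => ?_
  change swapVars 1 (shVars _) = _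
  rw [shVars_mul, swapVars_mul, swapVars_shVars_brWeight]
  congr 1
  rw [brValue]
  split_ifs
  · rw [shVars_zero]; exact map_zero _
  · exact swapVars_shVars_shVars _


theorem upSet_empty : upSet ∅ = {1 + 1} := by
  rw [upSet, shSet, LawfulSingleton.insert_empty_eq, Finset.map_singleton, addRightEmbedding_apply]

theorem notMem_brKeys {K : List (Finset ℕ+)} {v : ℕ+} (hK : ∀ S ∈ K, v ∉ S) (ds : List Bool) :
    ∀ S ∈ brKeys K ds, v ∉ S := fun _ hS h =>
  let ⟨T, hT, hST⟩ := exists_subset_of_mem_brKeys hS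
  hK T hT (hST h)

theorem brValue_brKeys_true {L : List (Finset ℕ+)} (hL : ∀ S ∈ L, 1 ∉ S ∧ 1 + 1 ∈ S) (c : ℕ)
    {ds : List Bool} (hds : ds.length = L.length) :
    brValue (brKeys (L.map upSet ++ List.replicate c (upSet ∅)) (ds ++ List.replicate c true))
      = betaPi (1 + 1) (MvPolynomial.X (1 + 1) ^ L.length * shVars (brValue (brKeys L ds))) := by
  have hk : brKeys (List.replicate c (upSet ∅)) (List.replicate c true) = List.replicate c ∅ := by
    have hk := brKeys_replicate 0 c (v := 1 + 1)
    rwa [← upSet_empty, Nat.zero_add, List.replicate_zero, List.replicate_zero, List.nil_append,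
      List.nil_append] at hk
  have hh : (brKeys (List.replicate c (upSet ∅)) (List.replicate c true)).headD ∅ = ∅ := by
    rw [hk]
    cases c with
    | zero => rfl
    | succ c => rfl
  rw [brKeys_map_upSet_append' hL hh hds, hk,
    brValue_map_swapSet_upSet (notMem_brKeys (fun S hS => (hL S hS).1) ds), length_brKeys hds]

theorem brValue_brKeys_false {L : List (Finset ℕ+)} (hL : ∀ S ∈ L, 1 ∉ S) {c q : ℕ} (hq : q < c)
    {ds : List Bool} (hds : ds.length = L.length) :
    brValue (brKeys (L.map upSet ++ List.replicate c (upSet ∅))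
        (ds ++ (List.replicate (q + 1) false ++ List.replicate (c - 1 - q) true)))
      = MvPolynomial.X (1 + 1) ^ (L.length + (q + 1)) * shVars (brValue (brKeys L ds)) := by
  have hk := brKeys_replicate (q + 1) (c - 1 - q) (v := 1 + 1)
  rw [← upSet_empty, show q + 1 + (c - 1 - q) = c by omega] at hk
  have hh : (brKeys (List.replicate c (upSet ∅))
      (List.replicate (q + 1) false ++ List.replicate (c - 1 - q) true)).headD ∅ = upSet ∅ := by
    rw [hk]; rfl
  rw [brKeys_map_upSet_append hL hh hds, hk, brValue_map_upSet (notMem_brKeys hL ds),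
    length_brKeys hds]

theorem sum_boolWords_upSet {L : List (Finset ℕ+)} (hL : ∀ S ∈ L, 1 ∉ S ∧ 1 + 1 ∈ S) (c : ℕ)
    (es : List Bool) :
    ∑ ds ∈ boolWords L.length,
      brWeight (L.map upSet ++ List.replicate c (upSet ∅)) (ds ++ es)
        * brValue (brKeys (L.map upSet ++ List.replicate c (upSet ∅)) (ds ++ es))
      = brWeight (List.replicate c (upSet ∅)) es * ∑ ds ∈ boolWords L.length, brWeight L ds
        * brValue (brKeys (L.map upSet ++ List.replicate c (upSet ∅)) (ds ++ es)) := by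
  have hT : ((List.replicate c (upSet ∅)).headD ∅).card ≤ 1 := by
    rw [upSet_empty]
    cases c with
    | zero => exact Nat.zero_le _
    | succ c => exact (Finset.card_singleton _).le
  rw [Finset.mul_sum]
  refine Finset.sum_congr rfl fun ds hds => ?_
  rw [brWeight_map_upSet_append (fun S hS => ⟨(hL S hS).1, _, (hL S hS).2⟩) hT
    (mem_boolWords.1 hds), mul_right_comm, mul_comm, mul_comm (brWeight L ds)]

theorem sum_brValue_true {L : List (Finset ℕ+)} (hL : ∀ S ∈ L, 1 ∉ S ∧ 1 + 1 ∈ S) (c : ℕ) :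
    ∑ ds ∈ boolWords L.length, brWeight L ds
        * brValue (brKeys (L.map upSet ++ List.replicate c (upSet ∅)) (ds ++ List.replicate c true))
      = betaPi (1 + 1)
          (MvPolynomial.X (1 + 1) ^ L.length * swapVars 1 (shVars (brSum L))) := by
  rw [swapVars_shVars_brSum, Finset.mul_sum, betaPi_sum]
  refine Finset.sum_congr rfl fun ds hds => ?_
  rw [mul_left_comm, betaPi_mul_of_symm (swapVars_brWeight (one_lt_add_one 1) _ _),
    brValue_brKeys_true hL c (mem_boolWords.1 hds)]

theorem sum_brValue_false {L : List (Finset ℕ+)} (hL : ∀ S ∈ L, 1 ∉ S) {c q : ℕ} (hq : q < c) :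
    ∑ ds ∈ boolWords L.length, brWeight L ds
        * brValue (brKeys (L.map upSet ++ List.replicate c (upSet ∅))
          (ds ++ (List.replicate (q + 1) false ++ List.replicate (c - 1 - q) true)))
      = MvPolynomial.X (1 + 1) ^ (L.length + (q + 1)) * swapVars 1 (shVars (brSum L)) := by
  rw [swapVars_shVars_brSum, Finset.mul_sum]
  refine Finset.sum_congr rfl fun ds hds => ?_
  rw [mul_left_comm, brValue_brKeys_false hL hq (mem_boolWords.1 hds)]

-- The branchings of the `c` short columns either remove all their entries, where 2 and 3 change
-- roles and `π₂` appears, or keep the first `q + 1`, where a power of `x₂` splits off. The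
-- remaining sum is the branching sum of `L`.
open MvPolynomial in
theorem brSum_map_upSet {L : List (Finset ℕ+)} (hL : ∀ S ∈ L, 1 ∉ S ∧ 1 + 1 ∈ S) (c : ℕ) :
    brSum (L.map upSet ++ List.replicate c (upSet ∅))
      = X 1 ^ c * betaPi (1 + 1) (X (1 + 1) ^ L.length * swapVars 1 (shVars (brSum L)))
        + ∑ q ∈ Finset.range c, X 1 ^ (c - 1 - q) * (1 + C betaCoeff * X 1)
            * (X (1 + 1) ^ (L.length + (q + 1)) * swapVars 1 (shVars (brSum L))) := by
  have hcard : (upSet ∅).card = 1 := by rw [upSet_empty, Finset.card_singleton]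
  have h1 : brSum (L.map upSet ++ List.replicate c (upSet ∅))
      = ∑ es ∈ boolWords c, brWeight (List.replicate c (upSet ∅)) es *
        ∑ ds ∈ boolWords L.length, brWeight L ds
        * brValue (brKeys (L.map upSet ++ List.replicate c (upSet ∅)) (ds ++ es)) := by
    rw [brSum, List.length_append, List.length_map, List.length_replicate, sum_words_add]
    exact Finset.sum_congr rfl fun es _ => sum_boolWords_upSet hL c es
  have h2 := sum_brWeight_replicate c hcard fun es => ∑ ds ∈ boolWords L.length, brWeight L ds
        * brValue (brKeys (L.map upSet ++ List.replicate c (upSet ∅)) (ds ++ es))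
  refine h1.trans (h2.trans ?_)
  rw [← sum_brValue_true hL c]
  refine congrArg _ (Finset.sum_congr rfl fun q hq => ?_)
  rw [← sum_brValue_false (fun S hS => (hL S hS).1) (Finset.mem_range.1 hq)]

theorem exists_shSet {S : Finset ℕ+} (h : 1 ∉ S) : ∃ T, S = shSet T := by
  refine ⟨S.preimage (· + 1) (add_left_injective (1 : ℕ+)).injOn, ?_⟩
  refine ext_sets (iff_of_false h (one_notMem_shSet _)) fun v => ?_
  rw [add_one_mem_shSet, Finset.mem_preimage]

theorem eq_seg_card {S : Finset ℕ+} (h : ∀ v, v + 1 ∈ S → v ∈ S) : S = seg S.card := by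
  induction hn : S.card generalizing S with
  | zero => rw [Finset.card_eq_zero.1 hn]; rfl
  | succ n ih =>
    have h1 : 1 ∈ S := by
      have hne : S.Nonempty := Finset.card_pos.1 (by omega)
      obtain ⟨v, hv⟩ := hne
      induction v using PNat.recOn with
      | one => exact hv
      | succ v ihv => exact ihv (h v hv)
    obtain ⟨T, hT⟩ := exists_shSet (Finset.notMem_erase 1 S)
    have hmem : ∀ v, v ∈ T ↔ v + 1 ∈ S := fun v => by
      rw [← add_one_mem_shSet, ← hT, Finset.mem_erase]
      simp [(one_lt_add_one v).ne']
    have hcard : T.card = n := by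
      have := congrArg Finset.card hT
      rw [Finset.card_erase_of_mem h1, card_shSet] at this
      omega
    have hT' := ih (S := T) (fun v hv => (hmem v).2 (h _ ((hmem _).1 hv))) hcard
    rw [seg, ← hT', ← hT, Finset.insert_erase h1]

theorem exists_pred_partition {m : List ℕ} (hm : m.Pairwise (· ≥ ·)) (h1 : ∀ x ∈ m, 1 ≤ x) :
    ∃ (n : List ℕ) (c : ℕ), m = n.map (· + 1) ++ List.replicate c 1 ∧ n.Pairwise (· ≥ ·) ∧
      ∀ x ∈ n, 1 ≤ x := by
  induction m with
  | nil => exact ⟨[], 0, rfl, List.Pairwise.nil, by simp⟩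
  | cons x m ih =>
    rw [List.pairwise_cons] at hm
    obtain ⟨n, c, rfl, hn, hn1⟩ := ih hm.2 fun y hy => h1 y (List.mem_cons_of_mem _ hy)
    obtain hx | ⟨y, rfl⟩ : x = 1 ∨ ∃ y, x = y + 1 + 1 := by
      have := h1 x List.mem_cons_self
      rcases x with _ | _ | y
      · omega
      · exact Or.inl rfl
      · exact Or.inr ⟨y, rfl⟩
    · subst hx
      cases n with
      | nil => exact ⟨[], c + 1, rfl, List.Pairwise.nil, by simp⟩
      | cons z n =>
        have h2 := hm.1 (z + 1) (by simp)
        have h3 := hn1 z List.mem_cons_self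
        omega
    · refine ⟨(y + 1) :: n, c, rfl, List.pairwise_cons.2 ⟨fun z hz => ?_, hn⟩, ?_⟩
      · have := hm.1 (z + 1) (List.mem_append_left _ (List.mem_map_of_mem hz))
        omega
      · intro z hz
        rcases List.mem_cons.1 hz with rfl | hz
        · omega
        · exact hn1 z hz

theorem keyWeight_map_upSet {L : List (Finset ℕ+)} (hL : ∀ S ∈ L, 1 ∉ S) (c : ℕ) :
    keyWeight (L.map upSet ++ List.replicate c (upSet ∅))
      = swapParts 1 (Finsupp.single 1 (L.length + c) + shParts (keyWeight L)) := by
  have e : L.map upSet ++ List.replicate c (upSet ∅)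
      = (L.map (insert 1) ++ List.replicate c {1}).map shSet := by
    simp only [List.map_append, List.map_map, List.map_replicate]
    rfl
  rw [e, keyWeight_map_shSet, keyWeight_append, keyWeight_map_insert_one hL,
    keyWeight_replicate_one, add_right_comm, ← Finsupp.single_add]
  refine ext_parts ?_ fun v => ?_
  · rw [shParts_one, swapParts_left, Finsupp.add_apply, single_one_apply_add_one, shParts_add_one,
      keyWeight_eq_zero hL]
  · rw [shParts_add_one]
    rcases pnat_one_or_add_one v with rfl | ⟨u, rfl⟩
    · rw [swapParts_right, Finsupp.add_apply, Finsupp.add_apply, shParts_one, keyWeight_eq_zero hL]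
    · rw [swapParts_of_ne, Finsupp.add_apply, Finsupp.add_apply, shParts_add_one,
        single_one_apply_add_one, single_one_apply_add_one]
      · exact (one_lt_add_one _).ne'
      · intro h
        exact (one_lt_add_one u).ne' (add_right_cancel h)

/-- The weight arises from one with a maximal first part by exchanging the first two parts, the
second being 0. -/
theorem lascoux_keyWeight_map_upSet {L : List (Finset ℕ+)} (hL : ∀ S ∈ L, 1 ∉ S) (c : ℕ) :
    lascoux (keyWeight (L.map upSet ++ List.replicate c (upSet ∅)))
      = betaPi 1 (MvPolynomial.X 1 ^ (L.length + c) * shVars (lascoux (keyWeight L))) := by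
  have hle : ∀ v, keyWeight L v ≤ L.length + c := fun v =>
    (keyWeight_le_length L v).trans (Nat.le_add_right _ _)
  rw [keyWeight_map_upSet hL, ← lascoux_cons hle, betaPi_lascoux_of_ge]
  rw [Finsupp.add_apply, Finsupp.add_apply, single_one_apply_add_one, shParts_add_one, shParts_one,
    keyWeight_eq_zero hL]
  exact Nat.zero_le _

theorem map_shSet_seg (n : List ℕ) (c : ℕ) :
    (n.map (· + 1) ++ List.replicate c 1).map (fun x => shSet (seg x))
      = (n.map fun x => shSet (seg x)).map upSet ++ List.replicate c (upSet ∅) := by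
  simp only [List.map_append, List.map_map, List.map_replicate]
  rfl

theorem one_notMem_map_shSet {n : List ℕ} : ∀ S ∈ n.map fun x => shSet (seg x), 1 ∉ S := by
  intro S hS
  obtain ⟨x, -, rfl⟩ := List.mem_map.1 hS
  exact one_notMem_shSet _

/-- Remove one level from the columns. The expansions `brSum_map_upSet` and `betaPi_pow_add` have
the same terms, except for the coefficient of the top power, where `betaPi_core` is required. -/
theorem brSum_map_shSet_seg {m : List ℕ} (hm : m.Pairwise (· ≥ ·)) (h1 : ∀ x ∈ m, 1 ≤ x) :
    brSum (m.map fun x => shSet (seg x)) = lascoux (keyWeight (m.map fun x => shSet (seg x))) := by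
  induction hs : m.sum + m.length using Nat.strong_induction_on generalizing m with
  | _ s ih =>
    subst hs
    rcases eq_or_ne m [] with rfl | hne
    · rw [List.map_nil, keyWeight_nil, lascoux_of_forall fun i => le_rfl]
      have h0 : unshParts 0 = 0 := Finsupp.ext fun _ => rfl
      change ∑ ds ∈ {[]}, brWeight [] ds * brValue (brKeys [] ds) = _
      rw [Finset.sum_singleton]
      change 1 * brValue [] = _
      rw [brValue, one_mul, keyWeight_nil, h0, if_neg (by simp), lascoux_of_forall fun i => le_rfl]
      exact shVars_one
    obtain ⟨n, c, rfl, hn, hn1⟩ := exists_pred_partition hm h1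
    have hlt : n.sum + n.length < (n.map (· + 1) ++ List.replicate c 1).sum
        + (n.map (· + 1) ++ List.replicate c 1).length := by
      have h : (n.map (· + 1)).sum = n.sum + n.length := by
        clear * -
        induction n with
        | nil => rfl
        | cons a n ih => simp only [List.map_cons, List.sum_cons, List.length_cons, ih]; omega
      have h0 : 0 < (n.map (· + 1) ++ List.replicate c 1).length := List.length_pos_of_ne_nil hne
      rw [List.sum_append, h]
      omega
    have hS := ih _ hlt hn hn1 rfl
    obtain ⟨n', c', hn', -, -⟩ := exists_pred_partition hn hn1
    have hL : ∀ S ∈ n.map fun x => shSet (seg x), 1 ∉ S ∧ 1 + 1 ∈ S := by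
      intro S hS
      obtain ⟨x, hx, rfl⟩ := List.mem_map.1 hS
      exact ⟨one_notMem_shSet _, add_one_mem_shSet.2 (mem_seg.2 (hn1 x hx))⟩
    rw [map_shSet_seg, brSum_map_upSet hL, lascoux_keyWeight_map_upSet fun S hS => (hL S hS).1,
      betaPi_pow_add, hS]
    refine congrArg (· + _) (congrArg (MvPolynomial.X 1 ^ c * ·) ?_)
    have hlen : (n'.map fun x => shSet (seg x)).length + c' = n.length := by
      rw [hn']; simp
    -- Removing a second level exhibits the shifted polynomial in the form `π₂ (x₂ ^ b * h)`, with
    -- `h` free of `x₁` and `x₂`.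
    have e : shVars (lascoux (keyWeight (n.map fun x => shSet (seg x))))
        = betaPi (1 + 1) (MvPolynomial.X (1 + 1) ^ (n.map fun x => shSet (seg x)).length *
          shVars (shVars (lascoux (keyWeight (n'.map fun x => shSet (seg x)))))) := by
      rw [List.length_map, ← hlen]
      conv_lhs => rw [hn', map_shSet_seg, lascoux_keyWeight_map_upSet one_notMem_map_shSet]
      rw [shVars_betaPi, shVars_mul, shVars_pow, shVars_X]
    rw [e]
    exact (betaPi_core _ (swapVars_shVars_shVars _)).symm

theorem eraseMin_insert_one_shSet {A N : Finset ℕ+} (hN : 1 ∉ N) :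
    eraseMin (insert 1 (shSet A)) N = shSet A := by
  ext v
  rw [mem_eraseMin, Finset.mem_insert]
  by_cases hv : v = 1
  · subst hv
    refine iff_of_false ?_ (one_notMem_shSet _)
    rintro ⟨-, h | ⟨u, -, -, h⟩⟩
    · exact hN h
    · exact not_lt_one h
  · simp only [hv, false_or]
    refine ⟨And.left, fun h => ⟨h, Or.inr ⟨1, Finset.mem_insert_self _ _, hN, ?_⟩⟩⟩
    exact lt_of_le_of_ne (one_le (a := v)) (Ne.symm hv)

theorem keyWeight_seg_succ (n : ℕ) :
    keyWeight [seg (n + 1)] = Finsupp.single 1 1 + shParts (keyWeight [seg n]) := by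
  have h := keyWeight_map_insert_one (K := [shSet (seg n)]) (by simpa using one_notMem_shSet _)
  rw [← keyWeight_map_shSet]
  exact h

theorem keyWeight_seg_apply (n : ℕ) (v : ℕ+) :
    keyWeight [seg n] v = if (v : ℕ) ≤ n then 1 else 0 := by
  rw [keyWeight_cons_apply, keyWeight_nil]
  simp [mem_seg]

theorem lascoux_keyWeight_seg_add {n : ℕ} {γ : ℕ+ →₀ ℕ} (h : ∀ v : ℕ+, n < v → γ v = 0) :
    lascoux (keyWeight [seg n] + γ) = MvPolynomial.monomial (keyWeight [seg n]) 1 * lascoux γ := by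
  rw [add_comm]
  refine lascoux_add (fun i => ?_) fun i hi v hv => h v ?_
  · rw [keyWeight_seg_apply, keyWeight_seg_apply, PNat.add_coe, PNat.one_coe]
    split_ifs <;> omega
  · rw [keyWeight_seg_apply, keyWeight_seg_apply, PNat.add_coe, PNat.one_coe] at hi
    have : (i : ℕ) < v := hv
    by_contra hvn
    exact hi (by rw [if_pos (by omega), if_pos (by omega)])

theorem keyWeight_cons (S : Finset ℕ+) (K : List (Finset ℕ+)) :
    keyWeight (S :: K) = keyWeight [S] + keyWeight K := keyWeight_append [S] K

/-- Keeping this column leaves an entry 1 and has value 0. Removing takes away the 1, contributes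
`x₁` and leaves the set `{2, …, n + 1}`, whose weight splits off because it contains every later
column. -/
theorem brWeight_mul_brValue_cons_seg {n : ℕ} {K : List (Finset ℕ+)}
    (hK : (seg (n + 1) :: K).IsChain (· ⊇ ·)) (d : Bool) {ds : List Bool}
    (hds : ds.length = K.length) :
    brWeight (seg (n + 1) :: K) (d :: ds) * brValue (brKeys (seg (n + 1) :: K) (d :: ds))
      = if d then MvPolynomial.monomial (keyWeight [seg (n + 1)]) 1 *
          (brWeight K ds * brValue (brKeys K ds)) else 0 := by
  have h1 : 1 ∈ seg (n + 1) := Finset.mem_insert_self _ _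
  cases d with
  | false =>
    rw [if_neg (by simp), brKeys, brValue, if_pos, mul_zero]
    exact h1
  | true =>
    rw [if_pos rfl]
    by_cases hN : 1 ∈ (brKeys K ds).headD ∅
    · have h2 : 1 ∈ (brKeys (seg (n + 1) :: K) (true :: ds)).headD ∅ := by
        rw [brKeys, List.headD_cons, if_pos rfl]
        exact mem_eraseMin.2 ⟨h1, Or.inl hN⟩
      rw [brValue, if_pos h2, brValue, if_pos hN, mul_zero, mul_zero, mul_zero]
    · have hsub : ∀ S ∈ brKeys K ds, S ⊆ seg (n + 1) := fun S hS =>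
        let ⟨T, hT, hST⟩ := exists_subset_of_mem_brKeys hS
        hST.trans (subset_head_of_isChain hK T hT)
      -- If removal were not allowed here, the next column would be equal to this one and kept, so
      -- it would contain 1.
      have hcond : (K.headD ∅).card < (seg (n + 1)).card ∨ ds.headD false = true := by
        by_contra hcon
        push Not at hcon
        cases K with
        | nil =>
          have := hcon.1
          rw [card_seg] at this
          simp at this
        | cons B R =>
          cases ds with
          | nil => simp at hds
          | cons e es =>
            have he : e = false := by simpa using hcon.2
            subst he
            have hB : B = seg (n + 1) :=
              Finset.eq_of_subset_of_card_le (headD_subset_of_isChain hK) hcon.1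
            refine hN ?_
            rw [brKeys, List.headD_cons, if_neg (by simp), hB]
            exact h1
      have hk : brKeys (seg (n + 1) :: K) (true :: ds) = shSet (seg n) :: brKeys K ds := by
        rw [brKeys, if_pos rfl]
        exact congrArg (· :: _) (eraseMin_insert_one_shSet hN)
      have hw : brWeight (seg (n + 1) :: K) (true :: ds) = brWeight K ds * MvPolynomial.X 1 := by
        rw [brWeight, if_pos hcond, if_pos rfl]
      have hv : brValue (shSet (seg n) :: brKeys K ds)
          = MvPolynomial.monomial (shParts (keyWeight [seg n])) 1 * brValue (brKeys K ds) := by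
        rw [brValue, List.headD_cons, if_neg (one_notMem_shSet _), brValue, if_neg hN, keyWeight_cons, unshParts_add,
          show keyWeight [shSet (seg n)] = shParts (keyWeight [seg n]) from
            keyWeight_map_shSet [seg n], unshParts_shParts, lascoux_keyWeight_seg_add, shVars_mul,
          shVars_monomial]
        intro v hv
        rw [unshParts_apply, keyWeight_eq_zero]
        intro S hS h
        have := mem_seg.1 (hsub S hS h)
        rw [PNat.add_coe, PNat.one_coe] at this
        omega
      have hX : (MvPolynomial.X 1 : BetaPoly) = MvPolynomial.monomial (Finsupp.single 1 1) 1 := rfl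
      rw [hk, hw, hv, keyWeight_seg_succ, hX, ← one_mul (1 : Polynomial ℤ),
        ← MvPolynomial.monomial_mul, one_mul]
      ring

theorem brSum_cons_seg {n : ℕ} {K : List (Finset ℕ+)}
    (hK : (seg (n + 1) :: K).IsChain (· ⊇ ·)) :
    brSum (seg (n + 1) :: K) = MvPolynomial.monomial (keyWeight [seg (n + 1)]) 1 * brSum K := by
  rw [brSum, List.length_cons, sum_words_succ, brSum, Finset.mul_sum]
  refine Finset.sum_congr rfl fun ds hds => ?_
  rw [Finset.sum_congr rfl fun d _ => brWeight_mul_brValue_cons_seg hK d (mem_boolWords.1 hds)]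
  simp

/-- If 1 occurs, the first column is a full initial segment and splits off. Otherwise every column
is a segment starting at 2. -/
theorem brSum_of_sorted {K : List (Finset ℕ+)} (hK : K.IsChain (· ⊇ ·))
    (hne : ∀ S ∈ K, S.Nonempty) (hs : ∀ S ∈ K, ∀ v, v + 1 + 1 ∈ S → v + 1 ∈ S) :
    brSum K = lascoux (keyWeight K) := by
  by_cases h1 : ∀ S ∈ K, 1 ∉ S
  · have hJ : ∀ S ∈ K, shSet (seg S.card) = S := by
      intro S hS
      obtain ⟨T, rfl⟩ := exists_shSet (h1 S hS)
      rw [card_shSet, ← eq_seg_card]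
      intro v hv
      exact add_one_mem_shSet.1 (hs _ hS v (add_one_mem_shSet.2 hv))
    have e : (K.map Finset.card).map (fun x => shSet (seg x)) = K := by
      rw [List.map_map]
      exact (List.map_congr_left hJ).trans (List.map_id' K)
    rw [← e]
    refine brSum_map_shSet_seg ?_ ?_
    · rw [List.pairwise_map]
      exact hK.pairwise.imp fun h => Finset.card_le_card h
    · intro x hx
      obtain ⟨S, hS, rfl⟩ := List.mem_map.1 hx
      exact (hne S hS).card_pos
  · cases K with
    | nil => simp at h1
    | cons A R =>
      have hA1 : 1 ∈ A := by
        push Not at h1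
        obtain ⟨S, hS, h⟩ := h1
        rcases List.mem_cons.1 hS with rfl | hS
        · exact h
        · exact subset_head_of_isChain hK S hS h
      have hA : A = seg A.card := eq_seg_card fun v hv => by
        rcases pnat_one_or_add_one v with rfl | ⟨u, rfl⟩
        · exact hA1
        · exact hs A List.mem_cons_self u hv
      obtain ⟨n, hn⟩ : ∃ n, A.card = n + 1 :=
        Nat.exists_eq_add_one.2 (Finset.card_pos.2 ⟨1, hA1⟩)
      rw [hn] at hA
      subst hA
      rw [brSum_cons_seg hK, keyWeight_cons _ R, lascoux_keyWeight_seg_add,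
        brSum_of_sorted hK.of_cons (fun S hS => hne S (List.mem_cons_of_mem _ hS))
          fun S hS => hs S (List.mem_cons_of_mem _ hS)]
      intro v hv
      refine keyWeight_eq_zero fun S hS h => ?_
      have := mem_seg.1 (subset_head_of_isChain hK S hS h)
      omega
termination_by K.length

/-- Branching of Lascoux polynomials: the expansion in powers of `x₁`. -/
theorem brSum_eq_lascoux {K : List (Finset ℕ+)} (hK : K.IsChain (· ⊇ ·))
    (hne : ∀ S ∈ K, S.Nonempty) : brSum K = lascoux (keyWeight K) := by
  by_cases h : ∃ k, keyWeight K (k + 1) < keyWeight K (k + 1 + 1)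
  · obtain ⟨k, hk⟩ := h
    have ih := brSum_eq_lascoux (isChain_map_swapSet (k := k + 1) hK) fun S hS => by
      obtain ⟨T, hT, rfl⟩ := List.mem_map.1 hS
      exact (hne T hT).map
    rw [lascoux_eq hk, ← keyWeight_map_swapSet, ← ih,
      betaPi_brSum hK (imp_of_keyWeight_le hK hk.le)]
  · push Not at h
    exact brSum_of_sorted hK hne fun S hS v => imp_of_keyWeight_le hK (h v) S hS
termination_by partMoment (keyWeight K)
decreasing_by
  rw [keyWeight_map_swapSet]
  exact partMoment_swapParts_lt hk

/-! ### Shifting all letters -/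

theorem forall_mem_shSet {X : Finset ℕ+} {p : ℕ+ → Prop} :
    (∀ a ∈ shSet X, p a) ↔ ∀ a ∈ X, p (a + 1) := Finset.forall_mem_map

theorem exists_mem_shSet {X : Finset ℕ+} {p : ℕ+ → Prop} :
    (∃ a ∈ shSet X, p a) ↔ ∃ a ∈ X, p (a + 1) := by
  simp [shSet]

theorem shSet_injective : Function.Injective shSet := Finset.map_injective _

theorem shSet_insert (x : ℕ+) (X : Finset ℕ+) : shSet (insert x X) = insert (x + 1) (shSet X) :=
  Finset.map_insert _ _ _

theorem shSet_erase (x : ℕ+) (X : Finset ℕ+) : shSet (X.erase x) = (shSet X).erase (x + 1) :=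
  Finset.map_erase _ _ _

theorem predIn_shSet (X : Finset ℕ+) (t : ℕ+) : predIn (shSet X) (t + 1) = predIn X t + 1 := by
  by_cases h : ∃ a ∈ X, a < t
  · obtain ⟨a, ha, hat⟩ := h
    obtain ⟨h1, h2, h3⟩ := predIn_spec ha hat
    refine predIn_eq (add_one_mem_shSet.2 h1) (by simpa using h2) ?_
    simpa [forall_mem_shSet] using h3
  · push Not at h
    rw [predIn_of_forall h, predIn_of_forall]
    simpa [forall_mem_shSet] using h

theorem succIn_shSet (X : Finset ℕ+) (t : ℕ+) : succIn (shSet X) (t + 1) = succIn X t + 1 := by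
  by_cases h : ∃ a ∈ X, t < a
  · obtain ⟨a, ha, hat⟩ := h
    obtain ⟨h1, h2, h3⟩ := succIn_spec ha hat
    refine succIn_eq (add_one_mem_shSet.2 h1) (by simpa using h2) ?_
    simpa [forall_mem_shSet] using h3
  · push Not at h
    rw [succIn_of_forall h, succIn_of_forall]
    simpa [forall_mem_shSet] using h

theorem cntGt_shSet (X : Finset ℕ+) (t : ℕ+) : cntGt (shSet X) (t + 1) = cntGt X t := by
  rw [cntGt, shSet, Finset.filter_map, Finset.card_map, cntGt]
  congr 1
  exact Finset.filter_congr fun a _ => add_lt_add_iff_right 1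

theorem cntGe_shSet (X : Finset ℕ+) (t : ℕ+) : cntGe (shSet X) (t + 1) = cntGe X t := by
  rw [cntGe, shSet, Finset.filter_map, Finset.card_map, cntGe]
  congr 1
  exact Finset.filter_congr fun a _ => add_le_add_iff_right 1

theorem Dom.of_shSet {A B : Finset ℕ+} (h : Dom (shSet A) (shSet B)) : Dom A B := fun t => by
  rw [← cntGe_shSet, ← cntGt_shSet]; exact h _

theorem colIns_shSet (A : Finset ℕ+) (x : ℕ+) :
    colIns (shSet A) (x + 1) = shSet (colIns A x) := by
  rw [colIns, colIns, predIn_shSet]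
  simp only [add_one_mem_shSet]
  split_ifs
  · rfl
  · rw [shSet_insert, shSet_erase]

theorem adj_shSet (A B : Finset ℕ+) (y : ℕ+) :
    adj (shSet A) (shSet B) (y + 1) = adj A B y + 1 := by
  rw [adj, adj, cntGt_shSet, cntGt_shSet, succIn_shSet]
  split_ifs <;> rfl

theorem headD_map_shSet (R : List (Finset ℕ+)) : (R.map shSet).headD ∅ = shSet (R.headD ∅) := by
  cases R with
  | nil => rfl
  | cons A R => rfl

theorem setInsert_map_shSet (F : List (Finset ℕ+)) (x : ℕ+) :
    setInsert (F.map shSet) (x + 1) = (setInsert F x).map shSet := by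
  induction F generalizing x with
  | nil => simp [setInsert, shSet, addRightEmbedding]
  | cons A R ih =>
    have hc : (∃ a ∈ shSet A, a < x + 1) ↔ ∃ a ∈ A, a < x := by
      rw [exists_mem_shSet]; simp
    simp only [List.map_cons, setInsert, hc]
    split_ifs
    · rw [List.map_cons, ← ih, predIn_shSet, colIns_shSet, headD_map_shSet, adj_shSet]
    · rw [List.map_cons, shSet_insert]

theorem foldl_setInsert_map_shSet (a : List ℕ+) (F : List (Finset ℕ+)) :
    (a.map (· + 1)).foldl setInsert (F.map shSet) = (a.foldl setInsert F).map shSet := by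
  induction a generalizing F with
  | nil => rfl
  | cons x a ih => rw [List.map_cons, List.foldl_cons, setInsert_map_shSet, ih, List.foldl_cons]

theorem starAct_shSet (S : Finset ℕ+) (m : ℕ+) : starAct (shSet S) (m + 1) = shSet (starAct S m) := by
  refine ext_sets (iff_of_false ?_ (one_notMem_shSet _)) fun v => ?_
  · rw [mem_starAct]
    rintro (h | ⟨h, -⟩)
    · exact (one_lt_add_one m).ne h
    · exact one_notMem_shSet _ h
  · rw [add_one_mem_shSet, mem_starAct, mem_starAct, add_one_mem_shSet, exists_mem_shSet]
    simp

theorem foldl_starAct_map (l : List ℕ+) (S : Finset ℕ+) :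
    (l.map (· + 1)).foldl starAct (shSet S) = shSet (l.foldl starAct S) := by
  induction l generalizing S with
  | nil => rfl
  | cons x l ih => rw [List.map_cons, List.foldl_cons, starAct_shSet, ih, List.foldl_cons]

theorem ascWord_shSet (S : Finset ℕ+) : ascWord (shSet S) = (ascWord S).map (· + 1) := by
  have h : ((ascWord S).map (· + 1)).Pairwise (· < ·) := by
    rw [List.pairwise_map]
    exact (ascWord_pairwise S).imp fun h => by simpa using h
  rw [← ascWord_toFinset h]
  congr 1
  ext v
  simp [shSet, mem_ascWord]

theorem setWord_map_shSet (F : List (Finset ℕ+)) :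
    setWord (F.map shSet) = (setWord F).map (· + 1) := by
  induction F with
  | nil => rfl
  | cons A R ih => rw [List.map_cons, setWord_cons, ih, setWord_cons, List.map_append, ascWord_shSet]

theorem keys_map_shSet (F : List (Finset ℕ+)) : keys (F.map shSet) = (keys F).map shSet := by
  induction F with
  | nil => rfl
  | cons A R ih =>
    rw [List.map_cons, keys, keys, ih, List.map_cons, ← List.map_cons (f := shSet),
      setWord_map_shSet, ← shSet_empty, foldl_starAct_map, shSet_empty]

/-! ### Empty columns -/

theorem setWord_filter (F : List (Finset ℕ+)) : setWord (F.filter (· ≠ ∅)) = setWord F := by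
  induction F with
  | nil => rfl
  | cons A R ih =>
    by_cases hA : A = ∅
    · subst hA
      rw [List.filter_cons_of_neg (by simp), ih, setWord_cons]
      simp [ascWord]
    · rw [List.filter_cons_of_pos (by simpa using hA), setWord_cons, ih, setWord_cons]

theorem keyWeight_keys_filter {F : List (Finset ℕ+)} (h : TrailingEmpty F) :
    keyWeight (keys (F.filter (· ≠ ∅))) = keyWeight (keys F) := by
  induction F with
  | nil => rfl
  | cons A R ih =>
    by_cases hA : A = ∅
    · rw [h.filter_eq_nil hA, keys, keyWeight_nil]
      ext v
      rw [keyWeight_eq_zero]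
      · rfl
      intro S hS
      have hw : setWord (A :: R) = [] := by
        rw [← setWord_filter, h.filter_eq_nil hA]; rfl
      have hsub := isChain_keys (A :: R)
      have hhead := keys_headD (A :: R)
      rw [hw] at hhead
      rw [keys] at hS hsub hhead
      rw [List.headD_cons] at hhead
      rw [List.foldl_nil] at hhead
      have hSA : S ⊆ ∅ := by
        rcases List.mem_cons.1 hS with rfl | hS
        · exact hhead.le
        · exact (subset_head_of_isChain hsub S hS).trans hhead.le
      exact fun hv => absurd (hSA hv) (Finset.notMem_empty v)
    · have ih' := ih (trailingEmpty_cons.1 h).2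
      rw [List.filter_cons_of_pos (by simpa using hA), keys, keys, keyWeight_cons, ih',
        keyWeight_cons _ (keys R), ← List.filter_cons_of_pos (p := fun S => decide (S ≠ ∅)) (by simpa using hA), setWord_filter]

theorem brValue_congr {R R' : List (Finset ℕ+)} (h1 : R.headD ∅ = R'.headD ∅)
    (h2 : keyWeight R = keyWeight R') : brValue R = brValue R' := by
  rw [brValue, brValue, h1, h2]

theorem brValue_keys_filter {F : List (Finset ℕ+)} (h : TrailingEmpty F) :
    brValue (keys (F.filter (· ≠ ∅))) = brValue (keys F) :=
  brValue_congr (by rw [keys_headD, keys_headD, setWord_filter]) (keyWeight_keys_filter h)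

theorem one_mem_foldl_starAct {l : List ℕ+} {S : Finset ℕ+} (h : 1 ∈ S ∨ 1 ∈ l) :
    1 ∈ l.foldl starAct S := by
  induction l generalizing S with
  | nil => simpa using h
  | cons x l ih =>
    refine ih ?_
    rw [mem_starAct]
    by_cases hx : 1 = x
    · exact Or.inl (Or.inl hx)
    · rcases h with h | h
      · exact Or.inl (Or.inr ⟨h, Or.inl (lt_of_le_of_ne one_le hx)⟩)
      · exact Or.inr ((List.mem_cons.1 h).resolve_left hx)

/-- Once 1 is present, `⋆` never loses it. The zero reflects that no word with letters at least 2
produces an entry 1. -/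
theorem brValue_keys_of_one_mem {F : List (Finset ℕ+)} (h : ∃ S ∈ F, 1 ∈ S) :
    brValue (keys F) = 0 := by
  rw [brValue, keys_headD, if_pos]
  refine one_mem_foldl_starAct (Or.inr ?_)
  obtain ⟨S, hS, h1⟩ := h
  exact List.mem_flatten.2 ⟨_, List.mem_map_of_mem hS, mem_ascWord.2 h1⟩

/-! ### Sizes -/

theorem boxCount_eq {T : List (List ℕ+)} (hT : IsDecreasingTableau T) :
    boxCount T = ((colSets T).map Finset.card).sum := by
  rw [boxCount, colSets, List.map_map]
  congr 1
  refine List.map_congr_left fun C hC => ?_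
  exact (List.toFinset_card_of_nodup ((hT.1 C hC).2.imp fun h => ne_of_gt h)).symm

theorem length_columnWord (T : List (List ℕ+)) : (columnWord T).length = boxCount T := by
  simp [columnWord, boxCount, Function.comp_def]

theorem card_colIns_le {A : Finset ℕ+} {x : ℕ+} (h : ∃ a ∈ A, a < x) :
    (colIns A x).card ≤ A.card := by
  obtain ⟨a, ha, hax⟩ := h
  rw [colIns]
  split_ifs
  · rfl
  · have h1 := (predIn_spec ha hax).1
    have := Finset.card_insert_le x (A.erase (predIn A x))
    rw [Finset.card_erase_of_mem h1] at this
    have := Finset.card_pos.2 ⟨a, ha⟩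
    omega

theorem sum_card_setInsert_le (F : List (Finset ℕ+)) (x : ℕ+) :
    ((setInsert F x).map Finset.card).sum ≤ (F.map Finset.card).sum + 1 := by
  induction F generalizing x with
  | nil => simp [setInsert]
  | cons A R ih =>
    rw [setInsert]
    split_ifs with h
    · have h1 := ih (adj (colIns A x) (R.headD ∅) (predIn A x))
      have h2 := card_colIns_le h
      simp only [List.map_cons, List.sum_cons]
      omega
    · have := Finset.card_insert_le x A
      simp only [List.map_cons, List.sum_cons]
      omega

theorem sum_card_foldl_setInsert_le (a : List ℕ+) (F : List (Finset ℕ+)) :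
    ((a.foldl setInsert F).map Finset.card).sum ≤ (F.map Finset.card).sum + a.length := by
  induction a generalizing F with
  | nil => simp
  | cons x a ih =>
    have h1 := ih (setInsert F x)
    have h2 := sum_card_setInsert_le F x
    rw [List.foldl_cons, List.length_cons]
    omega

theorem isDecreasingTableau_nil : IsDecreasingTableau [] := ⟨by simp, by simp⟩

theorem heckeTableau_isDecreasing (a : List ℕ+) : IsDecreasingTableau (heckeTableau a) :=
  foldl_heckeInsert_isDecreasing isDecreasingTableau_nil a

theorem colSets_heckeTableau (a : List ℕ+) :
    colSets (heckeTableau a) = a.foldl setInsert [] :=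
  colSets_foldl_heckeInsert isDecreasingTableau_nil a

theorem boxCount_heckeTableau_le (a : List ℕ+) : boxCount (heckeTableau a) ≤ a.length := by
  rw [boxCount_eq (heckeTableau_isDecreasing a), colSets_heckeTableau]
  simpa using sum_card_foldl_setInsert_le a []

/-- The two Coxeter lengths agree. All truncated differences are exact: the length is at most the
number of boxes, which is at most the length of `a`. -/
theorem wordExcess_eq (a : List ℕ+) :
    wordExcess (columnWord (heckeTableau a)) + (a.length - boxCount (heckeTableau a))
      = wordExcess a := by
  have h1 := boxCount_heckeTableau_le a
  have h2 := coxeterLength_wordPerm_le (columnWord (heckeTableau a))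
  have h3 := coxeterLength_wordPerm_heckeTableau a
  rw [length_columnWord] at h2
  rw [wordExcess, wordExcess, length_columnWord]
  omega

theorem card_passOn {A U B : Finset ℕ+} (hAB : Dom A B) :
    (passOn A U B).card = (colBump A U).card := by
  refine Finset.card_image_of_injOn fun v hv w hw h => ?_
  have := congrArg (unadj (colOut A U) B) h
  rwa [unadj_adj hAB hv, unadj_adj hAB hw] at this

theorem card_runSets {F : List (Finset ℕ+)} (hF : F.IsChain Dom) (U : Finset ℕ+) :
    U.card = (runSets F U).2.card + (runMarks F U).count Mark.add
        + (runMarks F U).count Mark.absorb ∧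
      ((runSets F U).1.map Finset.card).sum
        = (F.map Finset.card).sum + (runMarks F U).count Mark.add := by
  induction F generalizing U with
  | nil => simp [runSets, runMarks]
  | cons A R ih =>
    obtain ⟨h1, h2⟩ := isChain_dom_cons.1 hF
    obtain ⟨i1, i2⟩ := ih h2 (passOn A U (R.headD ∅))
    have c1 := card_colOut A U
    have c2 := card_colBump' A U
    rw [← card_passOn h1, i1] at c2
    simp only [runSets, runMarks, List.map_cons, List.sum_cons, i2, c1, c2, List.count_cons]
    cases markOf A U <;> simp <;> omega

/-- Undoing the insertion creates no entry above those present, so `T` inherits the bound used in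
the final induction. -/
theorem le_of_mem_unrun {P : List (Finset ℕ+)} (ms : List Mark) {N : ℕ}
    (hP : ∀ S ∈ P, ∀ v ∈ S, (v : ℕ) ≤ N) :
    (∀ S ∈ (unrun P ms).1, ∀ v ∈ S, (v : ℕ) ≤ N) ∧ ∀ v ∈ (unrun P ms).2, (v : ℕ) ≤ N := by
  induction P generalizing ms with
  | nil => cases ms <;> simp [unrun]
  | cons C P ih =>
    cases ms with
    | nil => simp [unrun]
    | cons m ms =>
      obtain ⟨h1, h2⟩ := ih ms fun S hS => hP S (List.mem_cons_of_mem _ hS)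
      have hC := hP C List.mem_cons_self
      have hV : ∀ v ∈ unpass C (unrun P ms).2 ((unrun P ms).1.headD ∅), (v : ℕ) ≤ N := by
        intro v hv
        obtain ⟨u, hu, rfl⟩ := Finset.mem_image.1 hv
        have hu' := h2 u hu
        rw [unadj]
        split_ifs
        · exact le_trans (PNat.coe_le_coe _ _ |>.2 (predIn_le C u)) hu'
        · exact hu'
      have hback : ∀ X Y : Finset ℕ+, (∀ v ∈ X, (v : ℕ) ≤ N) → (∀ v ∈ Y, (v : ℕ) ≤ N) → ∀ p,
          ∀ v ∈ colBack X Y p, (v : ℕ) ≤ N := by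
        intro X Y hX hY p v hv
        rcases Finset.mem_union.1 (Finset.mem_filter.1 hv).1 with h | h
        · exact hX v h
        · exact hY v h
      rw [unrun]
      refine ⟨fun S hS => ?_, hback _ _ hV hC _⟩
      rcases List.mem_cons.1 hS with rfl | hS
      · exact hback _ _ hC hV _
      · exact h1 S hS

/-! ### The generating function of the marks -/

instance : Fintype Mark where
  elems := {Mark.keep, Mark.add, Mark.absorb}
  complete m := by cases m <;> simp

theorem sum_mark {M : Type*} [AddCommMonoid M] (f : Mark → M) :
    ∑ m, f m = f Mark.keep + (f Mark.add + f Mark.absorb) := by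
  change ∑ m ∈ {Mark.keep, Mark.add, Mark.absorb}, f m = _
  rw [Finset.sum_insert (by simp), Finset.sum_insert (by simp), Finset.sum_singleton]

/-- All lists of `n` marks. -/
def markWords (n : ℕ) : Finset (List Mark) := words Finset.univ n

/-- The columns in which an element is removed from the key. -/
def removals (ms : List Mark) : List Bool := ms.map (· == Mark.add)

theorem removals_cons (m : Mark) (ms : List Mark) :
    removals (m :: ms) = (m == Mark.add) :: removals ms := rfl

theorem headD_removals (ms : List Mark) :
    (removals ms).headD false = true ↔ ms.headD Mark.keep = Mark.add := by
  cases ms <;> simp [removals]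

open MvPolynomial in
/-- The factor contributed by the mark of a column. -/
noncomputable def markFactor (C : Finset ℕ+) (P : List (Finset ℕ+)) (m : Mark) (ms : List Mark) :
    BetaPoly :=
  if C.card = (P.headD ∅).card ∧ ms.headD Mark.keep = Mark.absorb then 0 else
    match m with
    | Mark.keep => 1
    | Mark.add =>
      if (P.headD ∅).card < C.card ∨ (removals ms).headD false = true then X 1 else 0
    | Mark.absorb => MvPolynomial.C betaCoeff * X 1

/-- The weight of a list of marks; zero if it is not admissible. -/
noncomputable def markWeight : List (Finset ℕ+) → List Mark → BetaPoly
  | [], [] => 1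
  | C :: P, m :: ms => markWeight P ms * markFactor C P m ms
  | _, _ => 0

theorem markWeight_cons (C : Finset ℕ+) (P : List (Finset ℕ+)) (m : Mark) (ms : List Mark) :
    markWeight (C :: P) (m :: ms) = markWeight P ms * markFactor C P m ms := rfl

open MvPolynomial in
theorem markWeight_eq {P : List (Finset ℕ+)} {ms : List Mark} (h : Admissible P ms) :
    markWeight P ms = X 1 ^ (ms.count Mark.add + ms.count Mark.absorb)
      * MvPolynomial.C (betaCoeff ^ ms.count Mark.absorb) := by
  induction P generalizing ms with
  | nil =>
    cases ms with
    | nil => simp [markWeight]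
    | cons m ms => exact h.elim
  | cons A P ih =>
    cases ms with
    | nil => exact h.elim
    | cons m ms =>
      obtain ⟨h1, h2, h3⟩ := h
      rw [markWeight_cons, ih h3, markFactor.eq_def, if_neg fun h => h1 h.1 h.2]
      cases m with
      | keep => simp
      | add =>
        have h2' := h2 rfl
        rw [← headD_removals] at h2'
        simp only [if_pos h2', List.count_cons_self]
        rw [List.count_cons_of_ne (by simp)]
        ring
      | absorb =>
        rw [List.count_cons_self, List.count_cons_of_ne (by simp), pow_succ betaCoeff, C_mul]
        ring

theorem markWeight_eq_zero {P : List (Finset ℕ+)} {ms : List Mark} (h : ¬ Admissible P ms) :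
    markWeight P ms = 0 := by
  induction P generalizing ms with
  | nil =>
    cases ms with
    | nil => exact absurd trivial h
    | cons m ms => rfl
  | cons A P ih =>
    cases ms with
    | nil => rfl
    | cons m ms =>
      rw [markWeight_cons]
      by_cases h3 : Admissible P ms
      · by_cases h1 : A.card = (P.headD ∅).card ∧ ms.headD Mark.keep = Mark.absorb
        · rw [markFactor.eq_def, if_pos h1, mul_zero]
        · have h2 : m = Mark.add ∧ ¬ ((P.headD ∅).card < A.card ∨ ms.headD Mark.keep = Mark.add) := by
            by_contra hc
            refine h ⟨fun e e' => h1 ⟨e, e'⟩, fun e => ?_, h3⟩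
            by_contra hcc
            exact hc ⟨e, hcc⟩
          obtain ⟨rfl, h2⟩ := h2
          rw [← headD_removals] at h2
          simp only [markFactor, if_neg h2, ite_self, mul_zero]
      · rw [ih h3, zero_mul]

-- For fixed removals, the forbidden term `β x₁` of `absorb` is made up for by the factor `1 + β x₁`
-- on `keep`.
open MvPolynomial in
theorem sum_markWeight_cons_ne (A : Finset ℕ+) (P : List (Finset ℕ+)) (f : List Bool → BetaPoly) :
    ∑ ms ∈ markWords (A :: P).length, (if ms.headD Mark.keep = Mark.absorb then 0 else
        markWeight (A :: P) ms * (f (removals ms) *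
          if (removals ms).headD false = true then 1 else 1 + C betaCoeff * X 1))
      = ∑ ms ∈ markWords (A :: P).length, markWeight (A :: P) ms * f (removals ms) := by
  rw [markWords, List.length_cons, sum_words_succ, sum_words_succ]
  refine Finset.sum_congr rfl fun ms _ => ?_
  rw [sum_mark, sum_mark]
  simp only [removals, List.map_cons, List.headD_cons, markWeight_cons, markFactor]
  simp only [beq_self_eq_true, if_true, reduceCtorEq, if_false,
    show (Mark.keep == Mark.add) = false from rfl, show (Mark.absorb == Mark.add) = false from rfl,
    Bool.false_eq_true]
  split_ifs <;> ring

-- In a column longer than the next, `keep` and `absorb` add up to `1 + β x₁`. Between columns of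
-- equal length, absorption in the right one is forbidden unless compensated:
-- `sum_markWeight_cons_ne` transfers the factor `1 + β x₁` of the right column to the left one.
open MvPolynomial in
theorem sum_markWeight {P : List (Finset ℕ+)} (hP : P.IsChain Dom) (hne : ∀ C ∈ P, C.Nonempty)
    (f : List Bool → BetaPoly) :
    ∑ ms ∈ markWords P.length, markWeight P ms * f (removals ms)
      = ∑ ds ∈ boolWords P.length, brWeight P ds * f ds := by
  induction P generalizing f with
  | nil =>
    change ∑ ms ∈ {[]}, _ = ∑ ds ∈ {[]}, _
    rw [Finset.sum_singleton, Finset.sum_singleton]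
    rfl
  | cons A P ih =>
    have ih' := ih (isChain_dom_cons.1 hP).2 fun S hS => hne S (List.mem_cons_of_mem _ hS)
    have hle : (P.headD ∅).card ≤ A.card := (isChain_dom_cons.1 hP).1.card_le
    rw [markWords, List.length_cons, sum_words_succ, sum_words_succ]
    simp only [sum_mark, Fintype.sum_bool]
    rcases hle.lt_or_eq with hlt | heq
    · have e1 := ih' fun ds => X 1 * f (true :: ds) + (1 + C betaCoeff * X 1) * f (false :: ds)
      refine Eq.trans ?_ (e1.trans ?_)
      · refine Finset.sum_congr rfl fun ms _ => ?_
        simp only [markWeight_cons, markFactor, hlt.ne', false_and, if_false, hlt, true_or, if_true, removals,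
          List.map_cons, beq_self_eq_true, show (Mark.keep == Mark.add) = false from rfl,
          show (Mark.absorb == Mark.add) = false from rfl]
        ring
      · refine Finset.sum_congr rfl fun ds _ => ?_
        simp only [brWeight, hlt, true_or, if_true, Bool.false_eq_true, if_false]
        ring
    · cases P with
      | nil =>
        have := (hne A List.mem_cons_self).card_pos
        rw [← heq] at this
        simp at this
      | cons B R =>
        have e1 := ih' fun ds => if ds.headD false = true then
          X 1 * f (true :: ds) + (1 + C betaCoeff * X 1) * f (false :: ds) else f (false :: ds)
        rw [← sum_markWeight_cons_ne B R fun ds => if ds.headD false = true then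
          X 1 * f (true :: ds) + (1 + C betaCoeff * X 1) * f (false :: ds) else f (false :: ds)]
          at e1
        refine Eq.trans ?_ (e1.trans ?_)
        · refine Finset.sum_congr rfl fun ms _ => ?_
          simp only [markWeight_cons, markFactor, heq, lt_irrefl, false_or, true_and]
          by_cases h1 : ms.headD Mark.keep = Mark.absorb
          · simp only [h1, if_true, mul_zero, zero_mul, add_zero]
          · simp only [h1, if_false]
            simp only [removals_cons, beq_self_eq_true,
              show (Mark.keep == Mark.add) = false from rfl,
              show (Mark.absorb == Mark.add) = false from rfl]
            cases h2 : (removals ms).headD false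
            · simp only [Bool.false_eq_true, if_false]
              ring
            · simp only [if_true]
              ring
        · refine Finset.sum_congr rfl fun ds _ => ?_
          simp only [brWeight, heq, lt_irrefl, false_or, if_true, Bool.false_eq_true, if_false]
          split_ifs <;> ring

/-- The sum over marks computes the branching sum of the key. -/
theorem sum_markWeight_keys {P : List (Finset ℕ+)} (hP : P.IsChain Dom)
    (hne : ∀ C ∈ P, C.Nonempty) :
    ∑ ms ∈ markWords P.length, markWeight P ms * brValue (brKeys (keys P) (removals ms))
      = lascoux (keyWeight (keys P)) := by
  have hcard := map_card_keys hP
  have hlen : (keys P).length = P.length := by simpa using congrArg List.length hcard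
  rw [← brSum_eq_lascoux (isChain_keys P), sum_markWeight hP hne fun ds => brValue (brKeys (keys P) ds),
    brSum, hlen]
  · exact Finset.sum_congr rfl fun ds _ => by rw [brWeight_congr hcard]
  · intro S hS
    rw [← Finset.card_pos]
    have := List.mem_map_of_mem (f := Finset.card) hS
    rw [hcard] at this
    obtain ⟨T, hT, h⟩ := List.mem_map.1 this
    rw [← h]
    exact (hne T hT).card_pos

/-! ### Compatible pairs as lists of pairs -/

/-- The relation between the columns of a compatible pair. -/
def PairRel (p q : ℕ+ × ℕ+) : Prop := q.2 ≤ p.2 ∧ (p.2 = q.2 → p.1 < q.1)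

/-- The columns of a bounded compatible pair. -/
def IsPairList (z : List (ℕ+ × ℕ+)) : Prop := z.Pairwise PairRel ∧ ∀ p ∈ z, p.2 ≤ p.1

/-- Compatibility only constrains consecutive positions; transitivity makes it a pairwise condition,
which splits well over concatenation. -/
instance : IsTrans (ℕ+ × ℕ+) PairRel where
  trans _ _ _ h1 h2 := ⟨h2.1.trans h1.1, fun h =>
    have e := le_antisymm (h ▸ h2.1 : _) h1.1
    (h1.2 e.symm.symm).trans (h2.2 (by rw [← h]; exact e.symm))⟩

theorem isPairList_of_isCompatible {a i : List ℕ+} (h : IsCompatible a i) (hb : IsBoundedPair a i) :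
    IsPairList (a.zip i) := by
  constructor
  · rw [← List.isChain_iff_pairwise, List.isChain_iff_getElem]
    intro j hj
    rw [List.length_zip, ← h.length_eq, min_self] at hj
    rw [List.getElem_zip, List.getElem_zip]
    refine ⟨?_, h.ascent j hj (h.length_eq ▸ hj)⟩
    exact List.pairwise_iff_getElem.1 h.weaklyDecreasing _ _ _ _ (Nat.lt_succ_self j)
  · intro p hp
    obtain ⟨j, hj, rfl⟩ := List.getElem_of_mem hp
    rw [List.getElem_zip]
    exact hb j _ _

theorem IsPairList.isCompatible {z : List (ℕ+ × ℕ+)} (h : IsPairList z) :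
    IsCompatible (z.map Prod.fst) (z.map Prod.snd) ∧
      IsBoundedPair (z.map Prod.fst) (z.map Prod.snd) := by
  refine ⟨⟨by simp, ?_, ?_⟩, ?_⟩
  · rw [List.pairwise_map]
    exact h.1.imp And.left
  · intro j ha hi
    rw [List.length_map] at ha
    simp only [List.getElem_map]
    exact (List.pairwise_iff_getElem.1 h.1 j (j + 1) (by omega) ha (Nat.lt_succ_self j)).2
  · intro j ha hi
    simp only [List.getElem_map]
    exact h.2 _ (List.getElem_mem _)

/-- Add one to both letters. -/
def shPair (p : ℕ+ × ℕ+) : ℕ+ × ℕ+ := (p.1 + 1, p.2 + 1)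

/-- Append a run of letters with index `1`. -/
def glueRun (z : List (ℕ+ × ℕ+)) (u : List ℕ+) : List (ℕ+ × ℕ+) :=
  z.map shPair ++ u.map fun x => (x, 1)

theorem map_fst_glueRun (z : List (ℕ+ × ℕ+)) (u : List ℕ+) :
    (glueRun z u).map Prod.fst = (z.map Prod.fst).map (· + 1) ++ u := by
  simp [glueRun, shPair, Function.comp_def]

theorem map_snd_glueRun (z : List (ℕ+ × ℕ+)) (u : List ℕ+) :
    (glueRun z u).map Prod.snd = (z.map Prod.snd).map (· + 1) ++ List.replicate u.length 1 := by
  simp [glueRun, shPair, Function.comp_def]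

theorem isPairList_glueRun {z : List (ℕ+ × ℕ+)} {u : List ℕ+} :
    IsPairList (glueRun z u) ↔ IsPairList z ∧ u.Pairwise (· < ·) := by
  have h1 : (z.map shPair).Pairwise PairRel ↔ z.Pairwise PairRel := by
    rw [List.pairwise_map]
    refine List.Pairwise.iff fun p q => ?_
    simp [PairRel, shPair]
  have h2 : (u.map fun x => ((x, 1) : ℕ+ × ℕ+)).Pairwise PairRel ↔ u.Pairwise (· < ·) := by
    rw [List.pairwise_map]
    simp [PairRel]
  have h3 : ∀ p ∈ z.map shPair, ∀ q ∈ u.map fun x => ((x, 1) : ℕ+ × ℕ+), PairRel p q := by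
    intro p hp q hq
    obtain ⟨a, -, rfl⟩ := List.mem_map.1 hp
    obtain ⟨b, -, rfl⟩ := List.mem_map.1 hq
    exact ⟨one_le, fun h => absurd h (one_lt_add_one _).ne'⟩
  have h4 : (∀ p ∈ z.map shPair, p.2 ≤ p.1) ↔ ∀ p ∈ z, p.2 ≤ p.1 := by
    rw [List.forall_mem_map]
    simp [shPair]
  have h5 : ∀ q ∈ u.map fun x => ((x, 1) : ℕ+ × ℕ+), q.2 ≤ q.1 := by
    intro q hq
    obtain ⟨b, -, rfl⟩ := List.mem_map.1 hq
    exact one_le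
  rw [IsPairList, IsPairList, glueRun, List.pairwise_append, h1, h2]
  constructor
  · rintro ⟨⟨a, b, -⟩, c⟩
    exact ⟨⟨a, h4.1 fun p hp => c p (List.mem_append_left _ hp)⟩, b⟩
  · rintro ⟨⟨a, c⟩, b⟩
    refine ⟨⟨a, b, h3⟩, fun p hp => ?_⟩
    rcases List.mem_append.1 hp with hp | hp
    · exact h4.2 c p hp
    · exact h5 p hp

/-- Indices decrease weakly, so those equal to 1 come last; an index of at least 2 forces a letter
of at least 2, and both can be lowered. -/
theorem IsPairList.exists_glueRun {w : List (ℕ+ × ℕ+)} (h : IsPairList w) :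
    ∃ z u, w = glueRun z u := by
  induction w with
  | nil => exact ⟨[], [], rfl⟩
  | cons p w ih =>
    obtain ⟨h1, h2⟩ := h
    rw [List.pairwise_cons] at h1
    obtain ⟨z, u, rfl⟩ := ih ⟨h1.2, fun q hq => h2 q (List.mem_cons_of_mem _ hq)⟩
    have hp := h2 p List.mem_cons_self
    obtain ⟨a, i⟩ := p
    rcases pnat_one_or_add_one i with rfl | ⟨j, rfl⟩
    · cases z with
      | nil => exact ⟨[], a :: u, rfl⟩
      | cons q z =>
        have h3 := (h1.1 (shPair q) (List.mem_append_left _ List.mem_cons_self)).1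
        exact absurd h3 (not_le.2 (one_lt_add_one _))
    · rcases pnat_one_or_add_one a with rfl | ⟨b, rfl⟩
      · exact absurd hp (not_le.2 (one_lt_add_one _))
      · exact ⟨(b, j) :: z, u, rfl⟩

theorem shPair_ne (p : ℕ+ × ℕ+) (x : ℕ+) : shPair p ≠ (x, 1) := fun h =>
  (one_lt_add_one p.2).ne' (congrArg Prod.snd h)

theorem glueRun_inj {z z' : List (ℕ+ × ℕ+)} {u u' : List ℕ+} (h : glueRun z u = glueRun z' u') :
    z = z' ∧ u = u' := by
  induction z generalizing z' with
  | nil =>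
    cases z' with
    | nil =>
      refine ⟨rfl, ?_⟩
      have := congrArg (List.map Prod.fst) h
      rw [map_fst_glueRun, map_fst_glueRun] at this
      simpa using this
    | cons q z' =>
      cases u with
      | nil => simp [glueRun] at h
      | cons x u => exact absurd (List.cons.inj h).1.symm (shPair_ne q x)
  | cons p z ih =>
    cases z' with
    | nil =>
      cases u' with
      | nil => simp [glueRun] at h
      | cons x u => exact absurd (List.cons.inj h).1 (shPair_ne p x)
    | cons q z' =>
      obtain ⟨h1, h2⟩ := List.cons.inj h
      obtain ⟨rfl, rfl⟩ := ih h2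
      refine ⟨?_, rfl⟩
      obtain ⟨p1, p2⟩ := p
      obtain ⟨q1, q2⟩ := q
      simpa [shPair] using h1

theorem wordWeight_apply (l : List ℕ+) (v : ℕ+) : wordWeight l v = l.count v := by
  rw [wordWeight, Multiset.toFinsupp_apply, Multiset.coe_count]

theorem wordWeight_glueRun (z : List (ℕ+ × ℕ+)) (u : List ℕ+) :
    wordWeight ((glueRun z u).map Prod.snd)
      = Finsupp.single 1 u.length + shParts (wordWeight (z.map Prod.snd)) := by
  rw [map_snd_glueRun]
  refine ext_parts ?_ fun v => ?_
  · rw [wordWeight_apply, Finsupp.add_apply, shParts_one, List.count_append,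
      List.count_replicate_self, List.count_eq_zero.2, Finsupp.single_eq_same, zero_add, add_zero]
    simp only [List.mem_map, not_exists, not_and]
    exact fun x _ => (one_lt_add_one x).ne'
  · rw [wordWeight_apply, Finsupp.add_apply, shParts_add_one, single_one_apply_add_one,
      List.count_append, List.count_map_of_injective _ _ (add_left_injective (1 : ℕ+)),
      List.count_replicate, wordWeight_apply, zero_add]
    simp [(one_lt_add_one v).ne]

/-- The monomial of a compatible pair. -/
noncomputable def pairTerm (n : ℕ) (z : List (ℕ+ × ℕ+)) : BetaPoly :=
  MvPolynomial.monomial (wordWeight (z.map Prod.snd)) (betaCoeff ^ (z.length - n))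

theorem pairTerm_glueRun {z : List (ℕ+ × ℕ+)} {u : List ℕ+} {n m k : ℕ}
    (h : z.length + u.length - n = z.length - m + k) :
    pairTerm n (glueRun z u) = MvPolynomial.X 1 ^ u.length * MvPolynomial.C (betaCoeff ^ k)
      * shVars (pairTerm m z) := by
  have hlen : (glueRun z u).length = z.length + u.length := by simp [glueRun]
  rw [pairTerm, pairTerm, wordWeight_glueRun, shVars_monomial, hlen, h, MvPolynomial.X_pow_eq_monomial,
    mul_assoc, MvPolynomial.C_mul_monomial, MvPolynomial.monomial_mul, one_mul, pow_add, mul_comm]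

/-! ### The sum over compatible pairs -/

theorem colSets_heckeTableau_map (a : List ℕ+) :
    colSets (heckeTableau (a.map (· + 1))) = (colSets (heckeTableau a)).map shSet := by
  rw [colSets_heckeTableau, colSets_heckeTableau]
  exact foldl_setInsert_map_shSet a []

theorem exists_map_shSet {F : List (Finset ℕ+)} (h : ∀ S ∈ F, 1 ∉ S) 
    : ∃ F' : List (Finset ℕ+), F = F'.map shSet := by
  induction F with
  | nil => exact ⟨[], rfl⟩
  | cons A F ih =>
    obtain ⟨F', rfl⟩ := ih fun S hS => h S (List.mem_cons_of_mem _ hS)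
    obtain ⟨A', rfl⟩ := exists_shSet (h A List.mem_cons_self)
    exact ⟨A' :: F', rfl⟩

theorem sum_map_card_filter (F : List (Finset ℕ+)) :
    ((F.filter (· ≠ ∅)).map Finset.card).sum = (F.map Finset.card).sum := by
  induction F with
  | nil => rfl
  | cons A R ih =>
    by_cases hA : A = ∅
    · subst hA
      rw [List.filter_cons_of_neg (by simp), ih]
      simp
    · rw [List.filter_cons_of_pos (by simpa using hA), List.map_cons, List.sum_cons, ih]
      rfl

/-- The compatible pairs of `P` with their generating function. -/
def HasPairSum (P : List (List ℕ+)) : Prop :=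
  ∃ s : Finset (List (ℕ+ × ℕ+)),
    (∀ z, z ∈ s ↔ IsPairList z ∧ heckeTableau (z.map Prod.fst) = P) ∧
    ∑ z ∈ s, pairTerm (boxCount P) z = lascoux (keyWeight (keys (colSets P)))

/-- If `Q` has an entry 1, both sides vanish. Otherwise all letters can be lowered by one, which
brings the entries under the bound of the induction hypothesis. -/
theorem exists_sum_shift {N : ℕ}
    (ih : ∀ P, IsDecreasingTableau P → (∀ S ∈ colSets P, ∀ v ∈ S, (v : ℕ) ≤ N) → HasPairSum P)
    {Q : List (List ℕ+)} (hQ : IsDecreasingTableau Q)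
    (hN : ∀ S ∈ colSets Q, ∀ v ∈ S, (v : ℕ) ≤ N + 1) :
    ∃ s : Finset (List (ℕ+ × ℕ+)),
      (∀ z, z ∈ s ↔ IsPairList z ∧ heckeTableau ((z.map Prod.fst).map (· + 1)) = Q) ∧
      ∑ z ∈ s, shVars (pairTerm (boxCount Q) z) = brValue (keys (colSets Q)) := by
  by_cases h1 : ∃ S ∈ colSets Q, 1 ∈ S
  · refine ⟨∅, fun z => iff_of_false (Finset.notMem_empty _) ?_, ?_⟩
    · rintro ⟨-, h⟩
      obtain ⟨S, hS, h1⟩ := h1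
      rw [← h, colSets_heckeTableau_map] at hS
      obtain ⟨T, -, rfl⟩ := List.mem_map.1 hS
      exact one_notMem_shSet _ h1
    · rw [brValue_keys_of_one_mem h1, Finset.sum_empty]
  · push Not at h1
    obtain ⟨F, hF⟩ := exists_map_shSet h1
    have hdom : F.IsChain Dom := by
      have := (isDecreasingTableau_iff.1 hQ).2
      rw [hF, List.isChain_map] at this
      exact this.imp fun _ _ => Dom.of_shSet
    have hne : ∀ S ∈ F, S ≠ ∅ := by
      rintro S hS rfl
      refine colSets_ne_empty hQ ∅ ?_ rfl
      rw [hF]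
      exact List.mem_map.2 ⟨∅, hS, shSet_empty⟩
    have hFQ : colSets (toTableau F) = F := by
      rw [colSets_toTableau, List.filter_eq_self]
      simpa using hne
    have hQ' := isDecreasingTableau_toTableau hdom
    obtain ⟨s, hs, hsum⟩ := ih (toTableau F) hQ' fun S hS v hv => by
      rw [hFQ] at hS
      have := hN (shSet S) (by rw [hF]; exact List.mem_map_of_mem hS) (v + 1)
        (add_one_mem_shSet.2 hv)
      rw [PNat.add_coe, PNat.one_coe] at this
      omega
    have hbox : boxCount Q = boxCount (toTableau F) := by
      rw [boxCount_eq hQ, boxCount_eq hQ', hF, hFQ, List.map_map]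
      congr 1
      exact List.map_congr_left fun S _ => card_shSet S
    refine ⟨s, fun z => ?_, ?_⟩
    · rw [hs]
      refine and_congr_right fun _ => ⟨fun h => ?_, fun h => ?_⟩
      · refine eq_of_colSets_eq (heckeTableau_isDecreasing _) hQ ?_
        rw [colSets_heckeTableau_map, h, hFQ, hF]
      · refine eq_of_colSets_eq (heckeTableau_isDecreasing _) hQ' ?_
        have := congrArg colSets h
        rw [colSets_heckeTableau_map, hF] at this
        rw [hFQ]
        exact List.map_injective_iff.2 shSet_injective this
    · rw [hF, keys_map_shSet, brValue_map_shSet, ← hFQ, ← hsum, hbox, shVars, map_sum]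
      rfl

theorem length_of_admissible {P : List (Finset ℕ+)} {ms : List Mark} (h : Admissible P ms) :
    ms.length = P.length := by
  induction P generalizing ms with
  | nil =>
    cases ms with
    | nil => rfl
    | cons m ms => exact h.elim
  | cons A P ih =>
    cases ms with
    | nil => exact h.elim
    | cons m ms => rw [List.length_cons, List.length_cons, ih h.2.2]

theorem heckeTableau_append (a u : List ℕ+) :
    heckeTableau (a ++ u) = u.foldl heckeInsert (heckeTableau a) := List.foldl_append

section Step

variable {P : List (List ℕ+)} (hP : IsDecreasingTableau P) {ms : List Mark}
  (hms : Admissible (colSets P) ms)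
include hP hms

theorem boxCount_prevTableau :
    boxCount P = boxCount (prevTableau P ms) + ms.count Mark.add ∧
      (lastRun P ms).length = ms.count Mark.add + ms.count Mark.absorb := by
  obtain ⟨-, h2, h3, h4⟩ := unrun_colSets hP hms
  obtain ⟨c1, c2⟩ := card_runSets h2 (unrun (colSets P) ms).2
  rw [h3, h4] at c1 c2
  rw [boxCount_eq hP, boxCount_eq (prevTableau_isDecreasing hP hms), prevTableau,
    colSets_toTableau, sum_map_card_filter, lastRun, ascWord, Finset.length_sort]
  refine ⟨c2, ?_⟩
  rw [c1, Finset.card_empty, zero_add]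

theorem brValue_prevTableau :
    brValue (keys (colSets (prevTableau P ms)))
      = brValue (brKeys (keys (colSets P)) (removals ms)) := by
  obtain ⟨-, h2, h3, h4⟩ := unrun_colSets hP hms
  have := keys_runSets h2 (U := (unrun (colSets P) ms).2) (by rw [h3])
  rw [h3, h4] at this
  rw [prevTableau, colSets_toTableau, brValue_keys_filter (trailingEmpty_of_isChain h2), this]
  rfl

theorem pairTerm_glueRun_lastRun {z : List (ℕ+ × ℕ+)}
    (hz : heckeTableau ((z.map Prod.fst).map (· + 1)) = prevTableau P ms) :
    pairTerm (boxCount P) (glueRun z (lastRun P ms))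
      = markWeight (colSets P) ms * shVars (pairTerm (boxCount (prevTableau P ms)) z) := by
  obtain ⟨h1, h2⟩ := boxCount_prevTableau hP hms
  -- A word is at least as long as its tableau has boxes, so the truncated exponents of `β` add
  -- correctly.
  have h3 := boxCount_heckeTableau_le ((z.map Prod.fst).map (· + 1))
  rw [hz, List.length_map, List.length_map] at h3
  rw [pairTerm_glueRun (m := boxCount (prevTableau P ms)) (k := ms.count Mark.absorb),
    markWeight_eq hms, h2]
  omega

end Step

theorem hasPairSum_nil : HasPairSum [] := by
  refine ⟨{[]}, fun z => ?_, ?_⟩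
  · rw [Finset.mem_singleton]
    constructor
    · rintro rfl
      exact ⟨⟨List.Pairwise.nil, by simp⟩, rfl⟩
    · rintro ⟨-, h⟩
      have hc := congrArg colSets h
      rw [colSets_heckeTableau] at hc
      rcases List.eq_nil_or_concat (z.map Prod.fst) with hz | ⟨a, x, hz⟩
      · simpa using hz
      · exfalso
        rw [hz, List.concat_eq_append, List.foldl_append] at hc
        cases hF : a.foldl setInsert [] with
        | nil => rw [hF] at hc; simp [setInsert, colSets] at hc
        | cons A R =>
          rw [hF, List.foldl_cons, List.foldl_nil, setInsert] at hc
          split_ifs at hc <;> simp [colSets] at hc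
  · rw [Finset.sum_singleton]
    change pairTerm 0 [] = lascoux (keyWeight [])
    rw [keyWeight_nil, lascoux_of_forall fun _ => le_rfl, pairTerm]
    have : wordWeight (([] : List (ℕ+ × ℕ+)).map Prod.snd) = 0 := by
      ext v; rw [wordWeight_apply]; rfl
    rw [this, List.length_nil, pow_zero]

-- The compatible pairs of `P` form the disjoint union, over admissible marks, of pairs for the
-- shifted `prevTableau` extended by `lastRun`; their weights are those of the branching sum of the
-- key.
open Classical in
theorem hasPairSum_step {N : ℕ}
    (ih : ∀ P, IsDecreasingTableau P → (∀ S ∈ colSets P, ∀ v ∈ S, (v : ℕ) ≤ N) → HasPairSum P)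
    {P : List (List ℕ+)} (hP : IsDecreasingTableau P)
    (hN : ∀ S ∈ colSets P, ∀ v ∈ S, (v : ℕ) ≤ N + 1) : HasPairSum P := by
  have hex : ∀ ms, ∃ s : Finset (List (ℕ+ × ℕ+)), Admissible (colSets P) ms →
      (∀ z, z ∈ s ↔ IsPairList z ∧
        heckeTableau ((z.map Prod.fst).map (· + 1)) = prevTableau P ms) ∧
      ∑ z ∈ s, shVars (pairTerm (boxCount (prevTableau P ms)) z)
        = brValue (keys (colSets (prevTableau P ms))) := by
    intro ms
    by_cases hms : Admissible (colSets P) ms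
    · obtain ⟨s, hs⟩ := exists_sum_shift ih (prevTableau_isDecreasing hP hms) fun S hS => by
        rw [prevTableau, colSets_toTableau] at hS
        exact (le_of_mem_unrun ms hN).1 S (List.mem_of_mem_filter hS)
      exact ⟨s, fun _ => hs⟩
    · exact ⟨∅, fun h => absurd h hms⟩
  choose t ht using hex
  let M := (markWords (colSets P).length).filter fun ms => Admissible (colSets P) ms
  have hM : ∀ ms, ms ∈ M ↔ Admissible (colSets P) ms := fun ms => by
    rw [Finset.mem_filter, markWords, mem_words]
    exact ⟨And.right, fun h => ⟨⟨length_of_admissible h, fun _ _ => Finset.mem_univ _⟩, h⟩⟩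
  -- A glued pair determines its final run and its remaining word, hence the previous tableau, hence
  -- the marks.
  have hdisj : (M : Set (List Mark)).PairwiseDisjoint
      fun ms => (t ms).image fun z => glueRun z (lastRun P ms) := by
    intro ms hms ms' hms' hne
    rw [Function.onFun, Finset.disjoint_left]
    intro w hw hw'
    obtain ⟨z, hz, rfl⟩ := Finset.mem_image.1 hw
    obtain ⟨z', hz', h⟩ := Finset.mem_image.1 hw'
    obtain ⟨rfl, hu⟩ := glueRun_inj h
    have a := (hM _).1 hms
    have a' := (hM _).1 hms'
    refine hne (marks_injective hP a a' ?_ hu.symm)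
    rw [← (((ht ms a).1 _).1 hz).2, (((ht ms' a').1 _).1 hz').2]
  refine ⟨M.biUnion fun ms => (t ms).image fun z => glueRun z (lastRun P ms), fun w => ?_, ?_⟩
  · simp only [Finset.mem_biUnion, Finset.mem_image]
    constructor
    · rintro ⟨ms, hms, z, hz, rfl⟩
      have a := (hM _).1 hms
      obtain ⟨h1, h2⟩ := ((ht ms a).1 z).1 hz
      refine ⟨isPairList_glueRun.2 ⟨h1, ascWord_pairwise _⟩, ?_⟩
      rw [map_fst_glueRun, heckeTableau_append, h2, foldl_lastRun hP a]
    · rintro ⟨hw, h⟩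
      obtain ⟨z, u, rfl⟩ := hw.exists_glueRun
      obtain ⟨h1, h2⟩ := isPairList_glueRun.1 hw
      rw [map_fst_glueRun, heckeTableau_append] at h
      obtain ⟨ms, a, h3, rfl⟩ := exists_marks hP (heckeTableau_isDecreasing _) h2 h
      exact ⟨ms, (hM _).2 a, z, ((ht ms a).1 z).2 ⟨h1, h3.symm⟩, rfl⟩
  · have hM0 : ∀ ms ∈ markWords (colSets P).length, markWeight (colSets P) ms
        * brValue (brKeys (keys (colSets P)) (removals ms)) ≠ 0 → Admissible (colSets P) ms := by
      intro ms _ h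
      by_contra hc
      exact h (by rw [markWeight_eq_zero hc, zero_mul])
    rw [Finset.sum_biUnion hdisj, ← sum_markWeight_keys (isDecreasingTableau_iff.1 hP).2 fun S hS =>
        Finset.nonempty_iff_ne_empty.2 (colSets_ne_empty hP S hS),
      ← Finset.sum_filter_of_ne hM0]
    · refine Finset.sum_congr rfl fun ms hms => ?_
      have a := (hM _).1 hms
      rw [Finset.sum_image fun z _ z' _ h => (glueRun_inj h).1,
        ← brValue_prevTableau hP a, ← (ht ms a).2, Finset.mul_sum]
      exact Finset.sum_congr rfl fun z hz =>
        pairTerm_glueRun_lastRun hP a (((ht ms a).1 z).1 hz).2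

/-- Induction on a bound for the entries; with bound 0 only the empty tableau is left. -/
theorem hasPairSum {P : List (List ℕ+)} (hP : IsDecreasingTableau P) : HasPairSum P := by
  have key : ∀ N : ℕ, ∀ P, IsDecreasingTableau P → (∀ S ∈ colSets P, ∀ v ∈ S, (v : ℕ) ≤ N) →
      HasPairSum P := by
    intro N
    induction N with
    | zero =>
      intro P hP hN
      cases P with
      | nil => exact hasPairSum_nil
      | cons C P =>
        obtain ⟨v, hv⟩ := List.exists_mem_of_ne_nil C (hP.1 C List.mem_cons_self).1
        have := hN C.toFinset List.mem_cons_self v (List.mem_toFinset.2 hv)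
        exact absurd v.pos (by omega)
    | succ N ih => exact fun P hP hN => hasPairSum_step ih hP hN
  -- The sum of all entries is a crude bound for each of them.
  refine key (((colSets P).map fun S => S.sum fun v => (v : ℕ)).sum) P hP fun S hS v hv => ?_
  exact (Finset.single_le_sum (f := fun v : ℕ+ => (v : ℕ)) (fun _ _ => Nat.zero_le _) hv).trans
    (List.single_le_sum (fun _ _ => Nat.zero_le _) _ (List.mem_map_of_mem (f := fun S : Finset ℕ+ => S.sum fun v => (v : ℕ)) hS))

/-! ### Return to pairs of words, and conclusion -/

theorem zip_map_fst_map_snd (z : List (ℕ+ × ℕ+)) : (z.map Prod.fst).zip (z.map Prod.snd) = z := by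
  induction z with
  | nil => rfl
  | cons p z ih => rw [List.map_cons, List.map_cons, List.zip_cons_cons, ih]

theorem mainTheorem6 (P : List (List ℕ+)) (hP : IsDecreasingTableau P) :
    (compatiblePairs P).Finite ∧
    lascoux (keyWeight (rightKey P)) =
      ∑ᶠ p ∈ compatiblePairs P,
        MvPolynomial.monomial (wordWeight p.2) (betaCoeff ^ (p.1.length - boxCount P)) ∧
    MvPolynomial.C (betaCoeff ^ wordExcess (columnWord P)) *
        lascoux (keyWeight (rightKey P)) =
      ∑ᶠ p ∈ compatiblePairs P,
        MvPolynomial.monomial (wordWeight p.2) (betaCoeff ^ wordExcess p.1) := by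
  classical
  obtain ⟨s, hs, hsum⟩ := hasPairSum hP
  let e : List (ℕ+ × ℕ+) → List ℕ+ × List ℕ+ := fun z => (z.map Prod.fst, z.map Prod.snd)
  have he : Function.Injective e := fun z z' h => by
    rw [← zip_map_fst_map_snd z, ← zip_map_fst_map_snd z']
    exact congrArg (fun p => List.zip p.1 p.2) h
  have hset : compatiblePairs P = (s.image e : Finset _) := by
    ext ⟨a, i⟩
    rw [Finset.mem_coe, Finset.mem_image]
    constructor
    · rintro ⟨h1, h2, h3⟩
      have ha : (a.zip i).map Prod.fst = a := List.map_fst_zip h1.length_eq.le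
      have hi : (a.zip i).map Prod.snd = i := List.map_snd_zip h1.length_eq.ge
      exact ⟨a.zip i, (hs _).2 ⟨isPairList_of_isCompatible h1 h2, by rw [ha]; exact h3⟩,
        Prod.ext ha hi⟩
    · rintro ⟨z, hz, h⟩
      rw [← h]
      obtain ⟨h1, h2⟩ := (hs z).1 hz
      exact ⟨h1.isCompatible.1, h1.isCompatible.2, h2⟩
  have hkey : rightKey P = keys (colSets P) := rightKey_eq_keys fun C hC => (hP.1 C hC).2
  rw [hset, finsum_mem_coe_finset, finsum_mem_coe_finset, hkey, ← hsum,
    Finset.sum_image fun z _ z' _ h => he h, Finset.sum_image fun z _ z' _ h => he h]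
  refine ⟨Finset.finite_toSet _, Finset.sum_congr rfl fun z _ => ?_, ?_⟩
  · rw [pairTerm, List.length_map]
  · rw [Finset.mul_sum]
    refine Finset.sum_congr rfl fun z hz => ?_
    -- The excess of the word exceeds that of `P` by exactly the exponent of `β` in the first
    -- formula, so the second is its multiple.
    have h := wordExcess_eq (z.map Prod.fst)
    rw [((hs z).1 hz).2, List.length_map] at h
    rw [pairTerm, MvPolynomial.C_mul_monomial, ← pow_add, h]
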